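/- Let $U:[0,\infty)\to\mathbb{R}$ be a twice differentiable profile with $$U(0)=0,\quad U(Y)>0\ \text{for } Y>0,\quad \lim_{Y\to+\infty}U(Y)=1,\quad U'(0)>0,\quad \sum_{k=1,2}\sup_{Y\ge 0}(1+Y)^3|\partial_Y^kU(Y)|<\infty .$$ Write $\mathbb{R}_+=(0,\infty)$ and $\|\cdot\|_{L^2}=\|\cdot\|_{L^2(\mathbb{R}_+)}$, with $\|(g,h)\|_{L^2}^2=\|g\|_{L^2}^2+\|h\|_{L^2}^2$; all functions except $U$ are complex valued. Then there exist constants $c_1>0$ and $C>0$, depending only on $U$, such that for all real $\varepsilon$ and $\alpha$ with $0<\varepsilon\le c_1$ and $\alpha\neq 0$ and every $f\in H^1_0(\mathbb{R}_+)$ with $(1+Y)^2f\in L^2(\mathbb{R}_+)$, there is a unique $\varphi\in H^4(\mathbb{R}_+)\cap H^1_0(\mathbb{R}_+)$ solving the Orr–Sommerfeld equation with artificial boundary conditions $$U(\partial_Y^2-\alpha^2)\varphi-U''\varphi+\mathrm{i}\varepsilon(\partial_Y^2-\alpha^2)^2\varphi=f \ \text{ in } \mathbb{R}_+,\qquad w=(\partial_Y^2-\alpha^2)\varphi,\qquad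 \varphi|_{Y=0}=\partial_Yw|_{Y=0}=0 .$$ Moreover $(1+Y)w$, $(1+Y)\partial_Yw$ and $(1+Y)(\partial_Y^2-\alpha^2)w$ belong to $L^2(\mathbb{R}_+)$, and $$\varepsilon^{1/3}\|(1+Y)w\|_{L^2}+\varepsilon^{2/3}\|(1+Y)(\partial_Yw,\alpha w)\|_{L^2}+\varepsilon\|(1+Y)(\partial_Y^2-\alpha^2)w\|_{L^2}+\|(\partial_Y\varphi,\alpha\varphi)\|_{L^2}\le C\Big(\|(1+Y)^2f\|_{L^2}+\frac{1}{|\alpha|^2}\Big|\int_0^{+\infty}f\,\mathrm{d}Y\Big|\Big).$$ -/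

import Mathlib

open MeasureTheory Set Filter
open scoped Topology ContDiff

namespace OrrSommerfeld

noncomputable section

/-- Lebesgue measure on the half line `ℝ₊ = (0, ∞)`. All functions below are functions on `ℝ`
of which only the values on the half line matter; elements of `L²` and of the Sobolev spaces are
identified when they agree almost everywhere for this measure. -/
abbrev halfLine : Measure ℝ := volume.restrict (Ioi (0 : ℝ))

/-- `v` is a weak (distributional) derivative of `u` on `(0, ∞)`. -/
structure HasWeakDeriv (u v : ℝ → ℂ) : Prop where
  locInt : LocallyIntegrableOn u (Ioi (0 : ℝ))
  locInt_deriv : LocallyIntegrableOn v (Ioi (0 : ℝ))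
  integral_eq : ∀ ψ : ℝ → ℝ, ContDiff ℝ ∞ ψ → HasCompactSupport ψ → tsupport ψ ⊆ Ioi (0 : ℝ) →
    ∫ Y in Ioi (0 : ℝ), deriv ψ Y • u Y = -∫ Y in Ioi (0 : ℝ), ψ Y • v Y

/-- Weak derivatives are unique up to null sets. -/
theorem HasWeakDeriv.ae_eq {u v v' : ℝ → ℂ} (h : HasWeakDeriv u v) (h' : HasWeakDeriv u v') :
    v =ᵐ[halfLine] v' := by
  have key : ∀ᵐ Y ∂(volume : Measure ℝ), Y ∈ Ioi (0 : ℝ) → (v - v') Y = 0 := by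
    refine isOpen_Ioi.ae_eq_zero_of_integral_contDiff_smul_eq_zero
      (h.locInt_deriv.sub h'.locInt_deriv) ?_
    intro g hg hc hs
    have int : ∀ f : ℝ → ℂ, LocallyIntegrableOn f (Ioi (0 : ℝ)) →
        Integrable (fun Y => g Y • f Y) := by
      intro f hf
      have hK : IntegrableOn (fun Y => g Y • f Y) (tsupport g) :=
        (hf.integrableOn_compact_subset hs hc).continuousOn_smul hg.continuous.continuousOn hc
      refine (integrableOn_iff_integrable_of_support_subset fun Y hY => ?_).mp hK
      exact subset_tsupport g fun h0 => hY (by simp [h0])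
    have full : ∀ f : ℝ → ℂ, ∫ Y in Ioi (0 : ℝ), g Y • f Y = ∫ Y, g Y • f Y := by
      intro f
      refine setIntegral_eq_integral_of_forall_compl_eq_zero fun Y hY => ?_
      rw [image_eq_zero_of_notMem_tsupport fun hmem => hY (hs hmem), zero_smul]
    have e := (h.integral_eq g hg hc hs).symm.trans (h'.integral_eq g hg hc hs)
    rw [neg_inj, full, full] at e
    simp only [Pi.sub_apply, smul_sub]
    rw [integral_sub (int v h.locInt_deriv) (int v' h'.locInt_deriv), e, sub_self]
  rw [Filter.EventuallyEq, ae_restrict_iff' measurableSet_Ioi]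
  filter_upwards [key] with Y hY hm
  exact sub_eq_zero.mp (hY hm)

open Classical in
/-- The weak derivative `∂_Y u` on `(0, ∞)`, as a representative of its almost everywhere class
(and `0` if `u` has no weak derivative). -/
def weakDeriv (u : ℝ → ℂ) : ℝ → ℂ :=
  if h : ∃ v, HasWeakDeriv u v then h.choose else 0

theorem HasWeakDeriv.hasWeakDeriv_weakDeriv {u v : ℝ → ℂ} (h : HasWeakDeriv u v) :
    HasWeakDeriv u (weakDeriv u) := by
  have hex : ∃ v, HasWeakDeriv u v := ⟨v, h⟩
  rw [weakDeriv, dif_pos hex]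
  exact hex.choose_spec

/-- `u ∈ Hᵏ(ℝ₊)`: `u` and its weak derivatives up to order `k` are in `L²(ℝ₊)`. -/
def MemSobolev : ℕ → (ℝ → ℂ) → Prop
  | 0, u => MemLp u 2 halfLine
  | k + 1, u => MemLp u 2 halfLine ∧ ∃ v, HasWeakDeriv u v ∧ MemSobolev k v

/-- The boundary value `u|_{Y=0} = c`: `u` has a representative that is continuous on `[0, ∞)` and
takes the value `c` at `0`. -/
def HasBoundaryValue (u : ℝ → ℂ) (c : ℂ) : Prop :=
  ∃ v : ℝ → ℂ, ContinuousOn v (Ici (0 : ℝ)) ∧ u =ᵐ[halfLine] v ∧ v 0 = c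

/-- `u ∈ H¹₀(ℝ₊)`: `u ∈ H¹(ℝ₊)` with `u|_{Y=0} = 0`. -/
def MemH10 (u : ℝ → ℂ) : Prop :=
  MemSobolev 1 u ∧ HasBoundaryValue u 0

/-- The operator `∂_Y² - α²`, with weak derivatives. -/
def helmholtz (α : ℝ) (u : ℝ → ℂ) : ℝ → ℂ :=
  fun Y => weakDeriv (weakDeriv u) Y - (α : ℂ) ^ 2 * u Y

/-- First derivative of a profile on `[0, ∞)` (one-sided at `0`). -/
def profileDeriv (U : ℝ → ℝ) : ℝ → ℝ := derivWithin U (Ici (0 : ℝ))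

/-- The structure assumptions on the shear profile `U : [0, ∞) → ℝ`. -/
structure IsShearProfile (U : ℝ → ℝ) : Prop where
  differentiable : DifferentiableOn ℝ U (Ici (0 : ℝ))
  differentiable_deriv : DifferentiableOn ℝ (profileDeriv U) (Ici (0 : ℝ))
  zero : U 0 = 0
  pos : ∀ Y, 0 < Y → 0 < U Y
  tendsto_one : Tendsto U atTop (𝓝 1)
  deriv_zero_pos : 0 < profileDeriv U 0
  deriv_bound : ∃ K : ℝ, ∀ Y, 0 ≤ Y → (1 + Y) ^ 3 * |profileDeriv U Y| ≤ K
  deriv2_bound : ∃ K : ℝ, ∀ Y, 0 ≤ Y → (1 + Y) ^ 3 * |profileDeriv (profileDeriv U) Y| ≤ K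

/-- `φ ∈ H⁴(ℝ₊) ∩ H¹₀(ℝ₊)` solves the Orr--Sommerfeld equation with the artificial boundary
conditions `φ|_{Y=0} = ∂_Y w|_{Y=0} = 0`, where `w = (∂_Y² - α²) φ`. (The condition
`φ|_{Y=0} = 0` is part of `φ ∈ H¹₀(ℝ₊)`.) -/
structure IsSolution (U : ℝ → ℝ) (ε α : ℝ) (f φ : ℝ → ℂ) : Prop where
  memSobolev : MemSobolev 4 φ
  memH10 : MemH10 φ
  equation : ∀ᵐ Y ∂halfLine,
    (U Y : ℂ) * helmholtz α φ Y - (profileDeriv (profileDeriv U) Y : ℂ) * φ Y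
      + Complex.I * (ε : ℂ) * helmholtz α (helmholtz α φ) Y = f Y
  neumann : HasBoundaryValue (weakDeriv (helmholtz α φ)) 0

/-- The function `(1 + Y)ᵏ g`. -/
def weighted (k : ℕ) (g : ℝ → ℂ) : ℝ → ℂ := fun Y => ((1 + Y : ℝ) : ℂ) ^ k * g Y

/-- The norm `‖g‖_{L²(ℝ₊)}` (used for `g ∈ L²(ℝ₊)` only). -/
def normL2 (g : ℝ → ℂ) : ℝ := (eLpNorm g 2 halfLine).toReal

/-- The norm `‖(g, h)‖_{L²(ℝ₊)}` of a pair. -/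
def normL2Pair (g h : ℝ → ℂ) : ℝ := Real.sqrt (normL2 g ^ 2 + normL2 h ^ 2)

end

end OrrSommerfeld

open OrrSommerfeld

/-!
The equation is read as a first order system for absolutely continuous functions
`φ`, `φ₁ = φ'`, `w = φ'' - a² φ`, `w₁ = w'`, `h = w'' - a² w` with `a = |α|` (`OSSystem`), and
`ε = s⁶`. The proof consists of an a priori estimate, uniform in `a` and in small `s`, and of the
method of continuity.

*Vorticity.* Tested with `ρ² w`, the equation `U w + i ε (w'' - a² w) = f + U'' φ` has an
imaginary part that controls `w'` and `a w`, because of the condition `w'(0) = 0`, and a real part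
that controls `√U w`. The degeneracy of `U` at the wall is compensated by one derivative on the
scale `s² = ε^{1/3}` of the boundary layer (`ProfileBounds.interpolation`). Together with Hardy's
inequality for the stretching term `U'' φ` this gives all bounds for `w` in terms of `f` and
`s ‖φ'‖` (`OSSystem.weighted_estimate`). Unbounded weights are reached through bounded ones by
Fatou's lemma.

*Stream function, `a ≥ 1`.* Divided by `U` and tested with `φ`, the equation has a nonnegative
Rayleigh part, since `∫ |φ'|² + (U''/U) |φ|² = ∫ |φ' - (U'/U) φ|²`. The diffusion term
`ε h φ / U` is integrated by parts outside the boundary layer and estimated through the equation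
inside it (`OSSystem.energy_estimate`).

*Stream function, `a ≤ 1`.* That estimate degenerates as `a → 0`. The Rayleigh operator is
`(U φ' - U' φ)' - a² U φ`, so the equation can be integrated once. The integrated equation
is tested with `(1 + Y)² (q + G)`, where `q = U φ' - U' φ` and `G` collects the integrated source and
the viscous flux `i ε w'` (`OSSystem.rayleigh_estimate`). Only the mean of the source,
which cannot be integrated to a function vanishing both at the wall and at infinity, costs the factor
`a⁻²`. Everything else is estimated by Hardy's inequality at infinity
(`low_frequency_estimate`). The result is `a_priori_estimate`.

*Existence.* With `h` as the unknown, the system is an equation for a bounded operator on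
`L²`, depending continuously on `ε` and on a factor `t` in front of `U'' φ`. An operator with a lower
bound that is uniform along a path stays invertible along it (`isUnit_of_path`). The path goes from
large `ε` and `t = 0`, where the operator is close to a multiple of the identity, to very small `ε`,
there to `t = 1`, and back to the given `ε` (`exists_osSystem`).

*Sobolev spaces.* By the lemma of du Bois-Reymond a function with a square integrable weak derivative
has an absolutely continuous representative (`HasWeakDeriv.exists_locAC`). This translates
solutions of the equation into solutions of the system and back (`IsSolution.exists_osSystem`,
`OSSystem.isSolution`).
-/

open scoped ComplexConjugate

namespace OrrSommerfeld

/-! ### Square integrable functions on the half line -/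

/-- Membership in `L²(ℝ₊)`. -/
abbrev MemL2 (f : ℝ → ℂ) : Prop := MemLp f 2 halfLine

theorem normL2_nonneg (f : ℝ → ℂ) : 0 ≤ normL2 f := ENNReal.toReal_nonneg

theorem normL2_congr {f g : ℝ → ℂ} (h : f =ᵐ[halfLine] g) : normL2 f = normL2 g := by
  unfold normL2; rw [eLpNorm_congr_ae h]

theorem normL2_sq {f : ℝ → ℂ} (hf : MemL2 f) : normL2 f ^ 2 = ∫ Y, ‖f Y‖ ^ 2 ∂halfLine := by
  unfold normL2
  rw [hf.eLpNorm_eq_integral_rpow_norm (by norm_num) (by norm_num)]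
  have h0 : 0 ≤ ∫ Y, ‖f Y‖ ^ 2 ∂halfLine := integral_nonneg fun _ => by positivity
  simp only [ENNReal.toReal_ofNat, Real.rpow_ofNat]
  rw [ENNReal.toReal_ofReal (by positivity), ← Real.rpow_natCast, ← Real.rpow_mul h0]
  norm_num

theorem MemL2.integrable_norm_sq {f : ℝ → ℂ} (hf : MemL2 f) :
    Integrable (fun Y => ‖f Y‖ ^ 2) halfLine :=
  (memLp_two_iff_integrable_sq_norm hf.1).1 hf

theorem MemL2.of_le {f g : ℝ → ℂ} {C : ℝ} (hg : MemL2 g) (hf : AEStronglyMeasurable f halfLine)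
    (h : ∀ Y, 0 < Y → ‖f Y‖ ≤ C * ‖g Y‖) : MemL2 f :=
  hg.of_le_mul hf ((ae_restrict_iff' measurableSet_Ioi).2 (ae_of_all _ h))

theorem ae_halfLine {p : ℝ → Prop} (h : ∀ Y, 0 < Y → p Y) : ∀ᵐ Y ∂halfLine, p Y :=
  (ae_restrict_iff' measurableSet_Ioi).2 (ae_of_all _ h)

theorem ae_halfLine_pos : ∀ᵐ Y ∂halfLine, 0 < Y := ae_halfLine fun _ h => h

theorem MemL2.integrable_norm_mul {f g : ℝ → ℂ} (hf : MemL2 f) (hg : MemL2 g) :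
    Integrable (fun Y => ‖f Y‖ * ‖g Y‖) halfLine :=
  hf.norm.integrable_mul hg.norm

theorem integral_norm_mul_le {f g : ℝ → ℂ} (hf : MemL2 f) (hg : MemL2 g) :
    ∫ Y, ‖f Y‖ * ‖g Y‖ ∂halfLine ≤ normL2 f * normL2 g := by
  have hpq : Real.HolderConjugate 2 2 := Real.HolderConjugate.two_two
  have e := integral_mul_norm_le_Lp_mul_Lq (μ := halfLine) (f := f) (g := g) hpq
    (by simpa using hf) (by simpa using hg)
  refine e.trans (le_of_eq ?_)
  have key : ∀ {u : ℝ → ℂ}, MemL2 u →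
      (∫ a, ‖u a‖ ^ (2 : ℝ) ∂halfLine) ^ (1 / 2 : ℝ) = normL2 u := by
    intro u hu
    rw [← Real.sqrt_eq_rpow]
    simp only [Real.rpow_ofNat]
    rw [← normL2_sq hu, Real.sqrt_sq (normL2_nonneg u)]
  rw [key hf, key hg]

/-- Cauchy--Schwarz for a function dominated by a product. -/
theorem integrable_of_le_mul {F f g : ℝ → ℂ} {C : ℝ} (hf : MemL2 f) (hg : MemL2 g)
    (hF : AEStronglyMeasurable F halfLine) (h : ∀ᵐ Y ∂halfLine, ‖F Y‖ ≤ C * (‖f Y‖ * ‖g Y‖)) :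
    Integrable F halfLine :=
  ((hf.integrable_norm_mul hg).const_mul C).mono' hF h

theorem norm_integral_le_mul {F f g : ℝ → ℂ} {C : ℝ} (hC : 0 ≤ C) (hf : MemL2 f) (hg : MemL2 g)
    (h : ∀ᵐ Y ∂halfLine, ‖F Y‖ ≤ C * (‖f Y‖ * ‖g Y‖)) :
    ‖∫ Y, F Y ∂halfLine‖ ≤ C * (normL2 f * normL2 g) := by
  calc ‖∫ Y, F Y ∂halfLine‖ ≤ ∫ Y, C * (‖f Y‖ * ‖g Y‖) ∂halfLine :=
        norm_integral_le_of_norm_le ((hf.integrable_norm_mul hg).const_mul C) h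
    _ = C * ∫ Y, ‖f Y‖ * ‖g Y‖ ∂halfLine := integral_const_mul _ _
    _ ≤ _ := mul_le_mul_of_nonneg_left (integral_norm_mul_le hf hg) hC

theorem normL2_add_le {f g : ℝ → ℂ} (hf : MemL2 f) (hg : MemL2 g) :
    normL2 (fun Y => f Y + g Y) ≤ normL2 f + normL2 g := by
  unfold normL2
  rw [← ENNReal.toReal_add hf.2.ne hg.2.ne]
  exact ENNReal.toReal_mono (ENNReal.add_ne_top.2 ⟨hf.2.ne, hg.2.ne⟩)
    (eLpNorm_add_le hf.1 hg.1 (by norm_num))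

theorem normL2_const_mul (c : ℂ) (f : ℝ → ℂ) : normL2 (fun Y => c * f Y) = ‖c‖ * normL2 f := by
  unfold normL2
  have := eLpNorm_const_smul c f 2 halfLine
  rw [show (fun Y => c * f Y) = c • f from rfl, this, ENNReal.toReal_mul]
  simp

theorem normL2_le_of_ae_le {f g : ℝ → ℂ} {C : ℝ} (hC : 0 ≤ C) (hg : MemL2 g)
    (h : ∀ᵐ Y ∂halfLine, ‖f Y‖ ≤ C * ‖g Y‖) : normL2 f ≤ C * normL2 g := by
  have h1 := eLpNorm_le_mul_eLpNorm_of_ae_le_mul h 2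
  unfold normL2
  have h2 := ENNReal.toReal_mono (ENNReal.mul_ne_top ENNReal.ofReal_ne_top hg.2.ne) h1
  rwa [ENNReal.toReal_mul, ENNReal.toReal_ofReal hC] at h2

theorem normL2_le_of_le {f g : ℝ → ℂ} {C : ℝ} (hC : 0 ≤ C) (hg : MemL2 g)
    (h : ∀ Y, 0 < Y → ‖f Y‖ ≤ C * ‖g Y‖) : normL2 f ≤ C * normL2 g :=
  normL2_le_of_ae_le hC hg (ae_halfLine h)

/-- Pointwise bounds by a combination of square integrable functions, in `L²`. -/
theorem memL2_and_normL2_le_add {f g k : ℝ → ℂ} {a b : ℝ} (ha : 0 ≤ a) (hb : 0 ≤ b)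
    (hf : AEStronglyMeasurable f halfLine) (hg : MemL2 g) (hk : MemL2 k)
    (h : ∀ᵐ Y ∂halfLine, ‖f Y‖ ≤ a * ‖g Y‖ + b * ‖k Y‖) :
    MemL2 f ∧ normL2 f ≤ a * normL2 g + b * normL2 k := by
  set G : ℝ → ℂ := fun Y => ((a * ‖g Y‖ : ℝ) : ℂ) with hG
  set H : ℝ → ℂ := fun Y => ((b * ‖k Y‖ : ℝ) : ℂ) with hH
  have mG : MemL2 G := (hg.norm.const_mul a).ofReal
  have mH : MemL2 H := (hk.norm.const_mul b).ofReal
  have hle : ∀ᵐ Y ∂halfLine, ‖f Y‖ ≤ 1 * ‖G Y + H Y‖ := by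
    filter_upwards [h] with Y hY
    have : G Y + H Y = ((a * ‖g Y‖ + b * ‖k Y‖ : ℝ) : ℂ) := by simp [hG, hH]
    rw [this, Complex.norm_real, Real.norm_of_nonneg (by positivity), one_mul]
    exact hY
  have mS : MemL2 (fun Y => G Y + H Y) := mG.add mH
  refine ⟨mS.of_le_mul hf hle, (normL2_le_of_ae_le zero_le_one mS hle).trans ?_⟩
  rw [one_mul]
  refine (normL2_add_le mG mH).trans (add_le_add ?_ ?_)
  · exact normL2_le_of_le ha hg fun Y _ => by
      simp [hG, abs_of_nonneg ha]
  · exact normL2_le_of_le hb hk fun Y _ => by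
      simp [hH, abs_of_nonneg hb]

/-- Fatou's lemma for the norm of `L²`. -/
theorem memL2_and_normL2_le_of_tendsto {F : ℕ → ℝ → ℂ} {f : ℝ → ℂ} {B : ℝ} (hB : 0 ≤ B)
    (hF : ∀ n, MemL2 (F n)) (hb : ∀ n, normL2 (F n) ≤ B) (hf : AEStronglyMeasurable f halfLine)
    (hl : ∀ Y, 0 < Y → Tendsto (fun n => F n Y) atTop (𝓝 (f Y))) : MemL2 f ∧ normL2 f ≤ B := by
  have h1 : eLpNorm f 2 halfLine ≤ ENNReal.ofReal B := by
    refine (Lp.eLpNorm_lim_le_liminf_eLpNorm (fun n => (hF n).1) f (ae_halfLine hl)).trans ?_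
    refine liminf_le_of_le (by isBoundedDefault) fun b hb' => ?_
    obtain ⟨n, hn⟩ := hb'.exists
    refine hn.trans ?_
    rw [← ENNReal.ofReal_toReal (hF n).2.ne]
    exact ENNReal.ofReal_le_ofReal (hb n)
  exact ⟨⟨hf, h1.trans_lt ENNReal.ofReal_lt_top⟩, ENNReal.toReal_le_of_le_ofReal hB h1⟩

theorem MemL2.conj {f : ℝ → ℂ} (hf : MemL2 f) : MemL2 (fun Y => (starRingEnd ℂ) (f Y)) :=
  hf.of_le_mul (c := 1) (Complex.continuous_conj.comp_aestronglyMeasurable hf.1)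
    (ae_of_all _ fun Y => by simp)

theorem integral_mul_conj {f : ℝ → ℂ} (hf : MemL2 f) :
    ∫ Y, f Y * (starRingEnd ℂ) (f Y) ∂halfLine = ((normL2 f ^ 2 : ℝ) : ℂ) := by
  rw [normL2_sq hf, ← integral_complex_ofReal]
  refine integral_congr_ae (ae_of_all _ fun Y => ?_)
  simp only [Complex.mul_conj, Complex.normSq_eq_norm_sq]

/-! ### Local absolute continuity -/

/-- `u` is locally absolutely continuous on `(0, ∞)` with almost everywhere derivative `v`, in
integrated form. Nothing is asked of the values on `(-∞, 0]`. -/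
def LocAC (u v : ℝ → ℂ) : Prop :=
  ∀ x y : ℝ, 0 < x → x ≤ y → IntervalIntegrable v volume x y ∧ u y - u x = ∫ t in x..y, v t

namespace LocAC

variable {u v u' v' : ℝ → ℂ}

theorem integrable (h : LocAC u v) {x y : ℝ} (hx : 0 < x) (hy : x ≤ y) :
    IntervalIntegrable v volume x y := (h x y hx hy).1

theorem sub_eq (h : LocAC u v) {x y : ℝ} (hx : 0 < x) (hy : x ≤ y) :
    u y - u x = ∫ t in x..y, v t := (h x y hx hy).2

theorem continuousOn (h : LocAC u v) : ContinuousOn u (Ioi 0) := by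
  intro y hy
  have hy' : 0 < y := hy
  have h2 : 0 < y / 2 := by linarith
  have hc : ContinuousOn (fun t => u (y/2) + ∫ s in (y/2)..t, v s) (Icc (y / 2) (2 * y)) := by
    have := intervalIntegral.continuousOn_primitive_interval (a := y / 2) (b := 2 * y)
      (((intervalIntegrable_iff_integrableOn_Icc_of_le (by linarith)).1
        (h.integrable h2 (y := 2 * y) (by linarith))).mono_set
          (by rw [uIcc_of_le (by linarith)]))
    rw [uIcc_of_le (by linarith)] at this
    exact continuousOn_const.add this
  have hc' : ContinuousOn u (Icc (y / 2) (2 * y)) := by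
    refine hc.congr fun t ht => ?_
    have := h.sub_eq h2 ht.1
    simp only
    rw [← this]; ring
  exact ((hc'.continuousAt (Icc_mem_nhds (by linarith) (by linarith)))).continuousWithinAt

theorem aestronglyMeasurable (h : LocAC u v) : AEStronglyMeasurable u halfLine :=
  h.continuousOn.aestronglyMeasurable measurableSet_Ioi

theorem add (h : LocAC u v) (h' : LocAC u' v') :
    LocAC (fun Y => u Y + u' Y) (fun Y => v Y + v' Y) := by
  intro x y hx hy
  refine ⟨(h.integrable hx hy).add (h'.integrable hx hy), ?_⟩
  rw [intervalIntegral.integral_add (h.integrable hx hy) (h'.integrable hx hy),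
    ← h.sub_eq hx hy, ← h'.sub_eq hx hy]
  ring

theorem const_mul (h : LocAC u v) (c : ℂ) : LocAC (fun Y => c * u Y) (fun Y => c * v Y) := by
  intro x y hx hy
  refine ⟨(h.integrable hx hy).const_mul c, ?_⟩
  rw [intervalIntegral.integral_const_mul, ← h.sub_eq hx hy]
  ring

theorem neg (h : LocAC u v) : LocAC (fun Y => - u Y) (fun Y => - v Y) := by
  simpa using h.const_mul (-1)

theorem sub (h : LocAC u v) (h' : LocAC u' v') :
    LocAC (fun Y => u Y - u' Y) (fun Y => v Y - v' Y) := by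
  simpa [sub_eq_add_neg] using h.add h'.neg

theorem congr_ae (h : LocAC u v) {v₁ : ℝ → ℂ} (hv : v =ᵐ[halfLine] v₁) : LocAC u v₁ := by
  intro x y hx hy
  have hsub : uIoc x y ⊆ Ioi 0 := by
    rw [uIoc_of_le hy]; exact fun t ht => hx.trans ht.1
  have e : v =ᵐ[volume.restrict (uIoc x y)] v₁ := ae_restrict_of_ae_restrict_of_subset hsub hv
  refine ⟨(h.integrable hx hy).congr_ae e, ?_⟩
  rw [h.sub_eq hx hy]
  exact intervalIntegral.integral_congr_ae_restrict e

theorem congr (h : LocAC u v) {u₁ v₁ : ℝ → ℂ} (hu : ∀ Y, 0 < Y → u₁ Y = u Y)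
    (hv : ∀ Y, 0 < Y → v₁ Y = v Y) : LocAC u₁ v₁ := by
  have h1 : LocAC u v₁ := h.congr_ae (ae_halfLine fun Y hY => (hv Y hY).symm)
  intro x y hx hy
  rw [hu x hx, hu y (hx.trans_le hy)]
  exact h1 x y hx hy

theorem _root_.OrrSommerfeld.locAC_of_clm (L : ℂ →L[ℝ] ℂ) (h : LocAC u v) :
    LocAC (fun Y => L (u Y)) (fun Y => L (v Y)) := by
  intro x y hx hy
  refine ⟨⟨L.integrable_comp (h.integrable hx hy).1, L.integrable_comp (h.integrable hx hy).2⟩, ?_⟩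
  rw [← map_sub, h.sub_eq hx hy, L.intervalIntegral_comp_comm (h.integrable hx hy)]

theorem _root_.OrrSommerfeld.LocAC.conj (h : LocAC u v) :
    LocAC (fun Y => (starRingEnd ℂ) (u Y)) (fun Y => (starRingEnd ℂ) (v Y)) :=
  locAC_of_clm (Complex.conjCLE : ℂ →L[ℝ] ℂ) h

theorem of_hasDerivAt (hu : ∀ Y, 0 < Y → HasDerivAt u (v Y) Y)
    (hv : ∀ x y : ℝ, 0 < x → x ≤ y → IntervalIntegrable v volume x y) : LocAC u v := by
  intro x y hx hy
  refine ⟨hv x y hx hy, ?_⟩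
  rw [intervalIntegral.integral_eq_sub_of_hasDerivAt _ (hv x y hx hy)]
  intro t ht
  rw [uIcc_of_le hy] at ht
  exact hu t (hx.trans_le ht.1)

theorem of_hasDerivAt_continuousOn (hu : ∀ Y, 0 < Y → HasDerivAt u (v Y) Y)
    (hv : ContinuousOn v (Ioi 0)) : LocAC u v := by
  refine of_hasDerivAt hu fun x y hx hy => ContinuousOn.intervalIntegrable (hv.mono ?_)
  rw [uIcc_of_le hy]; exact fun t ht => hx.trans_le ht.1

/-- The product rule for real valued functions that are primitives on an interval. -/
theorem _root_.OrrSommerfeld.integral_product_rule {p q p' q' : ℝ → ℝ} {x y : ℝ} (hy : x ≤ y)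
    (hp' : IntervalIntegrable p' volume x y) (hq' : IntervalIntegrable q' volume x y)
    (hp : ∀ t ∈ Icc x y, p t = p x + ∫ s in x..t, p' s)
    (hq : ∀ t ∈ Icc x y, q t = q x + ∫ s in x..t, q' s) :
    p y * q y - p x * q x = ∫ t in x..y, (p' t * q t + p t * q' t) := by
  set P : ℝ → ℝ := fun t => p x + ∫ s in x..t, p' s with hP
  set Q : ℝ → ℝ := fun t => q x + ∫ s in x..t, q' s with hQ
  have const : ∀ c : ℝ, AbsolutelyContinuousOnInterval (fun _ : ℝ => c) x y := fun c =>
    ((LipschitzWith.const c).lipschitzOnWith (s := uIcc x y)).absolutelyContinuousOnInterval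
  have aP : AbsolutelyContinuousOnInterval P x y :=
    (const _).add (hp'.absolutelyContinuousOnInterval_intervalIntegral left_mem_uIcc)
  have aQ : AbsolutelyContinuousOnInterval Q x y :=
    (const _).add (hq'.absolutelyContinuousOnInterval_intervalIntegral left_mem_uIcc)
  have e := aP.integral_deriv_mul_eq_sub aQ
  rw [hp y ⟨hy, le_rfl⟩, hq y ⟨hy, le_rfl⟩]
  have ePx : P x = p x := by simp [hP]
  have eQx : Q x = q x := by simp [hQ]
  rw [ePx, eQx] at e
  rw [← e]
  refine intervalIntegral.integral_congr_ae ?_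
  filter_upwards [hp'.ae_hasDerivAt_integral, hq'.ae_hasDerivAt_integral] with t h1 h2 ht
  have ht' : t ∈ uIcc x y := uIoc_subset_uIcc ht
  have d1 : deriv P t = p' t := ((h1 ht' x left_mem_uIcc).const_add _).deriv
  have d2 : deriv Q t = q' t := ((h2 ht' x left_mem_uIcc).const_add _).deriv
  rw [uIcc_of_le hy] at ht'
  rw [d1, d2, hp t ht', hq t ht']

theorem mul (h : LocAC u v) (h' : LocAC u' v') :
    LocAC (fun Y => u Y * u' Y) (fun Y => v Y * u' Y + u Y * v' Y) := by
  intro x y hx hy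
  have sub : uIcc x y ⊆ Ioi 0 := by
    rw [uIcc_of_le hy]; exact fun t ht => hx.trans_le ht.1
  have i1 : IntervalIntegrable (fun Y => v Y * u' Y) volume x y :=
    (h.integrable hx hy).mul_continuousOn (h'.continuousOn.mono sub)
  have i2 : IntervalIntegrable (fun Y => u Y * v' Y) volume x y :=
    (h'.integrable hx hy).continuousOn_mul (h.continuousOn.mono sub)
  refine ⟨i1.add i2, ?_⟩
  -- real and imaginary parts reduce the claim to real valued functions
  have iv := h.integrable hx hy
  have iv' := h'.integrable hx hy
  have part : ∀ (L : ℂ →L[ℝ] ℝ) {a b : ℝ → ℂ}, LocAC a b →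
      IntervalIntegrable (fun t => L (b t)) volume x y ∧
      ∀ t ∈ Icc x y, L (a t) = L (a x) + ∫ s in x..t, L (b s) := by
    intro L a b hab
    refine ⟨⟨L.integrable_comp (hab.integrable hx hy).1,
      L.integrable_comp (hab.integrable hx hy).2⟩, fun t ht => ?_⟩
    rw [L.intervalIntegral_comp_comm (hab.integrable hx ht.1), ← hab.sub_eq hx ht.1, map_sub]
    ring
  obtain ⟨r1, r1'⟩ := part Complex.reCLM h
  obtain ⟨m1, m1'⟩ := part Complex.imCLM h
  obtain ⟨r2, r2'⟩ := part Complex.reCLM h'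
  obtain ⟨m2, m2'⟩ := part Complex.imCLM h'
  have rr := integral_product_rule hy r1 r2 r1' r2'
  have mm := integral_product_rule hy m1 m2 m1' m2'
  have rm := integral_product_rule hy r1 m2 r1' m2'
  have mr := integral_product_rule hy m1 r2 m1' r2'
  simp only [Complex.reCLM_apply, Complex.imCLM_apply] at rr mm rm mr r1 r2 m1 m2
  have cu : ContinuousOn u (uIcc x y) := h.continuousOn.mono sub
  have cu' : ContinuousOn u' (uIcc x y) := h'.continuousOn.mono sub
  have re : ∀ {a : ℝ → ℂ}, ContinuousOn a (uIcc x y) →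
    ContinuousOn (fun t => (a t).re) (uIcc x y) := fun ha => Complex.continuous_re.comp_continuousOn ha
  have im : ∀ {a : ℝ → ℂ}, ContinuousOn a (uIcc x y) →
    ContinuousOn (fun t => (a t).im) (uIcc x y) := fun ha => Complex.continuous_im.comp_continuousOn ha
  apply Complex.ext
  · have e : (∫ t in x..y, (v t * u' t + u t * v' t)).re
        = ∫ t in x..y, (v t * u' t + u t * v' t).re :=
      (Complex.reCLM.intervalIntegral_comp_comm (i1.add i2)).symm
    rw [e]
    have : ∀ t, (v t * u' t + u t * v' t).re = ((v t).re * (u' t).re + (u t).re * (v' t).re)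
        - ((v t).im * (u' t).im + (u t).im * (v' t).im) := fun t => by
      simp only [Complex.add_re, Complex.mul_re]; ring
    simp only [this]
    rw [intervalIntegral.integral_sub, ← rr, ← mm]
    · simp only [Complex.sub_re, Complex.mul_re]; ring
    · exact (r1.mul_continuousOn (re cu')).add (r2.continuousOn_mul (re cu))
    · exact (m1.mul_continuousOn (im cu')).add (m2.continuousOn_mul (im cu))
  · have e : (∫ t in x..y, (v t * u' t + u t * v' t)).im
        = ∫ t in x..y, (v t * u' t + u t * v' t).im :=
      (Complex.imCLM.intervalIntegral_comp_comm (i1.add i2)).symm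
    rw [e]
    have : ∀ t, (v t * u' t + u t * v' t).im = ((v t).re * (u' t).im + (u t).re * (v' t).im)
        + ((v t).im * (u' t).re + (u t).im * (v' t).re) := fun t => by
      simp only [Complex.add_im, Complex.mul_im]; ring
    simp only [this]
    rw [intervalIntegral.integral_add, ← rm, ← mr]
    · simp only [Complex.sub_im, Complex.mul_im]; ring
    · exact (r1.mul_continuousOn (im cu')).add (m2.continuousOn_mul (re cu))
    · exact (m1.mul_continuousOn (re cu')).add (r2.continuousOn_mul (im cu))

theorem _root_.OrrSommerfeld.exists_bound_near_zero (h : ContinuousOn u (Ici 0)) :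
    ∃ B, 0 ≤ B ∧ ∀ Y ∈ Icc (0 : ℝ) 1, ‖u Y‖ ≤ B := by
  obtain ⟨B, hB⟩ := isCompact_Icc.exists_bound_of_continuousOn (h.mono Icc_subset_Ici_self)
  exact ⟨B, (norm_nonneg _).trans (hB 0 (by simp)), hB⟩

/-- If a function and its derivative are integrable, then the function vanishes at infinity, and
the integral of the derivative is minus the boundary value at `0`. All integrations by parts on the
half line are instances of this identity. -/
theorem integral_eq_neg {p : ℂ} (h : LocAC u v) (hu : Integrable u halfLine)
    (hv : Integrable v halfLine) (h0 : Tendsto u (𝓝[>] 0) (𝓝 p)) :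
    ∫ Y, v Y ∂halfLine = - p := by
  have hvOn : IntegrableOn v (Ioi 0) := hv
  -- the limit at infinity
  have lim1 : Tendsto u atTop (𝓝 (u 1 + ∫ t in Ioi 1, v t)) := by
    have := (intervalIntegral_tendsto_integral_Ioi 1
      (hvOn.mono_set (Ioi_subset_Ioi zero_le_one)) tendsto_id).const_add (u 1)
    refine this.congr' ?_
    filter_upwards [eventually_ge_atTop 1] with y hy
    simp only [id]
    rw [← h.sub_eq zero_lt_one hy]; ring
  have inf : Tendsto u atTop (𝓝 0) := by
    have hz : u 1 + ∫ t in Ioi 1, v t = 0 := by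
      refine IntegrableAtFilter.eq_zero_of_tendsto (μ := volume) ⟨Ioi 0, Ioi_mem_atTop _, hu⟩ ?_ lim1
      intro s hs
      obtain ⟨b, hb⟩ := mem_atTop_sets.1 hs
      rw [← top_le_iff, ← Real.volume_Ici (a := b)]
      exact measure_mono hb
    rwa [hz] at lim1
  have e1 : u 1 + ∫ t in Ioi 1, v t = 0 := tendsto_nhds_unique lim1 inf
  -- the limit at zero
  have e2 : p = u 1 - ∫ t in (0 : ℝ)..1, v t := by
    have ii : IntervalIntegrable v volume 0 1 :=
      (intervalIntegrable_iff_integrableOn_Ioc_of_le zero_le_one).2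
        (hvOn.mono_set Ioc_subset_Ioi_self)
    have hc : ContinuousOn (fun x => ∫ t in (0 : ℝ)..x, v t) (Icc 0 1) := by
      have := intervalIntegral.continuousOn_primitive_interval (f := v) (a := 0) (b := 1)
        (μ := volume) (by rw [uIcc_of_le zero_le_one, ← intervalIntegrable_iff_integrableOn_Icc_of_le zero_le_one]; exact ii)
      rwa [uIcc_of_le zero_le_one] at this
    have t0 : Tendsto (fun x => ∫ t in (0 : ℝ)..x, v t) (𝓝[>] 0) (𝓝 0) := by
      have := (hc 0 (by simp)).mono_left (nhdsWithin_mono _ Ioo_subset_Icc_self)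
      rw [nhdsWithin_Ioo_eq_nhdsGT zero_lt_one] at this
      simpa using this
    have t1 : Tendsto u (𝓝[>] 0) (𝓝 (u 1 - (∫ t in (0 : ℝ)..1, v t) + 0)) := by
      refine (t0.const_add _).congr' ?_
      filter_upwards [Ioo_mem_nhdsGT (zero_lt_one' ℝ)] with x hx
      have := h.sub_eq hx.1 hx.2.le
      have s := intervalIntegral.integral_add_adjacent_intervals
        (ii.mono_set (by rw [uIcc_of_le hx.1.le, uIcc_of_le zero_le_one]; exact Icc_subset_Icc_right hx.2.le))
        (h.integrable hx.1 hx.2.le)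
      rw [← s, ← this]; ring
    rw [add_zero] at t1
    exact tendsto_nhds_unique h0 t1
  have e3 : ∫ Y, v Y ∂halfLine = (∫ t in (0 : ℝ)..1, v t) + ∫ t in Ioi 1, v t := by
    rw [intervalIntegral.integral_of_le zero_le_one, ← setIntegral_union
      (Ioc_disjoint_Ioi le_rfl) measurableSet_Ioi (hvOn.mono_set Ioc_subset_Ioi_self)
      (hvOn.mono_set (Ioi_subset_Ioi zero_le_one)), Ioc_union_Ioi_eq_Ioi zero_le_one]
  rw [e3, e2]
  linear_combination e1

end LocAC

/-! ### Bounds for the shear profile -/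

/-- The quantitative properties of a shear profile `U`, with first and second derivatives `U₁`
and `U₂`, on which all estimates depend: a single constant `K` bounds everything. -/
structure ProfileBounds (U U₁ U₂ : ℝ → ℝ) (K : ℝ) : Prop where
  one_le : 1 ≤ K
  deriv : ∀ Y, 0 < Y → HasDerivAt U (U₁ Y) Y
  deriv2 : ∀ Y, 0 < Y → HasDerivAt U₁ (U₂ Y) Y
  meas : AEStronglyMeasurable U₂ halfLine
  lower : ∀ Y, 0 < Y → Y ≤ K * (1 + Y) * U Y
  le_mul : ∀ Y, 0 < Y → U Y ≤ K * Y
  le : ∀ Y, 0 < Y → U Y ≤ K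
  bound1 : ∀ Y, 0 < Y → (1 + Y) ^ 3 * |U₁ Y| ≤ K
  bound2 : ∀ Y, 0 < Y → (1 + Y) ^ 3 * |U₂ Y| ≤ K

/-- The profile is bounded below by a multiple of `Y / (1 + Y)`: by its positive slope near the wall,
by its limit `1` at infinity, and by compactness in between. -/
theorem IsShearProfile.exists_lower {U : ℝ → ℝ} (hU : IsShearProfile U) :
    ∃ K, ∀ Y, 0 < Y → Y ≤ K * (1 + Y) * U Y := by
  have hd : HasDerivWithinAt U (profileDeriv U 0) (Ici 0) 0 :=
    (hU.differentiable 0 (by simp)).hasDerivWithinAt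
  set d := profileDeriv U 0 with hdd
  have dpos : 0 < d := hU.deriv_zero_pos
  have near : ∃ r, 0 < r ∧ ∀ Y, 0 < Y → Y ≤ r → d / 2 * Y ≤ U Y := by
    have h1 := (hasDerivWithinAt_iff_tendsto_slope.1 hd).eventually (lt_mem_nhds (half_lt_self dpos))
    have h2 : Ici (0 : ℝ) \ {0} = Ioi 0 := by
      ext x; simp [lt_iff_le_and_ne, eq_comm]
    rw [h2] at h1
    obtain ⟨r, hr, hrs⟩ := mem_nhdsGT_iff_exists_Ioc_subset.1 h1
    refine ⟨r, hr, fun Y h0 hY => ?_⟩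
    have := hrs ⟨h0, hY⟩
    simp only [slope_def_field, hU.zero, sub_zero, mem_ofPred_eq] at this
    rw [lt_div_iff₀ h0] at this
    exact this.le
  obtain ⟨r, hr, hnear⟩ := near
  obtain ⟨R, hR⟩ := (hU.tendsto_one.eventually (lt_mem_nhds (by norm_num : (1 / 2 : ℝ) < 1))).exists_forall_of_atTop
  have mid : ∃ m, 0 < m ∧ ∀ Y, r ≤ Y → Y ≤ R → m ≤ U Y := by
    by_cases hrR : r ≤ R
    · obtain ⟨x, hx, hmin⟩ := isCompact_Icc.exists_isMinOn (nonempty_Icc.2 hrR)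
        (hU.differentiable.continuousOn.mono
          (fun Y hY => (hr.le.trans hY.1 : (0 : ℝ) ≤ Y) : Icc r R ⊆ Ici 0))
      exact ⟨U x, hU.pos x (hr.trans_le hx.1), fun Y h1 h2 => hmin ⟨h1, h2⟩⟩
    · exact ⟨1, one_pos, fun Y h1 h2 => absurd (h1.trans h2) hrR⟩
  obtain ⟨m, hm, hmid⟩ := mid
  refine ⟨2 / d + 2 + 1 / m, fun Y hY => ?_⟩
  have hUY := hU.pos Y hY
  have e : (2 / d + 2 + 1 / m) * (1 + Y) * U Y
      = 2 / d * (1 + Y) * U Y + 2 * (1 + Y) * U Y + 1 / m * (1 + Y) * U Y := by ring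
  have p1 : 0 ≤ 2 / d * (1 + Y) * U Y := by positivity
  have p2 : 0 ≤ 2 * (1 + Y) * U Y := by positivity
  have p3 : 0 ≤ 1 / m * (1 + Y) * U Y := by positivity
  rw [e]
  by_cases c1 : Y ≤ r
  · have h1 := hnear Y hY c1
    have h2 : Y ≤ 2 / d * U Y := by
      rw [div_mul_eq_mul_div, le_div_iff₀ dpos]; linarith
    have h3 : 2 / d * U Y ≤ 2 / d * (1 + Y) * U Y := by
      have : 0 ≤ 2 / d * Y * U Y := by positivity
      linarith
    linarith
  · by_cases c2 : Y ≤ R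
    · have h1 := hmid Y (not_le.1 c1).le c2
      have h2 : 1 ≤ 1 / m * U Y := by
        rw [div_mul_eq_mul_div, le_div_iff₀ hm]; linarith
      have h3 : Y * 1 ≤ Y * (1 / m * U Y) := mul_le_mul_of_nonneg_left h2 hY.le
      linarith
    · have h1 := hR Y (not_le.1 c2).le
      have h3 : (1 + Y) * (1 / 2) ≤ (1 + Y) * U Y := mul_le_mul_of_nonneg_left h1.le (by linarith)
      linarith

theorem IsShearProfile.exists_profileBounds {U : ℝ → ℝ} (hU : IsShearProfile U) :
    ∃ K, ProfileBounds U (profileDeriv U) (profileDeriv (profileDeriv U)) K := by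
  obtain ⟨K₀, h0⟩ := hU.exists_lower
  obtain ⟨K₁, h1⟩ := hU.deriv_bound
  obtain ⟨K₂, h2⟩ := hU.deriv2_bound
  have hder : ∀ {V : ℝ → ℝ}, DifferentiableOn ℝ V (Ici 0) → ∀ Y, 0 < Y →
      HasDerivAt V (profileDeriv V Y) Y := fun hV Y hY =>
    ((hV Y hY.le).hasDerivWithinAt).hasDerivAt (Ici_mem_nhds hY)
  have d1 := hder hU.differentiable
  have d2 := hder hU.differentiable_deriv
  -- a bound for `U` away from the wall
  obtain ⟨R, hR⟩ := (hU.tendsto_one.eventually (gt_mem_nhds (by norm_num : (1 : ℝ) < 2))).exists_forall_of_atTop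
  have b1 : ∀ Y, 0 ≤ Y → |profileDeriv U Y| ≤ |K₁| := fun Y hY => by
    have := h1 Y hY
    have h3 : 1 ≤ (1 + Y) ^ 3 := one_le_pow₀ (by linarith)
    calc |profileDeriv U Y| ≤ (1 + Y) ^ 3 * |profileDeriv U Y| :=
          le_mul_of_one_le_left (abs_nonneg _) h3
      _ ≤ |K₁| := this.trans (le_abs_self _)
  have lin : ∀ Y, 0 < Y → U Y ≤ |K₁| * Y := fun Y hY => by
    have := Convex.norm_image_sub_le_of_norm_derivWithin_le (s := Ici (0 : ℝ)) (f := U)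
      (C := |K₁|) (x := 0) (y := Y) hU.differentiable (fun x hx => b1 x hx) (convex_Ici 0)
      (by simp) hY.le
    rw [hU.zero, sub_zero, sub_zero, Real.norm_of_nonneg hY.le, Real.norm_eq_abs] at this
    exact (le_abs_self _).trans this
  set K := 1 + |K₀| + |K₁| + |K₂| + 2 + |K₁| * |R| with hK
  have p4 : 0 ≤ |K₁| * |R| := by positivity
  have p0 := abs_nonneg K₀
  have p1 := abs_nonneg K₁
  have p2 := abs_nonneg K₂
  refine ⟨K, by linarith, d1, d2, ?_, fun Y hY => ?_, fun Y hY => ?_, fun Y hY => ?_,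
    fun Y hY => ?_, fun Y hY => ?_⟩
  · refine (measurable_deriv (profileDeriv U)).aestronglyMeasurable.congr ?_
    exact ae_halfLine fun Y hY => (d2 Y hY).deriv
  · have := h0 Y hY
    have u := hU.pos Y hY
    refine this.trans ?_
    have : K₀ ≤ K := (le_abs_self _).trans (by linarith)
    gcongr
  · exact (lin Y hY).trans (by gcongr; linarith)
  · by_cases c : Y ≤ R
    · have : Y ≤ |R| := c.trans (le_abs_self _)
      calc U Y ≤ |K₁| * Y := lin Y hY
        _ ≤ |K₁| * |R| := by gcongr
        _ ≤ K := by linarith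
    · have := hR Y (not_le.1 c).le
      linarith
  · exact (h1 Y hY.le).trans ((le_abs_self _).trans (by linarith))
  · exact (h2 Y hY.le).trans ((le_abs_self _).trans (by linarith))

namespace ProfileBounds

variable {U U₁ U₂ : ℝ → ℝ} {K : ℝ} (hU : ProfileBounds U U₁ U₂ K)
include hU

theorem K_pos : 0 < K := zero_lt_one.trans_le hU.one_le

theorem pos {Y : ℝ} (hY : 0 < Y) : 0 < U Y := by
  have h := hU.lower Y hY
  by_contra hc
  have : K * (1 + Y) * U Y ≤ 0 :=
    mul_nonpos_of_nonneg_of_nonpos (mul_nonneg hU.K_pos.le (by linarith)) (not_lt.1 hc)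
  linarith

theorem abs_deriv_le {Y : ℝ} (hY : 0 < Y) : |U₁ Y| ≤ K := by
  have h3 : 1 ≤ (1 + Y) ^ 3 := one_le_pow₀ (by linarith)
  exact (le_mul_of_one_le_left (abs_nonneg _) h3).trans (hU.bound1 Y hY)

theorem abs_deriv2_le {Y : ℝ} (hY : 0 < Y) : |U₂ Y| ≤ K := by
  have h3 : 1 ≤ (1 + Y) ^ 3 := one_le_pow₀ (by linarith)
  exact (le_mul_of_one_le_left (abs_nonneg _) h3).trans (hU.bound2 Y hY)

theorem inv_le {Y : ℝ} (hY : 0 < Y) : (U Y)⁻¹ ≤ K * ((1 + Y) / Y) := by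
  rw [inv_le_iff_one_le_mul₀ (hU.pos hY), mul_div_assoc', div_mul_eq_mul_div, le_div_iff₀ hY,
    one_mul]
  exact hU.lower Y hY

theorem continuousOn_deriv : ContinuousOn U₁ (Ioi 0) := fun Y hY =>
  (hU.deriv2 Y hY).continuousAt.continuousWithinAt

theorem continuousOn : ContinuousOn U (Ioi 0) := fun Y hY =>
  (hU.deriv Y hY).continuousAt.continuousWithinAt

theorem aesm : AEStronglyMeasurable (fun Y => (U Y : ℂ)) halfLine :=
  (Complex.continuous_ofReal.comp_continuousOn hU.continuousOn).aestronglyMeasurable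
    measurableSet_Ioi

theorem aesm_deriv : AEStronglyMeasurable (fun Y => (U₁ Y : ℂ)) halfLine :=
  (Complex.continuous_ofReal.comp_continuousOn hU.continuousOn_deriv).aestronglyMeasurable
    measurableSet_Ioi

theorem aesm_deriv2 : AEStronglyMeasurable (fun Y => (U₂ Y : ℂ)) halfLine :=
  Complex.continuous_ofReal.comp_aestronglyMeasurable hU.meas

end ProfileBounds

theorem LocAC.ofReal {k k' : ℝ → ℝ} (hk : ∀ Y, 0 < Y → HasDerivAt k (k' Y) Y)
    (hk' : ContinuousOn k' (Ioi 0)) : LocAC (fun Y => (k Y : ℂ)) (fun Y => (k' Y : ℂ)) :=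
  LocAC.of_hasDerivAt_continuousOn (fun Y hY => (hk Y hY).ofReal_comp)
    (Complex.continuous_ofReal.comp_continuousOn hk')

namespace ProfileBounds

variable {U U₁ U₂ : ℝ → ℝ} {K : ℝ} (hU : ProfileBounds U U₁ U₂ K)
include hU

theorem locAC : LocAC (fun Y => (U Y : ℂ)) (fun Y => (U₁ Y : ℂ)) :=
  LocAC.ofReal hU.deriv hU.continuousOn_deriv

theorem locAC_deriv : LocAC (fun Y => (U₁ Y : ℂ)) (fun Y => (U₂ Y : ℂ)) := by
  refine LocAC.of_hasDerivAt (fun Y hY => (hU.deriv2 Y hY).ofReal_comp) fun x y hx hy => ?_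
  rw [intervalIntegrable_iff_integrableOn_Ioc_of_le hy]
  have hsub : Ioc x y ⊆ Ioi 0 := fun t ht => hx.trans ht.1
  refine Integrable.mono' (g := fun _ => K) (by simp) (hU.aesm_deriv2.mono_measure
    (Measure.restrict_mono hsub le_rfl)) ?_
  refine (ae_restrict_iff' measurableSet_Ioc).2 (ae_of_all _ fun t ht => ?_)
  simpa using hU.abs_deriv2_le (hsub ht)

theorem locAC_inv : LocAC (fun Y => ((U Y)⁻¹ : ℂ)) (fun Y => (-(U₁ Y) / (U Y) ^ 2 : ℂ)) := by
  have := LocAC.ofReal (k := fun Y => (U Y)⁻¹) (k' := fun Y => -(U₁ Y) / (U Y) ^ 2)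
    (fun Y hY => (hU.deriv Y hY).inv (hU.pos hY).ne')
    (hU.continuousOn_deriv.neg.div (hU.continuousOn.pow 2)
      (fun Y hY => (pow_pos (hU.pos hY) 2).ne'))
  simpa using this

end ProfileBounds

/-! ### Hardy inequalities -/

/-- Integration by parts on the half line, for a derivative written as a sum `a + b`. -/
theorem integral_add_eq_neg {u a b : ℝ → ℂ} {p : ℂ} (h : LocAC u (fun Y => a Y + b Y))
    (hu : Integrable u halfLine) (ha : Integrable a halfLine) (hb : Integrable b halfLine)
    (h0 : Tendsto u (𝓝[>] 0) (𝓝 p)) :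
    ∫ Y, a Y ∂halfLine = - p - ∫ Y, b Y ∂halfLine := by
  have := h.integral_eq_neg hu (ha.add hb) h0
  rw [integral_add ha hb] at this
  linear_combination this

theorem le_of_sq_le_mul {x y : ℝ} (hy : 0 ≤ y) (h : x ^ 2 ≤ y * x) : x ≤ y := by
  by_contra hc
  have : y < x := not_le.1 hc
  nlinarith

theorem continuousOn_aesm {g : ℝ → ℂ} (h : ContinuousOn g (Ioi 0)) :
    AEStronglyMeasurable g halfLine :=
  h.aestronglyMeasurable measurableSet_Ioi

/-- Hardy's inequality with the bounded weight `(Y + η)⁻¹`, for which no integrability of `Y⁻¹ u`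
has to be known beforehand. -/
theorem hardy_shift {u v : ℝ → ℂ} (h : LocAC u v) (hu : MemL2 u) (hv : MemL2 v)
    (h0 : Tendsto u (𝓝[>] 0) (𝓝 0)) {η : ℝ} (hη : 0 < η) :
    MemL2 (fun Y => ((Y + η : ℝ) : ℂ)⁻¹ * u Y) ∧
      normL2 (fun Y => ((Y + η : ℝ) : ℂ)⁻¹ * u Y) ≤ 2 * normL2 v := by
  set k : ℝ → ℝ := fun Y => (Y + η)⁻¹ with hk
  have kpos : ∀ Y, 0 < Y → 0 < k Y := fun Y hY => by simp only [hk]; positivity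
  have kle : ∀ Y, 0 < Y → k Y ≤ η⁻¹ := fun Y hY => by
    simp only [hk]; exact inv_anti₀ hη (by linarith)
  have kd : ∀ Y, 0 < Y → HasDerivAt k (-(k Y) ^ 2) Y := fun Y hY => by
    have := ((hasDerivAt_id Y).add_const η).inv (by simp only [id]; positivity)
    refine this.congr_deriv ?_
    simp only [hk, id]; field_simp
  have kc : ContinuousOn k (Ioi 0) := fun Y hY => (kd Y hY).continuousAt.continuousWithinAt
  have lk := LocAC.ofReal kd ((kc.pow 2).neg)
  set F : ℝ → ℂ := fun Y => (k Y : ℂ) * u Y with hF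
  have kcm : AEStronglyMeasurable (fun Y => (k Y : ℂ)) halfLine := lk.aestronglyMeasurable
  have hu' := h.aestronglyMeasurable
  have hv' := hv.1
  have hub := h.conj.aestronglyMeasurable
  have hvb := hv.conj.1
  have mF : MemL2 F := hu.of_le (kcm.mul hu') fun Y hY => by
    simp only [hF, norm_mul, Complex.norm_real, Real.norm_of_nonneg (kpos Y hY).le]
    exact mul_le_mul_of_nonneg_right (kle Y hY) (norm_nonneg _)
  have eF : (fun Y => ((Y + η : ℝ) : ℂ)⁻¹ * u Y) = F := by
    funext Y; simp [hF, hk]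
  rw [eF]
  refine ⟨mF, ?_⟩
  have hP := (h.mul h.conj).mul lk
  have i1 : Integrable (fun Y => (v Y * (starRingEnd ℂ) (u Y) + u Y * (starRingEnd ℂ) (v Y))
      * (k Y : ℂ)) halfLine := by
    refine integrable_of_le_mul (C := 2) hv mF (((hv'.mul hub).add (hu'.mul hvb)).mul kcm)
      (ae_halfLine fun Y hY => ?_)
    simp only [hF, norm_mul, Complex.norm_real, Real.norm_of_nonneg (kpos Y hY).le]
    calc _ ≤ (‖v Y‖ * ‖u Y‖ + ‖u Y‖ * ‖v Y‖) * k Y := by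
          refine mul_le_mul_of_nonneg_right ((norm_add_le _ _).trans ?_) (kpos Y hY).le
          simp
      _ = _ := by ring
  have e2 : ∀ Y, u Y * (starRingEnd ℂ) (u Y) * ((-(k Y) ^ 2 : ℝ) : ℂ)
      = -(F Y * (starRingEnd ℂ) (F Y)) := fun Y => by
    simp only [hF, map_mul, Complex.conj_ofReal]; push_cast; ring
  have i2' : Integrable (fun Y => F Y * (starRingEnd ℂ) (F Y)) halfLine :=
    integrable_of_le_mul (C := 1) mF mF (mF.1.mul mF.conj.1) (ae_of_all _ fun Y => by simp)
  have i2 : Integrable (fun Y => u Y * (starRingEnd ℂ) (u Y) * ((-(k Y) ^ 2 : ℝ) : ℂ)) halfLine := by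
    simp only [e2]; exact i2'.neg
  have iP : Integrable (fun Y => u Y * (starRingEnd ℂ) (u Y) * (k Y : ℂ)) halfLine := by
    refine integrable_of_le_mul (C := 1) mF hu ((hu'.mul hub).mul kcm)
      (ae_halfLine fun Y hY => ?_)
    simp only [hF, norm_mul, RCLike.norm_conj]
    apply le_of_eq; ring
  have lim : Tendsto (fun Y => u Y * (starRingEnd ℂ) (u Y) * (k Y : ℂ)) (𝓝[>] 0) (𝓝 0) := by
    have c1 : Tendsto (fun Y => (k Y : ℂ)) (𝓝[>] 0) (𝓝 ((k 0 : ℝ) : ℂ)) := by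
      refine (Complex.continuous_ofReal.tendsto _).comp (Tendsto.mono_left ?_ nhdsWithin_le_nhds)
      exact ContinuousAt.inv₀ (by fun_prop) (by simpa using hη.ne')
    have c2 := (h0.mul ((Complex.continuous_conj.tendsto _).comp h0)).mul c1
    simpa using c2
  have key := integral_add_eq_neg hP iP i1 i2 lim
  simp only [e2] at key
  rw [integral_neg, integral_mul_conj mF] at key
  have b : ‖∫ Y, (v Y * (starRingEnd ℂ) (u Y) + u Y * (starRingEnd ℂ) (v Y)) * (k Y : ℂ) ∂halfLine‖
      ≤ 2 * (normL2 v * normL2 F) := by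
    refine norm_integral_le_mul (by norm_num) hv mF (ae_halfLine fun Y hY => ?_)
    simp only [hF, norm_mul, Complex.norm_real, Real.norm_of_nonneg (kpos Y hY).le]
    calc _ ≤ (‖v Y‖ * ‖u Y‖ + ‖u Y‖ * ‖v Y‖) * k Y := by
          refine mul_le_mul_of_nonneg_right ((norm_add_le _ _).trans ?_) (kpos Y hY).le
          simp
      _ = _ := by ring
  rw [key] at b
  simp only [neg_zero, sub_neg_eq_add, zero_add, Complex.norm_real, norm_pow,
    Real.norm_of_nonneg (normL2_nonneg F)] at b
  exact le_of_sq_le_mul (by have := normL2_nonneg v; positivity) (by linarith)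

/-- Hardy's inequality for functions vanishing at `0`. -/
theorem hardy {u v : ℝ → ℂ} (h : LocAC u v) (hu : MemL2 u) (hv : MemL2 v)
    (h0 : Tendsto u (𝓝[>] 0) (𝓝 0)) :
    MemL2 (fun Y => (Y : ℂ)⁻¹ * u Y) ∧ normL2 (fun Y => (Y : ℂ)⁻¹ * u Y) ≤ 2 * normL2 v := by
  have hη : ∀ n : ℕ, (0 : ℝ) < 1 / ((n : ℝ) + 1) := fun n => by positivity
  refine memL2_and_normL2_le_of_tendsto (by have := normL2_nonneg v; positivity)
    (fun n => (hardy_shift h hu hv h0 (hη n)).1) (fun n => (hardy_shift h hu hv h0 (hη n)).2)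
    ?_ fun Y hY => ?_
  · refine AEStronglyMeasurable.mul ?_ h.aestronglyMeasurable
    refine continuousOn_aesm (ContinuousOn.inv₀ (by fun_prop) fun Y hY => ?_)
    exact_mod_cast (ne_of_gt hY)
  · refine Tendsto.mul_const _ ?_
    refine Tendsto.inv₀ ?_ (by exact_mod_cast hY.ne')
    refine (Complex.continuous_ofReal.tendsto _).comp ?_
    simpa using (tendsto_one_div_add_atTop_nhds_zero_nat (𝕜 := ℝ)).const_add Y

/-! ### Energy identities with bounded multipliers -/

theorem integrable_multiplier {m : ℝ → ℝ} {f g : ℝ → ℂ} {B : ℝ}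
    (hm : AEStronglyMeasurable (fun Y => (m Y : ℂ)) halfLine) (hB : ∀ Y, 0 < Y → |m Y| ≤ B)
    (hf : MemL2 f) (hg : MemL2 g) : Integrable (fun Y => (m Y : ℂ) * f Y * conj (g Y)) halfLine := by
  refine integrable_of_le_mul (C := B) hf hg ((hm.mul hf.1).mul hg.conj.1)
    (ae_halfLine fun Y hY => ?_)
  simp only [norm_mul, Complex.norm_real, Real.norm_eq_abs, RCLike.norm_conj, mul_assoc]
  exact mul_le_mul_of_nonneg_right (hB Y hY) (by positivity)

/-- Integration by parts on the half line with a bounded real multiplier. -/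
theorem integral_by_parts {m m' : ℝ → ℝ} {u v u' v' : ℝ → ℂ} {B B' : ℝ}
    (dm : LocAC (fun Y => (m Y : ℂ)) (fun Y => (m' Y : ℂ)))
    (mm : AEStronglyMeasurable (fun Y => (m' Y : ℂ)) halfLine)
    (hB : ∀ Y, 0 < Y → |m Y| ≤ B) (hB' : ∀ Y, 0 < Y → |m' Y| ≤ B')
    (h : LocAC u v) (h' : LocAC u' v') (hu : MemL2 u) (hv : MemL2 v) (hu' : MemL2 u')
    (hv' : MemL2 v')
    (lim : Tendsto (fun Y => (m Y : ℂ) * u Y * conj (u' Y)) (𝓝[>] 0) (𝓝 0)) :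
    ∫ Y, (m Y : ℂ) * v Y * conj (u' Y) ∂halfLine
      = - (∫ Y, (m Y : ℂ) * u Y * conj (v' Y) ∂halfLine)
        - ∫ Y, (m' Y : ℂ) * u Y * conj (u' Y) ∂halfLine := by
  have dP := (dm.mul h).mul h'.conj
  have cm := dm.aestronglyMeasurable
  have i1 := integrable_multiplier cm hB hv hu'
  have i2 := integrable_multiplier cm hB hu hv'
  have i3 := integrable_multiplier mm hB' hu hu'
  have dP' : LocAC (fun Y => (m Y : ℂ) * u Y * conj (u' Y)) (fun Y =>
      (m Y : ℂ) * v Y * conj (u' Y) + ((m Y : ℂ) * u Y * conj (v' Y)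
        + (m' Y : ℂ) * u Y * conj (u' Y))) :=
    dP.congr (fun _ _ => rfl) (fun Y _ => by ring)
  have e := integral_add_eq_neg dP' (integrable_multiplier cm hB hu hu') i1 (i2.add i3) lim
  rw [e, integral_add i2 i3]
  ring

theorem tendsto_zero_of_bound {F G : ℝ → ℂ} {B : ℝ} (hG : Tendsto G (𝓝[>] 0) (𝓝 0))
    (h : ∀ Y, 0 < Y → Y ≤ 1 → ‖F Y‖ ≤ B * ‖G Y‖) : Tendsto F (𝓝[>] 0) (𝓝 0) := by
  have h1 : Tendsto (fun Y => B * ‖G Y‖) (𝓝[>] 0) (𝓝 0) := by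
    simpa using hG.norm.const_mul B
  refine squeeze_zero_norm' ?_ h1
  filter_upwards [Ioc_mem_nhdsGT (zero_lt_one' ℝ)] with Y hY using h Y hY.1 hY.2

theorem tendsto_of_continuousOn {u : ℝ → ℂ} (h : ContinuousOn u (Ici 0)) :
    Tendsto u (𝓝[>] 0) (𝓝 (u 0)) :=
  (h 0 (by simp)).mono_left (nhdsWithin_mono _ Ioi_subset_Ici_self)

/-- A square integrable solution of `u'' - a² u = g`, as the triple of `u`, `u₁ = u'` and `g`, with
`u` and `u'` continuous up to the wall. No boundary condition is included. -/
structure HelmholtzTriple (a : ℝ) (u u₁ g : ℝ → ℂ) : Prop where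
  d : LocAC u u₁
  d₁ : LocAC u₁ (fun Y => g Y + (a : ℂ) ^ 2 * u Y)
  c : ContinuousOn u (Ici 0)
  c₁ : ContinuousOn u₁ (Ici 0)
  m : MemL2 u
  m₁ : MemL2 u₁
  mg : MemL2 g

namespace HelmholtzTriple

variable {a : ℝ} {u u₁ g : ℝ → ℂ}

theorem mdd (h : HelmholtzTriple a u u₁ g) : MemL2 (fun Y => g Y + (a : ℂ) ^ 2 * u Y) :=
  h.mg.add (h.m.const_mul _)

/-- The boundary term in an integration by parts against `u'`. -/
theorem tendsto_boundary (h : HelmholtzTriple a u u₁ g) (hb : u₁ 0 * u 0 = 0) {m : ℝ → ℝ} {B : ℝ}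
    (hB : ∀ Y, 0 < Y → |m Y| ≤ B) :
    Tendsto (fun Y => (m Y : ℂ) * u₁ Y * conj (u Y)) (𝓝[>] 0) (𝓝 0) := by
  have t : Tendsto (fun Y => u₁ Y * u Y) (𝓝[>] 0) (𝓝 0) := by
    simpa [hb] using (tendsto_of_continuousOn h.c₁).mul (tendsto_of_continuousOn h.c)
  refine tendsto_zero_of_bound (B := B) t fun Y h0 h1 => ?_
  simp only [norm_mul, Complex.norm_real, Real.norm_eq_abs, RCLike.norm_conj, mul_assoc]
  exact mul_le_mul_of_nonneg_right (hB Y h0) (by positivity)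

/-- The energy identity for `u'' - a² u = g` tested with `m u`. The hypothesis on `u'(0) u(0)` covers
the Dirichlet condition (for the stream function) and the Neumann condition (for the vorticity). -/
theorem energy_identity (h : HelmholtzTriple a u u₁ g) (hb : u₁ 0 * u 0 = 0) {m m' : ℝ → ℝ}
    {B B' : ℝ} (dm : LocAC (fun Y => (m Y : ℂ)) (fun Y => (m' Y : ℂ)))
    (mm : AEStronglyMeasurable (fun Y => (m' Y : ℂ)) halfLine)
    (hB : ∀ Y, 0 < Y → |m Y| ≤ B) (hB' : ∀ Y, 0 < Y → |m' Y| ≤ B') :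
    ∫ Y, (m Y : ℂ) * g Y * conj (u Y) ∂halfLine
      = - (∫ Y, (m Y : ℂ) * u₁ Y * conj (u₁ Y) ∂halfLine)
        - (a : ℂ) ^ 2 * (∫ Y, (m Y : ℂ) * u Y * conj (u Y) ∂halfLine)
        - ∫ Y, (m' Y : ℂ) * u₁ Y * conj (u Y) ∂halfLine := by
  have e := integral_by_parts dm mm hB hB' h.d₁ h.d h.m₁ h.mdd h.m h.m₁
    (h.tendsto_boundary hb hB)
  have cm := dm.aestronglyMeasurable
  have s : ∫ Y, (m Y : ℂ) * (g Y + (a : ℂ) ^ 2 * u Y) * conj (u Y) ∂halfLine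
      = (∫ Y, (m Y : ℂ) * g Y * conj (u Y) ∂halfLine)
        + (a : ℂ) ^ 2 * ∫ Y, (m Y : ℂ) * u Y * conj (u Y) ∂halfLine := by
    rw [← integral_const_mul, ← integral_add (integrable_multiplier cm hB h.mg h.m)
      ((integrable_multiplier cm hB h.m h.m).const_mul _)]
    congr 1; funext Y; ring
  rw [s] at e
  linear_combination e

/-- The energy identity with the constant multiplier. -/
theorem energy (h : HelmholtzTriple a u u₁ g) (hb : u₁ 0 * u 0 = 0) :
    ((normL2 u₁ ^ 2 + a ^ 2 * normL2 u ^ 2 : ℝ) : ℂ) = - ∫ Y, g Y * conj (u Y) ∂halfLine := by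
  have e := h.energy_identity hb (m := fun _ => 1) (m' := fun _ => 0) (B := 1) (B' := 0)
    (LocAC.ofReal (fun Y _ => hasDerivAt_const Y (1 : ℝ)) continuousOn_const)
    aestronglyMeasurable_const (by simp) (by simp)
  simp only [Complex.ofReal_one, one_mul, Complex.ofReal_zero, zero_mul, integral_zero] at e
  rw [integral_mul_conj h.m₁, integral_mul_conj h.m] at e
  push_cast at e ⊢
  linear_combination e

theorem energy_le (h : HelmholtzTriple a u u₁ g) (hb : u₁ 0 * u 0 = 0) :
    normL2 u₁ ^ 2 + a ^ 2 * normL2 u ^ 2 ≤ normL2 g * normL2 u := by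
  have e := congrArg norm (h.energy hb)
  rw [Complex.norm_real, norm_neg, Real.norm_of_nonneg (by positivity)] at e
  rw [e]
  refine (norm_integral_le_mul zero_le_one h.mg h.m (ae_of_all _ fun Y => ?_)).trans (by simp)
  simp

theorem sq_mul_norm_le (h : HelmholtzTriple a u u₁ g) (hb : u₁ 0 * u 0 = 0) :
    a ^ 2 * normL2 u ≤ normL2 g := by
  have e := h.energy_le hb
  have p := normL2_nonneg u
  rcases p.eq_or_lt with h0 | h0
  · rw [← h0]; simpa using normL2_nonneg g
  · have : a ^ 2 * normL2 u * normL2 u ≤ normL2 g * normL2 u := by nlinarith [sq_nonneg (normL2 u₁)]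
    exact le_of_mul_le_mul_right this h0

end HelmholtzTriple

/-! ### Weights -/

/-- A bounded weight `ρ` with `0 ≤ ρ' ≤ 2ρ`, dominated by `(1 + Y)²`. Boundedness by `B` makes all
integrations by parts legitimate; no estimate below depends on `B`. -/
structure Weight (ρ ρ' : ℝ → ℝ) (B : ℝ) : Prop where
  deriv : ∀ Y, 0 < Y → HasDerivAt ρ (ρ' Y) Y
  cont : ContinuousOn ρ' (Ioi 0)
  pos : ∀ Y, 0 < Y → 0 < ρ Y
  nonneg : ∀ Y, 0 < Y → 0 ≤ ρ' Y
  le_two : ∀ Y, 0 < Y → ρ' Y ≤ 2 * ρ Y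
  le_sq : ∀ Y, 0 < Y → ρ Y ≤ (1 + Y) ^ 2
  le : ∀ Y, 0 < Y → ρ Y ≤ B

namespace Weight

variable {ρ ρ' : ℝ → ℝ} {B : ℝ}

theorem one : Weight (fun _ => 1) (fun _ => 0) 1 where
  deriv Y _ := hasDerivAt_const Y 1
  cont := continuousOn_const
  pos _ _ := one_pos
  nonneg _ _ := le_rfl
  le_two _ _ := by norm_num
  le_sq Y hY := one_le_pow₀ (by linarith)
  le _ _ := le_rfl

theorem locAC (hρ : Weight ρ ρ' B) : LocAC (fun Y => (ρ Y : ℂ)) (fun Y => (ρ' Y : ℂ)) :=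
  LocAC.ofReal hρ.deriv hρ.cont

theorem continuousOn (hρ : Weight ρ ρ' B) : ContinuousOn ρ (Ioi 0) := fun Y hY =>
  (hρ.deriv Y hY).continuousAt.continuousWithinAt

theorem aesm (hρ : Weight ρ ρ' B) : AEStronglyMeasurable (fun Y => (ρ Y : ℂ)) halfLine :=
  hρ.locAC.aestronglyMeasurable

theorem memL2 (hρ : Weight ρ ρ' B) {f : ℝ → ℂ} (hf : MemL2 f) :
    MemL2 (fun Y => (ρ Y : ℂ) * f Y) :=
  hf.of_le (C := B) (hρ.aesm.mul hf.1) fun Y hY => by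
    simp only [norm_mul, Complex.norm_real, Real.norm_of_nonneg (hρ.pos Y hY).le]
    exact mul_le_mul_of_nonneg_right (hρ.le Y hY) (norm_nonneg _)

/-- The bounded approximations `((1 + Y) / (1 + η Y))ᵏ` of the weight `(1 + Y)ᵏ`. -/
theorem approx {η : ℝ} (h0 : 0 < η) (h1 : η ≤ 1) {k : ℕ} (hk : k ≤ 2) :
    Weight (fun Y => ((1 + Y) / (1 + η * Y)) ^ k)
      (fun Y => k * ((1 + Y) / (1 + η * Y)) ^ (k - 1) * ((1 - η) / (1 + η * Y) ^ 2)) ((η⁻¹) ^ k) where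
  deriv Y hY := by
    have hp : 0 < 1 + η * Y := by positivity
    have := (((hasDerivAt_id Y).const_add 1).div
      (((hasDerivAt_id Y).const_mul η).const_add 1) hp.ne').pow k
    refine this.congr_deriv ?_
    simp only [id, Pi.div_apply]
    congr 1
    congr 1
    ring
  cont := by
    have hp : ∀ Y ∈ Ioi (0 : ℝ), 1 + η * Y ≠ 0 := fun Y hY => by
      have : 0 < Y := hY
      positivity
    have hp2 : ∀ Y ∈ Ioi (0 : ℝ), (1 + η * Y) ^ 2 ≠ 0 := fun Y hY => pow_ne_zero 2 (hp Y hY)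
    exact (continuousOn_const.mul (((by fun_prop : ContinuousOn (fun Y : ℝ => 1 + Y) _).div
      (by fun_prop) hp).pow _)).mul (continuousOn_const.div (by fun_prop) hp2)
  pos Y hY := by positivity
  nonneg Y hY := by
    have : 0 ≤ 1 - η := by linarith
    positivity
  le_two Y hY := by
    have hp : 1 ≤ 1 + η * Y := by nlinarith
    have h1Y : 1 ≤ 1 + Y := by linarith
    set r := (1 + Y) / (1 + η * Y) with hr
    have hr0 : 0 < r := by positivity
    have hq : (1 - η) / (1 + η * Y) ^ 2 ≤ r := by
      rw [hr, div_le_div_iff₀ (by positivity) (by positivity)]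
      nlinarith [mul_pos h0 hY, mul_le_mul h1Y hp zero_le_one (by linarith)]
    rcases k with _ | k
    · simp
    · have hk2 : ((k + 1 : ℕ) : ℝ) ≤ 2 := by exact_mod_cast hk
      calc _ ≤ 2 * r ^ k * r := by
            simp only [Nat.add_sub_cancel]
            gcongr
        _ = _ := by ring
  le_sq Y hY := by
    have hp : 1 ≤ 1 + η * Y := by nlinarith
    have : (1 + Y) / (1 + η * Y) ≤ 1 + Y := div_le_self (by linarith) hp
    calc ((1 + Y) / (1 + η * Y)) ^ k ≤ (1 + Y) ^ k := by gcongr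
      _ ≤ (1 + Y) ^ 2 := pow_le_pow_right₀ (by linarith) hk
  le Y hY := by
    have : (1 + Y) / (1 + η * Y) ≤ η⁻¹ := by
      rw [inv_eq_one_div, div_le_div_iff₀ (by positivity) h0]
      nlinarith
    gcongr

end Weight

/-! ### Estimates for the Airy part of the equation -/

/-- The Orr--Sommerfeld equation with the vorticity stretching term `U'' φ` multiplied by `t`, for
absolutely continuous representatives: `φ₁ = φ'`, `w = φ'' - a² φ`, `w₁ = w'`, `h = w'' - a² w`. -/
structure OSSystem (U U₂ : ℝ → ℝ) (t ε a : ℝ) (f φ φ₁ w w₁ h : ℝ → ℂ) : Prop where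
  hφ : HelmholtzTriple a φ φ₁ w
  hw : HelmholtzTriple a w w₁ h
  φ_zero : φ 0 = 0
  w₁_zero : w₁ 0 = 0
  mf : MemL2 f
  eq : ∀ᵐ Y ∂halfLine,
    (U Y : ℂ) * w Y - (t : ℂ) * (U₂ Y : ℂ) * φ Y + Complex.I * (ε : ℂ) * h Y = f Y

theorem integral_weight_sq {ρ : ℝ → ℝ} {u : ℝ → ℂ} (h : MemL2 (fun Y => (ρ Y : ℂ) * u Y)) :
    ∫ Y, ((ρ Y ^ 2 : ℝ) : ℂ) * u Y * conj (u Y) ∂halfLine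
      = ((normL2 (fun Y => (ρ Y : ℂ) * u Y) ^ 2 : ℝ) : ℂ) := by
  rw [← integral_mul_conj h]
  congr 1; funext Y
  simp only [map_mul, Complex.conj_ofReal]; push_cast; ring

namespace ProfileBounds

variable {U U₁ U₂ : ℝ → ℝ} {K : ℝ} (hU : ProfileBounds U U₁ U₂ K)
include hU

theorem div_le {Y : ℝ} (hY : 0 < Y) : Y / (1 + Y) ≤ K * U Y := by
  rw [div_le_iff₀ (by linarith)]
  linarith [hU.lower Y hY]

theorem le_mul_sqrt {x Y : ℝ} (hY : 0 < Y) (h1 : x ≤ 1) (hx : 0 ≤ x) (h : x ≤ K * U Y) :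
    x ≤ K * √(U Y) := by
  have hK := hU.one_le
  have h2 : x ^ 2 ≤ (K * √(U Y)) ^ 2 := by
    rw [mul_pow, Real.sq_sqrt (hU.pos hY).le]
    have := hU.pos hY
    nlinarith
  exact (abs_le_of_sq_le_sq' h2 (by have := hU.K_pos; positivity)).2

theorem aesm_sqrt : AEStronglyMeasurable (fun Y => ((√(U Y) : ℝ) : ℂ)) halfLine :=
  (Complex.continuous_ofReal.comp_continuousOn
    (Real.continuous_sqrt.comp_continuousOn hU.continuousOn)).aestronglyMeasurable measurableSet_Ioi

theorem memL2_mul {u : ℝ → ℂ} (hu : MemL2 u) : MemL2 (fun Y => (U Y : ℂ) * u Y) :=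
  hu.of_le (C := K) (hU.aesm.mul hu.1) fun Y hY => by
    simp only [norm_mul, Complex.norm_real, Real.norm_of_nonneg (hU.pos hY).le]
    exact mul_le_mul_of_nonneg_right (hU.le Y hY) (norm_nonneg _)

theorem sqrt_le {Y : ℝ} (hY : 0 < Y) : √(U Y) ≤ K := by
  rw [Real.sqrt_le_left hU.K_pos.le]
  have := hU.le Y hY
  nlinarith [hU.one_le]

theorem memL2_sqrt_mul {u : ℝ → ℂ} (hu : MemL2 u) :
    MemL2 (fun Y => ((√(U Y) : ℝ) : ℂ) * u Y) :=
  hu.of_le (C := K) (hU.aesm_sqrt.mul hu.1) fun Y hY => by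
    simp only [norm_mul, Complex.norm_real, Real.norm_of_nonneg (Real.sqrt_nonneg _)]
    exact mul_le_mul_of_nonneg_right (hU.sqrt_le hY) (norm_nonneg _)

/-- The interpolation inequality behind the boundary layer scale `δ = s²`: the degenerate weight
`U` is compensated by one derivative. -/
theorem interpolation {ρ ρ' : ℝ → ℝ} {B s : ℝ} (hρ : Weight ρ ρ' B) (hs : 0 < s) (hs1 : s ≤ 1)
    {a : ℝ} {w w₁ h : ℝ → ℂ} (hw : HelmholtzTriple a w w₁ h) :
    s ^ 2 * normL2 (fun Y => (ρ Y : ℂ) * w Y) ^ 2 ≤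
      2 * K * normL2 (fun Y => (ρ Y : ℂ) * (((√(U Y) : ℝ) : ℂ) * w Y)) ^ 2
      + 8 * K * s ^ 3 * (normL2 (fun Y => (ρ Y : ℂ) * (((√(U Y) : ℝ) : ℂ) * w Y))
        * normL2 (fun Y => (ρ Y : ℂ) * w₁ Y)) := by
  have hK := hU.one_le
  set δ := s ^ 2 with hδ
  have δ0 : 0 < δ := by positivity
  have δ1 : δ ≤ 1 := pow_le_one₀ hs.le hs1
  -- the multiplier `Y δ / (Y + δ)` increases from `0` and saturates at the value `δ`
  set k : ℝ → ℝ := fun Y => Y * δ / (Y + δ) with hk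
  set k' : ℝ → ℝ := fun Y => δ ^ 2 / (Y + δ) ^ 2 with hk'
  set m : ℝ → ℝ := fun Y => k Y * ρ Y ^ 2 with hm
  set m' : ℝ → ℝ := fun Y => k' Y * ρ Y ^ 2 + k Y * (2 * ρ Y * ρ' Y) with hm'
  have k0 : ∀ Y, 0 < Y → 0 ≤ k Y := fun Y hY => by simp only [hk]; positivity
  have kδ : ∀ Y, 0 < Y → k Y ≤ δ := fun Y hY => by
    simp only [hk]; rw [div_le_iff₀ (by positivity)]; nlinarith
  have k'0 : ∀ Y, 0 < Y → 0 ≤ k' Y := fun Y hY => by simp only [hk']; positivity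
  have k'1 : ∀ Y, 0 < Y → k' Y ≤ 1 := fun Y hY => by
    simp only [hk']; rw [div_le_one (by positivity)]; gcongr; linarith
  have dk : ∀ Y, 0 < Y → HasDerivAt k (k' Y) Y := fun Y hY => by
    have := ((hasDerivAt_id Y).mul_const δ).div ((hasDerivAt_id Y).add_const δ)
      (by simp only [id]; positivity)
    refine this.congr_deriv ?_
    simp only [hk', id]; congr 1; ring
  have ck' : ContinuousOn k' (Ioi 0) := by
    refine continuousOn_const.div (by fun_prop) fun Y hY => ?_
    have : 0 < Y := hY
    positivity
  have ck : ContinuousOn k (Ioi 0) := fun Y hY => (dk Y hY).continuousAt.continuousWithinAt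
  have dm : ∀ Y, 0 < Y → HasDerivAt m (m' Y) Y := fun Y hY => by
    have := (dk Y hY).mul ((hρ.deriv Y hY).pow 2)
    refine this.congr_deriv ?_
    simp [hm']
  have cm' : ContinuousOn m' (Ioi 0) :=
    (ck'.mul (hρ.continuousOn.pow 2)).add (ck.mul ((continuousOn_const.mul hρ.continuousOn).mul hρ.cont))
  have lm := LocAC.ofReal dm cm'
  have mm : AEStronglyMeasurable (fun Y => (m' Y : ℂ)) halfLine :=
    continuousOn_aesm (Complex.continuous_ofReal.comp_continuousOn cm')
  have ρB : ∀ Y, 0 < Y → ρ Y ^ 2 ≤ B ^ 2 := fun Y hY =>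
    pow_le_pow_left₀ (hρ.pos Y hY).le (hρ.le Y hY) 2
  have B1 : ∀ Y, 0 < Y → |m Y| ≤ B ^ 2 := fun Y hY => by
    rw [abs_of_nonneg (mul_nonneg (k0 Y hY) (sq_nonneg _))]
    calc k Y * ρ Y ^ 2 ≤ 1 * ρ Y ^ 2 :=
          mul_le_mul_of_nonneg_right ((kδ Y hY).trans δ1) (sq_nonneg _)
      _ ≤ B ^ 2 := by rw [one_mul]; exact ρB Y hY
  have m'0 : ∀ Y, 0 < Y → 0 ≤ m' Y := fun Y hY => by
    have h1 := k0 Y hY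
    have h2 := k'0 Y hY
    have h3 := hρ.pos Y hY
    have h4 := hρ.nonneg Y hY
    simp only [hm']; positivity
  have B2 : ∀ Y, 0 < Y → |m' Y| ≤ 5 * B ^ 2 := fun Y hY => by
    rw [abs_of_nonneg (m'0 Y hY)]
    have h3 := hρ.pos Y hY
    have e1 : k' Y * ρ Y ^ 2 ≤ 1 * ρ Y ^ 2 := mul_le_mul_of_nonneg_right (k'1 Y hY) (sq_nonneg _)
    have e2 : k Y * (2 * ρ Y * ρ' Y) ≤ 1 * (2 * ρ Y * (2 * ρ Y)) := by
      have := hρ.le_two Y hY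
      have := hρ.nonneg Y hY
      exact mul_le_mul ((kδ Y hY).trans δ1) (by gcongr) (by positivity) zero_le_one
    have := ρB Y hY
    simp only [hm']
    nlinarith
  have lim : Tendsto (fun Y => (m Y : ℂ) * w Y * conj (w Y)) (𝓝[>] 0) (𝓝 0) := by
    have t : Tendsto (fun Y : ℝ => (Y : ℂ)) (𝓝[>] 0) (𝓝 0) := by
      have : Tendsto (fun Y : ℝ => (Y : ℂ)) (𝓝 0) (𝓝 ((0 : ℝ) : ℂ)) :=
        Complex.continuous_ofReal.tendsto _
      simpa using this.mono_left nhdsWithin_le_nhds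
    obtain ⟨b, hb0, hb⟩ := exists_bound_near_zero hw.c
    refine tendsto_zero_of_bound (B := B ^ 2 * b ^ 2) t fun Y hY h1 => ?_
    have hk1 : k Y ≤ Y := by
      simp only [hk]; rw [div_le_iff₀ (by positivity)]; nlinarith
    have hw1 := hb Y ⟨hY.le, h1⟩
    have hm1 : |m Y| ≤ Y * B ^ 2 := by
      rw [abs_of_nonneg (mul_nonneg (k0 Y hY) (sq_nonneg _))]
      exact mul_le_mul hk1 (ρB Y hY) (sq_nonneg _) hY.le
    simp only [norm_mul, Complex.norm_real, Real.norm_eq_abs, RCLike.norm_conj]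
    rw [abs_of_pos hY]
    calc |m Y| * ‖w Y‖ * ‖w Y‖ ≤ Y * B ^ 2 * b * b := by gcongr
      _ = _ := by ring
  have id1 := integral_by_parts lm mm B1 B2 hw.d hw.d hw.m hw.m₁ hw.m hw.m₁ lim
  set W : ℝ → ℂ := fun Y => (ρ Y : ℂ) * w Y with hW
  set V : ℝ → ℂ := fun Y => (ρ Y : ℂ) * (((√(U Y) : ℝ) : ℂ) * w Y) with hV
  set W₁ : ℝ → ℂ := fun Y => (ρ Y : ℂ) * w₁ Y with hW₁
  have mW : MemL2 W := hρ.memL2 hw.m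
  have mW₁ : MemL2 W₁ := hρ.memL2 hw.m₁
  have mV : MemL2 V := hρ.memL2 (hU.memL2_sqrt_mul hw.m)
  have kV : ∀ Y, 0 < Y → k Y ≤ K * s * √(U Y) := fun Y hY => by
    have hd : k Y ≤ Y / (1 + Y) := by
      simp only [hk]; rw [div_le_div_iff₀ (by positivity) (by positivity)]
      nlinarith [mul_pos hY hY]
    have hx : k Y ^ 2 ≤ (K * s * √(U Y)) ^ 2 := by
      rw [mul_pow, mul_pow, Real.sq_sqrt (hU.pos hY).le, ← hδ]
      have h1 := hd.trans (hU.div_le hY)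
      have h2 := kδ Y hY
      have h3 := k0 Y hY
      calc k Y ^ 2 = k Y * k Y := sq _
        _ ≤ δ * (K * U Y) := mul_le_mul h2 h1 h3 δ0.le
        _ = 1 * K * δ * U Y := by ring
        _ ≤ K * K * δ * U Y := by have := hU.pos hY; gcongr
        _ = _ := by ring
    exact (abs_le_of_sq_le_sq' hx (by have := hU.K_pos; positivity)).2
  have bd : ∀ {x y : ℝ → ℂ}, ((∀ Y, ‖x Y‖ * ‖y Y‖ = ‖w Y‖ * ‖w₁ Y‖)) →
      ‖∫ Y, (m Y : ℂ) * x Y * conj (y Y) ∂halfLine‖ ≤ K * s * (normL2 V * normL2 W₁) := by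
    intro x y hxy
    refine norm_integral_le_mul (by have := hU.K_pos; positivity) mV mW₁ (ae_halfLine fun Y hY => ?_)
    have r0 := (hρ.pos Y hY).le
    simp only [hV, hW₁, norm_mul, Complex.norm_real, RCLike.norm_conj, mul_assoc, hxy, hm,
      Real.norm_of_nonneg (k0 Y hY), norm_pow, Real.norm_of_nonneg r0,
      Real.norm_of_nonneg (Real.sqrt_nonneg _)]
    calc _ = k Y * (ρ Y ^ 2 * (‖w Y‖ * ‖w₁ Y‖)) := by ring
      _ ≤ K * s * √(U Y) * (ρ Y ^ 2 * (‖w Y‖ * ‖w₁ Y‖)) :=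
          mul_le_mul_of_nonneg_right (kV Y hY) (by positivity)
      _ = _ := by ring
  have b1 := bd (x := w) (y := w₁) fun Y => rfl
  have b2 := bd (x := w₁) (y := w) fun Y => mul_comm _ _
  have e3 : ∫ Y, (m' Y : ℂ) * w Y * conj (w Y) ∂halfLine
      = ((∫ Y, m' Y * ‖w Y‖ ^ 2 ∂halfLine : ℝ) : ℂ) := by
    rw [← integral_complex_ofReal]; congr 1; funext Y
    rw [mul_assoc, Complex.mul_conj, Complex.normSq_eq_norm_sq]; push_cast; ring
  have b3 : ∫ Y, m' Y * ‖w Y‖ ^ 2 ∂halfLine ≤ 2 * (K * s * (normL2 V * normL2 W₁)) := by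
    have e4 : ((∫ Y, m' Y * ‖w Y‖ ^ 2 ∂halfLine : ℝ) : ℂ)
        = -(∫ Y, (m Y : ℂ) * w Y * conj (w₁ Y) ∂halfLine)
          - ∫ Y, (m Y : ℂ) * w₁ Y * conj (w Y) ∂halfLine := by
      rw [← e3]; linear_combination id1
    have e5 := congrArg norm e4
    rw [Complex.norm_real] at e5
    have e6 := norm_sub_le (-(∫ Y, (m Y : ℂ) * w Y * conj (w₁ Y) ∂halfLine))
      (∫ Y, (m Y : ℂ) * w₁ Y * conj (w Y) ∂halfLine)
    rw [← e5, norm_neg] at e6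
    exact (le_abs_self _).trans (e6.trans (by linarith))
  have im' : Integrable (fun Y => m' Y * ‖w Y‖ ^ 2) halfLine := by
    have := integrable_multiplier mm B2 hw.m hw.m
    refine this.norm.congr (ae_halfLine fun Y hY => ?_)
    simp only [norm_mul, Complex.norm_real, RCLike.norm_conj, Real.norm_of_nonneg (m'0 Y hY)]
    ring
  have fin : δ * normL2 W ^ 2 ≤ 2 * K * normL2 V ^ 2
      + 4 * δ * ∫ Y, m' Y * ‖w Y‖ ^ 2 ∂halfLine := by
    rw [normL2_sq mW, normL2_sq mV, ← integral_const_mul, ← integral_const_mul,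
      ← integral_const_mul, ← integral_add (mV.integrable_norm_sq.const_mul _) (im'.const_mul _)]
    refine integral_mono_ae (mW.integrable_norm_sq.const_mul _)
      ((mV.integrable_norm_sq.const_mul _).add (im'.const_mul _)) (ae_halfLine fun Y hY => ?_)
    have r0 := hρ.pos Y hY
    have u0 := hU.pos hY
    simp only [hW, hV, norm_mul, Complex.norm_real, Real.norm_of_nonneg r0.le,
      Real.norm_of_nonneg (Real.sqrt_nonneg _), mul_pow, Real.sq_sqrt u0.le]
    -- the multiplier grows for `Y ≤ δ`, and the profile is at least of size `δ` for `Y ≥ δ`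
    have p : δ ≤ 2 * K * U Y + 4 * δ * k' Y := by
      by_cases hYδ : Y ≤ δ
      · have : 1 / 4 ≤ k' Y := by
          simp only [hk']; rw [div_le_div_iff₀ (by norm_num) (by positivity)]
          nlinarith
        have hKU : 0 ≤ 2 * K * U Y := by have := hU.K_pos; positivity
        nlinarith
      · have h1 := hU.div_le hY
        have h2 : δ / 2 ≤ Y / (1 + Y) := by
          rw [div_le_div_iff₀ (by norm_num) (by positivity)]
          nlinarith [not_le.1 hYδ]
        have := k'0 Y hY
        have : 0 ≤ 4 * δ * k' Y := by positivity
        linarith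
    have q : k' Y * ρ Y ^ 2 ≤ m' Y := by
      have h1 := k0 Y hY
      have h4 := hρ.nonneg Y hY
      simp only [hm']
      have : 0 ≤ k Y * (2 * ρ Y * ρ' Y) := by positivity
      linarith
    have hn : 0 ≤ ρ Y ^ 2 * ‖w Y‖ ^ 2 := by positivity
    calc δ * (ρ Y ^ 2 * ‖w Y‖ ^ 2) ≤ (2 * K * U Y + 4 * δ * k' Y) * (ρ Y ^ 2 * ‖w Y‖ ^ 2) :=
          mul_le_mul_of_nonneg_right p hn
      _ = 2 * K * (ρ Y ^ 2 * (U Y * ‖w Y‖ ^ 2)) + 4 * δ * ((k' Y * ρ Y ^ 2) * ‖w Y‖ ^ 2) := by ring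
      _ ≤ _ := by gcongr
  calc δ * normL2 W ^ 2 ≤ _ := fin
    _ ≤ 2 * K * normL2 V ^ 2 + 4 * δ * (2 * (K * s * (normL2 V * normL2 W₁))) := by gcongr
    _ = _ := by rw [hδ]; ring

end ProfileBounds

theorem integrable_mul_conj {f g : ℝ → ℂ} (hf : MemL2 f) (hg : MemL2 g) :
    Integrable (fun Y => f Y * conj (g Y)) halfLine :=
  integrable_of_le_mul (C := 1) hf hg (hf.1.mul hg.conj.1) (ae_of_all _ fun Y => by simp)

theorem norm_integral_mul_conj_le {f g : ℝ → ℂ} (hf : MemL2 f) (hg : MemL2 g) :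
    ‖∫ Y, f Y * conj (g Y) ∂halfLine‖ ≤ normL2 f * normL2 g := by
  simpa using norm_integral_le_mul zero_le_one hf hg
    (ae_of_all _ fun Y => by simp : ∀ᵐ Y ∂halfLine, ‖f Y * conj (g Y)‖ ≤ 1 * (‖f Y‖ * ‖g Y‖))

/-- The arithmetic of `airy_estimate`: absorption of the lower order terms. -/
theorem airy_arith {K s a A B₁ D F P X : ℝ} (hK : 1 ≤ K) (hs : 0 < s)
    (hs2 : 64 * K * s ^ 2 ≤ 1) (A0 : 0 ≤ A) (B0 : 0 ≤ B₁) (D0 : 0 ≤ D) (F0 : 0 ≤ F)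
    (P0 : 0 ≤ P) (X0 : 0 ≤ X) (Xsq : X ^ 2 = A ^ 2 + s ^ 6 * (B₁ ^ 2 + a ^ 2 * D ^ 2))
    (int : s ^ 2 * D ^ 2 ≤ 2 * K * A ^ 2 + 8 * K * s ^ 3 * (A * B₁))
    (x2 : X ^ 2 ≤ 2 * (F * D + 2 * K ^ 2 * P * A + 4 * s ^ 6 * (B₁ * D))) :
    A ≤ X ∧ s ^ 3 * B₁ ≤ X ∧ s ^ 3 * (a * D) ≤ X ∧ s * D ≤ 4 * K * X
      ∧ s * X ≤ 16 * K ^ 2 * (F + s * P) := by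
  have s6 : s ^ 6 = (s ^ 3) ^ 2 := by ring
  have xA : A ≤ X := by
    refine (abs_le_of_sq_le_sq' ?_ X0).2
    rw [Xsq]; have : 0 ≤ s ^ 6 * (B₁ ^ 2 + a ^ 2 * D ^ 2) := by positivity
    linarith
  have xB : s ^ 3 * B₁ ≤ X := by
    refine (abs_le_of_sq_le_sq' ?_ X0).2
    rw [Xsq, mul_pow, ← s6]
    have : 0 ≤ A ^ 2 + s ^ 6 * (a ^ 2 * D ^ 2) := by positivity
    linarith
  have xD : s ^ 3 * (a * D) ≤ X := by
    refine (abs_le_of_sq_le_sq' ?_ X0).2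
    rw [Xsq, mul_pow, ← s6, mul_pow]
    have : 0 ≤ A ^ 2 + s ^ 6 * B₁ ^ 2 := by positivity
    linarith
  have xW : s * D ≤ 4 * K * X := by
    refine (abs_le_of_sq_le_sq' ?_ (by positivity)).2
    have h1 : s ^ 3 * (A * B₁) ≤ X ^ 2 := by
      calc s ^ 3 * (A * B₁) = A * (s ^ 3 * B₁) := by ring
        _ ≤ X * X := mul_le_mul xA xB (by positivity) X0
        _ = X ^ 2 := by ring
    have h2 : A ^ 2 ≤ X ^ 2 := pow_le_pow_left₀ A0 xA 2
    calc (s * D) ^ 2 = s ^ 2 * D ^ 2 := by ring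
      _ ≤ 2 * K * A ^ 2 + 8 * K * (s ^ 3 * (A * B₁)) := by linarith [int]
      _ ≤ 2 * K * X ^ 2 + 8 * K * X ^ 2 := by gcongr
      _ = 10 * K * X ^ 2 := by ring
      _ ≤ 16 * K * K * X ^ 2 := by
          have : 10 * K ≤ 16 * K * K := by nlinarith
          gcongr
      _ = (4 * K * X) ^ 2 := by ring
  refine ⟨xA, xB, xD, xW, ?_⟩
  have c1 : s ^ 6 * (B₁ * D) ≤ 4 * K * s ^ 2 * X ^ 2 := by
    calc s ^ 6 * (B₁ * D) = s ^ 2 * ((s ^ 3 * B₁) * (s * D)) := by ring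
      _ ≤ s ^ 2 * (X * (4 * K * X)) := by gcongr
      _ = _ := by ring
  have c2 : 32 * K * s ^ 2 * X ^ 2 ≤ 1 / 2 * X ^ 2 := by
    have : 32 * K * s ^ 2 ≤ 1 / 2 := by linarith
    gcongr
  have x3 : X ^ 2 ≤ 4 * (F * D) + 8 * K ^ 2 * P * X := by
    have : K ^ 2 * P * A ≤ K ^ 2 * P * X := by gcongr
    linarith
  have x4 : (s * X) ^ 2 ≤ (16 * K * F + 8 * K ^ 2 * (s * P)) * (s * X) := by
    have h1 : s * (F * (s * D)) ≤ s * (F * (4 * K * X)) := by gcongr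
    have h2 : s ^ 2 * X ^ 2 ≤ s ^ 2 * (4 * (F * D) + 8 * K ^ 2 * P * X) := by gcongr
    calc (s * X) ^ 2 = s ^ 2 * X ^ 2 := by ring
      _ ≤ 4 * (s * (F * (s * D))) + s ^ 2 * (8 * K ^ 2 * P * X) := by linarith
      _ ≤ 4 * (s * (F * (4 * K * X))) + s ^ 2 * (8 * K ^ 2 * P * X) := by linarith
      _ = _ := by ring
  have x5 := le_of_sq_le_mul (by positivity) x4
  refine x5.trans ?_
  have : 16 * K * F ≤ 16 * K ^ 2 * F := by
    have : 16 * K ≤ 16 * K ^ 2 := by nlinarith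
    gcongr
  have : 0 ≤ 8 * K ^ 2 * (s * P) := by positivity
  linarith

namespace OSSystem

variable {U U₁ U₂ : ℝ → ℝ} {K t ε a s : ℝ} {f φ φ₁ w w₁ h : ℝ → ℂ}

theorem φ_tendsto (S : OSSystem U U₂ t ε a f φ φ₁ w w₁ h) : Tendsto φ (𝓝[>] 0) (𝓝 0) := by
  simpa [S.φ_zero] using tendsto_of_continuousOn S.hφ.c

theorem hardy_φ (S : OSSystem U U₂ t ε a f φ φ₁ w w₁ h) :
    MemL2 (fun Y => (Y : ℂ)⁻¹ * φ Y) ∧ normL2 (fun Y => (Y : ℂ)⁻¹ * φ Y) ≤ 2 * normL2 φ₁ :=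
  hardy S.hφ.d S.hφ.m S.hφ.m₁ S.φ_tendsto

/-- The stretching term is controlled through Hardy's inequality, even with a quadratic weight. -/
theorem norm_stretching_le (hU : ProfileBounds U U₁ U₂ K) {ρ : ℝ} {Y : ℝ} (hY : 0 < Y)
    (hρ : ρ ≤ (1 + Y) ^ 2) (z : ℂ) :
    ρ * (|U₂ Y| * ‖z‖) ≤ K * (Y / (1 + Y)) * ‖(Y : ℂ)⁻¹ * z‖ := by
  have h1 := hU.bound2 Y hY
  have hp : 0 < 1 + Y := by linarith
  have h2 : ρ * |U₂ Y| ≤ K / (1 + Y) := by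
    rw [le_div_iff₀ hp]
    calc ρ * |U₂ Y| * (1 + Y) ≤ (1 + Y) ^ 2 * |U₂ Y| * (1 + Y) := by gcongr
      _ = (1 + Y) ^ 3 * |U₂ Y| := by ring
      _ ≤ K := h1
  rw [norm_mul, norm_inv, Complex.norm_real, Real.norm_of_nonneg hY.le]
  calc ρ * (|U₂ Y| * ‖z‖) = ρ * |U₂ Y| * ‖z‖ := by ring
    _ ≤ K / (1 + Y) * ‖z‖ := by gcongr
    _ = _ := by field_simp

theorem memL2_stretching (S : OSSystem U U₂ t ε a f φ φ₁ w w₁ h)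
    (hU : ProfileBounds U U₁ U₂ K) : MemL2 (fun Y => (U₂ Y : ℂ) * φ Y) :=
  S.hφ.m.of_le (C := K) (hU.aesm_deriv2.mul S.hφ.m.1) fun Y hY => by
    simp only [norm_mul, Complex.norm_real, Real.norm_eq_abs]
    exact mul_le_mul_of_nonneg_right (hU.abs_deriv2_le hY) (norm_nonneg _)

/-- The stretching term gains any weight up to `(1 + Y)²`, by the decay of `U''`. -/
theorem norm_weight_stretching_le (S : OSSystem U U₂ t ε a f φ φ₁ w w₁ h)
    (hU : ProfileBounds U U₁ U₂ K) {ρ ρ' : ℝ → ℝ} {B : ℝ} (hρ : Weight ρ ρ' B) :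
    normL2 (fun Y => (ρ Y : ℂ) * ((U₂ Y : ℂ) * φ Y)) ≤ 2 * K * normL2 φ₁ := by
  have hK := hU.K_pos
  have e : normL2 (fun Y => (ρ Y : ℂ) * ((U₂ Y : ℂ) * φ Y)) ≤ K * normL2 (fun Y => (Y : ℂ)⁻¹ * φ Y) := by
    refine normL2_le_of_le hK.le S.hardy_φ.1 fun Y hY => ?_
    rw [norm_mul, norm_mul, Complex.norm_real, Complex.norm_real, Real.norm_of_nonneg (hρ.pos Y hY).le,
      Real.norm_eq_abs]
    refine (norm_stretching_le hU hY (hρ.le_sq Y hY) _).trans ?_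
    have : Y / (1 + Y) ≤ 1 := by rw [div_le_one (by linarith)]; linarith
    have h2 : K * (Y / (1 + Y)) ≤ K := by nlinarith
    exact mul_le_mul_of_nonneg_right h2 (norm_nonneg _)
  have := S.hardy_φ.2
  nlinarith

/-- Test of the equation, written as an equation for `w`, with `m w` for a real multiplier `m`. The
real part controls `√U w`, the imaginary part `w'` and `a w`. -/
theorem tested (S : OSSystem U U₂ t ε a f φ φ₁ w w₁ h)
    (hU : ProfileBounds U U₁ U₂ K) {m m' : ℝ → ℝ}
    {B B' : ℝ} (dm : LocAC (fun Y => (m Y : ℂ)) (fun Y => (m' Y : ℂ)))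
    (mm : AEStronglyMeasurable (fun Y => (m' Y : ℂ)) halfLine)
    (hB : ∀ Y, 0 < Y → |m Y| ≤ B) (hB' : ∀ Y, 0 < Y → |m' Y| ≤ B') :
    (∫ Y, (m Y : ℂ) * ((U Y : ℂ) * w Y) * conj (w Y) ∂halfLine)
      - Complex.I * ε * ((∫ Y, (m Y : ℂ) * w₁ Y * conj (w₁ Y) ∂halfLine)
        + (a : ℂ) ^ 2 * ∫ Y, (m Y : ℂ) * w Y * conj (w Y) ∂halfLine)
      = (∫ Y, (m Y : ℂ) * f Y * conj (w Y) ∂halfLine)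
        + t * (∫ Y, (m Y : ℂ) * ((U₂ Y : ℂ) * φ Y) * conj (w Y) ∂halfLine)
        + Complex.I * ε * ∫ Y, (m' Y : ℂ) * w₁ Y * conj (w Y) ∂halfLine := by
  have e := S.hw.energy_identity (by simp [S.w₁_zero]) dm mm hB hB'
  have cm := dm.aestronglyMeasurable
  have i1 := integrable_multiplier cm hB (hU.memL2_mul S.hw.m) S.hw.m
  have i2 := integrable_multiplier cm hB S.mf S.hw.m
  have i3 := integrable_multiplier cm hB (S.memL2_stretching hU) S.hw.m
  have k : Complex.I * ε * ∫ Y, (m Y : ℂ) * h Y * conj (w Y) ∂halfLine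
      = (∫ Y, (m Y : ℂ) * f Y * conj (w Y) ∂halfLine)
        + t * (∫ Y, (m Y : ℂ) * ((U₂ Y : ℂ) * φ Y) * conj (w Y) ∂halfLine)
        - ∫ Y, (m Y : ℂ) * ((U Y : ℂ) * w Y) * conj (w Y) ∂halfLine := by
    have i4 : Integrable (fun Y => (m Y : ℂ) * f Y * conj (w Y)
        + t * ((m Y : ℂ) * ((U₂ Y : ℂ) * φ Y) * conj (w Y))) halfLine := i2.add (i3.const_mul _)
    rw [← integral_const_mul, ← integral_const_mul, ← integral_add i2 (i3.const_mul _),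
      ← integral_sub i4 i1]
    refine integral_congr_ae ?_
    filter_upwards [S.eq] with Y hY
    linear_combination (m Y : ℂ) * conj (w Y) * hY
  rw [e] at k
  linear_combination k

/-- The basic weighted estimate: `X` controls `√U w` and, up to powers of `s = ε^{1/6}`, also
`w'`, `a w` and `w`. -/
theorem airy_estimate (S : OSSystem U U₂ t (s ^ 6) a f φ φ₁ w w₁ h)
    (hU : ProfileBounds U U₁ U₂ K) (ht0 : 0 ≤ t) (ht1 : t ≤ 1)
    (hs : 0 < s) (hs1 : s ≤ 1) (hs2 : 64 * K * s ^ 2 ≤ 1)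
    {ρ ρ' : ℝ → ℝ} {B : ℝ} (hρ : Weight ρ ρ' B) :
    ∃ X, 0 ≤ X ∧ normL2 (fun Y => (ρ Y : ℂ) * (((√(U Y) : ℝ) : ℂ) * w Y)) ≤ X
      ∧ s ^ 3 * normL2 (fun Y => (ρ Y : ℂ) * w₁ Y) ≤ X
      ∧ s ^ 3 * (a * normL2 (fun Y => (ρ Y : ℂ) * w Y)) ≤ X
      ∧ s * normL2 (fun Y => (ρ Y : ℂ) * w Y) ≤ 4 * K * X
      ∧ s * X ≤ 16 * K ^ 2 * (normL2 (fun Y => (ρ Y : ℂ) * f Y) + s * normL2 φ₁) := by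
  have hK := hU.one_le
  have int := hU.interpolation hρ hs hs1 S.hw
  set W : ℝ → ℂ := fun Y => (ρ Y : ℂ) * w Y with hW
  set V : ℝ → ℂ := fun Y => (ρ Y : ℂ) * (((√(U Y) : ℝ) : ℂ) * w Y) with hV
  set W₁ : ℝ → ℂ := fun Y => (ρ Y : ℂ) * w₁ Y with hW₁
  set F : ℝ → ℂ := fun Y => (ρ Y : ℂ) * f Y with hF
  have mW : MemL2 W := hρ.memL2 S.hw.m
  have mW₁ : MemL2 W₁ := hρ.memL2 S.hw.m₁
  have mV : MemL2 V := hρ.memL2 (hU.memL2_sqrt_mul S.hw.m)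
  have mF : MemL2 F := hρ.memL2 S.mf
  have A0 := normL2_nonneg V
  have B0 := normL2_nonneg W₁
  have D0 := normL2_nonneg W
  have F0 := normL2_nonneg F
  have P0 := normL2_nonneg φ₁
  set A := normL2 V with hA
  set B₁ := normL2 W₁ with hB₁
  set D := normL2 W with hD
  -- the multiplier `ρ²`
  have dm : LocAC (fun Y => ((ρ Y ^ 2 : ℝ) : ℂ)) (fun Y => ((2 * ρ Y * ρ' Y : ℝ) : ℂ)) :=
    LocAC.ofReal (fun Y hY => ((hρ.deriv Y hY).pow 2).congr_deriv (by simp))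
      ((continuousOn_const.mul hρ.continuousOn).mul hρ.cont)
  have mm : AEStronglyMeasurable (fun Y => ((2 * ρ Y * ρ' Y : ℝ) : ℂ)) halfLine :=
    continuousOn_aesm (Complex.continuous_ofReal.comp_continuousOn
      ((continuousOn_const.mul hρ.continuousOn).mul hρ.cont))
  have ρB : ∀ Y, 0 < Y → ρ Y ^ 2 ≤ B ^ 2 := fun Y hY =>
    pow_le_pow_left₀ (hρ.pos Y hY).le (hρ.le Y hY) 2
  have ρ'le : ∀ Y, 0 < Y → |2 * ρ Y * ρ' Y| ≤ 4 * ρ Y ^ 2 := fun Y hY => by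
    have h1 := hρ.nonneg Y hY
    have h2 := hρ.pos Y hY
    rw [abs_of_nonneg (by positivity)]
    nlinarith [hρ.le_two Y hY]
  have e := S.tested hU dm mm (B := B ^ 2) (B' := 4 * B ^ 2)
    (fun Y hY => by rw [abs_of_nonneg (sq_nonneg _)]; exact ρB Y hY)
    (fun Y hY => (ρ'le Y hY).trans (by have := ρB Y hY; linarith))
  have eW : ∫ Y, ((ρ Y ^ 2 : ℝ) : ℂ) * w Y * conj (w Y) ∂halfLine = ((D ^ 2 : ℝ) : ℂ) :=
    integral_weight_sq mW
  have eW₁ : ∫ Y, ((ρ Y ^ 2 : ℝ) : ℂ) * w₁ Y * conj (w₁ Y) ∂halfLine = ((B₁ ^ 2 : ℝ) : ℂ) :=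
    integral_weight_sq mW₁
  rw [eW, eW₁] at e
  have eV : ∫ Y, ((ρ Y ^ 2 : ℝ) : ℂ) * ((U Y : ℂ) * w Y) * conj (w Y) ∂halfLine
      = ((A ^ 2 : ℝ) : ℂ) := by
    rw [hA, ← integral_mul_conj mV]
    refine integral_congr_ae (ae_halfLine fun Y hY => ?_)
    have : ((√(U Y) : ℝ) : ℂ) * ((√(U Y) : ℝ) : ℂ) = (U Y : ℂ) := by
      rw [← Complex.ofReal_mul, Real.mul_self_sqrt (hU.pos hY).le]
    simp only [hV, map_mul, Complex.conj_ofReal]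
    rw [← this]; push_cast; ring
  rw [eV] at e
  -- bounds of the right hand side
  have b1 : ‖∫ Y, ((ρ Y ^ 2 : ℝ) : ℂ) * f Y * conj (w Y) ∂halfLine‖ ≤ normL2 F * D := by
    have : ∫ Y, ((ρ Y ^ 2 : ℝ) : ℂ) * f Y * conj (w Y) ∂halfLine
        = ∫ Y, F Y * conj (W Y) ∂halfLine := by
      congr 1; funext Y
      simp only [hF, hW, map_mul, Complex.conj_ofReal]; push_cast; ring
    rw [this]; exact norm_integral_mul_conj_le mF mW
  have b2 : ‖∫ Y, ((ρ Y ^ 2 : ℝ) : ℂ) * ((U₂ Y : ℂ) * φ Y) * conj (w Y) ∂halfLine‖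
      ≤ K ^ 2 * (normL2 (fun Y => (Y : ℂ)⁻¹ * φ Y) * A) := by
    refine norm_integral_le_mul (by positivity) S.hardy_φ.1 mV (ae_halfLine fun Y hY => ?_)
    have r0 := hρ.pos Y hY
    have h1 := norm_stretching_le hU hY (hρ.le_sq Y hY) (φ Y)
    have h2 : Y / (1 + Y) ≤ K * √(U Y) := hU.le_mul_sqrt hY
      (by rw [div_le_one (by linarith)]; linarith) (by positivity) (hU.div_le hY)
    simp only [hV]
    rw [norm_mul, norm_mul, norm_mul ((U₂ Y : ℂ)), RCLike.norm_conj, Complex.norm_real,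
      Complex.norm_real, norm_mul (ρ Y : ℂ), norm_mul ((√(U Y) : ℝ) : ℂ), Complex.norm_real,
      Complex.norm_real, Real.norm_of_nonneg (sq_nonneg _), Real.norm_of_nonneg r0.le,
      Real.norm_of_nonneg (Real.sqrt_nonneg _), Real.norm_eq_abs]
    calc ρ Y ^ 2 * (|U₂ Y| * ‖φ Y‖) * ‖w Y‖ = (ρ Y * (|U₂ Y| * ‖φ Y‖)) * (ρ Y * ‖w Y‖) := by ring
      _ ≤ (K * (K * √(U Y)) * ‖(Y : ℂ)⁻¹ * φ Y‖) * (ρ Y * ‖w Y‖) := by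
          refine mul_le_mul_of_nonneg_right (h1.trans ?_) (by positivity)
          gcongr
      _ = _ := by ring
  have b3 : ‖∫ Y, ((2 * ρ Y * ρ' Y : ℝ) : ℂ) * w₁ Y * conj (w Y) ∂halfLine‖ ≤ 4 * (B₁ * D) := by
    refine norm_integral_le_mul (by norm_num) mW₁ mW (ae_halfLine fun Y hY => ?_)
    have r0 := hρ.pos Y hY
    simp only [hW, hW₁]
    rw [norm_mul, norm_mul, RCLike.norm_conj, Complex.norm_real, Real.norm_eq_abs, norm_mul,
      norm_mul, Complex.norm_real, Real.norm_of_nonneg r0.le]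
    calc |2 * ρ Y * ρ' Y| * ‖w₁ Y‖ * ‖w Y‖ ≤ 4 * ρ Y ^ 2 * ‖w₁ Y‖ * ‖w Y‖ := by
          gcongr; exact ρ'le Y hY
      _ = _ := by ring
  set E₁ := B₁ ^ 2 + a ^ 2 * D ^ 2 with hE
  have e' : ((A ^ 2 : ℝ) : ℂ) - Complex.I * ((s ^ 6 * E₁ : ℝ) : ℂ)
      = (∫ Y, ((ρ Y ^ 2 : ℝ) : ℂ) * f Y * conj (w Y) ∂halfLine)
        + t * (∫ Y, ((ρ Y ^ 2 : ℝ) : ℂ) * ((U₂ Y : ℂ) * φ Y) * conj (w Y) ∂halfLine)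
        + Complex.I * ((s ^ 6 : ℝ) : ℂ) * ∫ Y, ((2 * ρ Y * ρ' Y : ℝ) : ℂ) * w₁ Y * conj (w Y) ∂halfLine := by
    rw [← e, hE]; push_cast; ring
  set R := (∫ Y, ((ρ Y ^ 2 : ℝ) : ℂ) * f Y * conj (w Y) ∂halfLine)
        + t * (∫ Y, ((ρ Y ^ 2 : ℝ) : ℂ) * ((U₂ Y : ℂ) * φ Y) * conj (w Y) ∂halfLine)
        + Complex.I * ((s ^ 6 : ℝ) : ℂ) * ∫ Y, ((2 * ρ Y * ρ' Y : ℝ) : ℂ) * w₁ Y * conj (w Y) ∂halfLine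
    with hR
  have bR : ‖R‖ ≤ normL2 F * D + 2 * K ^ 2 * normL2 φ₁ * A + 4 * s ^ 6 * (B₁ * D) := by
    refine (norm_add₃_le).trans ?_
    rw [norm_mul, norm_mul, norm_mul, Complex.norm_I, Complex.norm_real, Complex.norm_real,
      Real.norm_of_nonneg ht0, Real.norm_of_nonneg (by positivity : (0 : ℝ) ≤ s ^ 6), one_mul]
    have h1 : t * ‖∫ Y, ((ρ Y ^ 2 : ℝ) : ℂ) * ((U₂ Y : ℂ) * φ Y) * conj (w Y) ∂halfLine‖
        ≤ 1 * (K ^ 2 * (2 * normL2 φ₁ * A)) := by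
      refine mul_le_mul ht1 (b2.trans ?_) (norm_nonneg _) zero_le_one
      have := S.hardy_φ.2
      gcongr
    have h2 : s ^ 6 * ‖∫ Y, ((2 * ρ Y * ρ' Y : ℝ) : ℂ) * w₁ Y * conj (w Y) ∂halfLine‖
        ≤ s ^ 6 * (4 * (B₁ * D)) := by gcongr
    linarith
  have re : A ^ 2 ≤ ‖R‖ := by
    have := Complex.abs_re_le_norm R
    rw [← e', Complex.sub_re, Complex.ofReal_re, Complex.re_mul_ofReal, Complex.I_re, zero_mul,
      sub_zero, abs_of_nonneg (sq_nonneg A), e'] at this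
    exact this
  have im : s ^ 6 * E₁ ≤ ‖R‖ := by
    have hp : 0 ≤ s ^ 6 * E₁ := by rw [hE]; positivity
    have := Complex.abs_im_le_norm R
    rw [← e', Complex.sub_im, Complex.ofReal_im, Complex.im_mul_ofReal, Complex.I_im, one_mul,
      zero_sub, abs_neg, abs_of_nonneg hp, e'] at this
    exact this
  refine ⟨√(A ^ 2 + s ^ 6 * E₁), Real.sqrt_nonneg _, ?_⟩
  refine airy_arith hK hs hs2 A0 B0 D0 F0 P0 (Real.sqrt_nonneg _)
    (Real.sq_sqrt (by rw [hE]; positivity)) int ?_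
  rw [Real.sq_sqrt (by rw [hE]; positivity)]
  linarith

end OSSystem

theorem le_add_of_sq_le {x p q : ℝ} (hp : 0 ≤ p) (hq : 0 ≤ q) (h : x ^ 2 ≤ p ^ 2 + q * x) :
    x ≤ p + q := by
  by_contra hc
  have h1 : p + q < x := not_le.1 hc
  nlinarith

/-- A family of bounds with bounded weights gives the bound with the weight `(1 + Y)ᵏ`. -/
theorem weighted_of_weight {k : ℕ} (hk : k ≤ 2) {u : ℝ → ℂ} (hu : MemL2 u) {C : ℝ} (hC : 0 ≤ C)
    (h : ∀ (ρ ρ' : ℝ → ℝ) (B : ℝ), Weight ρ ρ' B → (∀ Y, 0 < Y → ρ Y ≤ (1 + Y) ^ k) →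
      (∀ Y, 0 < Y → ρ' Y ≤ k * (1 + Y) ^ (k - 1)) → normL2 (fun Y => (ρ Y : ℂ) * u Y) ≤ C) :
    MemL2 (weighted k u) ∧ normL2 (weighted k u) ≤ C := by
  have hη : ∀ n : ℕ, (0 : ℝ) < 1 / ((n : ℝ) + 1) := fun n => by positivity
  have hη1 : ∀ n : ℕ, 1 / ((n : ℝ) + 1) ≤ 1 := fun n => by
    rw [div_le_one (by positivity)]; linarith [(Nat.cast_nonneg n : (0 : ℝ) ≤ n)]
  have hw := fun n => Weight.approx (hη n) (hη1 n) hk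
  refine memL2_and_normL2_le_of_tendsto hC (fun n => (hw n).memL2 hu)
    (fun n => h _ _ _ (hw n) (fun Y hY => ?_) fun Y hY => ?_) ?_ fun Y hY => ?_
  · have h1 : 1 ≤ 1 + 1 / ((n : ℝ) + 1) * Y := by have := hη n; nlinarith [mul_pos this hY]
    have : (1 + Y) / (1 + 1 / ((n : ℝ) + 1) * Y) ≤ 1 + Y := div_le_self (by linarith) h1
    gcongr
  · have h1 : 1 ≤ 1 + 1 / ((n : ℝ) + 1) * Y := by have := hη n; nlinarith [mul_pos this hY]
    have h2 : (1 + Y) / (1 + 1 / ((n : ℝ) + 1) * Y) ≤ 1 + Y := div_le_self (by linarith) h1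
    have h3 : (1 - 1 / ((n : ℝ) + 1)) / (1 + 1 / ((n : ℝ) + 1) * Y) ^ 2 ≤ 1 := by
      have := one_le_pow₀ h1 (n := 2)
      rw [div_le_one (by positivity)]
      linarith [hη n]
    calc _ ≤ (k : ℝ) * ((1 + Y) / (1 + 1 / ((n : ℝ) + 1) * Y)) ^ (k - 1) * 1 := by gcongr
      _ ≤ _ := by rw [mul_one]; gcongr
  · unfold weighted
    exact (Continuous.aestronglyMeasurable (by fun_prop)).mul hu.1
  · unfold weighted
    refine Tendsto.mul_const _ ?_
    have h1 : Tendsto (fun n : ℕ => ((1 + Y) / (1 + 1 / ((n : ℝ) + 1) * Y)) ^ k) atTop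
        (𝓝 ((1 + Y) ^ k)) := by
      have h2 := ((tendsto_one_div_add_atTop_nhds_zero_nat (𝕜 := ℝ)).mul_const Y).const_add 1
      have h3 := ((tendsto_const_nhds (x := 1 + Y)).div h2 (by norm_num)).pow k
      simpa using h3
    have h4 := (Complex.continuous_ofReal.tendsto _).comp h1
    simpa [Function.comp_def] using h4

theorem normL2_weight_le_weighted {k : ℕ} {u : ℝ → ℂ} (hu : MemL2 (weighted k u)) {ρ ρ' : ℝ → ℝ}
    {B : ℝ} (hρ : Weight ρ ρ' B) (h : ∀ Y, 0 < Y → ρ Y ≤ (1 + Y) ^ k) :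
    normL2 (fun Y => (ρ Y : ℂ) * u Y) ≤ normL2 (weighted k u) := by
  have := normL2_le_of_le (f := fun Y => (ρ Y : ℂ) * u Y) (C := 1) zero_le_one hu fun Y hY => by
    unfold weighted
    have h1 : 0 < 1 + Y := by linarith
    rw [norm_mul, norm_mul, norm_pow, Complex.norm_real, Complex.norm_real,
      Real.norm_of_nonneg (hρ.pos Y hY).le, Real.norm_of_nonneg h1.le, one_mul]
    exact mul_le_mul_of_nonneg_right (h Y hY) (norm_nonneg _)
  simpa using this

namespace OSSystem

variable {U U₁ U₂ : ℝ → ℝ} {K t ε a s : ℝ} {f φ φ₁ w w₁ h : ℝ → ℂ}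

/-- The weighted bound for `U w`, without loss of powers of `ε`: test with `ρ² U w`. -/
theorem norm_U_mul_le (S : OSSystem U U₂ t (s ^ 6) a f φ φ₁ w w₁ h)
    (hU : ProfileBounds U U₁ U₂ K) (ht0 : 0 ≤ t) (ht1 : t ≤ 1)
    (hs : 0 < s) (hs1 : s ≤ 1) (hs2 : 64 * K * s ^ 2 ≤ 1)
    {ρ ρ' : ℝ → ℝ} {B : ℝ} (hρ : Weight ρ ρ' B) :
    normL2 (fun Y => (ρ Y : ℂ) * ((U Y : ℂ) * w Y))
      ≤ 75 * K ^ 3 * (normL2 (fun Y => (ρ Y : ℂ) * f Y) + normL2 φ₁) := by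
  have hK := hU.one_le
  obtain ⟨X, X0, -, xB, -, xW, xY⟩ := S.airy_estimate hU ht0 ht1 hs hs1 hs2 hρ
  set W : ℝ → ℂ := fun Y => (ρ Y : ℂ) * w Y with hW
  set V : ℝ → ℂ := fun Y => (ρ Y : ℂ) * ((U Y : ℂ) * w Y) with hV
  set W₁ : ℝ → ℂ := fun Y => (ρ Y : ℂ) * w₁ Y with hW₁
  set F : ℝ → ℂ := fun Y => (ρ Y : ℂ) * f Y with hF
  set G : ℝ → ℂ := fun Y => (ρ Y : ℂ) * ((U₂ Y : ℂ) * φ Y) with hG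
  have mW : MemL2 W := hρ.memL2 S.hw.m
  have mW₁ : MemL2 W₁ := hρ.memL2 S.hw.m₁
  have mV : MemL2 V := hρ.memL2 (hU.memL2_mul S.hw.m)
  have mF : MemL2 F := hρ.memL2 S.mf
  have mG : MemL2 G := hρ.memL2 (S.memL2_stretching hU)
  have nG : normL2 G ≤ 2 * K * normL2 φ₁ := S.norm_weight_stretching_le hU hρ
  have B0 := normL2_nonneg W₁
  have D0 := normL2_nonneg W
  have F0 := normL2_nonneg F
  have P0 := normL2_nonneg φ₁
  -- the multiplier `ρ² U`
  set m' : ℝ → ℝ := fun Y => 2 * ρ Y * ρ' Y * U Y + ρ Y ^ 2 * U₁ Y with hm'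
  have cm' : ContinuousOn m' (Ioi 0) :=
    (((continuousOn_const.mul hρ.continuousOn).mul hρ.cont).mul hU.continuousOn).add
      ((hρ.continuousOn.pow 2).mul hU.continuousOn_deriv)
  have dm : LocAC (fun Y => ((ρ Y ^ 2 * U Y : ℝ) : ℂ)) (fun Y => (m' Y : ℂ)) :=
    LocAC.ofReal (fun Y hY => (((hρ.deriv Y hY).pow 2).mul (hU.deriv Y hY)).congr_deriv
      (by simp [hm'])) cm'
  have mm : AEStronglyMeasurable (fun Y => (m' Y : ℂ)) halfLine :=
    continuousOn_aesm (Complex.continuous_ofReal.comp_continuousOn cm')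
  have ρB : ∀ Y, 0 < Y → ρ Y ^ 2 ≤ B ^ 2 := fun Y hY =>
    pow_le_pow_left₀ (hρ.pos Y hY).le (hρ.le Y hY) 2
  have m'le : ∀ Y, 0 < Y → |m' Y| ≤ 5 * K * ρ Y ^ 2 := fun Y hY => by
    have h1 := hρ.nonneg Y hY
    have h2 := hρ.pos Y hY
    have h3 := hU.pos hY
    have e1 : |2 * ρ Y * ρ' Y * U Y| ≤ 4 * K * ρ Y ^ 2 := by
      rw [abs_of_nonneg (by positivity)]
      calc 2 * ρ Y * ρ' Y * U Y ≤ 2 * ρ Y * (2 * ρ Y) * K := by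
            have := hρ.le_two Y hY
            have := hU.le Y hY
            gcongr
        _ = _ := by ring
    have e2 : |ρ Y ^ 2 * U₁ Y| ≤ K * ρ Y ^ 2 := by
      rw [abs_mul, abs_of_nonneg (sq_nonneg _), mul_comm]
      exact mul_le_mul_of_nonneg_right (hU.abs_deriv_le hY) (sq_nonneg _)
    refine (abs_add_le _ _).trans ?_
    linarith
  have e := S.tested hU dm mm (B := B ^ 2 * K) (B' := 5 * K * B ^ 2)
    (fun Y hY => by
      rw [abs_of_nonneg (mul_nonneg (sq_nonneg _) (hU.pos hY).le)]
      exact mul_le_mul (ρB Y hY) (hU.le Y hY) (hU.pos hY).le (sq_nonneg _))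
    (fun Y hY => (m'le Y hY).trans (by have := ρB Y hY; gcongr))
  have eV : ∫ Y, ((ρ Y ^ 2 * U Y : ℝ) : ℂ) * ((U Y : ℂ) * w Y) * conj (w Y) ∂halfLine
      = ((normL2 V ^ 2 : ℝ) : ℂ) := by
    rw [← integral_mul_conj mV]
    congr 1; funext Y
    simp only [hV, map_mul, Complex.conj_ofReal]; push_cast; ring
  have eF : ∫ Y, ((ρ Y ^ 2 * U Y : ℝ) : ℂ) * f Y * conj (w Y) ∂halfLine
      = ∫ Y, F Y * conj (V Y) ∂halfLine := by
    congr 1; funext Y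
    simp only [hF, hV, map_mul, Complex.conj_ofReal]; push_cast; ring
  have eG : ∫ Y, ((ρ Y ^ 2 * U Y : ℝ) : ℂ) * ((U₂ Y : ℂ) * φ Y) * conj (w Y) ∂halfLine
      = ∫ Y, G Y * conj (V Y) ∂halfLine := by
    congr 1; funext Y
    simp only [hG, hV, map_mul, Complex.conj_ofReal]; push_cast; ring
  have real : ∀ (v : ℝ → ℂ), ∃ r : ℝ,
      ∫ Y, ((ρ Y ^ 2 * U Y : ℝ) : ℂ) * v Y * conj (v Y) ∂halfLine = (r : ℂ) := by
    intro v
    refine ⟨∫ Y, ρ Y ^ 2 * U Y * ‖v Y‖ ^ 2 ∂halfLine, ?_⟩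
    rw [← integral_complex_ofReal]; congr 1; funext Y
    rw [mul_assoc, Complex.mul_conj, Complex.normSq_eq_norm_sq]; push_cast; ring
  obtain ⟨r1, hr1⟩ := real w₁
  obtain ⟨r2, hr2⟩ := real w
  have b3 : ‖∫ Y, (m' Y : ℂ) * w₁ Y * conj (w Y) ∂halfLine‖ ≤ 5 * K * (normL2 W₁ * normL2 W) := by
    refine norm_integral_le_mul (by positivity) mW₁ mW (ae_halfLine fun Y hY => ?_)
    have r0 := hρ.pos Y hY
    simp only [hW, hW₁]
    rw [norm_mul, norm_mul, RCLike.norm_conj, Complex.norm_real, Real.norm_eq_abs, norm_mul,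
      norm_mul, Complex.norm_real, Real.norm_of_nonneg r0.le]
    calc |m' Y| * ‖w₁ Y‖ * ‖w Y‖ ≤ 5 * K * ρ Y ^ 2 * ‖w₁ Y‖ * ‖w Y‖ := by
          gcongr; exact m'le Y hY
      _ = _ := by ring
  have b1 := norm_integral_mul_conj_le mF mV
  have b2 := norm_integral_mul_conj_le mG mV
  rw [eV, eF, eG, hr1, hr2] at e
  set IF := ∫ Y, F Y * conj (V Y) ∂halfLine
  set IG := ∫ Y, G Y * conj (V Y) ∂halfLine
  set J := ∫ Y, (m' Y : ℂ) * w₁ Y * conj (w Y) ∂halfLine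
  have e2 : ((normL2 V ^ 2 : ℝ) : ℂ) - Complex.I * ((s ^ 6 * (r1 + a ^ 2 * r2) : ℝ) : ℂ)
      = IF + t * IG + Complex.I * ((s ^ 6 : ℝ) : ℂ) * J := by
    rw [← e]; push_cast; ring
  have bR : ‖IF + t * IG + Complex.I * ((s ^ 6 : ℝ) : ℂ) * J‖
      ≤ normL2 F * normL2 V + 2 * K * normL2 φ₁ * normL2 V
        + s ^ 6 * (5 * K * (normL2 W₁ * normL2 W)) := by
    refine (norm_add₃_le).trans ?_
    rw [norm_mul, norm_mul, norm_mul, Complex.norm_I, Complex.norm_real, Complex.norm_real,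
      Real.norm_of_nonneg ht0, Real.norm_of_nonneg (by positivity : (0 : ℝ) ≤ s ^ 6), one_mul]
    have h1 : t * ‖IG‖ ≤ 1 * (2 * K * normL2 φ₁ * normL2 V) := by
      refine mul_le_mul ht1 (b2.trans ?_) (norm_nonneg _) zero_le_one
      exact mul_le_mul_of_nonneg_right nG (normL2_nonneg _)
    have h2 : s ^ 6 * ‖J‖ ≤ s ^ 6 * (5 * K * (normL2 W₁ * normL2 W)) := by gcongr
    linarith
  have re : normL2 V ^ 2 ≤ ‖IF + t * IG + Complex.I * ((s ^ 6 : ℝ) : ℂ) * J‖ := by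
    have := Complex.abs_re_le_norm (IF + t * IG + Complex.I * ((s ^ 6 : ℝ) : ℂ) * J)
    rw [← e2, Complex.sub_re, Complex.ofReal_re, Complex.re_mul_ofReal, Complex.I_re, zero_mul,
      sub_zero, abs_of_nonneg (sq_nonneg _), e2] at this
    exact this
  have sP : s * normL2 φ₁ ≤ normL2 φ₁ := mul_le_of_le_one_left P0 hs1
  set Z := normL2 F + normL2 φ₁ with hZ
  have sX : s * X ≤ 16 * K ^ 2 * Z :=
    xY.trans (mul_le_mul_of_nonneg_left (by linarith) (by positivity))
  have c1 : s ^ 6 * (5 * K * (normL2 W₁ * normL2 W)) ≤ (72 * K ^ 3 * Z) ^ 2 := by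
    calc s ^ 6 * (5 * K * (normL2 W₁ * normL2 W))
        = s ^ 2 * (5 * K * ((s ^ 3 * normL2 W₁) * (s * normL2 W))) := by ring
      _ ≤ s ^ 2 * (5 * K * (X * (4 * K * X))) := by gcongr
      _ = 20 * K ^ 2 * (s * X) ^ 2 := by ring
      _ ≤ 20 * K ^ 2 * (16 * K ^ 2 * Z) ^ 2 := by gcongr
      _ = 5120 * (K ^ 3 * Z) ^ 2 := by ring
      _ ≤ 5184 * (K ^ 3 * Z) ^ 2 := by gcongr; norm_num
      _ = _ := by ring
  have fin := le_add_of_sq_le (x := normL2 V) (p := 72 * K ^ 3 * Z)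
    (q := normL2 F + 2 * K * normL2 φ₁) (by positivity) (by positivity) (by linarith)
  refine fin.trans ?_
  have k3 : K ≤ K ^ 3 := by
    calc K = K * 1 := by ring
      _ ≤ K * K ^ 2 := by gcongr; exact one_le_pow₀ hK
      _ = _ := by ring
  have h1 : normL2 F ≤ 2 * K ^ 3 * normL2 F := le_mul_of_one_le_left F0 (by linarith)
  have h2 : 2 * K * normL2 φ₁ ≤ 2 * K ^ 3 * normL2 φ₁ := by gcongr
  have h3 : 0 ≤ K ^ 3 * Z := by positivity
  rw [hZ] at h3 ⊢
  linarith

/-- Near the wall the diffusion term is controlled by the data, up to a gain in `s`: the equation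
expresses it through `U w`, and there `U` is dominated by `s √U`. -/
theorem norm_near_wall_le (S : OSSystem U U₂ t (s ^ 6) a f φ φ₁ w w₁ h)
    (hU : ProfileBounds U U₁ U₂ K) (ht0 : 0 ≤ t) (ht1 : t ≤ 1)
    (hs : 0 < s) (hs1 : s ≤ 1) (hs2 : 64 * K * s ^ 2 ≤ 1) :
    MemL2 (fun Y => ((s ^ 2 / (Y + s ^ 2) : ℝ) : ℂ) * h Y) ∧
    s ^ 6 * normL2 (fun Y => ((s ^ 2 / (Y + s ^ 2) : ℝ) : ℂ) * h Y)
      ≤ 20 * K ^ 3 * (normL2 f + s * normL2 φ₁) := by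
  have hK := hU.one_le
  obtain ⟨X, X0, xA, -, -, -, xY⟩ := S.airy_estimate hU ht0 ht1 hs hs1 hs2 Weight.one
  simp only [Complex.ofReal_one, one_mul] at xA xY
  set V : ℝ → ℂ := fun Y => ((√(U Y) : ℝ) : ℂ) * w Y with hV
  have mV : MemL2 V := hU.memL2_sqrt_mul S.hw.m
  have F0 := normL2_nonneg f
  have P0 := normL2_nonneg φ₁
  have s2 : 0 < s ^ 2 := by positivity
  have cm : AEStronglyMeasurable (fun Y : ℝ => ((s ^ 2 / (Y + s ^ 2) : ℝ) : ℂ)) halfLine := by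
    refine continuousOn_aesm (Complex.continuous_ofReal.comp_continuousOn
      (continuousOn_const.div (by fun_prop) fun Y hY => ?_))
    have : 0 < Y := hY
    positivity
  have mh : MemL2 (fun Y => ((s ^ 2 / (Y + s ^ 2) : ℝ) : ℂ) * h Y) := by
    refine S.hw.mg.of_le (C := 1) (cm.mul S.hw.mg.1) fun Y hY => ?_
    rw [norm_mul, Complex.norm_real, Real.norm_of_nonneg (by positivity)]
    refine mul_le_mul_of_nonneg_right ?_ (norm_nonneg _)
    rw [div_le_one (by positivity)]; linarith
  refine ⟨mh, ?_⟩
  have ef : s ^ 6 * normL2 (fun Y => ((s ^ 2 / (Y + s ^ 2) : ℝ) : ℂ) * h Y)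
      = normL2 (fun Y => ((s ^ 6 : ℝ) : ℂ) * (((s ^ 2 / (Y + s ^ 2) : ℝ) : ℂ) * h Y)) := by
    rw [normL2_const_mul, Complex.norm_real, Real.norm_of_nonneg (by positivity)]
  rw [ef]
  have m1 : MemL2 (fun Y => ((‖f Y‖ + K * s * ‖V Y‖ : ℝ) : ℂ)) :=
    (S.mf.norm.add (mV.norm.const_mul (K * s))).ofReal
  have n1 : normL2 (fun Y => ((‖f Y‖ + K * s * ‖V Y‖ : ℝ) : ℂ)) ≤ 1 * normL2 f + K * s * normL2 V := by
    refine (memL2_and_normL2_le_add zero_le_one (by positivity) m1.1 S.mf mV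
      (ae_of_all _ fun Y => ?_)).2
    rw [Complex.norm_real, Real.norm_of_nonneg (by positivity), one_mul]
  have n2 := (memL2_and_normL2_le_add (a := 1) (b := K * s ^ 2) zero_le_one (by positivity)
    (f := fun Y => ((s ^ 6 : ℝ) : ℂ) * (((s ^ 2 / (Y + s ^ 2) : ℝ) : ℂ) * h Y))
    (mh.1.const_mul _) m1 S.hardy_φ.1 ?_).2
  · refine n2.trans ?_
    have h1 := S.hardy_φ.2
    have h2 : K * s * normL2 V ≤ K * (16 * K ^ 2 * (normL2 f + s * normL2 φ₁)) := by
      calc K * s * normL2 V ≤ K * s * X := by gcongr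
        _ = K * (s * X) := by ring
        _ ≤ _ := by gcongr
    have h3 : K * s ^ 2 * normL2 (fun Y => (Y : ℂ)⁻¹ * φ Y) ≤ K * s * (2 * normL2 φ₁) := by
      have : s ^ 2 ≤ s := by nlinarith
      have := normL2_nonneg (fun Y => (Y : ℂ)⁻¹ * φ Y)
      gcongr
    have k3 : K ≤ K ^ 3 := by
      calc K = K * 1 := by ring
        _ ≤ K * K ^ 2 := by gcongr; exact one_le_pow₀ hK
        _ = _ := by ring
    have h4 : K * s * (2 * normL2 φ₁) ≤ K ^ 3 * (2 * (s * normL2 φ₁)) := by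
      calc K * s * (2 * normL2 φ₁) = K * (2 * (s * normL2 φ₁)) := by ring
        _ ≤ _ := by gcongr
    have h5 : normL2 f ≤ K ^ 3 * normL2 f := le_mul_of_one_le_left F0 (hK.trans k3)
    have h6 : 0 ≤ K ^ 3 * (s * normL2 φ₁) := by positivity
    nlinarith
  · filter_upwards [S.eq, ae_halfLine_pos] with Y hY hp
    have u0 := hU.pos hp
    have d0 : 0 < Y + s ^ 2 := by positivity
    set c := s ^ 2 / (Y + s ^ 2) with hc
    have c0 : 0 ≤ c := by positivity
    have c1 : c ≤ 1 := by rw [hc, div_le_one d0]; linarith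
    have e1 : ((s ^ 6 : ℝ) : ℂ) * h Y
        = -Complex.I * (f Y - (U Y : ℂ) * w Y + (t : ℂ) * (U₂ Y : ℂ) * φ Y) := by
      linear_combination (-Complex.I) * hY + ((s ^ 6 : ℝ) : ℂ) * h Y * Complex.I_sq
    have e2 : ((s ^ 6 : ℝ) : ℂ) * ((c : ℂ) * h Y)
        = (c : ℂ) * (-Complex.I * (f Y - (U Y : ℂ) * w Y + (t : ℂ) * (U₂ Y : ℂ) * φ Y)) := by
      rw [← e1]; ring
    rw [e2, norm_mul, norm_mul, norm_neg, Complex.norm_I, Complex.norm_real,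
      Real.norm_of_nonneg c0, one_mul, one_mul, Complex.norm_real,
      Real.norm_of_nonneg (by positivity)]
    have t1 : ‖f Y - (U Y : ℂ) * w Y + (t : ℂ) * (U₂ Y : ℂ) * φ Y‖
        ≤ ‖f Y‖ + U Y * ‖w Y‖ + |U₂ Y| * ‖φ Y‖ := by
      refine (norm_add_le _ _).trans (add_le_add ((norm_sub_le _ _).trans (le_of_eq ?_)) ?_)
      · rw [norm_mul, Complex.norm_real, Real.norm_of_nonneg u0.le]
      · rw [norm_mul, norm_mul, Complex.norm_real, Complex.norm_real, Real.norm_of_nonneg ht0,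
          Real.norm_eq_abs]
        have : t * |U₂ Y| ≤ |U₂ Y| := mul_le_of_le_one_left (abs_nonneg _) ht1
        gcongr
    have t2 : c * (U Y * ‖w Y‖) ≤ K * s * ‖V Y‖ := by
      have q : c * √(U Y) ≤ K * s := by
        refine (abs_le_of_sq_le_sq' ?_ (by positivity)).2
        rw [mul_pow, Real.sq_sqrt u0.le, mul_pow, hc, div_pow, div_mul_eq_mul_div,
          div_le_iff₀ (by positivity)]
        have g1 := hU.le_mul Y hp
        have g2 : (s ^ 2) ^ 2 * U Y ≤ (s ^ 2) ^ 2 * (K * Y) := by gcongr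
        have g3 : s ^ 2 * Y ≤ (Y + s ^ 2) ^ 2 := by nlinarith [mul_pos s2 hp, sq_nonneg Y, sq_nonneg (s ^ 2)]
        calc (s ^ 2) ^ 2 * U Y ≤ 1 * K * s ^ 2 * (s ^ 2 * Y) := by linarith
          _ ≤ K * K * s ^ 2 * (Y + s ^ 2) ^ 2 := by gcongr
          _ = _ := by ring
      simp only [hV]
      rw [norm_mul, Complex.norm_real, Real.norm_of_nonneg (Real.sqrt_nonneg _)]
      calc c * (U Y * ‖w Y‖) = c * √(U Y) * (√(U Y) * ‖w Y‖) := by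
            rw [show c * √(U Y) * (√(U Y) * ‖w Y‖) = c * (√(U Y) * √(U Y)) * ‖w Y‖ by ring,
              Real.mul_self_sqrt u0.le]; ring
        _ ≤ K * s * (√(U Y) * ‖w Y‖) := mul_le_mul_of_nonneg_right q (by positivity)
    have t3 : c * (|U₂ Y| * ‖φ Y‖) ≤ K * s ^ 2 * ‖(Y : ℂ)⁻¹ * φ Y‖ := by
      rw [norm_mul, norm_inv, Complex.norm_real, Real.norm_of_nonneg hp.le]
      have g : c ≤ s ^ 2 * Y⁻¹ := by
        rw [hc, div_eq_mul_inv]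
        have : (Y + s ^ 2)⁻¹ ≤ Y⁻¹ := inv_anti₀ hp (by linarith)
        gcongr
      calc c * (|U₂ Y| * ‖φ Y‖) ≤ s ^ 2 * Y⁻¹ * (K * ‖φ Y‖) := by
            have := hU.abs_deriv2_le hp
            gcongr
        _ = _ := by ring
    have t4 : c * ‖f Y‖ ≤ ‖f Y‖ := mul_le_of_le_one_left (norm_nonneg _) c1
    calc c * ‖f Y - (U Y : ℂ) * w Y + (t : ℂ) * (U₂ Y : ℂ) * φ Y‖
        ≤ c * (‖f Y‖ + U Y * ‖w Y‖ + |U₂ Y| * ‖φ Y‖) := by gcongr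
      _ = c * ‖f Y‖ + c * (U Y * ‖w Y‖) + c * (|U₂ Y| * ‖φ Y‖) := by ring
      _ ≤ _ := by linarith

/-- The weighted estimates with the full weight `(1 + Y)ᵏ`. -/
theorem weighted_estimate (S : OSSystem U U₂ t (s ^ 6) a f φ φ₁ w w₁ h)
    (hU : ProfileBounds U U₁ U₂ K) (ht0 : 0 ≤ t) (ht1 : t ≤ 1) (ha : 0 < a)
    (hs : 0 < s) (hs1 : s ≤ 1) (hs2 : 64 * K * s ^ 2 ≤ 1) {k : ℕ} (hk : k ≤ 2)
    (hf : MemL2 (weighted k f)) :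
    MemL2 (weighted k w) ∧ MemL2 (weighted k w₁) ∧
    s ^ 2 * normL2 (weighted k w) ≤ 64 * K ^ 3 * (normL2 (weighted k f) + s * normL2 φ₁) ∧
    s ^ 4 * normL2 (weighted k w₁) ≤ 16 * K ^ 2 * (normL2 (weighted k f) + s * normL2 φ₁) ∧
    s ^ 4 * (a * normL2 (weighted k w)) ≤ 16 * K ^ 2 * (normL2 (weighted k f) + s * normL2 φ₁) ∧
    normL2 (weighted k (fun Y => (U Y : ℂ) * w Y))
      ≤ 75 * K ^ 3 * (normL2 (weighted k f) + normL2 φ₁) := by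
  have hK := hU.one_le
  have P0 := normL2_nonneg φ₁
  have F0 := normL2_nonneg (weighted k f)
  set Z := normL2 (weighted k f) + s * normL2 φ₁ with hZ
  have Z0 : 0 ≤ Z := by positivity
  have main : ∀ (ρ ρ' : ℝ → ℝ) (B : ℝ), Weight ρ ρ' B → (∀ Y, 0 < Y → ρ Y ≤ (1 + Y) ^ k) →
      s ^ 2 * normL2 (fun Y => (ρ Y : ℂ) * w Y) ≤ 64 * K ^ 3 * Z ∧
      s ^ 4 * normL2 (fun Y => (ρ Y : ℂ) * w₁ Y) ≤ 16 * K ^ 2 * Z ∧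
      s ^ 4 * (a * normL2 (fun Y => (ρ Y : ℂ) * w Y)) ≤ 16 * K ^ 2 * Z := by
    intro ρ ρ' B hρ hle
    obtain ⟨X, X0, -, xB, xD, xW, xY⟩ := S.airy_estimate hU ht0 ht1 hs hs1 hs2 hρ
    have hF := normL2_weight_le_weighted hf hρ hle
    have sX : s * X ≤ 16 * K ^ 2 * Z := xY.trans (by rw [hZ]; gcongr)
    refine ⟨?_, ?_, ?_⟩
    · calc s ^ 2 * normL2 (fun Y => (ρ Y : ℂ) * w Y)
          = s * (s * normL2 (fun Y => (ρ Y : ℂ) * w Y)) := by ring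
        _ ≤ s * (4 * K * X) := by gcongr
        _ = 4 * K * (s * X) := by ring
        _ ≤ 4 * K * (16 * K ^ 2 * Z) := by gcongr
        _ = _ := by ring
    · calc s ^ 4 * normL2 (fun Y => (ρ Y : ℂ) * w₁ Y)
          = s * (s ^ 3 * normL2 (fun Y => (ρ Y : ℂ) * w₁ Y)) := by ring
        _ ≤ s * X := by gcongr
        _ ≤ _ := sX
    · calc s ^ 4 * (a * normL2 (fun Y => (ρ Y : ℂ) * w Y))
          = s * (s ^ 3 * (a * normL2 (fun Y => (ρ Y : ℂ) * w Y))) := by ring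
        _ ≤ s * X := by gcongr
        _ ≤ _ := sX
  have q1 := weighted_of_weight hk S.hw.m (C := 64 * K ^ 3 * Z / s ^ 2) (by positivity)
    fun ρ ρ' B hρ hle _ => by
      rw [le_div_iff₀ (by positivity), mul_comm]; exact (main ρ ρ' B hρ hle).1
  have q2 := weighted_of_weight hk S.hw.m₁ (C := 16 * K ^ 2 * Z / s ^ 4) (by positivity)
    fun ρ ρ' B hρ hle _ => by
      rw [le_div_iff₀ (by positivity), mul_comm]; exact (main ρ ρ' B hρ hle).2.1
  have q3 := weighted_of_weight hk S.hw.m (C := 16 * K ^ 2 * Z / (s ^ 4 * a)) (by positivity)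
    fun ρ ρ' B hρ hle _ => by
      rw [le_div_iff₀ (by positivity), mul_comm, mul_assoc]; exact (main ρ ρ' B hρ hle).2.2
  have q4 := weighted_of_weight hk (hU.memL2_mul S.hw.m)
    (C := 75 * K ^ 3 * (normL2 (weighted k f) + normL2 φ₁)) (by positivity)
    fun ρ ρ' B hρ hle _ => by
      refine (S.norm_U_mul_le hU ht0 ht1 hs hs1 hs2 hρ).trans ?_
      have hF := normL2_weight_le_weighted hf hρ hle
      gcongr
  refine ⟨q1.1, q2.1, ?_, ?_, ?_, q4.2⟩
  · have := q1.2; rwa [le_div_iff₀ (by positivity), mul_comm] at this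
  · have := q2.2; rwa [le_div_iff₀ (by positivity), mul_comm] at this
  · have := q3.2; rwa [le_div_iff₀ (by positivity), mul_comm, mul_assoc] at this

end OSSystem

/-! ### The energy estimate for the stream function -/

/-- Under the Dirichlet condition `u` vanishes linearly at the wall. -/
theorem HelmholtzTriple.norm_le_mul {a : ℝ} {u u₁ g : ℝ → ℂ} (h : HelmholtzTriple a u u₁ g)
    (h0 : u 0 = 0) : ∃ b, 0 ≤ b ∧ ∀ Y, 0 < Y → Y ≤ 1 → ‖u Y‖ ≤ b * Y := by
  obtain ⟨b, hb0, hb⟩ := exists_bound_near_zero h.c₁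
  refine ⟨b, hb0, fun Y hY h1 => ?_⟩
  have t : Tendsto u (𝓝[>] 0) (𝓝 0) := by simpa [h0] using tendsto_of_continuousOn h.c
  have t2 : Tendsto (fun x => ‖u Y - u x‖) (𝓝[>] 0) (𝓝 ‖u Y - 0‖) := (tendsto_const_nhds.sub t).norm
  rw [sub_zero] at t2
  refine le_of_tendsto t2 ?_
  filter_upwards [Ioc_mem_nhdsGT hY] with x hx
  rw [h.d.sub_eq hx.1 hx.2]
  refine (intervalIntegral.norm_integral_le_of_norm_le_const fun y hy => ?_).trans
    (?_ : b * |Y - x| ≤ b * Y)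
  · rw [uIoc_of_le hx.2] at hy
    exact hb y ⟨(hx.1.trans hy.1).le, hy.2.trans h1⟩
  · rw [abs_of_nonneg (by linarith [hx.2])]
    gcongr; linarith [hx.1]

namespace OSSystem

variable {U U₁ U₂ : ℝ → ℝ} {K t ε a s : ℝ} {f φ φ₁ w w₁ h : ℝ → ℂ}

/-- The quotient `φ / U` is square integrable, by Hardy's inequality. -/
theorem quotient (S : OSSystem U U₂ t ε a f φ φ₁ w w₁ h) (hU : ProfileBounds U U₁ U₂ K) :
    MemL2 (fun Y => (U Y : ℂ)⁻¹ * φ Y) ∧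
      normL2 (fun Y => (U Y : ℂ)⁻¹ * φ Y) ≤ K * (normL2 φ + 2 * normL2 φ₁) := by
  have hK := hU.K_pos
  have := memL2_and_normL2_le_add (f := fun Y => (U Y : ℂ)⁻¹ * φ Y) hK.le hK.le
    (hU.locAC_inv.aestronglyMeasurable.mul S.hφ.m.1) S.hφ.m S.hardy_φ.1 (ae_halfLine fun Y hY => by
      rw [norm_mul, norm_inv, Complex.norm_real, Real.norm_of_nonneg (hU.pos hY).le, norm_mul,
        norm_inv, Complex.norm_real, Real.norm_of_nonneg hY.le]
      calc (U Y)⁻¹ * ‖φ Y‖ ≤ K * ((1 + Y) / Y) * ‖φ Y‖ :=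
            mul_le_mul_of_nonneg_right (hU.inv_le hY) (norm_nonneg _)
        _ = _ := by field_simp; ring)
  refine ⟨this.1, this.2.trans ?_⟩
  have h2 := S.hardy_φ.2
  rw [← mul_add]
  gcongr

/-- The Rayleigh operator is nonnegative: `∫ |φ'|² + (U''/U) |φ|² = ∫ |φ' - (U'/U) φ|²`. The number
`Q` is the integral of `(U''/U) |φ|²`. -/
theorem rayleigh_nonneg (S : OSSystem U U₂ t ε a f φ φ₁ w w₁ h) (hU : ProfileBounds U U₁ U₂ K) :
    ∃ Q : ℝ, ∫ Y, (U₂ Y : ℂ) * φ Y * conj ((U Y : ℂ)⁻¹ * φ Y) ∂halfLine = (Q : ℂ) ∧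
      0 ≤ normL2 φ₁ ^ 2 + Q ∧ |Q| ≤ 2 * K ^ 2 * (normL2 φ₁ * normL2 φ) := by
  have hK := hU.K_pos
  have mψ := (S.quotient hU).1
  set ψ : ℝ → ℂ := fun Y => (U Y : ℂ)⁻¹ * φ Y with hψ
  have mU₁ψ : MemL2 (fun Y => (U₁ Y : ℂ) * ψ Y) :=
    mψ.of_le (C := K) (hU.aesm_deriv.mul mψ.1) fun Y hY => by
      rw [norm_mul, Complex.norm_real]
      exact mul_le_mul_of_nonneg_right (hU.abs_deriv_le hY) (norm_nonneg _)
  set v : ℝ → ℂ := fun Y => φ₁ Y - (U₁ Y : ℂ) * ψ Y with hv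
  have mv : MemL2 v := S.hφ.m₁.sub mU₁ψ
  have iQ := integrable_mul_conj (S.memL2_stretching hU) mψ
  have i1 := integrable_mul_conj S.hφ.m₁ S.hφ.m₁
  have iv := integrable_mul_conj mv mv
  have dP := (hU.locAC_deriv.mul hU.locAC_inv).mul (S.hφ.d.mul S.hφ.d.conj)
  set D : ℝ → ℂ := fun Y => φ₁ Y * conj (φ₁ Y) + (U₂ Y : ℂ) * φ Y * conj (ψ Y)
    - v Y * conj (v Y) with hD
  have iD : Integrable D halfLine := (i1.add iQ).sub iv
  have dP' : LocAC (fun Y => (U₁ Y : ℂ) * φ Y * conj (ψ Y)) D := by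
    refine dP.congr (fun Y hY => ?_) (fun Y hY => ?_)
    · simp only [hψ, map_mul, map_inv₀, Complex.conj_ofReal]; ring
    · have : (U Y : ℂ) ≠ 0 := by exact_mod_cast (hU.pos hY).ne'
      simp only [hD, hv, hψ, map_sub, map_mul, map_inv₀, Complex.conj_ofReal]
      field_simp
      ring
  have mU₁φ : MemL2 (fun Y => (U₁ Y : ℂ) * φ Y) :=
    S.hφ.m.of_le (C := K) (hU.aesm_deriv.mul S.hφ.m.1) fun Y hY => by
      rw [norm_mul, Complex.norm_real]
      exact mul_le_mul_of_nonneg_right (hU.abs_deriv_le hY) (norm_nonneg _)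
  obtain ⟨b, hb0, hb⟩ := S.hφ.norm_le_mul S.φ_zero
  have lim : Tendsto (fun Y => (U₁ Y : ℂ) * φ Y * conj (ψ Y)) (𝓝[>] 0) (𝓝 0) := by
    refine tendsto_zero_of_bound (B := K * (K * (2 * b))) S.φ_tendsto fun Y hY h1 => ?_
    have e1 : ‖ψ Y‖ ≤ K * (2 * b) := by
      simp only [hψ]
      rw [norm_mul, norm_inv, Complex.norm_real, Real.norm_of_nonneg (hU.pos hY).le]
      calc (U Y)⁻¹ * ‖φ Y‖ ≤ K * ((1 + Y) / Y) * (b * Y) :=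
            mul_le_mul (hU.inv_le hY) (hb Y hY h1) (norm_nonneg _) (by positivity)
        _ = K * ((1 + Y) * b) := by field_simp
        _ ≤ _ := by gcongr; linarith
    rw [norm_mul, norm_mul, RCLike.norm_conj, Complex.norm_real]
    calc ‖U₁ Y‖ * ‖φ Y‖ * ‖ψ Y‖ ≤ K * ‖φ Y‖ * (K * (2 * b)) := by
          gcongr; exact hU.abs_deriv_le hY
      _ = _ := by ring
  have zero := dP'.integral_eq_neg (integrable_mul_conj mU₁φ mψ) iD lim
  have sum : ∫ Y, D Y ∂halfLine = ((normL2 φ₁ ^ 2 : ℝ) : ℂ)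
      + (∫ Y, (U₂ Y : ℂ) * φ Y * conj (ψ Y) ∂halfLine) - ((normL2 v ^ 2 : ℝ) : ℂ) := by
    rw [← integral_mul_conj S.hφ.m₁, ← integral_mul_conj mv, ← integral_add i1 iQ]
    exact integral_sub (i1.add iQ) iv
  rw [zero, neg_zero] at sum
  refine ⟨normL2 v ^ 2 - normL2 φ₁ ^ 2, ?_, by nlinarith [sq_nonneg (normL2 v)], ?_⟩
  · push_cast at sum ⊢; linear_combination -sum
  · have e : ∫ Y, (U₂ Y : ℂ) * φ Y * conj (ψ Y) ∂halfLine
        = ((normL2 v ^ 2 - normL2 φ₁ ^ 2 : ℝ) : ℂ) := by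
      push_cast at sum ⊢; linear_combination -sum
    have bd : ‖∫ Y, (U₂ Y : ℂ) * φ Y * conj (ψ Y) ∂halfLine‖
        ≤ K ^ 2 * (normL2 (fun Y => (Y : ℂ)⁻¹ * φ Y) * normL2 φ) := by
      refine norm_integral_le_mul (by positivity) S.hardy_φ.1 S.hφ.m (ae_halfLine fun Y hY => ?_)
      have h1 : (1 + Y) * |U₂ Y| ≤ K := by
        refine le_trans ?_ (hU.bound2 Y hY)
        gcongr
        exact le_self_pow₀ (by linarith) (by norm_num)
      simp only [hψ]
      rw [norm_mul, norm_mul, RCLike.norm_conj, norm_mul, norm_mul, norm_inv, norm_inv,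
        Complex.norm_real, Complex.norm_real, Complex.norm_real, Real.norm_of_nonneg (hU.pos hY).le,
        Real.norm_of_nonneg hY.le, Real.norm_eq_abs]
      calc |U₂ Y| * ‖φ Y‖ * ((U Y)⁻¹ * ‖φ Y‖)
          ≤ |U₂ Y| * ‖φ Y‖ * (K * ((1 + Y) / Y) * ‖φ Y‖) := by
            gcongr; exact hU.inv_le hY
        _ = K * ((1 + Y) * |U₂ Y|) * (Y⁻¹ * ‖φ Y‖ * ‖φ Y‖) := by field_simp
        _ ≤ K * K * (Y⁻¹ * ‖φ Y‖ * ‖φ Y‖) := by gcongr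
        _ = _ := by ring
    rw [e, Complex.norm_real, Real.norm_eq_abs] at bd
    refine bd.trans ?_
    have := S.hardy_φ.2
    have := normL2_nonneg φ
    calc K ^ 2 * (normL2 (fun Y => (Y : ℂ)⁻¹ * φ Y) * normL2 φ)
        ≤ K ^ 2 * (2 * normL2 φ₁ * normL2 φ) := by gcongr
      _ = _ := by ring

/-- Away from the wall, with the cutoff `Y / (Y + s²)`, the diffusion term is integrated by parts
against `φ / U`. The cutoff removes the singularity of `φ' / U` at the wall. -/
theorem norm_integral_interior_le (S : OSSystem U U₂ t (s ^ 6) a f φ φ₁ w w₁ h)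
    (hU : ProfileBounds U U₁ U₂ K) (ht0 : 0 ≤ t) (ht1 : t ≤ 1) (ha : 0 < a)
    (hs : 0 < s) (hs1 : s ≤ 1) (hs2 : 64 * K * s ^ 2 ≤ 1) :
    s ^ 6 * ‖∫ Y, h Y * conj (((Y / (Y + s ^ 2) : ℝ) : ℂ) * ((U Y : ℂ)⁻¹ * φ Y)) ∂halfLine‖
      ≤ 80 * K ^ 5 * (normL2 f + s * normL2 φ₁) * (normL2 φ₁ + a * normL2 φ) := by
  have hK := hU.one_le
  obtain ⟨X, X0, -, xB, xD, -, xY⟩ := S.airy_estimate hU ht0 ht1 hs hs1 hs2 Weight.one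
  simp only [Complex.ofReal_one, one_mul] at xB xD xY
  have s2 : 0 < s ^ 2 := by positivity
  have mψ := (S.quotient hU).1
  set χ : ℝ → ℝ := fun Y => Y / (Y + s ^ 2) with hχ
  set χ' : ℝ → ℝ := fun Y => s ^ 2 / (Y + s ^ 2) ^ 2 with hχ'
  have dχ : ∀ Y, 0 < Y → HasDerivAt χ (χ' Y) Y := fun Y hY => by
    have := (hasDerivAt_id Y).div ((hasDerivAt_id Y).add_const (s ^ 2)) (by simp only [id]; positivity)
    refine this.congr_deriv ?_
    simp only [hχ', id]; congr 1; ring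
  have cχ' : ContinuousOn χ' (Ioi 0) := by
    refine continuousOn_const.div (by fun_prop) fun Y hY => ?_
    have : 0 < Y := hY
    positivity
  have lχ := LocAC.ofReal dχ cχ'
  have aχ' : AEStronglyMeasurable (fun Y => (χ' Y : ℂ)) halfLine :=
    continuousOn_aesm (Complex.continuous_ofReal.comp_continuousOn cχ')
  set g : ℝ → ℂ := fun Y => (χ Y : ℂ) * ((U Y : ℂ)⁻¹ * φ Y) with hg
  set g' : ℝ → ℂ := fun Y => (χ' Y : ℂ) * ((U Y : ℂ)⁻¹ * φ Y)
    + (χ Y : ℂ) * ((-(U₁ Y) / (U Y) ^ 2 : ℂ) * φ Y + (U Y : ℂ)⁻¹ * φ₁ Y) with hg'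
  have dg : LocAC g g' := lχ.mul (hU.locAC_inv.mul S.hφ.d)
  have χU : ∀ Y, 0 < Y → 0 ≤ χ Y * (U Y)⁻¹ ∧ χ Y * (U Y)⁻¹ ≤ K / s ^ 2 := fun Y hY => by
    have u0 := hU.pos hY
    refine ⟨by simp only [hχ]; positivity, ?_⟩
    calc χ Y * (U Y)⁻¹ ≤ χ Y * (K * ((1 + Y) / Y)) := by
          have := hU.inv_le hY
          have : 0 ≤ χ Y := by simp only [hχ]; positivity
          gcongr
      _ = K * ((1 + Y) / (Y + s ^ 2)) := by simp only [hχ]; field_simp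
      _ ≤ K * (1 / s ^ 2) := by
          refine mul_le_mul_of_nonneg_left ?_ hU.K_pos.le
          rw [div_le_div_iff₀ (by positivity) s2]
          have : s ^ 2 ≤ 1 := pow_le_one₀ hs.le hs1
          nlinarith
      _ = _ := by ring
  have mg : MemL2 g := S.hφ.m.of_le (C := K / s ^ 2) dg.aestronglyMeasurable fun Y hY => by
    simp only [hg]
    rw [← mul_assoc, norm_mul, ← Complex.ofReal_inv, ← Complex.ofReal_mul, Complex.norm_real,
      Real.norm_of_nonneg (χU Y hY).1]
    exact mul_le_mul_of_nonneg_right (χU Y hY).2 (norm_nonneg _)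
  have ng : normL2 g ≤ K / s ^ 2 * normL2 φ := normL2_le_of_le (by positivity) S.hφ.m fun Y hY => by
    simp only [hg]
    rw [← mul_assoc, norm_mul, ← Complex.ofReal_inv, ← Complex.ofReal_mul, Complex.norm_real,
      Real.norm_of_nonneg (χU Y hY).1]
    exact mul_le_mul_of_nonneg_right (χU Y hY).2 (norm_nonneg _)
  have bg' : ∀ Y, 0 < Y → ‖g' Y‖ ≤ (K / s ^ 2) * ‖φ₁ Y‖
      + (2 * K ^ 3 / s ^ 2) * ‖(Y : ℂ)⁻¹ * φ Y‖ := fun Y hY => by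
    have u0 := hU.pos hY
    have c0 : 0 ≤ χ Y := by simp only [hχ]; positivity
    have c0' : 0 ≤ χ' Y := by simp only [hχ']; positivity
    have n1 : ‖(χ' Y : ℂ) * ((U Y : ℂ)⁻¹ * φ Y)‖ ≤ K / s ^ 2 * (Y⁻¹ * ‖φ Y‖) := by
      rw [norm_mul, norm_mul, norm_inv, Complex.norm_real, Complex.norm_real,
        Real.norm_of_nonneg c0', Real.norm_of_nonneg u0.le]
      have q : χ' Y * (1 + Y) ≤ 1 / s ^ 2 := by
        simp only [hχ']
        rw [div_mul_eq_mul_div, div_le_div_iff₀ (by positivity) s2, one_mul]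
        have q1 : s ^ 2 * (1 + Y) ≤ Y + s ^ 2 := by
          have : s ^ 2 ≤ 1 := pow_le_one₀ hs.le hs1
          nlinarith
        calc s ^ 2 * (1 + Y) * s ^ 2 ≤ (Y + s ^ 2) * (Y + s ^ 2) :=
              mul_le_mul q1 (by linarith) s2.le (by positivity)
          _ = _ := by ring
      calc χ' Y * ((U Y)⁻¹ * ‖φ Y‖) ≤ χ' Y * (K * ((1 + Y) / Y) * ‖φ Y‖) := by
            have := hU.inv_le hY
            gcongr
        _ = K * (χ' Y * (1 + Y)) * (Y⁻¹ * ‖φ Y‖) := by field_simp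
        _ ≤ K * (1 / s ^ 2) * (Y⁻¹ * ‖φ Y‖) := by gcongr
        _ = _ := by ring
    have n2 : ‖(χ Y : ℂ) * ((-(U₁ Y) / (U Y) ^ 2 : ℂ) * φ Y + (U Y : ℂ)⁻¹ * φ₁ Y)‖
        ≤ K / s ^ 2 * (K ^ 2 * (Y⁻¹ * ‖φ Y‖) + ‖φ₁ Y‖) := by
      have e : (χ Y : ℂ) * ((-(U₁ Y) / (U Y) ^ 2 : ℂ) * φ Y + (U Y : ℂ)⁻¹ * φ₁ Y)
          = ((χ Y * (U Y)⁻¹ : ℝ) : ℂ) * ((-(U₁ Y * (U Y)⁻¹) : ℝ) * φ Y + φ₁ Y) := by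
        have : (U Y : ℂ) ≠ 0 := by exact_mod_cast u0.ne'
        push_cast; field_simp
      rw [e, norm_mul, Complex.norm_real, Real.norm_of_nonneg (χU Y hY).1]
      refine mul_le_mul (χU Y hY).2 ((norm_add_le _ _).trans ?_) (norm_nonneg _) (by positivity)
      gcongr
      rw [norm_mul, Complex.norm_real, Real.norm_eq_abs, abs_neg, abs_mul,
        abs_of_nonneg (inv_nonneg.2 u0.le)]
      have q : (1 + Y) * |U₁ Y| ≤ K := by
        refine le_trans ?_ (hU.bound1 Y hY)
        gcongr
        exact le_self_pow₀ (by linarith) (by norm_num)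
      calc |U₁ Y| * (U Y)⁻¹ * ‖φ Y‖ ≤ |U₁ Y| * (K * ((1 + Y) / Y)) * ‖φ Y‖ := by
            have := hU.inv_le hY
            gcongr
        _ = K * ((1 + Y) * |U₁ Y|) * (Y⁻¹ * ‖φ Y‖) := by field_simp
        _ ≤ K * K * (Y⁻¹ * ‖φ Y‖) := by gcongr
        _ = _ := by ring
    rw [norm_mul, norm_inv, Complex.norm_real, Real.norm_of_nonneg hY.le]
    have k3 : K / s ^ 2 ≤ K ^ 3 / s ^ 2 := by
      gcongr
      exact le_self_pow₀ hK (by norm_num)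
    have yφ : 0 ≤ Y⁻¹ * ‖φ Y‖ := by positivity
    calc ‖g' Y‖ ≤ _ := norm_add_le _ _
      _ ≤ K / s ^ 2 * (Y⁻¹ * ‖φ Y‖) + K / s ^ 2 * (K ^ 2 * (Y⁻¹ * ‖φ Y‖) + ‖φ₁ Y‖) := add_le_add n1 n2
      _ = K / s ^ 2 * (Y⁻¹ * ‖φ Y‖) + K ^ 3 / s ^ 2 * (Y⁻¹ * ‖φ Y‖) + K / s ^ 2 * ‖φ₁ Y‖ := by ring
      _ ≤ K ^ 3 / s ^ 2 * (Y⁻¹ * ‖φ Y‖) + K ^ 3 / s ^ 2 * (Y⁻¹ * ‖φ Y‖) + K / s ^ 2 * ‖φ₁ Y‖ := by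
          gcongr
      _ = _ := by ring
  have ag' : AEStronglyMeasurable g' halfLine :=
    (aχ'.mul (hU.locAC_inv.aestronglyMeasurable.mul S.hφ.m.1)).add
      (lχ.aestronglyMeasurable.mul (((hU.aesm_deriv.neg.div₀ (hU.aesm.pow 2)).mul S.hφ.m.1).add
        (hU.locAC_inv.aestronglyMeasurable.mul S.hφ.m₁.1)))
  obtain ⟨mg', ng'⟩ := memL2_and_normL2_le_add (by positivity) (by positivity) ag' S.hφ.m₁
    S.hardy_φ.1 (ae_halfLine bg')
  have lim : Tendsto (fun Y => w₁ Y * conj (g Y)) (𝓝[>] 0) (𝓝 0) := by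
    have t1 : Tendsto w₁ (𝓝[>] 0) (𝓝 0) := by
      simpa [S.w₁_zero] using tendsto_of_continuousOn S.hw.c₁
    obtain ⟨b, hb0, hb⟩ := exists_bound_near_zero S.hφ.c
    refine tendsto_zero_of_bound (B := K / s ^ 2 * b) t1 fun Y hY h1 => ?_
    rw [norm_mul, RCLike.norm_conj]
    simp only [hg]
    rw [← mul_assoc (χ Y : ℂ), norm_mul ((χ Y : ℂ) * _), ← Complex.ofReal_inv, ← Complex.ofReal_mul,
      Complex.norm_real, Real.norm_of_nonneg (χU Y hY).1, mul_comm]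
    have := (χU Y hY).2
    have := (χU Y hY).1
    have := hb Y ⟨hY.le, h1⟩
    gcongr
  have dP : LocAC (fun Y => w₁ Y * conj (g Y)) (fun Y => h Y * conj (g Y)
      + ((a : ℂ) ^ 2 * (w Y * conj (g Y)) + w₁ Y * conj (g' Y))) :=
    (S.hw.d₁.mul dg.conj).congr (fun _ _ => rfl) fun Y _ => by ring
  have i1 := (integrable_mul_conj S.hw.m mg).const_mul ((a : ℂ) ^ 2)
  have i2 := integrable_mul_conj S.hw.m₁ mg'
  have key := integral_add_eq_neg dP (integrable_mul_conj S.hw.m₁ mg) (integrable_mul_conj S.hw.mg mg)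
    (i1.add i2) lim
  rw [integral_add i1 i2, integral_const_mul] at key
  have b1 := norm_integral_mul_conj_le S.hw.m mg
  have b2 := norm_integral_mul_conj_le S.hw.m₁ mg'
  have n : ‖∫ Y, h Y * conj (g Y) ∂halfLine‖ ≤ a ^ 2 * (normL2 w * normL2 g)
      + normL2 w₁ * normL2 g' := by
    rw [key, neg_zero, zero_sub, norm_neg]
    refine (norm_add_le _ _).trans (add_le_add ?_ b2)
    rw [norm_mul, norm_pow, Complex.norm_real, Real.norm_of_nonneg ha.le]
    gcongr
  have P0 := normL2_nonneg φ₁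
  have Φ0 := normL2_nonneg φ
  have W0 := normL2_nonneg w
  have W₁0 := normL2_nonneg w₁
  have F0 := normL2_nonneg f
  have G0 := normL2_nonneg g
  have G'0 := normL2_nonneg g'
  have c1 : s ^ 6 * (a ^ 2 * (normL2 w * normL2 g)) ≤ s * X * (K * (a * normL2 φ)) := by
    calc s ^ 6 * (a ^ 2 * (normL2 w * normL2 g))
        = s ^ 3 * (s ^ 3 * (a * normL2 w)) * (a * normL2 g) := by ring
      _ ≤ s ^ 3 * X * (a * (K / s ^ 2 * normL2 φ)) := by gcongr
      _ = _ := by field_simp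
  have c2 : s ^ 6 * (normL2 w₁ * normL2 g') ≤ s * X * (5 * K ^ 3 * normL2 φ₁) := by
    have q : normL2 g' ≤ 5 * K ^ 3 / s ^ 2 * normL2 φ₁ := by
      refine ng'.trans ?_
      have h2 := S.hardy_φ.2
      calc K / s ^ 2 * normL2 φ₁ + 2 * K ^ 3 / s ^ 2 * normL2 (fun Y => (Y : ℂ)⁻¹ * φ Y)
          ≤ K ^ 3 / s ^ 2 * normL2 φ₁ + 2 * K ^ 3 / s ^ 2 * (2 * normL2 φ₁) := by
            gcongr
            exact le_self_pow₀ hK (by norm_num)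
        _ = _ := by ring
    calc s ^ 6 * (normL2 w₁ * normL2 g') = s ^ 3 * (s ^ 3 * normL2 w₁) * normL2 g' := by ring
      _ ≤ s ^ 3 * X * (5 * K ^ 3 / s ^ 2 * normL2 φ₁) := by gcongr
      _ = _ := by field_simp
  have k1 : K ≤ 5 * K ^ 3 := by
    have : K ≤ K ^ 3 := le_self_pow₀ hK (by norm_num)
    linarith
  calc s ^ 6 * ‖∫ Y, h Y * conj (g Y) ∂halfLine‖
      ≤ s ^ 6 * (a ^ 2 * (normL2 w * normL2 g) + normL2 w₁ * normL2 g') := by gcongr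
    _ ≤ s * X * (5 * K ^ 3 * normL2 φ₁) + s * X * (K * (a * normL2 φ)) := by linarith
    _ ≤ s * X * (5 * K ^ 3 * normL2 φ₁) + s * X * (5 * K ^ 3 * (a * normL2 φ)) := by gcongr
    _ = s * X * (5 * K ^ 3 * (normL2 φ₁ + a * normL2 φ)) := by ring
    _ ≤ 16 * K ^ 2 * (normL2 f + s * normL2 φ₁) * (5 * K ^ 3 * (normL2 φ₁ + a * normL2 φ)) := by gcongr
    _ = _ := by ring

end OSSystem

/-- The arithmetic of `energy_estimate`: coercivity and absorption. -/
theorem energy_arith {K a κ s t P Φ F Q : ℝ} (hK : 1 ≤ K) (ha : 0 < a) (hκ : κ = 1 + (a ^ 2)⁻¹)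
    (κ1 : 1 ≤ κ) (hs : 0 < s) (hs1 : 4000 * K ^ 9 * κ ^ 2 * s ≤ 1) (ht0 : 0 ≤ t) (ht1 : t ≤ 1)
    (P0 : 0 ≤ P) (Φ0 : 0 ≤ Φ) (F0 : 0 ≤ F) (hQ0 : 0 ≤ P ^ 2 + Q)
    (hQ1 : |Q| ≤ 2 * K ^ 2 * (P * Φ))
    (E : P ^ 2 + a ^ 2 * Φ ^ 2 + t * Q ≤ 122 * K ^ 5 * (F + s * P) * (P + a * Φ + Φ)) :
    P + a * Φ ≤ 4000 * K ^ 9 * κ ^ 2 * F := by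
  have aΦ0 : 0 ≤ a * Φ := by positivity
  have Φκ : Φ ≤ κ * (a * Φ) := by
    have h1 : 1 ≤ κ * a := by
      have : κ * a = a + a⁻¹ := by rw [hκ]; field_simp
      rw [this]
      have h2 : 0 < a⁻¹ := by positivity
      have h3 : a * a⁻¹ = 1 := mul_inv_cancel₀ ha.ne'
      nlinarith [sq_nonneg (a - a⁻¹)]
    calc Φ ≤ κ * a * Φ := le_mul_of_one_le_left Φ0 h1
      _ = _ := by ring
  set z := P + a * Φ with hz
  have z0 : 0 ≤ z := by positivity
  have zz : P + a * Φ + Φ ≤ 2 * κ * z := by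
    have : κ * (a * Φ) ≤ κ * z := by rw [hz]; gcongr; linarith
    have : z ≤ κ * z := le_mul_of_one_le_left z0 κ1
    linarith
  set Z := F + s * P with hZ
  have Z0 : 0 ≤ Z := by positivity
  have E2 : P ^ 2 + a ^ 2 * Φ ^ 2 + t * Q ≤ 244 * K ^ 5 * κ * Z * z := by
    calc P ^ 2 + a ^ 2 * Φ ^ 2 + t * Q ≤ 122 * K ^ 5 * Z * (P + a * Φ + Φ) := E
      _ ≤ 122 * K ^ 5 * Z * (2 * κ * z) := by gcongr
      _ = _ := by ring
  -- coercivity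
  have E3 : a ^ 2 * Φ ^ 2 ≤ P ^ 2 + a ^ 2 * Φ ^ 2 + t * Q := by
    nlinarith [mul_nonneg ht0 hQ0, mul_nonneg (sub_nonneg.2 ht1) (sq_nonneg P)]
  have E4 : 1 / 2 * P ^ 2 + a ^ 2 * Φ ^ 2 ≤ 2 * K ^ 4 * κ * (P ^ 2 + a ^ 2 * Φ ^ 2 + t * Q) := by
    set E' := P ^ 2 + a ^ 2 * Φ ^ 2 + t * Q with hE
    have tQ : -(t * Q) ≤ 1 / 2 * P ^ 2 + 2 * K ^ 4 * Φ ^ 2 := by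
      have h1 : -(t * Q) ≤ |Q| := by
        have : |t * Q| ≤ |Q| := by
          rw [abs_mul, abs_of_nonneg ht0]; exact mul_le_of_le_one_left (abs_nonneg _) ht1
        exact (neg_le_abs _).trans this
      nlinarith [sq_nonneg (P - 2 * K ^ 2 * Φ)]
    have Φ2 : Φ ^ 2 ≤ (a ^ 2)⁻¹ * E' := by
      rw [inv_mul_eq_div, le_div_iff₀ (by positivity)]; linarith
    have E0 : 0 ≤ E' := le_trans (by positivity) E3
    have k4 : 1 ≤ K ^ 4 := one_le_pow₀ hK
    calc 1 / 2 * P ^ 2 + a ^ 2 * Φ ^ 2 ≤ E' + 2 * K ^ 4 * Φ ^ 2 := by rw [hE]; linarith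
      _ ≤ E' + 2 * K ^ 4 * ((a ^ 2)⁻¹ * E') := by gcongr
      _ ≤ 2 * K ^ 4 * E' + 2 * K ^ 4 * ((a ^ 2)⁻¹ * E') := by
          have : 1 * E' ≤ 2 * K ^ 4 * E' := by gcongr; linarith
          linarith
      _ = _ := by rw [hκ]; ring
  have E5 : z ^ 2 ≤ (1952 * K ^ 9 * κ ^ 2 * Z) * z := by
    have h1 : z ^ 2 ≤ 4 * (1 / 2 * P ^ 2 + a ^ 2 * Φ ^ 2) := by
      rw [hz]; nlinarith [sq_nonneg (P - a * Φ), sq_nonneg (a * Φ)]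
    calc z ^ 2 ≤ 4 * (2 * K ^ 4 * κ * (244 * K ^ 5 * κ * Z * z)) := by
          refine h1.trans ?_
          gcongr
          exact E4.trans (by gcongr)
      _ = _ := by ring
  have E6 := le_of_sq_le_mul (by positivity) E5
  have Zz : Z ≤ F + s * z := by rw [hZ, hz]; gcongr; linarith
  have E7 : 1952 * K ^ 9 * κ ^ 2 * Z ≤ 1952 * K ^ 9 * κ ^ 2 * F + 1 / 2 * z := by
    calc 1952 * K ^ 9 * κ ^ 2 * Z ≤ 1952 * K ^ 9 * κ ^ 2 * (F + s * z) := by gcongr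
      _ = 1952 * K ^ 9 * κ ^ 2 * F + (1952 * K ^ 9 * κ ^ 2 * s) * z := by ring
      _ ≤ _ := by
        have : 1952 * K ^ 9 * κ ^ 2 * s ≤ 1 / 2 := by linarith
        gcongr
  have : 0 ≤ K ^ 9 * κ ^ 2 * F := by positivity
  linarith

namespace OSSystem

variable {U U₁ U₂ : ℝ → ℝ} {K t ε a s : ℝ} {f φ φ₁ w w₁ h : ℝ → ℂ}

/-- The equation divided by `U` and tested with `φ`; equivalently, the equation tested with `φ / U`. -/
theorem energy_identity (S : OSSystem U U₂ t ε a f φ φ₁ w w₁ h) (hU : ProfileBounds U U₁ U₂ K) :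
    ((normL2 φ₁ ^ 2 + a ^ 2 * normL2 φ ^ 2 : ℝ) : ℂ)
      + t * ∫ Y, (U₂ Y : ℂ) * φ Y * conj ((U Y : ℂ)⁻¹ * φ Y) ∂halfLine
    = Complex.I * ε * (∫ Y, h Y * conj ((U Y : ℂ)⁻¹ * φ Y) ∂halfLine)
      - ∫ Y, f Y * conj ((U Y : ℂ)⁻¹ * φ Y) ∂halfLine := by
  have mψ := (S.quotient hU).1
  have i1 := (integrable_mul_conj (S.memL2_stretching hU) mψ).const_mul (t : ℂ)
  have i2 := (integrable_mul_conj S.hw.mg mψ).const_mul (Complex.I * ε)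
  have i3 := integrable_mul_conj S.mf mψ
  have i4 : Integrable (fun Y => f Y * conj ((U Y : ℂ)⁻¹ * φ Y)
      + t * ((U₂ Y : ℂ) * φ Y * conj ((U Y : ℂ)⁻¹ * φ Y))) halfLine := i3.add i1
  rw [S.hφ.energy (by simp [S.φ_zero])]
  have e : ∫ Y, w Y * conj (φ Y) ∂halfLine = ((∫ Y, f Y * conj ((U Y : ℂ)⁻¹ * φ Y) ∂halfLine)
      + t * ∫ Y, (U₂ Y : ℂ) * φ Y * conj ((U Y : ℂ)⁻¹ * φ Y) ∂halfLine)
      - Complex.I * ε * (∫ Y, h Y * conj ((U Y : ℂ)⁻¹ * φ Y) ∂halfLine) := by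
    rw [← integral_const_mul, ← integral_const_mul, ← integral_add i3 i1, ← integral_sub i4 i2]
    refine integral_congr_ae ?_
    filter_upwards [S.eq, ae_halfLine_pos] with Y hY hp
    have u0 : (U Y : ℂ) ≠ 0 := by exact_mod_cast (hU.pos hp).ne'
    rw [← hY]
    simp only [map_mul, map_inv₀, Complex.conj_ofReal]
    field_simp
    ring
  rw [e]
  ring

/-- The diffusion term tested with `φ / U`, split by the cutoff `Y / (Y + s²)` at the scale of the
boundary layer. -/
theorem norm_integral_diffusion_le (S : OSSystem U U₂ t (s ^ 6) a f φ φ₁ w w₁ h)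
    (hU : ProfileBounds U U₁ U₂ K) (ht0 : 0 ≤ t) (ht1 : t ≤ 1) (ha : 0 < a)
    (hs : 0 < s) (hs1 : s ≤ 1) (hs2 : 64 * K * s ^ 2 ≤ 1) :
    s ^ 6 * ‖∫ Y, h Y * conj ((U Y : ℂ)⁻¹ * φ Y) ∂halfLine‖
      ≤ 120 * K ^ 5 * (normL2 f + s * normL2 φ₁) * (normL2 φ₁ + a * normL2 φ + normL2 φ) := by
  have hK := hU.one_le
  obtain ⟨mψ, nψ⟩ := S.quotient hU
  have b1 := S.norm_integral_interior_le hU ht0 ht1 ha hs hs1 hs2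
  obtain ⟨mh, nh⟩ := S.norm_near_wall_le hU ht0 ht1 hs hs1 hs2
  have s2 : 0 < s ^ 2 := by positivity
  have mg : MemL2 (fun Y => ((Y / (Y + s ^ 2) : ℝ) : ℂ) * ((U Y : ℂ)⁻¹ * φ Y)) := by
    refine mψ.of_le (C := 1) (AEStronglyMeasurable.mul ?_ mψ.1) fun Y hY => ?_
    · refine continuousOn_aesm (Complex.continuous_ofReal.comp_continuousOn
        (continuousOn_id.div (by fun_prop) fun Y hY => ?_))
      have : 0 < Y := hY
      positivity
    · rw [norm_mul, Complex.norm_real, Real.norm_of_nonneg (by positivity)]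
      refine mul_le_mul_of_nonneg_right ?_ (norm_nonneg _)
      rw [div_le_one (by positivity)]; linarith
  have split : ∫ Y, h Y * conj ((U Y : ℂ)⁻¹ * φ Y) ∂halfLine
      = (∫ Y, (((s ^ 2 / (Y + s ^ 2) : ℝ) : ℂ) * h Y) * conj ((U Y : ℂ)⁻¹ * φ Y) ∂halfLine)
        + ∫ Y, h Y * conj (((Y / (Y + s ^ 2) : ℝ) : ℂ) * ((U Y : ℂ)⁻¹ * φ Y)) ∂halfLine := by
    rw [← integral_add (integrable_mul_conj mh mψ) (integrable_mul_conj S.hw.mg mg)]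
    refine integral_congr_ae (ae_halfLine fun Y hY => ?_)
    have e : ((s ^ 2 / (Y + s ^ 2) : ℝ) : ℂ) + ((Y / (Y + s ^ 2) : ℝ) : ℂ) = 1 := by
      rw [← Complex.ofReal_add, ← add_div, add_comm, div_self (by positivity), Complex.ofReal_one]
    simp only
    rw [map_mul (starRingEnd ℂ) ((Y / (Y + s ^ 2) : ℝ) : ℂ), Complex.conj_ofReal]
    linear_combination -(h Y * conj ((U Y : ℂ)⁻¹ * φ Y)) * e
  have b2 := norm_integral_mul_conj_le mh mψ
  have P0 := normL2_nonneg φ₁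
  have Φ0 := normL2_nonneg φ
  have F0 := normL2_nonneg f
  set Z := normL2 f + s * normL2 φ₁ with hZ
  have Z0 : 0 ≤ Z := by positivity
  set N₁ := ‖∫ Y, (((s ^ 2 / (Y + s ^ 2) : ℝ) : ℂ) * h Y) * conj ((U Y : ℂ)⁻¹ * φ Y) ∂halfLine‖
  have c1 : s ^ 6 * N₁ ≤ 20 * K ^ 3 * Z * (K * (normL2 φ + 2 * normL2 φ₁)) := by
    have := normL2_nonneg (fun Y => (U Y : ℂ)⁻¹ * φ Y)
    calc s ^ 6 * N₁ ≤ s ^ 6 * (normL2 (fun Y => ((s ^ 2 / (Y + s ^ 2) : ℝ) : ℂ) * h Y)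
          * normL2 (fun Y => (U Y : ℂ)⁻¹ * φ Y)) := by gcongr
      _ = (s ^ 6 * normL2 (fun Y => ((s ^ 2 / (Y + s ^ 2) : ℝ) : ℂ) * h Y))
          * normL2 (fun Y => (U Y : ℂ)⁻¹ * φ Y) := by ring
      _ ≤ _ := by gcongr
  have c2 : 20 * K ^ 3 * Z * (K * (normL2 φ + 2 * normL2 φ₁))
      ≤ 20 * K ^ 5 * Z * (normL2 φ + 2 * normL2 φ₁) := by
    have : K ^ 4 ≤ K ^ 5 := pow_le_pow_right₀ hK (by norm_num)
    calc 20 * K ^ 3 * Z * (K * (normL2 φ + 2 * normL2 φ₁))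
        = 20 * K ^ 4 * Z * (normL2 φ + 2 * normL2 φ₁) := by ring
      _ ≤ _ := by gcongr
  have aΦ : 0 ≤ a * normL2 φ := by positivity
  rw [split]
  calc s ^ 6 * ‖_ + _‖ ≤ s ^ 6 * (N₁ + _) := mul_le_mul_of_nonneg_left (norm_add_le _ _) (by positivity)
    _ ≤ 20 * K ^ 5 * Z * (normL2 φ + 2 * normL2 φ₁)
        + 80 * K ^ 5 * Z * (normL2 φ₁ + a * normL2 φ) := by linarith
    _ = 20 * K ^ 5 * Z * (6 * normL2 φ₁ + 4 * (a * normL2 φ) + normL2 φ) := by ring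
    _ ≤ 20 * K ^ 5 * Z * (6 * normL2 φ₁ + 6 * (a * normL2 φ) + 6 * normL2 φ) := by gcongr <;> linarith
    _ = _ := by ring

/-- The energy estimate. The constant degenerates as `a → 0`; for `a ≥ 1` it is uniform. -/
theorem energy_estimate (S : OSSystem U U₂ t (s ^ 6) a f φ φ₁ w w₁ h)
    (hU : ProfileBounds U U₁ U₂ K) (ht0 : 0 ≤ t) (ht1 : t ≤ 1) (ha : 0 < a)
    (hs : 0 < s) (hs1 : 4000 * K ^ 9 * (1 + (a ^ 2)⁻¹) ^ 2 * s ≤ 1) :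
    normL2 φ₁ + a * normL2 φ ≤ 4000 * K ^ 9 * (1 + (a ^ 2)⁻¹) ^ 2 * normL2 f := by
  have hK := hU.one_le
  set κ := 1 + (a ^ 2)⁻¹ with hκ
  have κ1 : 1 ≤ κ := by
    have : 0 < (a ^ 2)⁻¹ := by positivity
    rw [hκ]; linarith
  have big : 4000 * K * s ≤ 1 := by
    refine le_trans ?_ hs1
    have h1 : K ≤ K ^ 9 := le_self_pow₀ hK (by norm_num)
    have h2 : (1 : ℝ) ≤ κ ^ 2 := one_le_pow₀ κ1
    calc 4000 * K * s = 4000 * K * 1 * s := by ring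
      _ ≤ _ := by gcongr
  have s_le : s ≤ 1 := by nlinarith
  have hs2 : 64 * K * s ^ 2 ≤ 1 := by
    have : 0 < K * s := by have := hU.K_pos; positivity
    nlinarith
  have e := S.energy_identity hU
  obtain ⟨Q, hQ, hQ0, hQ1⟩ := S.rayleigh_nonneg hU
  obtain ⟨mψ, nψ⟩ := S.quotient hU
  have b1 := S.norm_integral_diffusion_le hU ht0 ht1 ha hs s_le hs2
  have b2 := norm_integral_mul_conj_le S.mf mψ
  rw [hQ] at e
  set P := normL2 φ₁ with hP
  set Φ := normL2 φ with hΦ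
  set F := normL2 f with hF
  have P0 : 0 ≤ P := normL2_nonneg φ₁
  have Φ0 : 0 ≤ Φ := normL2_nonneg φ
  have F0 : 0 ≤ F := normL2_nonneg f
  have aΦ0 : 0 ≤ a * Φ := by positivity
  set I₁ := ∫ Y, h Y * conj ((U Y : ℂ)⁻¹ * φ Y) ∂halfLine
  set I₂ := ∫ Y, f Y * conj ((U Y : ℂ)⁻¹ * φ Y) ∂halfLine
  have e' : ((P ^ 2 + a ^ 2 * Φ ^ 2 + t * Q : ℝ) : ℂ)
      = Complex.I * ((s ^ 6 : ℝ) : ℂ) * I₁ - I₂ := by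
    rw [← e]; push_cast; ring
  have E1 : P ^ 2 + a ^ 2 * Φ ^ 2 + t * Q ≤ s ^ 6 * ‖I₁‖ + ‖I₂‖ := by
    have := congrArg norm e'
    rw [Complex.norm_real] at this
    refine (le_abs_self _).trans ?_
    rw [← Real.norm_eq_abs, this]
    refine (norm_sub_le _ _).trans ?_
    rw [norm_mul, norm_mul, Complex.norm_I, Complex.norm_real,
      Real.norm_of_nonneg (by positivity : (0 : ℝ) ≤ s ^ 6), one_mul]
  refine energy_arith hK ha hκ κ1 hs hs1 ht0 ht1 P0 Φ0 F0 hQ0 hQ1 ?_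
  set Z := F + s * P with hZ
  have Z0 : 0 ≤ Z := by positivity
  have FZ : F ≤ Z := by
    rw [hZ]; have : 0 ≤ s * P := by positivity
    linarith
  have h2 : ‖I₂‖ ≤ 2 * K ^ 5 * Z * (P + a * Φ + Φ) := by
    refine b2.trans ?_
    have k5 : K ≤ K ^ 5 := le_self_pow₀ hK (by norm_num)
    calc F * normL2 (fun Y => (U Y : ℂ)⁻¹ * φ Y) ≤ F * (K * (Φ + 2 * P)) := by gcongr
      _ ≤ Z * (K ^ 5 * (2 * (P + a * Φ + Φ))) := by gcongr; linarith
      _ = _ := by ring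
  linarith

end OSSystem

/-! ### The Rayleigh problem at low frequency -/

theorem norm_ofReal_mul {r : ℝ} (hr : 0 ≤ r) (z : ℂ) : ‖(r : ℂ) * z‖ = r * ‖z‖ := by
  rw [norm_mul, Complex.norm_real, Real.norm_of_nonneg hr]

theorem norm_ofReal_inv_mul {r : ℝ} (hr : 0 ≤ r) (z : ℂ) : ‖(r : ℂ)⁻¹ * z‖ = r⁻¹ * ‖z‖ := by
  rw [norm_mul, norm_inv, Complex.norm_real, Real.norm_of_nonneg hr]

theorem norm_ofReal_mul_mul_conj {r : ℝ} (hr : 0 ≤ r) (x y : ℂ) :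
    ‖(r : ℂ) * x * conj y‖ = r * ‖x‖ * ‖y‖ := by
  rw [norm_mul, RCLike.norm_conj, norm_ofReal_mul hr]

/-- An exponentially decaying majorant for all the cutoff functions below. -/
noncomputable def decay (Y : ℝ) : ℂ := (((1 + Y) ^ 3 * Real.exp (-Y) : ℝ) : ℂ)

theorem memL2_decay : MemL2 decay := by
  have hexp : MemL2 (fun Y => ((Real.exp (-Y / 2) : ℝ) : ℂ)) := by
    refine (memLp_two_iff_integrable_sq_norm (Continuous.aestronglyMeasurable (by fun_prop))).2 ?_
    have : IntegrableOn (fun Y : ℝ => Real.exp (-Y)) (Ioi 0) := integrableOn_exp_neg_Ioi 0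
    refine this.congr_fun (fun Y _ => ?_) measurableSet_Ioi
    simp only [Complex.norm_real, Real.norm_of_nonneg (Real.exp_pos _).le]
    rw [← Real.exp_nat_mul]; congr 1; push_cast; ring
  refine hexp.of_le (C := 216) (Continuous.aestronglyMeasurable (by unfold decay; fun_prop))
    fun Y hY => ?_
  unfold decay
  rw [Complex.norm_real, Complex.norm_real, Real.norm_of_nonneg (by positivity),
    Real.norm_of_nonneg (Real.exp_pos _).le]
  have h1 : 1 + Y ≤ 6 * Real.exp (Y / 6) := by
    have := Real.add_one_le_exp (Y / 6); linarith
  have h2 : (6 * Real.exp (Y / 6)) ^ 3 = 216 * Real.exp (Y / 2) := by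
    rw [mul_pow, ← Real.exp_nat_mul]; norm_num; ring_nf
  calc (1 + Y) ^ 3 * Real.exp (-Y) ≤ (6 * Real.exp (Y / 6)) ^ 3 * Real.exp (-Y) := by gcongr
    _ = 216 * (Real.exp (Y / 2) * Real.exp (-Y)) := by rw [h2]; ring
    _ = 216 * Real.exp (-Y / 2) := by rw [← Real.exp_add]; congr 2; ring

theorem norm_le_decay {x Y : ℝ} (hY : 0 < Y) (h0 : 0 ≤ x) (h : x ≤ (1 + Y) ^ 3) :
    ‖((x * Real.exp (-Y) : ℝ) : ℂ)‖ ≤ ‖decay Y‖ := by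
  unfold decay
  rw [Complex.norm_real, Complex.norm_real, Real.norm_of_nonneg (by positivity),
    Real.norm_of_nonneg (by positivity)]
  gcongr

/-- The algebra of the two energy estimates for the Rayleigh problem. -/
theorem rayleigh_arith {a N m M' x y x₁ y₁ : ℝ} (ha : 0 < a) (ha1 : a ≤ 1) (N0 : 0 ≤ N) (m0 : 0 ≤ m)
    (hM : M' ≤ m) (M0 : 0 ≤ M') (y0 : 0 ≤ y₁)
    (h0 : x ^ 2 + a ^ 2 * y ^ 2 ≤ m * x)
    (h1 : x₁ ^ 2 + a ^ 2 * y₁ ^ 2 ≤ a ^ 2 * (N * y₁) + M' * x₁ + 2 * (x + M') * y₁) :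
    x ≤ m ∧ y₁ ≤ N + 5 * (m / a ^ 2) := by
  have hx : x ≤ m := le_of_sq_le_mul m0 (by nlinarith [mul_nonneg (sq_nonneg a) (sq_nonneg y)])
  refine ⟨hx, ?_⟩
  have h2 : (a * y₁) ^ 2 ≤ m ^ 2 + (a * N + 4 * (m / a)) * (a * y₁) := by
    have e : (a * N + 4 * (m / a)) * (a * y₁) = a ^ 2 * (N * y₁) + 4 * m * y₁ := by field_simp
    rw [e]
    have h3 : 2 * (x + M') * y₁ ≤ 4 * m * y₁ := by nlinarith
    nlinarith [sq_nonneg (x₁ - M' / 2), pow_le_pow_left₀ M0 hM 2]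
  have h3 := le_add_of_sq_le m0 (by positivity) h2
  have h4 : m ≤ m / a := by rw [le_div_iff₀ ha]; nlinarith
  have h5 : a * y₁ ≤ a * (N + 5 * (m / a ^ 2)) := by
    have : a * (N + 5 * (m / a ^ 2)) = a * N + 5 * (m / a) := by field_simp
    rw [this]; linarith
  exact le_of_mul_le_mul_left h5 ha

namespace OSSystem

variable {U U₁ U₂ : ℝ → ℝ} {K t ε a s : ℝ} {f φ φ₁ w w₁ h : ℝ → ℂ}

/-- A one sided weighted Hardy inequality for `ψ = φ / U`, whose derivative is `q / U²` with
`q = U φ' - U' φ`. -/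
theorem norm_quotient_le (S : OSSystem U U₂ t ε a f φ φ₁ w w₁ h) (hU : ProfileBounds U U₁ U₂ K)
    (mq : MemL2 (weighted 1 fun Y => (U Y : ℂ)⁻¹ * (U Y * φ₁ Y - U₁ Y * φ Y))) :
    normL2 (fun Y => (U Y : ℂ)⁻¹ * φ Y)
      ≤ 2 * K * normL2 (weighted 1 fun Y => (U Y : ℂ)⁻¹ * (U Y * φ₁ Y - U₁ Y * φ Y)) := by
  have hK := hU.one_le
  have mψ := (S.quotient hU).1
  set ψ : ℝ → ℂ := fun Y => (U Y : ℂ)⁻¹ * φ Y with hψ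
  set ψ' : ℝ → ℂ := fun Y => (U Y : ℂ)⁻¹ * ((U Y : ℂ)⁻¹ * (U Y * φ₁ Y - U₁ Y * φ Y)) with hψ'
  have dψ : LocAC ψ ψ' := by
    refine (hU.locAC_inv.mul S.hφ.d).congr (fun _ _ => rfl) fun Y hY => ?_
    have u0 : (U Y : ℂ) ≠ 0 := by exact_mod_cast (hU.pos hY).ne'
    simp only [hψ']
    field_simp
    ring
  have aψ' : AEStronglyMeasurable ψ' halfLine :=
    hU.locAC_inv.aestronglyMeasurable.mul (hU.locAC_inv.aestronglyMeasurable.mul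
      ((hU.aesm.mul S.hφ.m₁.1).sub (hU.aesm_deriv.mul S.hφ.m.1)))
  set R : ℝ → ℂ := weighted 1 fun Y => (U Y : ℂ)⁻¹ * (U Y * φ₁ Y - U₁ Y * φ Y) with hR
  have nψ' : ∀ Y, 0 < Y → Y * ‖ψ' Y‖ ≤ K * ‖R Y‖ := fun Y hY => by
    have hp : 0 < 1 + Y := by linarith
    simp only [hψ', hR, weighted, pow_one]
    rw [norm_mul, norm_mul ((1 + Y : ℝ) : ℂ), norm_inv, Complex.norm_real, Complex.norm_real,
      Real.norm_of_nonneg (hU.pos hY).le, Real.norm_of_nonneg hp.le]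
    calc Y * ((U Y)⁻¹ * ‖(U Y : ℂ)⁻¹ * (U Y * φ₁ Y - U₁ Y * φ Y)‖)
        ≤ Y * (K * ((1 + Y) / Y) * ‖(U Y : ℂ)⁻¹ * (U Y * φ₁ Y - U₁ Y * φ Y)‖) := by
          gcongr; exact hU.inv_le hY
      _ = _ := by field_simp
  set B := normL2 R with hB
  have B0 : 0 ≤ B := normL2_nonneg R
  -- cut off at scale `δ`, with the multiplier `Y δ / (Y + δ)`
  have cut : ∀ δ : ℝ, 0 < δ → MemL2 (fun Y => ((δ / (Y + δ) : ℝ) : ℂ) * ψ Y) ∧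
      normL2 (fun Y => ((δ / (Y + δ) : ℝ) : ℂ) * ψ Y) ≤ 2 * K * B := by
    intro δ hδ
    set r : ℝ → ℝ := fun Y => δ / (Y + δ) with hr
    have cr : ContinuousOn r (Ioi 0) := by
      refine continuousOn_const.div (by fun_prop) fun Y hY => ?_
      have : 0 < Y := hY
      positivity
    have ar : AEStronglyMeasurable (fun Y => (r Y : ℂ)) halfLine :=
      continuousOn_aesm (Complex.continuous_ofReal.comp_continuousOn cr)
    have r0 : ∀ Y, 0 < Y → 0 ≤ r Y := fun Y hY => by simp only [hr]; positivity
    have r1 : ∀ Y, 0 < Y → r Y ≤ 1 := fun Y hY => by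
      simp only [hr]; rw [div_le_one (by positivity)]; linarith
    have mrψ : MemL2 (fun Y => (r Y : ℂ) * ψ Y) := mψ.of_le (C := 1) (ar.mul mψ.1) fun Y hY => by
      rw [norm_mul, Complex.norm_real, Real.norm_of_nonneg (r0 Y hY)]
      exact mul_le_mul_of_nonneg_right (r1 Y hY) (norm_nonneg _)
    refine ⟨mrψ, ?_⟩
    have dm : ∀ Y, 0 < Y → HasDerivAt (fun Y => Y * r Y) (r Y ^ 2) Y := fun Y hY => by
      have := (hasDerivAt_id Y).mul ((hasDerivAt_const Y δ).div ((hasDerivAt_id Y).add_const δ)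
        (by simp only [id]; positivity))
      refine this.congr_deriv ?_
      simp only [hr, id]
      field_simp
      simp only [Pi.div_apply]
      field_simp
      ring
    have lm := LocAC.ofReal dm (cr.pow 2)
    have mmψ' : MemL2 (fun Y => (r Y : ℂ) * ((Y : ℂ) * ψ' Y)) := by
      refine mq.of_le (C := K) (ar.mul ((Complex.continuous_ofReal.aestronglyMeasurable).mul aψ'))
        fun Y hY => ?_
      rw [norm_mul, Complex.norm_real, Real.norm_of_nonneg (r0 Y hY), norm_mul, Complex.norm_real,
        Real.norm_of_nonneg hY.le]
      exact (mul_le_of_le_one_left (by positivity) (r1 Y hY)).trans (nψ' Y hY)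
    have i0 := integrable_mul_conj mrψ mrψ
    have i1 := integrable_mul_conj mmψ' mψ
    have i2 := integrable_mul_conj mψ mmψ'
    have bm : ∀ Y, 0 < Y → |Y * r Y| ≤ δ := fun Y hY => by
      rw [abs_of_nonneg (mul_nonneg hY.le (r0 Y hY))]
      simp only [hr]
      rw [mul_div_assoc', div_le_iff₀ (by positivity)]
      nlinarith
    have iP := integrable_multiplier lm.aestronglyMeasurable bm mψ mψ
    obtain ⟨b, hb0, hb⟩ := S.hφ.norm_le_mul S.φ_zero
    have lim : Tendsto (fun Y => ((Y * r Y : ℝ) : ℂ) * ψ Y * conj (ψ Y)) (𝓝[>] 0) (𝓝 0) := by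
      have t : Tendsto (fun Y : ℝ => (Y : ℂ)) (𝓝[>] 0) (𝓝 0) := by
        have : Tendsto (fun Y : ℝ => (Y : ℂ)) (𝓝 0) (𝓝 ((0 : ℝ) : ℂ)) :=
          Complex.continuous_ofReal.tendsto _
        simpa using this.mono_left nhdsWithin_le_nhds
      refine tendsto_zero_of_bound (B := (K * (2 * b)) * (K * (2 * b))) t fun Y hY h1 => ?_
      have e1 : ‖ψ Y‖ ≤ K * (2 * b) := by
        simp only [hψ]
        rw [norm_mul, norm_inv, Complex.norm_real, Real.norm_of_nonneg (hU.pos hY).le]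
        calc (U Y)⁻¹ * ‖φ Y‖ ≤ K * ((1 + Y) / Y) * (b * Y) :=
              mul_le_mul (hU.inv_le hY) (hb Y hY h1) (norm_nonneg _) (by positivity)
          _ = K * ((1 + Y) * b) := by field_simp
          _ ≤ _ := by gcongr; linarith
      rw [norm_mul, norm_mul, RCLike.norm_conj, Complex.norm_real, Complex.norm_real,
        Real.norm_of_nonneg hY.le, Real.norm_of_nonneg (mul_nonneg hY.le (r0 Y hY))]
      calc Y * r Y * ‖ψ Y‖ * ‖ψ Y‖ ≤ Y * 1 * (K * (2 * b)) * (K * (2 * b)) := by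
            gcongr; exact r1 Y hY
        _ = _ := by ring
    have dP : LocAC (fun Y => ((Y * r Y : ℝ) : ℂ) * ψ Y * conj (ψ Y)) (fun Y =>
        (r Y : ℂ) * ψ Y * conj ((r Y : ℂ) * ψ Y) + ((r Y : ℂ) * ((Y : ℂ) * ψ' Y) * conj (ψ Y)
          + ψ Y * conj ((r Y : ℂ) * ((Y : ℂ) * ψ' Y)))) :=
      ((lm.mul dψ).mul dψ.conj).congr (fun _ _ => rfl) fun Y _ => by
        simp only [map_mul, Complex.conj_ofReal]; push_cast; ring
    have key := integral_add_eq_neg dP iP i0 (i1.add i2) lim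
    rw [integral_mul_conj mrψ, integral_add i1 i2] at key
    have bd : ∀ {u v : ℝ → ℂ}, (∀ Y, ‖u Y‖ * ‖v Y‖ = ‖(r Y : ℂ) * ((Y : ℂ) * ψ' Y)‖ * ‖ψ Y‖) →
        ‖∫ Y, u Y * conj (v Y) ∂halfLine‖
          ≤ K * (B * normL2 (fun Y => (r Y : ℂ) * ψ Y)) := by
      intro u v huv
      refine norm_integral_le_mul (by positivity) mq mrψ (ae_halfLine fun Y hY => ?_)
      rw [norm_mul, RCLike.norm_conj, huv, norm_ofReal_mul (r0 Y hY), norm_ofReal_mul hY.le,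
        norm_ofReal_mul (r0 Y hY)]
      have := r0 Y hY
      calc r Y * (Y * ‖ψ' Y‖) * ‖ψ Y‖ ≤ r Y * (K * ‖R Y‖) * ‖ψ Y‖ :=
            mul_le_mul_of_nonneg_right (mul_le_mul_of_nonneg_left (nψ' Y hY) this) (norm_nonneg _)
        _ = _ := by ring
    have b1 := bd (u := fun Y => (r Y : ℂ) * ((Y : ℂ) * ψ' Y)) (v := ψ) fun _ => rfl
    have b2 := bd (u := ψ) (v := fun Y => (r Y : ℂ) * ((Y : ℂ) * ψ' Y)) fun _ => mul_comm _ _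
    have n := congrArg norm key
    rw [Complex.norm_real, Real.norm_of_nonneg (sq_nonneg _), neg_zero, zero_sub, norm_neg] at n
    have n2 := norm_add_le (∫ Y, (r Y : ℂ) * ((Y : ℂ) * ψ' Y) * conj (ψ Y) ∂halfLine)
      (∫ Y, ψ Y * conj ((r Y : ℂ) * ((Y : ℂ) * ψ' Y)) ∂halfLine)
    rw [← n] at n2
    exact le_of_sq_le_mul (by positivity) (by linarith)
  refine (memL2_and_normL2_le_of_tendsto (F := fun n : ℕ => fun Y =>
    ((((n : ℝ) + 1) / (Y + ((n : ℝ) + 1)) : ℝ) : ℂ) * ψ Y) (by positivity)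
    (fun n => (cut _ (by positivity)).1) (fun n => (cut _ (by positivity)).2) mψ.1 fun Y hY => ?_).2
  have h1 : Tendsto (fun n : ℕ => ((n : ℝ) + 1) / (Y + ((n : ℝ) + 1))) atTop (𝓝 1) := by
    have h2 := ((tendsto_one_div_add_atTop_nhds_zero_nat (𝕜 := ℝ)).const_mul Y).const_add 1
    have h3 := h2.inv₀ (by norm_num)
    simp only [mul_zero, add_zero, inv_one] at h3
    refine h3.congr fun n => ?_
    field_simp
    ring
  have h4 := ((Complex.continuous_ofReal.tendsto _).comp h1).mul_const (ψ Y)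
  simpa [Function.comp_def] using h4

set_option maxHeartbeats 1000000 in
/-- The low frequency estimate for the Rayleigh problem. The equation is used in once integrated
form: with the flux `q = U φ' - U' φ` and a primitive `G` of the remaining terms, `H = q + G`
vanishes at the wall and `H' = a² U φ + M Y e^{-Y}`, where `M` is the mean of the source. The
derivative of `φ / U` is `q / U² = (H - G) / U²`; testing it with `ρ² H` gives
`∫ ρ² |H'|² / U² + a² ∫ ρ² |H|² / U²` on the left, first for `ρ = 1`, then for `ρ = 1 + Y`. The
logarithmic derivative of the weight is absorbed in the second step by means of the first. -/
theorem rayleigh_estimate (S : OSSystem U U₂ t ε a f φ φ₁ w w₁ h) (hU : ProfileBounds U U₁ U₂ K)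
    (ha : 0 < a) (ha1 : a ≤ 1) {G H : ℝ → ℂ} {M : ℂ}
    (hH : ∀ Y, 0 < Y → H Y = (U Y * φ₁ Y - U₁ Y * φ Y) + G Y)
    (dH : LocAC H (fun Y => (a : ℂ) ^ 2 * (U Y * φ Y) + M * ((Y * Real.exp (-Y) : ℝ) : ℂ)))
    (lH : Tendsto H (𝓝[>] 0) (𝓝 0)) (mH : MemL2 H)
    (mG : MemL2 (weighted 1 fun Y => (U Y : ℂ)⁻¹ * G Y)) :
    MemL2 (weighted 1 fun Y => (U Y : ℂ)⁻¹ * (U Y * φ₁ Y - U₁ Y * φ Y)) ∧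
    normL2 (weighted 1 fun Y => (U Y : ℂ)⁻¹ * (U Y * φ₁ Y - U₁ Y * φ Y))
      ≤ 12 * K ^ 2 * (normL2 (weighted 1 fun Y => (U Y : ℂ)⁻¹ * G Y)
        + normL2 decay * (‖M‖ / a ^ 2)) ∧
    a * normL2 φ ≤ 12 * K ^ 2 * (normL2 (weighted 1 fun Y => (U Y : ℂ)⁻¹ * G Y)
        + normL2 decay * (‖M‖ / a ^ 2)) := by
  have hK := hU.one_le
  have aU' := hU.locAC_inv.aestronglyMeasurable
  have mψ := (S.quotient hU).1
  set ψ : ℝ → ℂ := fun Y => (U Y : ℂ)⁻¹ * φ Y with hψ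
  set q : ℝ → ℂ := fun Y => U Y * φ₁ Y - U₁ Y * φ Y with hq
  have aq : AEStronglyMeasurable q halfLine :=
    (hU.aesm.mul S.hφ.m₁.1).sub (hU.aesm_deriv.mul S.hφ.m.1)
  have dψ : LocAC ψ (fun Y => (U Y : ℂ)⁻¹ * ((U Y : ℂ)⁻¹ * q Y)) := by
    refine (hU.locAC_inv.mul S.hφ.d).congr (fun _ _ => rfl) fun Y hY => ?_
    have u0 : (U Y : ℂ) ≠ 0 := by exact_mod_cast (hU.pos hY).ne'
    simp only [hq]
    field_simp
    ring
  set e : ℝ → ℂ := fun Y => (U Y : ℂ)⁻¹ * ((Y * Real.exp (-Y) : ℝ) : ℂ) with he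
  have n_e : ∀ Y, 0 < Y → ∀ r, 0 ≤ r → r ≤ 1 + Y → r * ‖e Y‖ ≤ K * ‖decay Y‖ := fun Y hY r h0 hr => by
    simp only [he, decay]
    rw [norm_mul, norm_inv, Complex.norm_real, Complex.norm_real, Complex.norm_real,
      Real.norm_of_nonneg (hU.pos hY).le, Real.norm_of_nonneg (by positivity),
      Real.norm_of_nonneg (by positivity)]
    calc r * ((U Y)⁻¹ * (Y * Real.exp (-Y))) ≤ (1 + Y) * (K * ((1 + Y) / Y) * (Y * Real.exp (-Y))) := by
          have := hU.inv_le hY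
          have := (inv_pos.2 (hU.pos hY)).le
          gcongr
      _ = K * ((1 + Y) ^ 2 * Real.exp (-Y)) := by field_simp
      _ ≤ _ := by gcongr <;> linarith
  have ae' : AEStronglyMeasurable e halfLine :=
    aU'.mul (Continuous.aestronglyMeasurable (by fun_prop))
  have m_e : MemL2 e := memL2_decay.of_le ae' fun Y hY => by
    simpa using n_e Y hY 1 zero_le_one (by linarith)
  set Hu : ℝ → ℂ := fun Y => (U Y : ℂ)⁻¹ * H Y with hHu
  have hHuN : ∀ Y, 0 < Y → ‖Hu Y‖ = (U Y)⁻¹ * ‖H Y‖ := fun Y hY =>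
    norm_ofReal_inv_mul (hU.pos hY).le _
  set H'u : ℝ → ℂ := fun Y => (a : ℂ) ^ 2 * φ Y + M * e Y with hH'u
  have mH'u : MemL2 H'u := (S.hφ.m.const_mul _).add (m_e.const_mul _)
  set H' : ℝ → ℂ := fun Y => (a : ℂ) ^ 2 * (U Y * φ Y) + M * ((Y * Real.exp (-Y) : ℝ) : ℂ) with hH'
  have H'eq : ∀ Y, 0 < Y → H' Y = (U Y : ℂ) * H'u Y := fun Y hY => by
    have u0 : (U Y : ℂ) ≠ 0 := by exact_mod_cast (hU.pos hY).ne'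
    simp only [hH', hH'u, he]
    field_simp
  have mH' : MemL2 H' := (hU.memL2_mul mH'u).ae_eq (ae_halfLine fun Y hY => (H'eq Y hY).symm)
  have nH' : normL2 H' ≤ K * normL2 H'u := normL2_le_of_le hU.K_pos.le mH'u fun Y hY => by
    rw [H'eq Y hY, norm_mul, Complex.norm_real, Real.norm_of_nonneg (hU.pos hY).le]
    exact mul_le_mul_of_nonneg_right (hU.le Y hY) (norm_nonneg _)
  obtain ⟨mHY, nHY⟩ := hardy dH mH mH' lH
  have mHu : MemL2 Hu := by
    refine (memL2_and_normL2_le_add (f := Hu) hU.K_pos.le hU.K_pos.le (aU'.mul mH.1) mH mHY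
      (ae_halfLine fun Y hY => ?_)).1
    rw [hHuN Y hY, norm_ofReal_inv_mul hY.le]
    calc (U Y)⁻¹ * ‖H Y‖ ≤ K * ((1 + Y) / Y) * ‖H Y‖ :=
          mul_le_mul_of_nonneg_right (hU.inv_le hY) (norm_nonneg _)
      _ = _ := by field_simp; ring
  set Gu : ℝ → ℂ := fun Y => (U Y : ℂ)⁻¹ * G Y with hGu
  set N := normL2 (weighted 1 Gu) with hN
  have N0 : 0 ≤ N := normL2_nonneg _
  have aGu : AEStronglyMeasurable Gu halfLine := by
    refine AEStronglyMeasurable.congr (f := fun Y => ((1 + Y : ℝ) : ℂ)⁻¹ * weighted 1 Gu Y)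
      (AEStronglyMeasurable.mul ?_ mG.1) (ae_halfLine fun Y hY => ?_)
    · refine continuousOn_aesm (ContinuousOn.inv₀ (by fun_prop) fun Y hY => ?_)
      have : 0 < 1 + Y := by have : 0 < Y := hY; linarith
      exact_mod_cast this.ne'
    · have : ((1 + Y : ℝ) : ℂ) ≠ 0 := by
        have : 0 < 1 + Y := by linarith
        exact_mod_cast this.ne'
      simp only [weighted, pow_one]
      field_simp
  have nGu : ∀ Y, 0 < Y → (1 + Y) * ‖Gu Y‖ = ‖weighted 1 Gu Y‖ := fun Y hY => by
    have : 0 < 1 + Y := by linarith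
    simp only [weighted, pow_one]
    rw [norm_ofReal_mul this.le]
  have mGu : MemL2 Gu := mG.of_le (C := 1) aGu fun Y hY => by
    rw [← nGu Y hY, one_mul]
    exact le_mul_of_one_le_left (norm_nonneg _) (by linarith)
  set qu : ℝ → ℂ := fun Y => (U Y : ℂ)⁻¹ * q Y with hqu
  have quHG : ∀ Y, 0 < Y → qu Y = Hu Y - Gu Y := fun Y hY => by
    simp only [hqu, hHu, hGu, hH Y hY, hq]; ring
  have mqu : MemL2 qu := (mHu.sub mGu).ae_eq (ae_halfLine fun Y hY => (quHG Y hY).symm)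
  obtain ⟨b, hb0, hb⟩ := S.hφ.norm_le_mul S.φ_zero
  have bψ : ∀ Y, 0 < Y → Y ≤ 1 → ‖ψ Y‖ ≤ K * (2 * b) := fun Y hY h1 => by
    simp only [hψ]
    rw [norm_mul, norm_inv, Complex.norm_real, Real.norm_of_nonneg (hU.pos hY).le]
    calc (U Y)⁻¹ * ‖φ Y‖ ≤ K * ((1 + Y) / Y) * (b * Y) :=
          mul_le_mul (hU.inv_le hY) (hb Y hY h1) (norm_nonneg _) (by positivity)
      _ = K * ((1 + Y) * b) := by field_simp
      _ ≤ _ := by gcongr; linarith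
  -- the identity behind both estimates: `(φ / U)' = (H - G) / U²` tested with `ρ² H`
  have ident : ∀ (ρ ρ' : ℝ → ℝ) (B : ℝ), Weight ρ ρ' B →
      (((normL2 (fun Y => (ρ Y : ℂ) * H'u Y)) ^ 2
        + a ^ 2 * (normL2 (fun Y => (ρ Y : ℂ) * Hu Y)) ^ 2 : ℝ) : ℂ)
      = (a : ℂ) ^ 2 * (∫ Y, ((ρ Y ^ 2 : ℝ) : ℂ) * Gu Y * conj (Hu Y) ∂halfLine)
        + (M * (∫ Y, ((ρ Y ^ 2 : ℝ) : ℂ) * e Y * conj (H'u Y) ∂halfLine)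
        - ∫ Y, ((2 * ρ Y * ρ' Y : ℝ) : ℂ) * (H'u Y - M * e Y) * conj (Hu Y) ∂halfLine) := by
    intro ρ ρ' B hρ
    have dm : LocAC (fun Y => ((ρ Y ^ 2 : ℝ) : ℂ)) (fun Y => ((2 * ρ Y * ρ' Y : ℝ) : ℂ)) :=
      LocAC.ofReal (fun Y hY => ((hρ.deriv Y hY).pow 2).congr_deriv (by simp))
        ((continuousOn_const.mul hρ.continuousOn).mul hρ.cont)
    have mm : AEStronglyMeasurable (fun Y => ((2 * ρ Y * ρ' Y : ℝ) : ℂ)) halfLine :=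
      continuousOn_aesm (Complex.continuous_ofReal.comp_continuousOn
        ((continuousOn_const.mul hρ.continuousOn).mul hρ.cont))
    have B1 : ∀ Y, 0 < Y → |ρ Y ^ 2| ≤ B ^ 2 := fun Y hY => by
      rw [abs_of_nonneg (sq_nonneg _)]
      exact pow_le_pow_left₀ (hρ.pos Y hY).le (hρ.le Y hY) 2
    have B2 : ∀ Y, 0 < Y → |2 * ρ Y * ρ' Y| ≤ 4 * B ^ 2 := fun Y hY => by
      have h1 := hρ.nonneg Y hY
      have h2 := hρ.pos Y hY
      rw [abs_of_nonneg (by positivity)]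
      have := B1 Y hY
      rw [abs_of_nonneg (sq_nonneg _)] at this
      nlinarith [hρ.le_two Y hY]
    have am := dm.aestronglyMeasurable
    have i1 := integrable_multiplier am B1 mqu mHu
    have i2 := integrable_multiplier am B1 S.hφ.m mH'u
    have i3 := integrable_multiplier mm B2 S.hφ.m mHu
    have dP : LocAC (fun Y => ((ρ Y ^ 2 : ℝ) : ℂ) * ψ Y * conj (H Y)) (fun Y =>
        ((ρ Y ^ 2 : ℝ) : ℂ) * qu Y * conj (Hu Y) + (((ρ Y ^ 2 : ℝ) : ℂ) * φ Y * conj (H'u Y)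
          + ((2 * ρ Y * ρ' Y : ℝ) : ℂ) * φ Y * conj (Hu Y))) :=
      ((dm.mul dψ).mul dH.conj).congr (fun _ _ => rfl) fun Y hY => by
        have u0 : (U Y : ℂ) ≠ 0 := by exact_mod_cast (hU.pos hY).ne'
        have hc : conj ((a : ℂ) ^ 2 * (U Y * φ Y) + M * ((Y * Real.exp (-Y) : ℝ) : ℂ))
            = (U Y : ℂ) * conj (H'u Y) := by
          have := congrArg conj (H'eq Y hY)
          rw [map_mul, Complex.conj_ofReal] at this
          exact this
        rw [hc]
        simp only [hqu, hHu, hψ, map_mul, map_inv₀, Complex.conj_ofReal]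
        field_simp
        ring
    have lim : Tendsto (fun Y => ((ρ Y ^ 2 : ℝ) : ℂ) * ψ Y * conj (H Y)) (𝓝[>] 0) (𝓝 0) := by
      refine tendsto_zero_of_bound (B := B ^ 2 * (K * (2 * b))) lH fun Y hY h1 => ?_
      rw [norm_mul, norm_mul, RCLike.norm_conj, Complex.norm_real, Real.norm_eq_abs]
      have := bψ Y hY h1
      have := B1 Y hY
      gcongr
    have key := integral_add_eq_neg dP (integrable_multiplier am B1 mψ mH) i1 (i2.add i3) lim
    rw [integral_add i2 i3] at key
    have s1 : ∫ Y, ((ρ Y ^ 2 : ℝ) : ℂ) * qu Y * conj (Hu Y) ∂halfLine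
        = (∫ Y, ((ρ Y ^ 2 : ℝ) : ℂ) * Hu Y * conj (Hu Y) ∂halfLine)
          - ∫ Y, ((ρ Y ^ 2 : ℝ) : ℂ) * Gu Y * conj (Hu Y) ∂halfLine := by
      rw [← integral_sub (integrable_multiplier am B1 mHu mHu) (integrable_multiplier am B1 mGu mHu)]
      exact integral_congr_ae (ae_halfLine fun Y hY => by simp only; rw [quHG Y hY]; ring)
    have s2 : (a : ℂ) ^ 2 * ∫ Y, ((ρ Y ^ 2 : ℝ) : ℂ) * φ Y * conj (H'u Y) ∂halfLine
        = (∫ Y, ((ρ Y ^ 2 : ℝ) : ℂ) * H'u Y * conj (H'u Y) ∂halfLine)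
          - M * ∫ Y, ((ρ Y ^ 2 : ℝ) : ℂ) * e Y * conj (H'u Y) ∂halfLine := by
      rw [← integral_const_mul, ← integral_const_mul,
        ← integral_sub (integrable_multiplier am B1 mH'u mH'u)
          ((integrable_multiplier am B1 m_e mH'u).const_mul _)]
      exact integral_congr_ae (ae_halfLine fun Y hY => by simp only [hH'u]; ring)
    have s3 : (a : ℂ) ^ 2 * ∫ Y, ((2 * ρ Y * ρ' Y : ℝ) : ℂ) * φ Y * conj (Hu Y) ∂halfLine
        = ∫ Y, ((2 * ρ Y * ρ' Y : ℝ) : ℂ) * (H'u Y - M * e Y) * conj (Hu Y) ∂halfLine := by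
      rw [← integral_const_mul]
      exact integral_congr_ae (ae_halfLine fun Y hY => by simp only [hH'u]; ring)
    rw [integral_weight_sq (hρ.memL2 mHu)] at s1
    rw [integral_weight_sq (hρ.memL2 mH'u)] at s2
    push_cast at s1 s2 ⊢
    push_cast at s3 key
    linear_combination (a : ℂ) ^ 2 * key - s2 - (a : ℂ) ^ 2 * s1 - s3
  set c := normL2 decay with hc
  have c0 : 0 ≤ c := normL2_nonneg _
  set M' := K * c * ‖M‖ with hM'
  have M'0 : 0 ≤ M' := by positivity
  -- unweighted estimate; the pairing of `G` with `H` costs `H / Y`, hence `H'`, by Hardy's inequality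
  set x := normL2 H'u with hx
  set y := normL2 Hu with hy
  have x0 : 0 ≤ x := normL2_nonneg _
  have y0 : 0 ≤ y := normL2_nonneg _
  set m := 2 * K ^ 2 * (a ^ 2 * N) + M' with hm
  have m0 : 0 ≤ m := by positivity
  have est0 : x ^ 2 + a ^ 2 * y ^ 2 ≤ m * x := by
    have id0 := congrArg norm (ident _ _ _ Weight.one)
    simp only [Complex.ofReal_one, one_mul, one_pow, mul_zero, Complex.ofReal_zero, zero_mul,
      integral_zero, sub_zero] at id0
    rw [Complex.norm_real, Real.norm_of_nonneg (by positivity)] at id0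
    have t1 : ‖∫ Y, Gu Y * conj (Hu Y) ∂halfLine‖ ≤ K * (N * normL2 (fun Y => (Y : ℂ)⁻¹ * H Y)) := by
      refine norm_integral_le_mul hU.K_pos.le mG mHY (ae_halfLine fun Y hY => ?_)
      rw [norm_mul (Gu Y), RCLike.norm_conj, ← nGu Y hY, hHuN Y hY, norm_ofReal_inv_mul hY.le]
      calc ‖Gu Y‖ * ((U Y)⁻¹ * ‖H Y‖) ≤ ‖Gu Y‖ * (K * ((1 + Y) / Y) * ‖H Y‖) := by
            gcongr; exact hU.inv_le hY
        _ = _ := by field_simp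
    have t2 : ‖∫ Y, e Y * conj (H'u Y) ∂halfLine‖ ≤ K * (c * x) := by
      refine norm_integral_le_mul hU.K_pos.le memL2_decay mH'u (ae_halfLine fun Y hY => ?_)
      rw [norm_mul (e Y), RCLike.norm_conj, ← mul_assoc]
      refine mul_le_mul_of_nonneg_right ?_ (norm_nonneg _)
      simpa using n_e Y hY 1 zero_le_one (by linarith)
    have t3 : ‖∫ Y, Gu Y * conj (Hu Y) ∂halfLine‖ ≤ 2 * K ^ 2 * N * x := by
      refine t1.trans ?_
      calc K * (N * normL2 (fun Y => (Y : ℂ)⁻¹ * H Y)) ≤ K * (N * (2 * (K * x))) := by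
            have := nHY.trans (mul_le_mul_of_nonneg_left nH' (by norm_num))
            gcongr
        _ = _ := by ring
    calc x ^ 2 + a ^ 2 * y ^ 2 = _ := id0
      _ ≤ a ^ 2 * ‖∫ Y, Gu Y * conj (Hu Y) ∂halfLine‖ + ‖M‖ * ‖∫ Y, e Y * conj (H'u Y) ∂halfLine‖ := by
          refine (norm_add_le _ _).trans (le_of_eq ?_)
          rw [norm_mul, norm_mul, norm_pow, Complex.norm_real, Real.norm_of_nonneg ha.le]
      _ ≤ a ^ 2 * (2 * K ^ 2 * N * x) + ‖M‖ * (K * (c * x)) := by gcongr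
      _ = _ := by rw [hm, hM']; ring
  have Mm : M' ≤ m := by
    have : 0 ≤ 2 * K ^ 2 * (a ^ 2 * N) := by positivity
    rw [hm]; linarith
  -- weighted estimate; the unweighted one bounds the term with the derivative of the weight
  have est1 : ∀ (ρ ρ' : ℝ → ℝ) (B : ℝ), Weight ρ ρ' B → (∀ Y, 0 < Y → ρ Y ≤ (1 + Y) ^ 1) →
      (∀ Y, 0 < Y → ρ' Y ≤ (1 : ℕ) * (1 + Y) ^ (1 - 1)) →
      normL2 (fun Y => (ρ Y : ℂ) * Hu Y) ≤ N + 5 * (m / a ^ 2) := by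
    intro ρ ρ' B hρ hle hle'
    have mx := hρ.memL2 mH'u
    have my := hρ.memL2 mHu
    have id1 := congrArg norm (ident _ _ _ hρ)
    rw [Complex.norm_real, Real.norm_of_nonneg (by positivity)] at id1
    have t1 : ‖∫ Y, ((ρ Y ^ 2 : ℝ) : ℂ) * Gu Y * conj (Hu Y) ∂halfLine‖
        ≤ 1 * (N * normL2 (fun Y => (ρ Y : ℂ) * Hu Y)) := by
      refine norm_integral_le_mul zero_le_one mG my (ae_halfLine fun Y hY => ?_)
      have r0 := (hρ.pos Y hY).le
      rw [norm_ofReal_mul_mul_conj (sq_nonneg _), ← nGu Y hY, norm_ofReal_mul r0]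
      have := hle Y hY
      rw [pow_one] at this
      calc ρ Y ^ 2 * ‖Gu Y‖ * ‖Hu Y‖ = ρ Y * ‖Gu Y‖ * (ρ Y * ‖Hu Y‖) := by ring
        _ ≤ (1 + Y) * ‖Gu Y‖ * (ρ Y * ‖Hu Y‖) := by gcongr
        _ = _ := by ring
    have t2 : ‖∫ Y, ((ρ Y ^ 2 : ℝ) : ℂ) * e Y * conj (H'u Y) ∂halfLine‖
        ≤ K * (c * normL2 (fun Y => (ρ Y : ℂ) * H'u Y)) := by
      refine norm_integral_le_mul hU.K_pos.le memL2_decay mx (ae_halfLine fun Y hY => ?_)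
      have r0 := (hρ.pos Y hY).le
      rw [norm_ofReal_mul_mul_conj (sq_nonneg _), norm_ofReal_mul r0]
      have := n_e Y hY (ρ Y) r0 (by simpa using hle Y hY)
      calc ρ Y ^ 2 * ‖e Y‖ * ‖H'u Y‖ = ρ Y * ‖e Y‖ * (ρ Y * ‖H'u Y‖) := by ring
        _ ≤ K * ‖decay Y‖ * (ρ Y * ‖H'u Y‖) := by gcongr
        _ = _ := by ring
    have md : MemL2 (fun Y => H'u Y - M * e Y) := mH'u.sub (m_e.const_mul _)
    have nd : normL2 (fun Y => H'u Y - M * e Y) ≤ x + M' := by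
      refine ((memL2_and_normL2_le_add zero_le_one (by positivity : 0 ≤ K * ‖M‖) md.1 mH'u
        memL2_decay (ae_halfLine fun Y hY => ?_)).2).trans (le_of_eq ?_)
      · refine (norm_sub_le _ _).trans ?_
        rw [one_mul, norm_mul M]
        have := n_e Y hY 1 zero_le_one (by linarith)
        rw [one_mul] at this
        have : ‖M‖ * ‖e Y‖ ≤ ‖M‖ * (K * ‖decay Y‖) := by gcongr
        linarith
      · rw [hM']; ring
    have t3 : ‖∫ Y, ((2 * ρ Y * ρ' Y : ℝ) : ℂ) * (H'u Y - M * e Y) * conj (Hu Y) ∂halfLine‖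
        ≤ 2 * (normL2 (fun Y => H'u Y - M * e Y) * normL2 (fun Y => (ρ Y : ℂ) * Hu Y)) := by
      refine norm_integral_le_mul (by norm_num) md my (ae_halfLine fun Y hY => ?_)
      have r0 := (hρ.pos Y hY).le
      have r1 := hρ.nonneg Y hY
      have r2 : ρ' Y ≤ 1 := by simpa using hle' Y hY
      rw [norm_ofReal_mul_mul_conj (by positivity), norm_ofReal_mul r0]
      calc 2 * ρ Y * ρ' Y * ‖H'u Y - M * e Y‖ * ‖Hu Y‖
          ≤ 2 * ρ Y * 1 * ‖H'u Y - M * e Y‖ * ‖Hu Y‖ := by gcongr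
        _ = _ := by ring
    set x₁ := normL2 (fun Y => (ρ Y : ℂ) * H'u Y)
    set y₁ := normL2 (fun Y => (ρ Y : ℂ) * Hu Y)
    have y₁0 : 0 ≤ y₁ := normL2_nonneg _
    refine (rayleigh_arith (x₁ := x₁) ha ha1 N0 m0 Mm M'0 y₁0 est0 ?_).2
    calc x₁ ^ 2 + a ^ 2 * y₁ ^ 2 = _ := id1
      _ ≤ a ^ 2 * (1 * (N * y₁)) + (‖M‖ * (K * (c * x₁))
          + 2 * (normL2 (fun Y => H'u Y - M * e Y) * y₁)) := by
          refine (norm_add_le _ _).trans (add_le_add ?_ ((norm_sub_le _ _).trans (add_le_add ?_ t3)))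
          · rw [norm_mul, norm_pow, Complex.norm_real, Real.norm_of_nonneg ha.le]; gcongr
          · rw [norm_mul]; gcongr
      _ ≤ a ^ 2 * (1 * (N * y₁)) + (‖M‖ * (K * (c * x₁)) + 2 * ((x + M') * y₁)) := by gcongr
      _ = _ := by rw [hM']; ring
  have xm : x ≤ m := le_of_sq_le_mul m0 (by
    have : 0 ≤ a ^ 2 * y ^ 2 := by positivity
    linarith)
  obtain ⟨mw, nw⟩ := weighted_of_weight (k := 1) (by norm_num) mHu
    (by positivity : 0 ≤ N + 5 * (m / a ^ 2)) est1
  have ma : m / a ^ 2 = 2 * K ^ 2 * N + K * c * (‖M‖ / a ^ 2) := by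
    rw [hm, hM']; field_simp
  have d0 : 0 ≤ c * (‖M‖ / a ^ 2) := by positivity
  have KK : K ≤ K ^ 2 := le_self_pow₀ hK (by norm_num)
  have K1 : (1 : ℝ) ≤ K ^ 2 := one_le_pow₀ hK
  have awq : AEStronglyMeasurable (weighted 1 qu) halfLine := by
    unfold weighted
    exact (Continuous.aestronglyMeasurable (by fun_prop)).mul mqu.1
  obtain ⟨mwq, nwq⟩ := memL2_and_normL2_le_add zero_le_one zero_le_one awq mw mG
    (ae_halfLine fun Y hY => by
      rw [one_mul, one_mul]
      simp only [weighted]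
      rw [quHG Y hY, mul_sub]
      exact norm_sub_le _ _)
  refine ⟨mwq, ?_, ?_⟩
  · refine nwq.trans ?_
    have h1 : K * (c * (‖M‖ / a ^ 2)) ≤ K ^ 2 * (c * (‖M‖ / a ^ 2)) := by gcongr
    have h2 : 1 * N ≤ K ^ 2 * N := by gcongr
    rw [one_mul, one_mul]
    rw [ma] at nw
    have : 0 ≤ K ^ 2 * (c * (‖M‖ / a ^ 2)) := by positivity
    linarith
  · have nφ : a ^ 2 * normL2 φ ≤ 2 * m := by
      have e1 : a ^ 2 * normL2 φ = normL2 (fun Y => (a : ℂ) ^ 2 * φ Y) := by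
        rw [normL2_const_mul, norm_pow, Complex.norm_real, Real.norm_of_nonneg ha.le]
      rw [e1]
      refine ((memL2_and_normL2_le_add zero_le_one (by positivity : 0 ≤ K * ‖M‖)
        (S.hφ.m.1.const_mul _) mH'u memL2_decay (ae_halfLine fun Y hY => ?_)).2).trans ?_
      · have e2 : (a : ℂ) ^ 2 * φ Y = H'u Y - M * e Y := by simp only [hH'u]; ring
        rw [e2]
        refine (norm_sub_le _ _).trans ?_
        rw [one_mul, norm_mul M]
        have := n_e Y hY 1 zero_le_one (by linarith)
        rw [one_mul] at this
        have : ‖M‖ * ‖e Y‖ ≤ ‖M‖ * (K * ‖decay Y‖) := by gcongr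
        linarith
      · have : K * ‖M‖ * c = M' := by rw [hM']; ring
        rw [this, one_mul]; linarith
    have h1 : a * normL2 φ ≤ 2 * (m / a ^ 2) := by
      rw [mul_div_assoc', le_div_iff₀ (by positivity)]
      calc a * normL2 φ * a ^ 2 = a * (a ^ 2 * normL2 φ) := by ring
        _ ≤ 1 * (2 * m) := by have := normL2_nonneg φ; gcongr
        _ = _ := by ring
    refine h1.trans ?_
    rw [ma]
    have h2 : K * (c * (‖M‖ / a ^ 2)) ≤ K ^ 2 * (c * (‖M‖ / a ^ 2)) := by gcongr
    have : 0 ≤ K ^ 2 * (c * (‖M‖ / a ^ 2)) := by positivity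
    have : 0 ≤ K ^ 2 * N := by positivity
    linarith

end OSSystem

/-! ### Weighted inequalities for the source -/

/-- The square integrable weight `(1 + Y)⁻¹`. -/
noncomputable def invWeight (Y : ℝ) : ℂ := (((1 + Y)⁻¹ : ℝ) : ℂ)

theorem memL2_invWeight : MemL2 invWeight := by
  have hc : ContinuousOn (fun Y : ℝ => (1 + Y)⁻¹) (Ioi 0) := by
    refine ContinuousOn.inv₀ (by fun_prop) fun Y hY => ?_
    have : 0 < Y := hY
    positivity
  refine (memLp_two_iff_integrable_sq_norm
    (continuousOn_aesm (Complex.continuous_ofReal.comp_continuousOn hc))).2 ?_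
  have h : IntegrableOn (fun Y : ℝ => 2 * (1 + Y ^ 2)⁻¹) (Ioi 0) :=
    (integrable_inv_one_add_sq.const_mul 2).integrableOn
  refine h.mono' (((continuousOn_aesm
    (Complex.continuous_ofReal.comp_continuousOn hc)).norm).pow 2) (ae_halfLine fun Y hY => ?_)
  have hp : 0 ≤ (1 + Y)⁻¹ := by positivity
  simp only [Function.comp_apply]
  rw [Complex.norm_real, Real.norm_of_nonneg (sq_nonneg _), Real.norm_of_nonneg hp, inv_pow, ← div_eq_mul_inv, inv_eq_one_div, div_le_div_iff₀ (by positivity) (by positivity)]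
  nlinarith

theorem norm_weighted {k : ℕ} {g : ℝ → ℂ} {Y : ℝ} (hY : 0 < Y) :
    ‖weighted k g Y‖ = (1 + Y) ^ k * ‖g Y‖ := by
  unfold weighted
  rw [norm_mul, norm_pow, Complex.norm_real, Real.norm_of_nonneg (by linarith)]

theorem aesm_weighted {k : ℕ} {g : ℝ → ℂ} (h : AEStronglyMeasurable g halfLine) :
    AEStronglyMeasurable (weighted k g) halfLine := by
  unfold weighted
  exact (Continuous.aestronglyMeasurable (by fun_prop)).mul h

theorem norm_le_norm_weighted {k : ℕ} {g : ℝ → ℂ} {Y : ℝ} (hY : 0 < Y) :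
    ‖g Y‖ ≤ 1 * ‖weighted k g Y‖ := by
  rw [norm_weighted hY, one_mul]
  exact le_mul_of_one_le_left (norm_nonneg _) (one_le_pow₀ (by linarith))

theorem MemL2.of_weighted {k : ℕ} {g : ℝ → ℂ} (hg : AEStronglyMeasurable g halfLine)
    (h : MemL2 (weighted k g)) : MemL2 g :=
  h.of_le (C := 1) hg fun _ hY => norm_le_norm_weighted hY

theorem normL2_le_weighted {k : ℕ} {g : ℝ → ℂ} (h : MemL2 (weighted k g)) :
    normL2 g ≤ normL2 (weighted k g) := by
  simpa using normL2_le_of_le zero_le_one h fun Y hY => norm_le_norm_weighted hY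

theorem memL2_weighted_le {j k : ℕ} (hjk : j ≤ k) {g : ℝ → ℂ} (hg : AEStronglyMeasurable g halfLine)
    (h : MemL2 (weighted k g)) :
    MemL2 (weighted j g) ∧ normL2 (weighted j g) ≤ normL2 (weighted k g) := by
  have key : ∀ Y, 0 < Y → ‖weighted j g Y‖ ≤ 1 * ‖weighted k g Y‖ := fun Y hY => by
    rw [norm_weighted hY, norm_weighted hY, one_mul]
    exact mul_le_mul_of_nonneg_right (pow_le_pow_right₀ (by linarith) hjk) (norm_nonneg _)
  exact ⟨h.of_le (aesm_weighted hg) key, by simpa using normL2_le_of_le zero_le_one h key⟩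

section tail

variable {g : ℝ → ℂ} (hg : AEStronglyMeasurable g halfLine) (h : MemL2 (weighted 2 g))
include hg h

theorem integrable_of_weighted : Integrable g halfLine ∧
    ‖∫ Y, g Y ∂halfLine‖ ≤ normL2 invWeight * normL2 (weighted 2 g) := by
  have key : ∀ Y, 0 < Y → ‖g Y‖ ≤ 1 * (‖invWeight Y‖ * ‖weighted 2 g Y‖) := fun Y hY => by
    have hp : 0 < 1 + Y := by linarith
    rw [norm_weighted hY, invWeight, Complex.norm_real, Real.norm_of_nonneg (by positivity)]
    calc ‖g Y‖ ≤ (1 + Y) * ‖g Y‖ := le_mul_of_one_le_left (norm_nonneg _) (by linarith)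
      _ = _ := by field_simp
  exact ⟨integrable_of_le_mul memL2_invWeight h hg (ae_halfLine key), by
    simpa using norm_integral_le_mul zero_le_one memL2_invWeight h (ae_halfLine key)⟩

omit hg in
theorem norm_tail_le {Y : ℝ} (hY : 0 < Y) :
    ‖∫ Z in Ioi Y, g Z‖ ≤ normL2 invWeight * normL2 (weighted 2 g) * ‖invWeight Y‖ := by
  have e : ∫ Z in Ioi Y, g Z = ∫ Z, (Ioi Y).indicator g Z ∂halfLine := by
    rw [integral_indicator measurableSet_Ioi, Measure.restrict_restrict measurableSet_Ioi,
      inter_eq_left.2 (Ioi_subset_Ioi hY.le)]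
  rw [e]
  refine (norm_integral_le_mul (C := ‖invWeight Y‖) (norm_nonneg _) memL2_invWeight h
    (ae_halfLine fun Z hZ => ?_)).trans (le_of_eq (by ring))
  have hZ1 : 0 < 1 + Z := by linarith
  by_cases hZY : Z ∈ Ioi Y
  · have hYZ : Y < Z := hZY
    rw [indicator_of_mem hZY, norm_weighted hZ, invWeight, invWeight, Complex.norm_real,
      Complex.norm_real, Real.norm_of_nonneg (by positivity), Real.norm_of_nonneg (by positivity)]
    have : 1 ≤ (1 + Y)⁻¹ * (1 + Z) := by
      rw [inv_mul_eq_div, one_le_div (by linarith)]; linarith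
    calc ‖g Z‖ ≤ ((1 + Y)⁻¹ * (1 + Z)) * ‖g Z‖ := le_mul_of_one_le_left (norm_nonneg _) this
      _ = _ := by field_simp
  · rw [indicator_of_notMem hZY, norm_zero]; positivity

theorem locAC_tail : LocAC (fun Y => ∫ Z in Ioi Y, g Z) (fun Y => - g Y) := by
  have hi : IntegrableOn g (Ioi 0) := (integrable_of_weighted hg h).1
  intro x y hx hy
  have hx' := hi.mono_set (Ioi_subset_Ioi hx.le)
  have h1 : IntervalIntegrable g volume x y :=
    (intervalIntegrable_iff_integrableOn_Ioc_of_le hy).2 (hx'.mono_set Ioc_subset_Ioi_self)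
  refine ⟨h1.neg, ?_⟩
  rw [intervalIntegral.integral_neg, ← intervalIntegral.integral_Ioi_sub_Ioi hx' hy]
  ring

theorem tendsto_tail :
    Tendsto (fun Y => ∫ Z in Ioi Y, g Z) (𝓝[>] 0) (𝓝 (∫ Y, g Y ∂halfLine)) := by
  have hi : IntegrableOn g (Ioi 0) := (integrable_of_weighted hg h).1
  have hc : ContinuousOn (fun Y => ∫ Z in (0:ℝ)..Y, g Z) (Icc 0 1) := by
    have := intervalIntegral.continuousOn_primitive_interval (a := (0:ℝ)) (b := 1) (f := g)
      (μ := volume) (by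
        rw [uIcc_of_le zero_le_one, integrableOn_Icc_iff_integrableOn_Ioc]
        exact hi.mono_set Ioc_subset_Ioi_self)
    rwa [uIcc_of_le zero_le_one] at this
  have h0 : Tendsto (fun Y => ∫ Z in (0:ℝ)..Y, g Z) (𝓝[>] 0) (𝓝 0) := by
    have := (hc 0 (by simp)).mono_left
      (nhdsWithin_mono _ (Ioc_subset_Icc_self : Ioc (0:ℝ) 1 ⊆ Icc 0 1))
    rw [nhdsWithin_Ioc_eq_nhdsGT zero_lt_one] at this
    simpa using this
  have h1 := h0.const_sub (∫ Y, g Y ∂halfLine)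
  rw [sub_zero] at h1
  refine h1.congr' ?_
  filter_upwards [self_mem_nhdsWithin] with Y hY
  have hY0 : (0 : ℝ) ≤ Y := le_of_lt hY
  rw [← intervalIntegral.integral_Ioi_sub_Ioi hi hY0]
  ring

end tail

/-- Hardy's inequality at infinity, in weighted form: `(1 + Y) u` is controlled by `(1 + Y)² u'`. -/
theorem hardy_infinity {u v : ℝ → ℂ} (h : LocAC u v) (hu : MemL2 u)
    (av : AEStronglyMeasurable v halfLine) (hv : MemL2 (weighted 2 v))
    (h0 : Tendsto u (𝓝[>] 0) (𝓝 0)) :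
    MemL2 (weighted 1 u) ∧ normL2 (weighted 1 u) ≤ 2 * normL2 (weighted 2 v) := by
  have mv : MemL2 v := hv.of_weighted av
  have V0 := normL2_nonneg (weighted 2 v)
  have step : ∀ η : ℝ, 0 < η → η ≤ 1 / 2 →
      MemL2 (fun Y => (((1 + Y) / (1 + η * Y) ^ 2 : ℝ) : ℂ) * u Y) ∧
      normL2 (fun Y => (((1 + Y) / (1 + η * Y) ^ 2 : ℝ) : ℂ) * u Y) ≤ 2 * normL2 (weighted 2 v) := by
    intro η h1 h2
    set r : ℝ → ℝ := fun Y => (1 + Y) / (1 + η * Y) ^ 2 with hr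
    set p : ℝ → ℝ := fun Y => (1 + Y) / (1 + η * Y) with hp
    have d0 : ∀ Y, 0 < Y → 0 < 1 + η * Y := fun Y hY => by positivity
    have cr : ContinuousOn r (Ioi 0) :=
      ContinuousOn.div (by fun_prop) (by fun_prop) fun Y hY => (pow_pos (d0 Y hY) 2).ne'
    have ar : AEStronglyMeasurable (fun Y => (r Y : ℂ)) halfLine :=
      continuousOn_aesm (Complex.continuous_ofReal.comp_continuousOn cr)
    have pη : ∀ Y, 0 < Y → p Y ≤ η⁻¹ := fun Y hY => by
      simp only [hp]
      rw [div_le_iff₀ (d0 Y hY)]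
      have : η⁻¹ * (1 + η * Y) = η⁻¹ + Y := by field_simp
      have : 1 ≤ η⁻¹ := (one_le_inv₀ h1).2 (by linarith)
      linarith
    have p0 : ∀ Y, 0 < Y → 0 < p Y := fun Y hY => by
      have := d0 Y hY
      simp only [hp]; positivity
    have r0 : ∀ Y, 0 < Y → 0 < r Y := fun Y hY => by
      have := d0 Y hY
      simp only [hr]; positivity
    have rp : ∀ Y, 0 < Y → r Y ≤ p Y := fun Y hY => by
      simp only [hr, hp]
      have : 1 ≤ 1 + η * Y := by have := mul_pos h1 hY; linarith
      gcongr
      exact le_self_pow₀ this (by norm_num)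
    have rη : ∀ Y, 0 < Y → r Y ≤ η⁻¹ := fun Y hY => (rp Y hY).trans (pη Y hY)
    have mr : MemL2 (fun Y => (r Y : ℂ) * u Y) := hu.of_le (C := η⁻¹) (ar.mul hu.1) fun Y hY => by
      rw [norm_ofReal_mul (r0 Y hY).le]
      exact mul_le_mul_of_nonneg_right (rη Y hY) (norm_nonneg _)
    refine ⟨mr, ?_⟩
    have dp : ∀ Y, 0 < Y → HasDerivAt (fun Y => p Y ^ 3) (3 * (1 - η) * r Y ^ 2) Y := fun Y hY => by
      have h3 := d0 Y hY
      have e : HasDerivAt p ((1 - η) / (1 + η * Y) ^ 2) Y :=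
        (((hasDerivAt_id Y).const_add 1).div (((hasDerivAt_id Y).const_mul η).const_add 1)
          (by simpa using h3.ne')).congr_deriv (by simp only [id]; congr 1; ring)
      refine (e.pow 3).congr_deriv ?_
      simp only [hr, hp, div_pow]
      field_simp
      norm_num
      field_simp
    have dm := LocAC.ofReal dp (continuousOn_const.mul (cr.pow 2))
    have key := integral_by_parts (B := η⁻¹ ^ 3) (B' := 3 * (1 - η) * η⁻¹ ^ 2) dm
      (continuousOn_aesm (Complex.continuous_ofReal.comp_continuousOn
        (continuousOn_const.mul (cr.pow 2))))
      (fun Y hY => by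
        rw [abs_of_nonneg (pow_nonneg (p0 Y hY).le 3)]
        exact pow_le_pow_left₀ (p0 Y hY).le (pη Y hY) 3)
      (fun Y hY => by
        have : 0 ≤ 3 * (1 - η) := by linarith
        rw [abs_of_nonneg (by positivity)]
        exact mul_le_mul_of_nonneg_left (pow_le_pow_left₀ (r0 Y hY).le (rη Y hY) 2) this)
      h h hu mv hu mv (by
        have hb : Tendsto (fun Y => (((p Y) ^ 3 : ℝ) : ℂ) * u Y * conj (u Y)) (𝓝[>] 0) (𝓝 0) := by
          have hc := h0.mul ((Complex.continuous_conj.tendsto 0).comp h0)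
          simp only [map_zero, mul_zero, Function.comp_def] at hc
          refine tendsto_zero_of_bound (B := η⁻¹ ^ 3) hc fun Y hY _ => ?_
          have := pow_nonneg (p0 Y hY).le 3
          rw [norm_ofReal_mul_mul_conj this, norm_mul, RCLike.norm_conj, ← mul_assoc]
          have := pow_le_pow_left₀ (p0 Y hY).le (pη Y hY) 3
          gcongr
        exact hb)
    have e1 : ∫ Y, ((3 * (1 - η) * r Y ^ 2 : ℝ) : ℂ) * u Y * conj (u Y) ∂halfLine
        = ((3 * (1 - η) * normL2 (fun Y => (r Y : ℂ) * u Y) ^ 2 : ℝ) : ℂ) := by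
      rw [Complex.ofReal_mul, ← integral_weight_sq mr, ← integral_const_mul]
      exact integral_congr_ae (ae_of_all _ fun Y => by simp only; push_cast; ring)
    have bd : ∀ {x y : ℝ → ℂ}, (∀ Y, ‖x Y‖ * ‖y Y‖ = ‖u Y‖ * ‖v Y‖) →
        ‖∫ Y, ((p Y ^ 3 : ℝ) : ℂ) * x Y * conj (y Y) ∂halfLine‖
          ≤ 1 * (normL2 (weighted 2 v) * normL2 (fun Y => (r Y : ℂ) * u Y)) := by
      intro x y hxy
      refine norm_integral_le_mul zero_le_one hv mr (ae_halfLine fun Y hY => ?_)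
      have h3 := d0 Y hY
      rw [norm_ofReal_mul_mul_conj (pow_nonneg (p0 Y hY).le 3), mul_assoc, hxy, norm_weighted hY,
        norm_ofReal_mul (r0 Y hY).le]
      have h4 : p Y ^ 3 ≤ (1 + Y) ^ 2 * r Y := by
        simp only [hp, hr]
        rw [div_pow, mul_div_assoc', div_le_div_iff₀ (by positivity) (by positivity)]
        have : (1 + η * Y) ^ 2 ≤ (1 + η * Y) ^ 3 :=
          pow_le_pow_right₀ (by have := mul_pos h1 hY; linarith) (by norm_num)
        calc (1 + Y) ^ 3 * (1 + η * Y) ^ 2 ≤ (1 + Y) ^ 3 * (1 + η * Y) ^ 3 := by gcongr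
          _ = _ := by ring
      calc p Y ^ 3 * (‖u Y‖ * ‖v Y‖) ≤ (1 + Y) ^ 2 * r Y * (‖u Y‖ * ‖v Y‖) := by gcongr
        _ = _ := by ring
    have b1 := bd (x := v) (y := u) fun _ => mul_comm _ _
    have b2 := bd (x := u) (y := v) fun _ => rfl
    rw [e1] at key
    have n : 3 * (1 - η) * normL2 (fun Y => (r Y : ℂ) * u Y) ^ 2
        = ‖(∫ Y, ((p Y ^ 3 : ℝ) : ℂ) * v Y * conj (u Y) ∂halfLine)
          + ∫ Y, ((p Y ^ 3 : ℝ) : ℂ) * u Y * conj (v Y) ∂halfLine‖ := by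
      rw [key, ← norm_neg, neg_add_rev, neg_sub]
      have : 0 ≤ 3 * (1 - η) * normL2 (fun Y => (r Y : ℂ) * u Y) ^ 2 :=
        mul_nonneg (by linarith) (sq_nonneg _)
      rw [show ∀ x y : ℂ, -x + (y - -x) = y by intros; ring, Complex.norm_real,
        Real.norm_of_nonneg this]
    have n2 := n.le.trans (norm_add_le _ _)
    refine le_of_sq_le_mul (by positivity) ?_
    nlinarith [sq_nonneg (normL2 (fun Y => (r Y : ℂ) * u Y))]
  refine memL2_and_normL2_le_of_tendsto (F := fun n : ℕ => fun Y =>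
    (((1 + Y) / (1 + (1 / ((n : ℝ) + 2)) * Y) ^ 2 : ℝ) : ℂ) * u Y) (by positivity)
    (fun n => (step _ (by positivity) ?_).1) (fun n => (step _ (by positivity) ?_).2)
    (aesm_weighted hu.1) fun Y hY => ?_
  iterate 2
    exact one_div_le_one_div_of_le (by norm_num) (by have : (0:ℝ) ≤ n := n.cast_nonneg; linarith)
  have h1 : Tendsto (fun n : ℕ => (1 : ℝ) / ((n : ℝ) + 2)) atTop (𝓝 0) := by
    have := (tendsto_one_div_add_atTop_nhds_zero_nat (𝕜 := ℝ)).comp (tendsto_add_atTop_nat 1)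
    refine this.congr fun n => ?_
    simp only [Function.comp_apply]; push_cast; ring
  have h2 : Tendsto (fun n : ℕ => (1 + Y) / (1 + (1 / ((n : ℝ) + 2)) * Y) ^ 2) atTop
      (𝓝 (1 + Y)) := by
    have := (tendsto_const_nhds (x := 1 + Y)).div (((h1.mul_const Y).const_add 1).pow 2)
      (by norm_num)
    simpa [Pi.div_def] using this
  have h3 := ((Complex.continuous_ofReal.tendsto _).comp h2).mul_const (u Y)
  simpa [Function.comp_def, weighted] using h3

/-- A primitive that vanishes at the wall and at infinity can be divided by the profile. -/
theorem ProfileBounds.norm_weighted_inv_mul_le {U U₁ U₂ : ℝ → ℝ} {K : ℝ}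
    (hU : ProfileBounds U U₁ U₂ K) {u : ℝ → ℂ} {Y : ℝ} (hY : 0 < Y) :
    ‖weighted 1 (fun Y => (U Y : ℂ)⁻¹ * u Y) Y‖
      ≤ K * ‖(Y : ℂ)⁻¹ * u Y‖ + 2 * K * ‖weighted 1 u Y‖ := by
  rw [norm_weighted hY, norm_weighted hY, norm_ofReal_inv_mul (hU.pos hY).le,
    norm_ofReal_inv_mul hY.le, pow_one]
  calc (1 + Y) * ((U Y)⁻¹ * ‖u Y‖) ≤ (1 + Y) * (K * ((1 + Y) / Y) * ‖u Y‖) := by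
        gcongr; exact hU.inv_le hY
    _ = K * (Y⁻¹ * ‖u Y‖) + K * ((2 + Y) * ‖u Y‖) := by field_simp; ring
    _ ≤ K * (Y⁻¹ * ‖u Y‖) + K * ((2 * (1 + Y)) * ‖u Y‖) := by
        have := hU.K_pos
        gcongr; linarith
    _ = _ := by ring

theorem ProfileBounds.memL2_weighted_inv_mul {U U₁ U₂ : ℝ → ℝ} {K : ℝ}
    (hU : ProfileBounds U U₁ U₂ K) {u v : ℝ → ℂ} (h : LocAC u v) (hu : MemL2 u)
    (av : AEStronglyMeasurable v halfLine) (hv : MemL2 (weighted 2 v))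
    (h0 : Tendsto u (𝓝[>] 0) (𝓝 0)) :
    MemL2 (weighted 1 fun Y => (U Y : ℂ)⁻¹ * u Y) ∧
    normL2 (weighted 1 fun Y => (U Y : ℂ)⁻¹ * u Y) ≤ 6 * K * normL2 (weighted 2 v) := by
  obtain ⟨m1, n1⟩ := hardy h hu (hv.of_weighted av) h0
  obtain ⟨m2, n2⟩ := hardy_infinity h hu av hv h0
  have n3 := normL2_le_weighted hv
  have K0 := hU.K_pos
  obtain ⟨m, n⟩ := memL2_and_normL2_le_add K0.le (by positivity : 0 ≤ 2 * K)
    (aesm_weighted (hU.locAC_inv.aestronglyMeasurable.mul hu.1)) m1 m2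
    (ae_halfLine fun Y hY => hU.norm_weighted_inv_mul_le hY)
  refine ⟨m, n.trans ?_⟩
  have := mul_le_mul_of_nonneg_left (n1.trans (mul_le_mul_of_nonneg_left n3 zero_le_two)) K0.le
  have := mul_le_mul_of_nonneg_left n2 (by positivity : 0 ≤ 2 * K)
  linarith

/-! ### The low frequency estimate -/

theorem locAC_exp : LocAC (fun Y => (((1 + Y) * Real.exp (-Y) : ℝ) : ℂ))
    (fun Y => ((-(Y * Real.exp (-Y)) : ℝ) : ℂ)) := by
  refine LocAC.ofReal (fun Y _ => ?_) (by fun_prop)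
  have := ((hasDerivAt_id Y).const_add 1).mul ((Real.hasDerivAt_exp (-Y)).comp Y
    (hasDerivAt_neg Y))
  refine this.congr_deriv ?_
  simp only [id, Function.comp_apply]
  ring

/-- The tail of the source, corrected by an exponential so as to vanish at the wall. -/
theorem corrected_tail {g : ℝ → ℂ} (hg : AEStronglyMeasurable g halfLine)
    (h : MemL2 (weighted 2 g)) {T : ℝ → ℂ} (hT : T = fun Y => (∫ Z in Ioi Y, g Z)
      - (∫ Z, g Z ∂halfLine) * (((1 + Y) * Real.exp (-Y) : ℝ) : ℂ))
    {T' : ℝ → ℂ} (hT' : T' = fun Y => - g Y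
      + (∫ Z, g Z ∂halfLine) * ((Y * Real.exp (-Y) : ℝ) : ℂ)) :
    LocAC T T' ∧ MemL2 T ∧ Tendsto T (𝓝[>] 0) (𝓝 0) ∧ AEStronglyMeasurable T' halfLine ∧
      MemL2 (weighted 2 T') ∧
      normL2 (weighted 2 T') ≤ normL2 (weighted 2 g) + ‖∫ Z, g Z ∂halfLine‖ * normL2 decay := by
  set M := ∫ Z, g Z ∂halfLine with hM
  have d : LocAC T T' := ((locAC_tail hg h).sub (locAC_exp.const_mul M)).congr
    (fun Y _ => by rw [hT]) fun Y _ => by rw [hT']; push_cast; ring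
  have aT' : AEStronglyMeasurable T' halfLine := by
    rw [hT']
    exact hg.neg.add (Continuous.aestronglyMeasurable (by fun_prop))
  refine ⟨d, ?_, ?_, aT', ?_⟩
  · refine (memL2_and_normL2_le_add (a := normL2 invWeight * normL2 (weighted 2 g))
      (mul_nonneg (normL2_nonneg _) (normL2_nonneg _)) (norm_nonneg M) d.aestronglyMeasurable
      memL2_invWeight memL2_decay (ae_halfLine fun Y hY => ?_)).1
    rw [hT]
    refine (norm_sub_le _ _).trans (add_le_add (norm_tail_le h hY) ?_)
    rw [norm_mul]
    refine mul_le_mul_of_nonneg_left (norm_le_decay hY (by positivity) ?_) (norm_nonneg _)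
    exact le_self_pow₀ (by linarith) (by norm_num)
  · have h1 : Tendsto (fun Y : ℝ => (((1 + Y) * Real.exp (-Y) : ℝ) : ℂ)) (𝓝[>] 0) (𝓝 1) := by
      have : Continuous (fun Y : ℝ => (((1 + Y) * Real.exp (-Y) : ℝ) : ℂ)) := by fun_prop
      have := (this.tendsto 0).mono_left (nhdsWithin_le_nhds (s := Ioi 0))
      simpa using this
    have h2 := (tendsto_tail hg h).sub (h1.const_mul M)
    rw [hT]
    simpa [hM] using h2
  · have := memL2_and_normL2_le_add (f := weighted 2 T') zero_le_one (norm_nonneg M)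
      (aesm_weighted aT') h memL2_decay (ae_halfLine fun Y hY => ?_)
    · simpa using this
    · have h3 : weighted 2 T' Y = -weighted 2 g Y
          + M * (((1 + Y) ^ 2 * Y * Real.exp (-Y) : ℝ) : ℂ) := by
        rw [hT']; simp only [weighted]; push_cast; ring
      rw [h3]
      refine (norm_add_le _ _).trans (add_le_add (by rw [norm_neg, one_mul]) ?_)
      rw [norm_mul]
      refine mul_le_mul_of_nonneg_left (norm_le_decay hY (by positivity) ?_) (norm_nonneg _)
      calc (1 + Y) ^ 2 * Y ≤ (1 + Y) ^ 2 * (1 + Y) := by gcongr; linarith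
        _ = _ := by ring

namespace OSSystem

variable {U U₁ U₂ : ℝ → ℝ} {K t ε a s : ℝ} {f φ φ₁ w w₁ h : ℝ → ℂ}

/-- The viscous flux `ε w'`, divided by the profile. It vanishes at the wall; near the wall it is
controlled through the cut off diffusion term, away from it through `w'` itself. -/
theorem norm_flux_le (S : OSSystem U U₂ t (s ^ 6) a f φ φ₁ w w₁ h)
    (hU : ProfileBounds U U₁ U₂ K) (ht0 : 0 ≤ t) (ht1 : t ≤ 1) (ha : 0 < a) (ha1 : a ≤ 1)
    (hs : 0 < s) (hs1 : s ≤ 1) (hs2 : 64 * K * s ^ 2 ≤ 1) (hf : MemL2 (weighted 1 f)) :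
    MemL2 (weighted 1 fun Y => (U Y : ℂ)⁻¹ * w₁ Y) ∧
    s ^ 6 * normL2 (weighted 1 fun Y => (U Y : ℂ)⁻¹ * w₁ Y)
      ≤ 152 * K ^ 4 * (normL2 (weighted 1 f) + s * normL2 φ₁) := by
  have hK := hU.one_le
  have K0 := hU.K_pos
  obtain ⟨mw, mw₁, -, n₁, na, -⟩ := S.weighted_estimate hU ht0 ht1 ha hs hs1 hs2 (by norm_num) hf
  obtain ⟨mr, nr⟩ := S.norm_near_wall_le hU ht0 ht1 hs hs1 hs2
  have nf := normL2_le_weighted hf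
  have nw := normL2_le_weighted mw
  have nw₁ := normL2_le_weighted mw₁
  set Z := normL2 (weighted 1 f) + s * normL2 φ₁ with hZ
  have Z0 : 0 ≤ Z := add_nonneg (normL2_nonneg _) (mul_nonneg hs.le (normL2_nonneg _))
  set r : ℝ → ℝ := fun Y => s ^ 2 / (Y + s ^ 2) with hr
  have sp : 0 < s ^ 2 := by positivity
  have r0 : ∀ Y, 0 < Y → 0 ≤ r Y := fun Y hY => by simp only [hr]; positivity
  have r1 : ∀ Y, 0 < Y → r Y ≤ 1 := fun Y hY => by
    simp only [hr]; rw [div_le_one (by positivity)]; linarith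
  have dr : ∀ Y, 0 < Y → HasDerivAt r (-(r Y ^ 2 / s ^ 2)) Y := fun Y hY => by
    have := (hasDerivAt_const Y (s ^ 2)).div ((hasDerivAt_id Y).add_const (s ^ 2))
      (by simp only [id]; positivity)
    refine this.congr_deriv ?_
    simp only [hr, id]
    field_simp
    ring
  have cr : ContinuousOn r (Ioi 0) := fun Y hY => (dr Y hY).continuousAt.continuousWithinAt
  have lr := LocAC.ofReal dr ((cr.pow 2).div_const _).neg
  have ar := lr.aestronglyMeasurable
  set v : ℝ → ℂ := fun Y => ((-(r Y ^ 2 / s ^ 2) : ℝ) : ℂ) * w₁ Y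
    + (r Y : ℂ) * (h Y + (a : ℂ) ^ 2 * w Y) with hv
  have dv : LocAC (fun Y => (r Y : ℂ) * w₁ Y) v := lr.mul S.hw.d₁
  have mrw₁ : MemL2 (fun Y => (r Y : ℂ) * w₁ Y) :=
    S.hw.m₁.of_le (C := 1) (ar.mul S.hw.m₁.1) fun Y hY => by
      rw [norm_ofReal_mul (r0 Y hY)]
      exact mul_le_mul_of_nonneg_right (r1 Y hY) (norm_nonneg _)
  have lim : Tendsto (fun Y => (r Y : ℂ) * w₁ Y) (𝓝[>] 0) (𝓝 0) := by
    have h1 := tendsto_of_continuousOn S.hw.c₁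
    rw [S.w₁_zero] at h1
    refine tendsto_zero_of_bound (B := 1) h1 fun Y hY _ => ?_
    rw [norm_ofReal_mul (r0 Y hY)]
    exact mul_le_mul_of_nonneg_right (r1 Y hY) (norm_nonneg _)
  have m1 : MemL2 (fun Y => ((-(r Y ^ 2 / s ^ 2) : ℝ) : ℂ) * w₁ Y) := by
    refine S.hw.m₁.of_le (C := (s ^ 2)⁻¹) (AEStronglyMeasurable.mul (continuousOn_aesm
      (Complex.continuous_ofReal.comp_continuousOn ((cr.pow 2).div_const _).neg)) S.hw.m₁.1)
      fun Y hY => ?_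
    rw [norm_mul, Complex.norm_real, norm_neg, Real.norm_of_nonneg (by positivity)]
    refine mul_le_mul_of_nonneg_right ?_ (norm_nonneg _)
    rw [div_eq_mul_inv]
    exact mul_le_of_le_one_left (by positivity) (pow_le_one₀ (r0 Y hY) (r1 Y hY))
  have n1 : normL2 (fun Y => ((-(r Y ^ 2 / s ^ 2) : ℝ) : ℂ) * w₁ Y) ≤ (s ^ 2)⁻¹ * normL2 w₁ := by
    refine normL2_le_of_le (by positivity) S.hw.m₁ fun Y hY => ?_
    rw [norm_mul, Complex.norm_real, norm_neg, Real.norm_of_nonneg (by positivity)]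
    refine mul_le_mul_of_nonneg_right ?_ (norm_nonneg _)
    rw [div_eq_mul_inv]
    exact mul_le_of_le_one_left (by positivity) (pow_le_one₀ (r0 Y hY) (r1 Y hY))
  obtain ⟨m2, n2⟩ := memL2_and_normL2_le_add (f := fun Y => (r Y : ℂ) * (h Y + (a : ℂ) ^ 2 * w Y))
    zero_le_one (sq_nonneg a) (ar.mul S.hw.mdd.1) mr S.hw.m (ae_halfLine fun Y hY => by
      rw [mul_add, one_mul]
      refine (norm_add_le _ _).trans (add_le_add le_rfl ?_)
      rw [norm_ofReal_mul (r0 Y hY), norm_mul, norm_pow, Complex.norm_real,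
        Real.norm_of_nonneg ha.le]
      exact mul_le_of_le_one_left (by positivity) (r1 Y hY))
  have mv : MemL2 v := m1.add m2
  have nv : normL2 v ≤ (s ^ 2)⁻¹ * normL2 w₁
      + (normL2 (fun Y => (r Y : ℂ) * h Y) + a ^ 2 * normL2 w) := by
    refine (normL2_add_le m1 m2).trans (add_le_add n1 (by rwa [one_mul] at n2))
  obtain ⟨mh, nh⟩ := hardy dv mrw₁ mv lim
  obtain ⟨mY, nY⟩ := memL2_and_normL2_le_add (f := fun Y => (Y : ℂ)⁻¹ * w₁ Y) zero_le_one
    (by positivity : 0 ≤ (s ^ 2)⁻¹)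
    (AEStronglyMeasurable.mul (continuousOn_aesm (ContinuousOn.inv₀ (by fun_prop) fun Y hY => by
      exact_mod_cast (ne_of_gt hY))) S.hw.m₁.1) mh S.hw.m₁ (ae_halfLine fun Y hY => by
      rw [norm_ofReal_inv_mul hY.le, norm_ofReal_inv_mul hY.le, norm_ofReal_mul (r0 Y hY)]
      have e : Y⁻¹ = Y⁻¹ * r Y + (Y + s ^ 2)⁻¹ := by simp only [hr]; field_simp; ring
      have e2 : (Y + s ^ 2)⁻¹ ≤ (s ^ 2)⁻¹ := inv_anti₀ sp (by linarith)
      calc Y⁻¹ * ‖w₁ Y‖ = (Y⁻¹ * r Y + (Y + s ^ 2)⁻¹) * ‖w₁ Y‖ := by rw [← e]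
        _ ≤ (Y⁻¹ * r Y + (s ^ 2)⁻¹) * ‖w₁ Y‖ := by gcongr
        _ = _ := by ring)
  obtain ⟨m, n⟩ := memL2_and_normL2_le_add K0.le (by positivity : 0 ≤ 2 * K)
    (aesm_weighted (hU.locAC_inv.aestronglyMeasurable.mul S.hw.m₁.1)) mY mw₁
    (ae_halfLine fun Y hY => hU.norm_weighted_inv_mul_le hY)
  refine ⟨m, ?_⟩
  have s4 : s ^ 6 ≤ s ^ 4 := pow_le_pow_of_le_one hs.le hs1 (by norm_num)
  have W0 := normL2_nonneg (weighted 1 w)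
  have W10 := normL2_nonneg (weighted 1 w₁)
  -- the four contributions
  have c1 : s ^ 6 * ((s ^ 2)⁻¹ * normL2 w₁) ≤ 16 * K ^ 2 * Z := by
    refine le_trans ?_ n₁
    rw [show s ^ 6 * ((s ^ 2)⁻¹ * normL2 w₁) = s ^ 4 * normL2 w₁ by field_simp]
    gcongr
  have c2 : s ^ 6 * normL2 (fun Y => (r Y : ℂ) * h Y) ≤ 20 * K ^ 3 * Z :=
    nr.trans (by rw [hZ]; gcongr)
  have c3 : s ^ 6 * (a ^ 2 * normL2 w) ≤ 16 * K ^ 2 * Z := by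
    refine le_trans ?_ na
    calc s ^ 6 * (a ^ 2 * normL2 w) ≤ s ^ 4 * (a * normL2 (weighted 1 w)) := by
          have := normL2_nonneg w
          gcongr
          exact pow_le_of_le_one ha.le ha1 (by norm_num)
      _ = _ := rfl
  have c4 : s ^ 6 * normL2 (weighted 1 w₁) ≤ 16 * K ^ 2 * Z := le_trans (by gcongr) n₁
  have c5 : K ^ 2 * Z ≤ K ^ 3 * Z := 
    mul_le_mul_of_nonneg_right (pow_le_pow_right₀ hK (by norm_num)) Z0
  have c6 : s ^ 6 * normL2 (fun Y => (Y : ℂ)⁻¹ * w₁ Y) ≤ 120 * K ^ 3 * Z := by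
    have := mul_le_mul_of_nonneg_left (nY.trans (add_le_add
      (mul_le_mul_of_nonneg_left (nh.trans (mul_le_mul_of_nonneg_left nv zero_le_two))
        zero_le_one) le_rfl)) (by positivity : 0 ≤ s ^ 6)
    have e : s ^ 6 * (1 * (2 * ((s ^ 2)⁻¹ * normL2 w₁ + (normL2 (fun Y => (r Y : ℂ) * h Y)
        + a ^ 2 * normL2 w))) + (s ^ 2)⁻¹ * normL2 w₁)
        = 3 * (s ^ 6 * ((s ^ 2)⁻¹ * normL2 w₁)) + 2 * (s ^ 6 * normL2 (fun Y => (r Y : ℂ) * h Y))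
          + 2 * (s ^ 6 * (a ^ 2 * normL2 w)) := by ring
    rw [e] at this
    linarith
  calc s ^ 6 * normL2 (weighted 1 fun Y => (U Y : ℂ)⁻¹ * w₁ Y)
      ≤ s ^ 6 * (K * normL2 (fun Y => (Y : ℂ)⁻¹ * w₁ Y) + 2 * K * normL2 (weighted 1 w₁)) :=
        mul_le_mul_of_nonneg_left n (by positivity)
    _ = K * (s ^ 6 * normL2 (fun Y => (Y : ℂ)⁻¹ * w₁ Y) + 2 * (s ^ 6 * normL2 (weighted 1 w₁))) := by
        ring
    _ ≤ K * (120 * K ^ 3 * Z + 2 * (16 * K ^ 3 * Z)) := by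
        refine mul_le_mul_of_nonneg_left (add_le_add c6 ?_) K0.le
        linarith
    _ = _ := by ring

end OSSystem

/-- Bookkeeping for the low frequency estimate: `A` is the norm of the corrected source, `m` its
mean divided by `a²`, `W` the weighted norm of the vorticity. -/
theorem low_frequency_arith {K s a c κ Z I W N A m M P : ℝ} (hK : 1 ≤ K) (hs : 0 < s) (hs1 : s ≤ 1)
    (ha : 0 < a) (ha1 : a ≤ 1) (c0 : 0 ≤ c) (κ0 : 0 ≤ κ) (Z0 : 0 ≤ Z) (I0 : 0 ≤ I) (W0 : 0 ≤ W)
    (M0 : 0 ≤ M) {F : ℝ} (hF : F ≤ Z)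
    (h1 : s ^ 2 * W ≤ 64 * K ^ 3 * Z) (h2 : s ^ 4 * (a * W) ≤ 16 * K ^ 2 * Z)
    (hN : N ≤ F + s ^ 6 * a ^ 2 * W) (hM : M ≤ I + s ^ 6 * a ^ 2 * (κ * W)) (hm : m = M / a ^ 2)
    (hA : A ≤ 6 * K * (N + M * c) + 152 * K ^ 4 * Z)
    (hP : P ≤ 12 * K ^ 2 * (A + c * m)) :
    (2 + 2 * K ^ 2) * P ≤ 48 * K ^ 8 * (254 + 448 * c * κ + 7 * c) * (Z + I / a ^ 2) := by
  have K0 : 0 < K := by linarith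
  have s4 : s ^ 6 ≤ s ^ 4 := pow_le_pow_of_le_one hs.le hs1 (by norm_num)
  have s2 : s ^ 6 ≤ s ^ 2 := pow_le_pow_of_le_one hs.le hs1 (by norm_num)
  have a2 : a ^ 2 ≤ a := pow_le_of_le_one ha.le ha1 (by norm_num)
  have e1 : s ^ 6 * a ^ 2 * W ≤ 16 * K ^ 2 * Z := by
    refine le_trans ?_ h2
    calc s ^ 6 * a ^ 2 * W ≤ s ^ 4 * a * W := by gcongr
      _ = _ := by ring
  have e2 : s ^ 6 * W ≤ 64 * K ^ 3 * Z := le_trans (by gcongr) h1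
  set J := I / a ^ 2 with hJ
  have J0 : 0 ≤ J := by positivity
  have e3 : m ≤ J + κ * (64 * K ^ 3 * Z) := by
    rw [hm, div_le_iff₀ (by positivity), hJ, add_mul, div_mul_cancel₀ _ (by positivity)]
    refine hM.trans ?_
    calc I + s ^ 6 * a ^ 2 * (κ * W) = I + κ * (s ^ 6 * W) * a ^ 2 := by ring
      _ ≤ _ := by gcongr
  have e4 : M ≤ m := by
    rw [hm, le_div_iff₀ (by positivity)]
    exact mul_le_of_le_one_right M0 (pow_le_one₀ ha.le ha1)
  have p : ∀ {i j : ℕ}, i ≤ j → K ^ i ≤ K ^ j := fun h => pow_le_pow_right₀ hK h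
  have k2 : (1 : ℝ) ≤ K ^ 2 := one_le_pow₀ hK
  have e5 : A + c * m ≤ 254 * K ^ 4 * Z + 7 * K * c * (J + κ * (64 * K ^ 3 * Z)) := by
    have h3 : N ≤ 17 * K ^ 2 * Z := by nlinarith
    have h4 : 6 * K * (N + M * c) ≤ 6 * K * (17 * K ^ 2 * Z + m * c) := by gcongr
    have h5 : K ^ 3 * Z ≤ K ^ 4 * Z := mul_le_mul_of_nonneg_right (p (by norm_num)) Z0
    have m0 : 0 ≤ m := M0.trans e4
    have h6 : c * m ≤ K * (c * m) := le_mul_of_one_le_left (by positivity) hK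
    have h7 : 7 * K * c * m ≤ 7 * K * c * (J + κ * (64 * K ^ 3 * Z)) := by gcongr
    nlinarith
  have e6 : A + c * m ≤ K ^ 4 * ((254 + 448 * c * κ + 7 * c) * (Z + J)) := by
    refine e5.trans ?_
    have h5 : K * (c * J) ≤ K ^ 4 * (c * J) :=
      mul_le_mul_of_nonneg_right (le_self_pow₀ hK (by norm_num)) (by positivity)
    have h6 : 0 ≤ K ^ 4 * (254 * J + 448 * c * κ * J + 7 * c * Z) := by positivity
    nlinarith
  have h0 : 0 ≤ K ^ 4 * ((254 + 448 * c * κ + 7 * c) * (Z + J)) := by positivity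
  calc (2 + 2 * K ^ 2) * P ≤ (2 + 2 * K ^ 2) * (12 * K ^ 2 * (A + c * m)) := by gcongr
    _ ≤ (2 + 2 * K ^ 2)
        * (12 * K ^ 2 * (K ^ 4 * ((254 + 448 * c * κ + 7 * c) * (Z + J)))) := by gcongr
    _ ≤ (4 * K ^ 2) * (12 * K ^ 2 * (K ^ 4 * ((254 + 448 * c * κ + 7 * c) * (Z + J)))) := by
        gcongr; linarith
    _ = _ := by ring

namespace OSSystem

variable {U U₁ U₂ : ℝ → ℝ} {K ε a s : ℝ} {f φ φ₁ w w₁ h : ℝ → ℂ}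

/-- The low frequency estimate before absorption of the right hand side. -/
theorem low_frequency_estimate_unabsorbed (S : OSSystem U U₂ 1 (s ^ 6) a f φ φ₁ w w₁ h)
    (hU : ProfileBounds U U₁ U₂ K) (ha : 0 < a) (ha1 : a ≤ 1)
    (hs : 0 < s) (hs1 : s ≤ 1) (hs2 : 64 * K * s ^ 2 ≤ 1) (hf : MemL2 (weighted 2 f)) :
    normL2 φ₁ + a * normL2 φ
      ≤ 48 * K ^ 8 * (254 + 448 * normL2 decay * normL2 invWeight + 7 * normL2 decay)
        * (normL2 (weighted 2 f) + s * normL2 φ₁ + ‖∫ Y, f Y ∂halfLine‖ / a ^ 2) := by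
  have hK := hU.one_le
  have K0 := hU.K_pos
  obtain ⟨mw, -, nw, -, na, -⟩ :=
    S.weighted_estimate hU zero_le_one le_rfl ha hs hs1 hs2 le_rfl hf
  obtain ⟨mf1, nf1⟩ := memL2_weighted_le (j := 1) (by norm_num) S.mf.1 hf
  obtain ⟨mx, nx⟩ := S.norm_flux_le hU zero_le_one le_rfl ha ha1 hs hs1 hs2 mf1
  set Z := normL2 (weighted 2 f) + s * normL2 φ₁ with hZ
  have Φ0 := normL2_nonneg φ₁
  have Z0 : 0 ≤ Z := add_nonneg (normL2_nonneg _) (mul_nonneg hs.le Φ0)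
  set W := normL2 (weighted 2 w) with hW
  have W0 : 0 ≤ W := normL2_nonneg _
  -- `ε (w'' - a² w)` is split: `ε w''` goes to the flux, `ε a² w` to the source
  set g : ℝ → ℂ := fun Y => f Y + Complex.I * ((s ^ 6 : ℝ) : ℂ) * (a : ℂ) ^ 2 * w Y with hg
  have ag : AEStronglyMeasurable g halfLine := S.mf.1.add (S.hw.m.1.const_mul _)
  have nc : ‖Complex.I * ((s ^ 6 : ℝ) : ℂ) * (a : ℂ) ^ 2‖ = s ^ 6 * a ^ 2 := by
    rw [norm_mul, norm_mul, Complex.norm_I, one_mul, norm_pow, Complex.norm_real, Complex.norm_real,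
      Real.norm_of_nonneg ha.le, Real.norm_of_nonneg (by positivity)]
  obtain ⟨mg, ng⟩ := memL2_and_normL2_le_add (f := weighted 2 g) zero_le_one
    (by positivity : 0 ≤ s ^ 6 * a ^ 2) (aesm_weighted ag) hf mw (ae_halfLine fun Y _ => by
      have : weighted 2 g Y = weighted 2 f Y
          + Complex.I * ((s ^ 6 : ℝ) : ℂ) * (a : ℂ) ^ 2 * weighted 2 w Y := by
        simp only [weighted, hg]; ring
      rw [this, one_mul, ← nc, ← norm_mul]
      exact norm_add_le _ _)
  rw [one_mul] at ng
  set M := ∫ Y, g Y ∂halfLine with hM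
  obtain ⟨if', -⟩ := integrable_of_weighted S.mf.1 hf
  obtain ⟨iw, niw⟩ := integrable_of_weighted S.hw.m.1 mw
  -- the factor `a²` compensates the division of the mean by `a²`
  have nM : ‖M‖ ≤ ‖∫ Y, f Y ∂halfLine‖ + s ^ 6 * a ^ 2 * (normL2 invWeight * W) := by
    have e : M = (∫ Y, f Y ∂halfLine)
        + Complex.I * ((s ^ 6 : ℝ) : ℂ) * (a : ℂ) ^ 2 * ∫ Y, w Y ∂halfLine := by
      rw [hM, ← integral_const_mul, ← integral_add if' (iw.const_mul _)]
    rw [e]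
    refine (norm_add_le _ _).trans (add_le_add le_rfl ?_)
    rw [norm_mul, nc]
    exact mul_le_mul_of_nonneg_left niw (by positivity)
  obtain ⟨dT, mT, lT, aT', mT', nT'⟩ := corrected_tail ag mg rfl rfl
  set T : ℝ → ℂ := fun Y => (∫ Z in Ioi Y, g Z)
      - (∫ Z, g Z ∂halfLine) * (((1 + Y) * Real.exp (-Y) : ℝ) : ℂ) with hT
  obtain ⟨mTu, nTu⟩ := hU.memL2_weighted_inv_mul dT mT aT' mT' lT
  set G : ℝ → ℂ := fun Y => T Y + Complex.I * ((s ^ 6 : ℝ) : ℂ) * w₁ Y with hG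
  have ncs : ‖Complex.I * ((s ^ 6 : ℝ) : ℂ)‖ = s ^ 6 := by
    rw [norm_mul, Complex.norm_I, one_mul, Complex.norm_real, Real.norm_of_nonneg (by positivity)]
  obtain ⟨mG, nG⟩ := memL2_and_normL2_le_add
    (f := weighted 1 fun Y => (U Y : ℂ)⁻¹ * G Y) zero_le_one
    (by positivity : 0 ≤ s ^ 6) (aesm_weighted (hU.locAC_inv.aestronglyMeasurable.mul
      (mT.1.add (S.hw.m₁.1.const_mul _)))) mTu mx (ae_halfLine fun Y _ => by
      have : weighted 1 (fun Y => (U Y : ℂ)⁻¹ * G Y) Y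
          = weighted 1 (fun Y => (U Y : ℂ)⁻¹ * T Y) Y
            + Complex.I * ((s ^ 6 : ℝ) : ℂ) * weighted 1 (fun Y => (U Y : ℂ)⁻¹ * w₁ Y) Y := by
        simp only [weighted, hG]; ring
      rw [this, one_mul]
      refine (norm_add_le _ _).trans ?_
      rw [norm_mul (Complex.I * ((s ^ 6 : ℝ) : ℂ)), ncs])
  rw [one_mul] at nG
  set H : ℝ → ℂ := fun Y => (U Y * φ₁ Y - U₁ Y * φ Y) + G Y with hH
  have dq : LocAC (fun Y => (U Y : ℂ) * φ₁ Y - U₁ Y * φ Y) (fun Y =>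
      (U₁ Y * φ₁ Y + U Y * (w Y + (a : ℂ) ^ 2 * φ Y)) - (U₂ Y * φ Y + U₁ Y * φ₁ Y)) :=
    (hU.locAC.mul S.hφ.d₁).sub (hU.locAC_deriv.mul S.hφ.d)
  have dH : LocAC H (fun Y => (a : ℂ) ^ 2 * (U Y * φ Y) + M * ((Y * Real.exp (-Y) : ℝ) : ℂ)) := by
    refine (dq.add (dT.add (S.hw.d₁.const_mul (Complex.I * ((s ^ 6 : ℝ) : ℂ))))).congr_ae ?_
    filter_upwards [S.eq] with Y hY
    have hgY : g Y = f Y + Complex.I * ((s ^ 6 : ℝ) : ℂ) * (a : ℂ) ^ 2 * w Y := rfl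
    simp only [← hM]
    rw [hgY, ← hY]
    push_cast
    ring
  have mq : MemL2 (fun Y => (U Y : ℂ) * φ₁ Y - U₁ Y * φ Y) := by
    refine (memL2_and_normL2_le_add (f := fun Y => (U Y : ℂ) * φ₁ Y - U₁ Y * φ Y) K0.le K0.le ((hU.aesm.mul S.hφ.m₁.1).sub
      (hU.aesm_deriv.mul S.hφ.m.1)) S.hφ.m₁ S.hφ.m (ae_halfLine fun Y hY => ?_)).1
    refine (norm_sub_le _ _).trans (add_le_add ?_ ?_)
    · rw [norm_ofReal_mul (hU.pos hY).le]
      exact mul_le_mul_of_nonneg_right (hU.le Y hY) (norm_nonneg _)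
    · rw [norm_mul, Complex.norm_real, Real.norm_eq_abs]
      exact mul_le_mul_of_nonneg_right (hU.abs_deriv_le hY) (norm_nonneg _)
  have mH : MemL2 H := mq.add (mT.add (S.hw.m₁.const_mul _))
  have lw₁ : Tendsto w₁ (𝓝[>] 0) (𝓝 0) := by
    simpa [S.w₁_zero] using tendsto_of_continuousOn S.hw.c₁
  have lφ : Tendsto φ (𝓝[>] 0) (𝓝 0) := by
    simpa [S.φ_zero] using tendsto_of_continuousOn S.hφ.c
  have lq : Tendsto (fun Y => (U Y : ℂ) * φ₁ Y - U₁ Y * φ Y) (𝓝[>] 0) (𝓝 0) := by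
    obtain ⟨B, B0, hB⟩ := exists_bound_near_zero S.hφ.c₁
    have lY : Tendsto (fun Y : ℝ => (Y : ℂ)) (𝓝[>] 0) (𝓝 0) := by
      have : Tendsto (fun Y : ℝ => (Y : ℂ)) (𝓝 0) (𝓝 ((0 : ℝ) : ℂ)) :=
        Complex.continuous_ofReal.tendsto _
      simpa using this.mono_left nhdsWithin_le_nhds
    have l1 : Tendsto (fun Y => (U Y : ℂ) * φ₁ Y) (𝓝[>] 0) (𝓝 0) := by
      refine tendsto_zero_of_bound (B := K * B) lY fun Y hY h1 => ?_
      rw [norm_ofReal_mul (hU.pos hY).le, Complex.norm_real, Real.norm_of_nonneg hY.le]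
      calc U Y * ‖φ₁ Y‖ ≤ (K * Y) * B :=
            mul_le_mul (hU.le_mul Y hY) (hB Y ⟨hY.le, h1⟩) (norm_nonneg _) (by positivity)
        _ = _ := by ring
    have l2 : Tendsto (fun Y => (U₁ Y : ℂ) * φ Y) (𝓝[>] 0) (𝓝 0) := by
      refine tendsto_zero_of_bound (B := K) lφ fun Y hY _ => ?_
      rw [norm_mul, Complex.norm_real, Real.norm_eq_abs]
      exact mul_le_mul_of_nonneg_right (hU.abs_deriv_le hY) (norm_nonneg _)
    simpa using l1.sub l2
  have lH : Tendsto H (𝓝[>] 0) (𝓝 0) := by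
    simpa using lq.add (lT.add (lw₁.const_mul (Complex.I * ((s ^ 6 : ℝ) : ℂ))))
  obtain ⟨mqu, nqu, nφ⟩ := S.rayleigh_estimate hU ha ha1 (fun Y _ => rfl) dH lH mH mG
  have nψ := S.norm_quotient_le hU mqu
  have mψ := (S.quotient hU).1
  set Q := normL2 (weighted 1 fun Y => (U Y : ℂ)⁻¹ * (U Y * φ₁ Y - U₁ Y * φ Y)) with hQ
  -- `φ' = q / U + U' (φ / U)`
  have nφ₁ : normL2 φ₁ ≤ (1 + 2 * K ^ 2) * Q := by
    refine (memL2_and_normL2_le_add zero_le_one K0.le S.hφ.m₁.1 mqu mψ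
      (ae_halfLine fun Y hY => ?_)).2.trans ?_
    · have u0 : (U Y : ℂ) ≠ 0 := by exact_mod_cast (hU.pos hY).ne'
      have e : φ₁ Y = (U Y : ℂ)⁻¹ * (U Y * φ₁ Y - U₁ Y * φ Y) + U₁ Y * ((U Y : ℂ)⁻¹ * φ Y) := by
        field_simp; ring
      calc ‖φ₁ Y‖ ≤ ‖(U Y : ℂ)⁻¹ * (U Y * φ₁ Y - U₁ Y * φ Y)‖ + ‖U₁ Y * ((U Y : ℂ)⁻¹ * φ Y)‖ :=
            (congrArg norm e).le.trans (norm_add_le _ _)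
        _ ≤ _ := by
          refine add_le_add (norm_le_norm_weighted (k := 1)
            (g := fun Y => (U Y : ℂ)⁻¹ * (U Y * φ₁ Y - U₁ Y * φ Y)) hY) ?_
          rw [norm_mul, Complex.norm_real, Real.norm_eq_abs]
          exact mul_le_mul_of_nonneg_right (hU.abs_deriv_le hY) (norm_nonneg _)
    · have := mul_le_mul_of_nonneg_left nψ K0.le
      linarith
  have hF : normL2 (weighted 2 f) ≤ Z := by
    have := mul_nonneg hs.le Φ0
    rw [hZ]; linarith
  have hA : normL2 (weighted 1 fun Y => (U Y : ℂ)⁻¹ * G Y)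
      ≤ 6 * K * (normL2 (weighted 2 g) + ‖M‖ * normL2 decay) + 152 * K ^ 4 * Z := by
    refine nG.trans (add_le_add (nTu.trans (mul_le_mul_of_nonneg_left nT' (by positivity)))
      (nx.trans ?_))
    rw [hZ]
    gcongr
  have fin := low_frequency_arith (P := 12 * K ^ 2 * (normL2 (weighted 1 fun Y => (U Y : ℂ)⁻¹ * G Y)
        + normL2 decay * (‖M‖ / a ^ 2))) hK hs hs1 ha ha1 (normL2_nonneg decay)
        (normL2_nonneg invWeight) Z0
    (norm_nonneg _) W0 (norm_nonneg M) hF nw na ng nM rfl hA le_rfl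
  refine le_trans ?_ fin
  have := mul_le_mul_of_nonneg_left nqu (by positivity : 0 ≤ 1 + 2 * K ^ 2)
  linarith

end OSSystem

/-- The low frequency estimate: for small `s` the term `s φ'` on the right hand side is absorbed. -/
theorem low_frequency_estimate {U U₁ U₂ : ℝ → ℝ} {K : ℝ} (hU : ProfileBounds U U₁ U₂ K) :
    ∃ C : ℝ, 1 ≤ C ∧ ∀ {a s : ℝ} {f φ φ₁ w w₁ h : ℝ → ℂ},
      OSSystem U U₂ 1 (s ^ 6) a f φ φ₁ w w₁ h → 0 < a → a ≤ 1 → 0 < s → C * s ≤ 1 →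
      MemL2 (weighted 2 f) →
      normL2 φ₁ + a * normL2 φ ≤ C * (normL2 (weighted 2 f) + ‖∫ Y, f Y ∂halfLine‖ / a ^ 2) := by
  have hK := hU.one_le
  have c0 := normL2_nonneg decay
  have κ0 := normL2_nonneg invWeight
  set D := 48 * K ^ 8 * (254 + 448 * normL2 decay * normL2 invWeight + 7 * normL2 decay) with hD
  have hD1 : 64 * K ≤ D := by
    have h1 : K ≤ K ^ 8 := le_self_pow₀ hK (by norm_num)
    have h2 : 254 ≤ 254 + 448 * normL2 decay * normL2 invWeight + 7 * normL2 decay := by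
      have := mul_nonneg c0 κ0
      linarith
    calc 64 * K ≤ 48 * K * 254 := by linarith
      _ ≤ 48 * K ^ 8 * (254 + 448 * normL2 decay * normL2 invWeight + 7 * normL2 decay) := by
          gcongr
  refine ⟨2 * D, by linarith, fun {a s f φ φ₁ w w₁ h} S ha ha1 hs hs1 hf => ?_⟩
  have h1 : D * s ≤ 1 / 2 := by linarith
  have h2 : 64 * K * s ≤ 1 := by nlinarith
  have h3 : s ≤ 1 := by nlinarith
  have := S.low_frequency_estimate_unabsorbed hU ha ha1 hs h3 (by nlinarith) hf
  rw [← hD] at this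
  have P0 := normL2_nonneg φ₁
  have Q0 := mul_nonneg ha.le (normL2_nonneg φ)
  have h4 : D * (s * normL2 φ₁) ≤ 1 / 2 * normL2 φ₁ := by
    rw [← mul_assoc]; gcongr
  nlinarith

/-! ### The a priori estimate -/

namespace OSSystem

variable {U U₁ U₂ : ℝ → ℝ} {K t ε a s : ℝ} {f φ φ₁ w w₁ h : ℝ → ℂ}

theorem memL2_weighted_stretching (S : OSSystem U U₂ t ε a f φ φ₁ w w₁ h)
    (hU : ProfileBounds U U₁ U₂ K) :
    MemL2 (weighted 2 fun Y => (U₂ Y : ℂ) * φ Y) ∧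
      normL2 (weighted 2 fun Y => (U₂ Y : ℂ) * φ Y) ≤ 2 * K * normL2 φ₁ := by
  have K0 := hU.K_pos
  have key : ∀ Y, 0 < Y → ‖weighted 2 (fun Y => (U₂ Y : ℂ) * φ Y) Y‖ ≤ K * ‖(Y : ℂ)⁻¹ * φ Y‖ := by
    intro Y hY
    rw [norm_weighted hY, norm_mul (U₂ Y : ℂ), Complex.norm_real, Real.norm_eq_abs]
    refine (norm_stretching_le hU hY le_rfl _).trans ?_
    have : Y / (1 + Y) ≤ 1 := by rw [div_le_one (by linarith)]; linarith
    exact mul_le_mul_of_nonneg_right (mul_le_of_le_one_right K0.le this) (norm_nonneg _)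
  obtain ⟨m, n⟩ := S.hardy_φ
  refine ⟨m.of_le (aesm_weighted (S.memL2_stretching hU).1) key,
    (normL2_le_of_le K0.le m key).trans ?_⟩
  have := mul_le_mul_of_nonneg_left n K0.le
  linarith

/-- The diffusion term, read off from the equation. -/
theorem norm_diffusion_le (S : OSSystem U U₂ 1 (s ^ 6) a f φ φ₁ w w₁ h)
    (hU : ProfileBounds U U₁ U₂ K) (hs : 0 < s) (hf : MemL2 (weighted 1 f))
    (hw : MemL2 (weighted 1 w)) :
    MemL2 (weighted 1 h) ∧ s ^ 6 * normL2 (weighted 1 h) ≤ normL2 (weighted 1 f)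
      + normL2 (weighted 1 fun Y => (U Y : ℂ) * w Y) + 2 * K * normL2 φ₁ := by
  have K0 := hU.K_pos
  obtain ⟨m2, n2⟩ := S.memL2_weighted_stretching hU
  obtain ⟨m1, n1⟩ := memL2_weighted_le (j := 1) (by norm_num) (S.memL2_stretching hU).1 m2
  have mUw : MemL2 (weighted 1 fun Y => (U Y : ℂ) * w Y) :=
    hw.of_le (C := K) (aesm_weighted (hU.memL2_mul S.hw.m).1) fun Y hY => by
      rw [norm_weighted hY, norm_weighted hY, norm_ofReal_mul (hU.pos hY).le]
      have := hU.le Y hY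
      calc (1 + Y) ^ 1 * (U Y * ‖w Y‖) ≤ (1 + Y) ^ 1 * (K * ‖w Y‖) := by gcongr
        _ = _ := by ring
  have mfU := hf.sub mUw
  have nfU : normL2 (fun Y => weighted 1 f Y - weighted 1 (fun Y => (U Y : ℂ) * w Y) Y)
      ≤ normL2 (weighted 1 f) + normL2 (weighted 1 fun Y => (U Y : ℂ) * w Y) := by
    have := (memL2_and_normL2_le_add
      (f := fun Y => weighted 1 f Y - weighted 1 (fun Y => (U Y : ℂ) * w Y) Y) zero_le_one
      zero_le_one mfU.1 hf mUw
      (ae_halfLine fun Y _ => by rw [one_mul, one_mul]; exact norm_sub_le _ _)).2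
    rwa [one_mul, one_mul] at this
  obtain ⟨m, n⟩ := memL2_and_normL2_le_add (f := fun Y => ((s ^ 6 : ℝ) : ℂ) * weighted 1 h Y)
    zero_le_one zero_le_one ((aesm_weighted S.hw.mg.1).const_mul _) mfU m1 (by
      filter_upwards [S.eq] with Y hY
      have e : ((s ^ 6 : ℝ) : ℂ) * weighted 1 h Y = -Complex.I * ((weighted 1 f Y
          - weighted 1 (fun Y => (U Y : ℂ) * w Y) Y)
          + weighted 1 (fun Y => (U₂ Y : ℂ) * φ Y) Y) := by
        simp only [weighted]
        rw [← hY, Complex.ofReal_one, one_mul]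
        linear_combination ((((1 + Y : ℝ) : ℂ) * ((s ^ 6 : ℝ) : ℂ) * h Y)) * Complex.I_sq
      rw [e, norm_mul, norm_neg, Complex.norm_I, one_mul, one_mul, one_mul]
      exact norm_add_le _ _)
  rw [normL2_const_mul, Complex.norm_real, Real.norm_of_nonneg (by positivity), one_mul,
    one_mul] at n
  refine ⟨(m.const_mul (((s ^ 6 : ℝ) : ℂ)⁻¹)).ae_eq (ae_of_all _ fun Y => ?_), ?_⟩
  · have : ((s ^ 6 : ℝ) : ℂ) ≠ 0 := by exact_mod_cast (by positivity : s ^ 6 ≠ 0)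
    field_simp
  · refine n.trans (add_le_add nfU (n1.trans n2))

end OSSystem

/-- The a priori estimate for the Orr--Sommerfeld system, with `ε = s⁶`. The stream function is
estimated by `low_frequency_estimate` for `a ≤ 1` and by `energy_estimate` for `a ≥ 1`, the
vorticity afterwards by `weighted_estimate`. -/
theorem a_priori_estimate {U U₁ U₂ : ℝ → ℝ} {K : ℝ} (hU : ProfileBounds U U₁ U₂ K) :
    ∃ C : ℝ, 1 ≤ C ∧ ∀ {a s : ℝ} {f φ φ₁ w w₁ h : ℝ → ℂ},
      OSSystem U U₂ 1 (s ^ 6) a f φ φ₁ w w₁ h → 0 < a → 0 < s → C * s ≤ 1 →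
      MemL2 (weighted 2 f) →
      MemL2 (weighted 1 w) ∧ MemL2 (weighted 1 w₁) ∧ MemL2 (weighted 1 h) ∧
      s ^ 2 * normL2 (weighted 1 w)
        + s ^ 4 * (normL2 (weighted 1 w₁) + a * normL2 (weighted 1 w))
        + s ^ 6 * normL2 (weighted 1 h) + (normL2 φ₁ + a * normL2 φ)
      ≤ C * (normL2 (weighted 2 f) + ‖∫ Y, f Y ∂halfLine‖ / a ^ 2) := by
  have hK := hU.one_le
  have K0 := hU.K_pos
  obtain ⟨D, hD, low⟩ := low_frequency_estimate hU
  set L := D + 16000 * K ^ 9 with hL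
  have K9 : K ≤ K ^ 9 := le_self_pow₀ hK (by norm_num)
  have hL1 : 1 ≤ L := by have : 0 ≤ 16000 * K ^ 9 := by positivity
                         linarith
  have hLK : 64 * K ≤ L := by linarith
  have K3 : (1 : ℝ) ≤ K ^ 3 := one_le_pow₀ hK
  have hCL : L ≤ 346 * K ^ 3 * L := by
    have : 1 * L ≤ K ^ 3 * L := by gcongr
    nlinarith
  refine ⟨346 * K ^ 3 * L, hL1.trans hCL,
    fun {a s f φ φ₁ w w₁ h} S ha hs hCs hf => ?_⟩
  have hLs : L * s ≤ 1 := le_trans (by gcongr) hCs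
  have hs1 : s ≤ 1 := by nlinarith
  have hs2 : 64 * K * s ^ 2 ≤ 1 := by
    have h1 : 64 * K * s ≤ 1 := by nlinarith
    nlinarith
  obtain ⟨mf1, nf1⟩ := memL2_weighted_le (j := 1) (by norm_num) S.mf.1 hf
  have nf := normL2_le_weighted hf
  set I := ‖∫ Y, f Y ∂halfLine‖ / a ^ 2 with hI
  have I0 : 0 ≤ I := by positivity
  set X := normL2 (weighted 2 f) + I with hX
  have F0 := normL2_nonneg (weighted 2 f)
  have X0 : 0 ≤ X := add_nonneg F0 I0
  have vel : normL2 φ₁ + a * normL2 φ ≤ L * X := by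
    rcases le_total a 1 with ha1 | ha1
    · refine (low S ha ha1 hs (le_trans ?_ hLs) hf).trans ?_
      · gcongr
        rw [hL]; exact le_add_of_nonneg_right (by positivity)
      · rw [← hI, ← hX]
        gcongr
        rw [hL]; exact le_add_of_nonneg_right (by positivity)
    · have hκ : 1 + (a ^ 2)⁻¹ ≤ 2 := by
        have : (a ^ 2)⁻¹ ≤ 1 := inv_le_one_of_one_le₀ (one_le_pow₀ ha1)
        linarith
      have hκ2 : 4000 * K ^ 9 * (1 + (a ^ 2)⁻¹) ^ 2 ≤ L := by
        calc 4000 * K ^ 9 * (1 + (a ^ 2)⁻¹) ^ 2 ≤ 4000 * K ^ 9 * 2 ^ 2 := by gcongr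
          _ ≤ L := by rw [hL]; linarith
      refine (S.energy_estimate hU zero_le_one le_rfl ha hs (le_trans (by gcongr) hLs)).trans ?_
      have := normL2_nonneg f
      have : normL2 f ≤ X := by rw [hX]; linarith
      gcongr
  have aφ := mul_nonneg ha.le (normL2_nonneg φ)
  have vel1 : normL2 φ₁ ≤ L * X := by linarith
  obtain ⟨mw, mw₁, nw, nw₁, naw, nUw⟩ :=
    S.weighted_estimate hU zero_le_one le_rfl ha hs hs1 hs2 (by norm_num) mf1
  obtain ⟨mh, nh⟩ := S.norm_diffusion_le hU hs mf1 mw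
  refine ⟨mw, mw₁, mh, ?_⟩
  have F1 : normL2 (weighted 1 f) ≤ X := by rw [hX]; linarith
  have sφ : s * normL2 φ₁ ≤ X := by
    calc s * normL2 φ₁ ≤ s * (L * X) := by gcongr
      _ = L * s * X := by ring
      _ ≤ 1 * X := by gcongr
      _ = X := one_mul X
  have Z2 : normL2 (weighted 1 f) + s * normL2 φ₁ ≤ 2 * X := by linarith
  have LX : X ≤ L * X := le_mul_of_one_le_left X0 hL1
  have KLX : L * X ≤ K ^ 3 * (L * X) := le_mul_of_one_le_left (by positivity) K3
  have k23 : K ^ 2 * X ≤ K ^ 3 * X :=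
    mul_le_mul_of_nonneg_right (pow_le_pow_right₀ hK (by norm_num)) X0
  have k3L : K ^ 3 * X ≤ K ^ 3 * (L * X) := by gcongr
  have b1 : s ^ 2 * normL2 (weighted 1 w) ≤ 64 * K ^ 3 * (2 * X) := nw.trans (by gcongr)
  have b2 : s ^ 4 * normL2 (weighted 1 w₁) ≤ 16 * K ^ 2 * (2 * X) := nw₁.trans (by gcongr)
  have b3 : s ^ 4 * (a * normL2 (weighted 1 w)) ≤ 16 * K ^ 2 * (2 * X) := naw.trans (by gcongr)
  have b4 : normL2 (weighted 1 fun Y => (U Y : ℂ) * w Y) ≤ 75 * K ^ 3 * (2 * (L * X)) :=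
    nUw.trans (by gcongr; linarith)
  have b5 : K * normL2 φ₁ ≤ K ^ 3 * (L * X) := by
    have : K ≤ K ^ 3 := le_self_pow₀ hK (by norm_num)
    have := normL2_nonneg φ₁
    gcongr
  have b6 : s ^ 6 * normL2 (weighted 1 h) ≤ 153 * (K ^ 3 * (L * X)) := by
    linarith
  rw [mul_add (s ^ 4)]
  linarith

/-! ### Solving the Helmholtz equation on the half line -/

/-- An even kernel whose square is integrable and dominates `exp (-a |x|)`. -/
noncomputable def kernel (x : ℝ) : ℝ := (1 + |x|)⁻¹

theorem kernel_pos (x : ℝ) : 0 < kernel x := by unfold kernel; positivity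

theorem continuous_kernel : Continuous kernel := by
  unfold kernel
  exact Continuous.inv₀ (by fun_prop) fun x => by positivity

theorem integrable_kernel_sq : Integrable (fun x => kernel x ^ 2) := by
  refine integrable_inv_one_add_sq.mono' (continuous_kernel.pow 2).aestronglyMeasurable
    (ae_of_all _ fun x => ?_)
  rw [Real.norm_of_nonneg (by positivity), kernel, inv_pow]
  refine inv_anti₀ (by positivity) ?_
  nlinarith [abs_nonneg x, sq_abs x]

theorem exp_le_kernel_sq {a : ℝ} (ha : 0 < a) {x : ℝ} (y : ℝ) (hx : 0 ≤ x) (hxy : |y| = x) :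
    Real.exp (-(a * x)) ≤ (1 + 2 / a) ^ 2 * kernel y ^ 2 := by
  have h1 : 1 + x ≤ (1 + 2 / a) * Real.exp (a * x / 2) := by
    have h2 := Real.add_one_le_exp (a * x / 2)
    have h3 : (1 + 2 / a) * (a * x / 2 + 1) = 1 + x + (a * x / 2 + 2 / a) := by field_simp; ring
    have h4 : 0 ≤ a * x / 2 + 2 / a := by positivity
    have h5 : 0 ≤ 1 + 2 / a := by positivity
    nlinarith
  have h6 := pow_le_pow_left₀ (by positivity) h1 2
  rw [mul_pow, ← Real.exp_nat_mul] at h6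
  rw [kernel, hxy, inv_pow, ← div_eq_mul_inv, le_div_iff₀ (by positivity), Real.exp_neg,
    inv_mul_le_iff₀ (Real.exp_pos _)]
  refine h6.trans (le_of_eq ?_)
  rw [mul_comm]
  congr 2
  push_cast
  ring

section convolution

variable {g : ℝ → ℂ} (hg : MemL2 g)
include hg

theorem memL2_kernel_mul (Y : ℝ) : MemL2 (fun Z => ((kernel (Y - Z) : ℝ) : ℂ) * g Z) := by
  refine hg.of_le (C := 1) (AEStronglyMeasurable.mul (Complex.continuous_ofReal.comp
    (continuous_kernel.comp (by fun_prop))).aestronglyMeasurable hg.1) fun Z _ => ?_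
  rw [norm_ofReal_mul (kernel_pos _).le]
  refine mul_le_mul_of_nonneg_right ?_ (norm_nonneg _)
  exact inv_le_one_of_one_le₀ (by have := abs_nonneg (Y - Z); linarith)

omit hg in
theorem memL2_kernel (Y : ℝ) : MemL2 (fun Z => ((kernel (Y - Z) : ℝ) : ℂ)) := by
  refine (memLp_two_iff_integrable_sq_norm (Complex.continuous_ofReal.comp
    (continuous_kernel.comp (by fun_prop))).aestronglyMeasurable).2 ?_
  have := (integrable_kernel_sq.comp_sub_left Y).restrict (s := Ioi 0)
  refine this.congr (ae_of_all _ fun Z => ?_)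
  simp [sq_abs]

/-- A function dominated by the convolution of `|g|` with an integrable kernel is in `L²`. -/
theorem memL2_of_norm_le_convolution {E : ℝ → ℂ} {C : ℝ} (hE : AEStronglyMeasurable E halfLine)
    (h : ∀ Y, 0 < Y → ‖E Y‖ ≤ C * ∫ Z, kernel (Y - Z) ^ 2 * ‖g Z‖ ∂halfLine) (hC : 0 ≤ C) :
    MemL2 E := by
  set G : ℝ → ℝ := (Ioi (0 : ℝ)).indicator fun Z => ‖g Z‖ ^ 2 with hG
  have iG : Integrable G := (integrable_indicator_iff measurableSet_Ioi).2 hg.integrable_norm_sq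
  have conv := Integrable.integrable_convolution (ContinuousLinearMap.mul ℝ ℝ) iG
    integrable_kernel_sq
  set P := ∫ x, kernel x ^ 2 with hP
  refine (memLp_two_iff_integrable_sq_norm hE).2 ?_
  refine ((conv.restrict (s := Ioi 0)).const_mul (C ^ 2 * P)).mono' (hE.norm.pow 2)
    (ae_halfLine fun Y hY => ?_)
  rw [Real.norm_of_nonneg (by positivity)]
  have e1 : convolution G (fun x => kernel x ^ 2) (ContinuousLinearMap.mul ℝ ℝ) volume Y
      = normL2 (fun Z => ((kernel (Y - Z) : ℝ) : ℂ) * g Z) ^ 2 := by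
    rw [normL2_sq (memL2_kernel_mul hg Y), convolution_def, ← integral_indicator measurableSet_Ioi]
    refine integral_congr_ae (ae_of_all _ fun Z => ?_)
    simp only [hG, ContinuousLinearMap.mul_apply']
    by_cases hZ : Z ∈ Ioi (0 : ℝ)
    · rw [indicator_of_mem hZ, indicator_of_mem hZ, norm_ofReal_mul (kernel_pos _).le]; ring
    · rw [indicator_of_notMem hZ, indicator_of_notMem hZ, zero_mul]
  have e2 : normL2 (fun Z => ((kernel (Y - Z) : ℝ) : ℂ)) ^ 2 ≤ P := by
    rw [normL2_sq (memL2_kernel Y), hP, ← integral_sub_left_eq_self (fun x => kernel x ^ 2) volume Y]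
    refine le_trans (le_of_eq ?_) (setIntegral_le_integral (s := Ioi 0)
      (integrable_kernel_sq.comp_sub_left Y) (ae_of_all _ fun Z => by positivity))
    exact integral_congr_ae (ae_of_all _ fun Z => by simp [sq_abs])
  have e3 : ∫ Z, kernel (Y - Z) ^ 2 * ‖g Z‖ ∂halfLine
      ≤ normL2 (fun Z => ((kernel (Y - Z) : ℝ) : ℂ))
        * normL2 (fun Z => ((kernel (Y - Z) : ℝ) : ℂ) * g Z) := by
    refine le_trans (le_of_eq ?_) (integral_norm_mul_le (memL2_kernel Y) (memL2_kernel_mul hg Y))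
    refine integral_congr_ae (ae_of_all _ fun Z => ?_)
    simp only
    rw [norm_ofReal_mul (kernel_pos _).le, Complex.norm_real, Real.norm_of_nonneg (kernel_pos _).le]
    ring
  have n1 := normL2_nonneg (fun Z => ((kernel (Y - Z) : ℝ) : ℂ))
  have n2 := normL2_nonneg (fun Z => ((kernel (Y - Z) : ℝ) : ℂ) * g Z)
  calc ‖E Y‖ ^ 2 ≤ (C * (normL2 (fun Z => ((kernel (Y - Z) : ℝ) : ℂ))
        * normL2 (fun Z => ((kernel (Y - Z) : ℝ) : ℂ) * g Z))) ^ 2 :=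
        pow_le_pow_left₀ (norm_nonneg _) ((h Y hY).trans (by gcongr)) 2
    _ = C ^ 2 * normL2 (fun Z => ((kernel (Y - Z) : ℝ) : ℂ)) ^ 2
        * normL2 (fun Z => ((kernel (Y - Z) : ℝ) : ℂ) * g Z) ^ 2 := by ring
    _ ≤ C ^ 2 * P * normL2 (fun Z => ((kernel (Y - Z) : ℝ) : ℂ) * g Z) ^ 2 := by gcongr
    _ = _ := by rw [e1]

/-- A partial convolution with `exp (-a |Y - Z|)` is dominated by the full kernel. -/
theorem norm_integral_indicator_le {a : ℝ} (ha : 0 < a) {Y : ℝ} (s : Set ℝ) :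
    ‖∫ Z, s.indicator (fun Z => ((Real.exp (-(a * |Y - Z|)) : ℝ) : ℂ) * g Z) Z ∂halfLine‖
      ≤ (1 + 2 / a) ^ 2 * ∫ Z, kernel (Y - Z) ^ 2 * ‖g Z‖ ∂halfLine := by
  rw [← integral_const_mul]
  refine norm_integral_le_of_norm_le (Integrable.const_mul ?_ _) (ae_of_all _ fun Z => ?_)
  · refine ((memL2_kernel Y).integrable_norm_mul (memL2_kernel_mul hg Y)).congr
      (ae_of_all _ fun Z => ?_)
    simp only
    rw [norm_ofReal_mul (kernel_pos _).le, Complex.norm_real, Real.norm_of_nonneg (kernel_pos _).le]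
    ring
  · refine (norm_indicator_le_norm_self _ _).trans ?_
    rw [norm_ofReal_mul (Real.exp_pos _).le, ← mul_assoc]
    exact mul_le_mul_of_nonneg_right (exp_le_kernel_sq ha _ (abs_nonneg _) rfl) (norm_nonneg _)

end convolution

theorem memL2_exp {a : ℝ} (ha : 0 < a) : MemL2 (fun Y => ((Real.exp (-(a * Y)) : ℝ) : ℂ)) := by
  refine (memLp_two_iff_integrable_sq_norm (Continuous.aestronglyMeasurable (by fun_prop))).2 ?_
  have : IntegrableOn (fun Y : ℝ => Real.exp (-(2 * a) * Y)) (Ioi 0) :=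
    exp_neg_integrableOn_Ioi 0 (by positivity)
  refine this.congr_fun (fun Y _ => ?_) measurableSet_Ioi
  simp only [Complex.norm_real, Real.norm_of_nonneg (Real.exp_pos _).le]
  rw [← Real.exp_nat_mul]; congr 1; push_cast; ring

theorem locAC_exp_mul (a : ℝ) : LocAC (fun Y => ((Real.exp (a * Y) : ℝ) : ℂ))
    (fun Y => (a : ℂ) * ((Real.exp (a * Y) : ℝ) : ℂ)) := by
  have := LocAC.ofReal (k := fun Y => Real.exp (a * Y)) (k' := fun Y => a * Real.exp (a * Y))
    (fun Y _ => by
      have := (Real.hasDerivAt_exp (a * Y)).comp Y ((hasDerivAt_id Y).const_mul a)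
      exact this.congr_deriv (by simp [mul_comm])) (by fun_prop)
  simpa using this

theorem locAC_primitive {v : ℝ → ℂ} (h : ∀ x y, IntervalIntegrable v volume x y) :
    LocAC (fun Y => ∫ Z in (0 : ℝ)..Y, v Z) v := fun x y _ _ =>
  ⟨h x y, intervalIntegral.integral_interval_sub_left (h 0 y) (h 0 x)⟩

theorem MemL2.intervalIntegrable_indicator {g : ℝ → ℂ} (hg : MemL2 g) (x y : ℝ) :
    IntervalIntegrable ((Ioi (0 : ℝ)).indicator g) volume x y := by
  have h1 : MemLp ((Ioi (0 : ℝ)).indicator g) 2 volume := (memLp_indicator_iff_restrict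
    measurableSet_Ioi).2 hg
  have h2 := h1.restrict (uIoc x y)
  have : IsFiniteMeasure (volume.restrict (uIoc x y)) := ⟨by simp [uIoc]⟩
  exact intervalIntegrable_iff.2 (h2.integrable (by norm_num))

/-- The Green function of `∂_Y² - a²`: for `σ = 1` the Neumann problem, for `σ = -1` the Dirichlet
problem. -/
theorem exists_helmholtzTriple {a : ℝ} (ha : 0 < a) {g : ℝ → ℂ} (hg : MemL2 g) (σ : ℂ) :
    ∃ u u₁, HelmholtzTriple a u u₁ g ∧ (1 - σ = 0 → u₁ 0 = 0) ∧ (1 + σ = 0 → u 0 = 0) := by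
  set γ : ℝ → ℂ := (Ioi (0 : ℝ)).indicator g with hγ
  have γe : ∀ Y, 0 < Y → γ Y = g Y := fun Y hY => indicator_of_mem (show Y ∈ Ioi (0:ℝ) from hY) g
  have ii : ∀ (c x y : ℝ), IntervalIntegrable (fun Z => ((Real.exp (c * Z) : ℝ) : ℂ) * γ Z)
      volume x y := fun c x y =>
    (hg.intervalIntegrable_indicator x y).continuousOn_mul (Continuous.continuousOn (by fun_prop))
  have ig : IntegrableOn (fun Z => ((Real.exp (-a * Z) : ℝ) : ℂ) * g Z) (Ioi 0) := by
    refine integrable_of_le_mul (C := 1) (memL2_exp ha) hg ((Continuous.aestronglyMeasurable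
      (by fun_prop)).mul hg.1) (ae_of_all _ fun Z => ?_)
    rw [norm_mul, one_mul, neg_mul]
  set A : ℝ → ℂ := fun Y => ∫ Z in (0:ℝ)..Y, ((Real.exp (a * Z) : ℝ) : ℂ) * γ Z with hA
  set b : ℂ := ∫ Z in Ioi (0:ℝ), ((Real.exp (-a * Z) : ℝ) : ℂ) * g Z with hb
  set B : ℝ → ℂ := fun Y => b - ∫ Z in (0:ℝ)..Y, ((Real.exp (-a * Z) : ℝ) : ℂ) * γ Z with hB
  set p : ℝ → ℂ := fun Y => ((Real.exp (a * Y) : ℝ) : ℂ) with hp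
  set m : ℝ → ℂ := fun Y => ((Real.exp (-a * Y) : ℝ) : ℂ) with hm
  have pm : ∀ Y, p Y * m Y = 1 := fun Y => by
    simp only [hp, hm]; rw [← Complex.ofReal_mul, ← Real.exp_add]; simp
  have cA : Continuous A := intervalIntegral.continuous_primitive (ii a) 0
  have cB : Continuous B := continuous_const.sub (intervalIntegral.continuous_primitive (ii (-a)) 0)
  have cp : Continuous p := by fun_prop
  have cm : Continuous m := by fun_prop
  have dA : LocAC A (fun Y => p Y * g Y) := (locAC_primitive (ii a)).congr (fun _ _ => rfl)
    fun Y hY => by simp only [hp]; rw [γe Y hY]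
  have dB : LocAC B (fun Y => -(m Y * g Y)) := by
    have h0 : LocAC (fun _ => b) (fun _ => 0) := LocAC.of_hasDerivAt_continuousOn
      (fun Y _ => hasDerivAt_const Y b) continuousOn_const
    refine (h0.sub (locAC_primitive (ii (-a)))).congr (fun _ _ => rfl) fun Y hY => ?_
    simp only [hm]; rw [γe Y hY, zero_sub]
  have dp : LocAC p (fun Y => (a : ℂ) * p Y) := locAC_exp_mul a
  have dm : LocAC m (fun Y => -(a : ℂ) * m Y) := (locAC_exp_mul (-a)).congr
    (fun _ _ => rfl) fun Y _ => by rw [Complex.ofReal_neg]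
  have d1 : LocAC (fun Y => m Y * A Y) (fun Y => -(a : ℂ) * (m Y * A Y) + g Y) :=
    (dm.mul dA).congr (fun _ _ => rfl) fun Y _ => by linear_combination (-g Y) * pm Y
  have d2 : LocAC (fun Y => p Y * B Y) (fun Y => (a : ℂ) * (p Y * B Y) - g Y) :=
    (dp.mul dB).congr (fun _ _ => rfl) fun Y _ => by linear_combination (g Y) * pm Y
  have m1 : MemL2 (fun Y => m Y * A Y) := by
    refine memL2_of_norm_le_convolution hg d1.aestronglyMeasurable (fun Y hY => ?_)
      (sq_nonneg (1 + 2 / a))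
    refine le_trans (le_of_eq ?_) (norm_integral_indicator_le hg ha (Ioc 0 Y))
    congr 1
    rw [integral_indicator measurableSet_Ioc, Measure.restrict_restrict measurableSet_Ioc,
      inter_eq_left.2 Ioc_subset_Ioi_self]
    simp only [hA]
    rw [intervalIntegral.integral_of_le hY.le, ← integral_const_mul]
    refine setIntegral_congr_fun measurableSet_Ioc fun Z hZ => ?_
    simp only [hm]
    rw [γe Z hZ.1, abs_of_nonneg (sub_nonneg.2 hZ.2), ← mul_assoc, ← Complex.ofReal_mul,
      ← Real.exp_add]
    ring_nf
  have m2 : MemL2 (fun Y => p Y * B Y) := by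
    refine memL2_of_norm_le_convolution hg d2.aestronglyMeasurable (fun Y hY => ?_)
      (sq_nonneg (1 + 2 / a))
    refine le_trans (le_of_eq ?_) (norm_integral_indicator_le hg ha (Ioi Y))
    congr 1
    rw [integral_indicator measurableSet_Ioi, Measure.restrict_restrict measurableSet_Ioi,
      inter_eq_left.2 (Ioi_subset_Ioi hY.le)]
    have e : B Y = ∫ Z in Ioi Y, ((Real.exp (-a * Z) : ℝ) : ℂ) * g Z := by
      have h1 : ∫ Z in (0:ℝ)..Y, ((Real.exp (-a * Z) : ℝ) : ℂ) * γ Z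
          = ∫ Z in (0:ℝ)..Y, ((Real.exp (-a * Z) : ℝ) : ℂ) * g Z := by
        rw [intervalIntegral.integral_of_le hY.le, intervalIntegral.integral_of_le hY.le]
        refine setIntegral_congr_fun measurableSet_Ioc fun Z hZ => ?_
        rw [γe Z hZ.1]
      simp only [hB]
      rw [h1, ← intervalIntegral.integral_Ioi_sub_Ioi ig hY.le, hb]
      ring
    simp only [e]
    rw [← integral_const_mul]
    refine setIntegral_congr_fun measurableSet_Ioi fun Z hZ => ?_
    have hZ' : Y < Z := hZ
    simp only [hp]
    rw [abs_of_nonpos (by linarith), ← mul_assoc, ← Complex.ofReal_mul, ← Real.exp_add]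
    ring_nf
  have m3 : MemL2 m := by simpa [hm] using memL2_exp ha
  have a0 : (a : ℂ) ≠ 0 := by exact_mod_cast ha.ne'
  refine ⟨fun Y => -(2 * (a : ℂ))⁻¹ * (m Y * A Y + p Y * B Y + σ * b * m Y),
    fun Y => -(1 / 2 : ℂ) * (-1 * (m Y * A Y) + p Y * B Y + -(σ * b) * m Y),
    ⟨?_, ?_, ?_, ?_, ?_, ?_, hg⟩, fun h => ?_, fun h => ?_⟩
  · refine (((d1.add d2).add (dm.const_mul (σ * b))).const_mul (-(2 * (a : ℂ))⁻¹)).congr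
      (fun _ _ => rfl) fun Y _ => ?_
    field_simp
    ring
  · refine ((((d1.const_mul (-1)).add d2).add (dm.const_mul (-(σ * b)))).const_mul
      (-(1 / 2 : ℂ))).congr (fun _ _ => rfl) fun Y _ => ?_
    field_simp
    ring
  · exact Continuous.continuousOn (by fun_prop)
  · exact Continuous.continuousOn (by fun_prop)
  · exact ((m1.add m2).add (m3.const_mul (σ * b))).const_mul (-(2 * (a : ℂ))⁻¹)
  · exact (((m1.const_mul (-1)).add m2).add (m3.const_mul (-(σ * b)))).const_mul (-(1 / 2 : ℂ))
  · have h0 : A 0 = 0 := by simp [hA]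
    have h1 : B 0 = b := by simp [hB]
    have h2 : m 0 = 1 := by simp [hm]
    have h3 : p 0 = 1 := by simp [hp]
    simp only [h0, h1, h2, h3]
    linear_combination (-(1 / 2 : ℂ) * b) * h
  · have h0 : A 0 = 0 := by simp [hA]
    have h1 : B 0 = b := by simp [hB]
    have h2 : m 0 = 1 := by simp [hm]
    have h3 : p 0 = 1 := by simp [hp]
    simp only [h0, h1, h2, h3]
    linear_combination (-(2 * (a : ℂ))⁻¹ * b) * h

/-! ### The method of continuity -/

/-- An operator with lower bound `c` stays invertible under perturbations of norm less than `c`. -/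
theorem isUnit_of_norm_sub_lt {E : Type*} [NormedAddCommGroup E] [NormedSpace ℂ E] [CompleteSpace E]
    {S T : E →L[ℂ] E} {c : ℝ} (hc : 0 < c) (hS : IsUnit S) (lower : ∀ v, c * ‖v‖ ≤ ‖S v‖)
    (h : ‖T - S‖ < c) : IsUnit T := by
  nontriviality (E →L[ℂ] E)
  obtain ⟨u, rfl⟩ := hS
  have hinv : ‖((u⁻¹ : (E →L[ℂ] E)ˣ) : E →L[ℂ] E)‖ ≤ c⁻¹ := by
    refine ContinuousLinearMap.opNorm_le_bound _ (by positivity) fun v => ?_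
    have h1 := lower (((u⁻¹ : (E →L[ℂ] E)ˣ) : E →L[ℂ] E) v)
    rw [← mul_apply_eq_comp, Units.mul_inv, one_apply_eq_self] at h1
    rwa [inv_mul_eq_div, le_div_iff₀ hc, mul_comm]
  have hpos : 0 < ‖((u⁻¹ : (E →L[ℂ] E)ˣ) : E →L[ℂ] E)‖ := Units.norm_pos _
  exact (u.ofNearby T (h.trans_le (by rwa [le_inv_comm₀ hc hpos]))).isUnit

theorem isUnit_of_path {E : Type*} [NormedAddCommGroup E] [NormedSpace ℂ E] [CompleteSpace E]
    {T : ℝ → E →L[ℂ] E} {s : Set ℝ} (hs : IsPreconnected s) (hT : Continuous T) {c : ℝ}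
    (hc : 0 < c) (lower : ∀ x ∈ s, ∀ v, c * ‖v‖ ≤ ‖T x v‖) {x y : ℝ} (hx : x ∈ s) (hy : y ∈ s)
    (h : IsUnit (T x)) : IsUnit (T y) := by
  have key : IsUnit (T x) ↔ IsUnit (T y) := by
    refine hs.induction₂ (fun x y => IsUnit (T x) ↔ IsUnit (T y)) (fun x hx => ?_)
      (fun _ _ _ _ _ _ h1 h2 => h1.trans h2) (fun _ _ _ _ h => h.symm) hx hy
    have h1 : ∀ᶠ y in 𝓝[s] x, ‖T y - T x‖ < c := by
      have : Tendsto (fun y => ‖T y - T x‖) (𝓝[s] x) (𝓝 ‖T x - T x‖) :=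
        ((hT.sub continuous_const).norm.tendsto x).mono_left nhdsWithin_le_nhds
      rw [sub_self, norm_zero] at this
      exact this.eventually (gt_mem_nhds hc)
    filter_upwards [h1, self_mem_nhdsWithin] with y hy hys
    exact ⟨fun h => isUnit_of_norm_sub_lt hc h (lower x hx) hy,
      fun h => isUnit_of_norm_sub_lt hc h (lower y hys) (by rwa [norm_sub_rev])⟩
  exact key.1 h

theorem norm_toLp {u : ℝ → ℂ} (hu : MemL2 u) : ‖hu.toLp u‖ = normL2 u := Lp.norm_toLp u hu

theorem normL2_eq_zero {u : ℝ → ℂ} (hu : MemL2 u) (h : normL2 u ≤ 0) : u =ᵐ[halfLine] 0 := by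
  have h0 : normL2 u = 0 := le_antisymm h (normL2_nonneg u)
  have h1 := (ENNReal.toReal_eq_zero_iff _).1 h0
  exact (eLpNorm_eq_zero_iff hu.1 (by norm_num)).1 (h1.resolve_right hu.2.ne)

/-- A total, linear and bounded relation between functions in `L²` is the graph of a bounded
operator. -/
theorem exists_clm_of_relation {R : (ℝ → ℂ) → (ℝ → ℂ) → Prop} {C : ℝ}
    (total : ∀ g, MemL2 g → ∃ u, R g u) (mem : ∀ {g u}, R g u → MemL2 u)
    (add : ∀ {g u g' u'}, R g u → R g' u' → R (g + g') (u + u'))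
    (smul : ∀ {g u} (c : ℂ), R g u → R (c • g) (c • u))
    (bound : ∀ {g u}, R g u → normL2 u ≤ C * normL2 g) :
    ∃ T : Lp ℂ 2 halfLine →L[ℂ] Lp ℂ 2 halfLine, ∀ {g u} (hg : MemL2 g) (hu : MemL2 u),
      R g u → T (hg.toLp g) = hu.toLp u := by
  have uniq : ∀ {g g' u u'}, R g u → R g' u' → g =ᵐ[halfLine] g' → u =ᵐ[halfLine] u' := by
    intro g g' u u' h h' e
    have h1 := add h (smul (-1) h')
    have h2 : normL2 (g + (-1 : ℂ) • g') = 0 := by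
      have : g + (-1 : ℂ) • g' =ᵐ[halfLine] 0 := by
        filter_upwards [e] with Y hY; simp [hY]
      rw [normL2_congr this]; simp [normL2]
    have h3 := bound h1
    rw [h2, mul_zero] at h3
    replace h3 := normL2_eq_zero (mem h1) h3
    filter_upwards [h3] with Y hY
    have : u Y + -u' Y = 0 := by simpa using hY
    linear_combination this
  choose F hF using fun G : Lp ℂ 2 halfLine => total G (Lp.memLp G)
  let L : Lp ℂ 2 halfLine →ₗ[ℂ] Lp ℂ 2 halfLine :=
    { toFun := fun G => (mem (hF G)).toLp (F G)
      map_add' := fun G G' => by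
        rw [← MemLp.toLp_add]
        refine MemLp.toLp_congr _ _ (uniq (hF (G + G')) (add (hF G) (hF G')) (Lp.coeFn_add G G'))
      map_smul' := fun c G => by
        rw [RingHom.id_apply, ← MemLp.toLp_const_smul]
        exact MemLp.toLp_congr _ _ (uniq (hF (c • G)) (smul c (hF G)) (Lp.coeFn_smul c G)) }
  refine ⟨L.mkContinuous C fun G => ?_, fun {g u} hg hu h => ?_⟩
  · change ‖(mem (hF G)).toLp (F G)‖ ≤ C * ‖G‖
    rw [norm_toLp]
    exact bound (hF G)
  · change (mem (hF (hg.toLp g))).toLp _ = _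
    exact MemLp.toLp_congr _ _ (uniq (hF _) h hg.coeFn_toLp)

/-! ### Linear combinations of solutions -/

namespace HelmholtzTriple

variable {a : ℝ} {u u₁ g u' u₁' g' : ℝ → ℂ}

theorem add (h : HelmholtzTriple a u u₁ g) (h' : HelmholtzTriple a u' u₁' g') :
    HelmholtzTriple a (u + u') (u₁ + u₁') (g + g') :=
  ⟨h.d.add h'.d, (h.d₁.add h'.d₁).congr (fun _ _ => rfl) fun Y _ => by
    simp only [Pi.add_apply]; ring, h.c.add h'.c, h.c₁.add h'.c₁, h.m.add h'.m, h.m₁.add h'.m₁,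
    h.mg.add h'.mg⟩

theorem smul (c : ℂ) (h : HelmholtzTriple a u u₁ g) :
    HelmholtzTriple a (c • u) (c • u₁) (c • g) :=
  ⟨h.d.const_mul c, (h.d₁.const_mul c).congr (fun _ _ => rfl) fun Y _ => by
    simp only [Pi.smul_apply, smul_eq_mul]; ring, h.c.const_smul c, h.c₁.const_smul c,
    h.m.const_smul c, h.m₁.const_smul c, h.mg.const_smul c⟩

theorem congr (h : HelmholtzTriple a u u₁ g) (hg : MemL2 g') (e : g =ᵐ[halfLine] g') :
    HelmholtzTriple a u u₁ g' :=
  ⟨h.d, h.d₁.congr_ae (by filter_upwards [e] with Y hY; rw [hY]), h.c, h.c₁, h.m, h.m₁, hg⟩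

theorem sub (h : HelmholtzTriple a u u₁ g) (h' : HelmholtzTriple a u' u₁' g') :
    HelmholtzTriple a (u - u') (u₁ - u₁') (g - g') := by
  simpa [sub_eq_add_neg] using h.add (h'.smul (-1))

end HelmholtzTriple

namespace OSSystem

variable {U U₁ U₂ : ℝ → ℝ} {K t ε a s : ℝ} {f φ φ₁ w w₁ h f' φ' φ₁' w' w₁' h' : ℝ → ℂ}

/-- The difference of two solutions, possibly for different factors `t`, `t'` of the stretching
term. -/
theorem sub {t' : ℝ} (S : OSSystem U U₂ t ε a f φ φ₁ w w₁ h)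
    (S' : OSSystem U U₂ t' ε a f' φ' φ₁' w' w₁' h') {k : ℝ → ℂ} (hk : MemL2 k)
    (e : ∀ Y, k Y = f Y - f' Y + ((t - t' : ℝ) : ℂ) * ((U₂ Y : ℂ) * φ' Y)) :
    OSSystem U U₂ t ε a k (φ - φ') (φ₁ - φ₁') (w - w') (w₁ - w₁') (h - h') where
  hφ := S.hφ.sub S'.hφ
  hw := S.hw.sub S'.hw
  φ_zero := by simp [S.φ_zero, S'.φ_zero]
  w₁_zero := by simp [S.w₁_zero, S'.w₁_zero]
  mf := hk
  eq := by
    filter_upwards [S.eq, S'.eq] with Y h1 h2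
    simp only [Pi.sub_apply]
    rw [e, ← h1, ← h2]
    push_cast
    ring

/-- The bound for `h` in terms of `w`. -/
theorem norm_h_le (S : OSSystem U U₂ t ε a f φ φ₁ w w₁ h) (hU : ProfileBounds U U₁ U₂ K)
    (ha : 0 < a) (hε : 0 < ε) (ht0 : 0 ≤ t) (ht1 : t ≤ 1) :
    ε * normL2 h ≤ normL2 f + K * (1 + (a ^ 2)⁻¹) * normL2 w := by
  have K0 := hU.K_pos
  set G : ℝ → ℂ := fun Y => (U Y : ℂ) * w Y - (t : ℂ) * (U₂ Y : ℂ) * φ Y with hG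
  have aG : AEStronglyMeasurable G halfLine :=
    (hU.aesm.mul S.hw.m.1).sub ((hU.aesm_deriv2.const_mul _).mul S.hφ.m.1)
  obtain ⟨mG, nG⟩ := memL2_and_normL2_le_add K0.le K0.le aG S.hw.m S.hφ.m (by
    refine ae_halfLine fun Y hp => (norm_sub_le _ _).trans (add_le_add ?_ ?_)
    · rw [norm_ofReal_mul (hU.pos hp).le]
      exact mul_le_mul_of_nonneg_right (hU.le Y hp) (norm_nonneg _)
    · rw [norm_mul, norm_mul, Complex.norm_real, Complex.norm_real, Real.norm_of_nonneg ht0,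
        Real.norm_eq_abs]
      refine mul_le_mul_of_nonneg_right ?_ (norm_nonneg _)
      calc t * |U₂ Y| ≤ 1 * K := mul_le_mul ht1 (hU.abs_deriv2_le hp) (abs_nonneg _) zero_le_one
        _ = K := one_mul K)
  have n2 : normL2 (fun Y => Complex.I * (ε : ℂ) * h Y) ≤ 1 * normL2 f + 1 * normL2 G := by
    refine (memL2_and_normL2_le_add zero_le_one zero_le_one (S.hw.mg.1.const_mul _) S.mf mG ?_).2
    filter_upwards [S.eq] with Y hY
    have e : Complex.I * (ε : ℂ) * h Y = f Y - G Y := by rw [← hY]; ring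
    rw [e, one_mul, one_mul]
    exact norm_sub_le _ _
  rw [normL2_const_mul, norm_mul, Complex.norm_I, one_mul, Complex.norm_real,
    Real.norm_of_nonneg hε.le] at n2
  have n3 := S.hφ.sq_mul_norm_le (by simp [S.φ_zero])
  have n4 : normL2 φ ≤ (a ^ 2)⁻¹ * normL2 w := by
    rw [inv_mul_eq_div, le_div_iff₀ (by positivity)]; linarith
  have n5 := mul_le_mul_of_nonneg_left n4 K0.le
  linarith

/-- Without the stretching term the equation for `w` is coercive. -/
theorem norm_w_le (S : OSSystem U U₂ 0 ε a f φ φ₁ w w₁ h) (hU : ProfileBounds U U₁ U₂ K)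
    (hε : 0 < ε) : ε * a ^ 2 * normL2 w ≤ normL2 f := by
  have key := S.tested hU Weight.one.locAC (by simpa using aestronglyMeasurable_const)
    (B := 1) (B' := 0) (fun _ _ => by simp) (fun _ _ => by simp)
  simp only [Complex.ofReal_one, one_mul, Complex.ofReal_zero, zero_mul, integral_zero, mul_zero,
    add_zero] at key
  have e1 : ∫ Y, (U Y : ℂ) * w Y * conj (w Y) ∂halfLine
      = ((normL2 (fun Y => ((√(U Y) : ℝ) : ℂ) * w Y) ^ 2 : ℝ) : ℂ) := by
    rw [← integral_weight_sq (ρ := fun Y => √(U Y)) (hU.memL2_sqrt_mul S.hw.m)]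
    exact integral_congr_ae (ae_halfLine fun Y hY => by
      simp only; rw [Real.sq_sqrt (hU.pos hY).le])
  rw [e1, integral_mul_conj S.hw.m₁, integral_mul_conj S.hw.m] at key
  have im := congrArg Complex.im key
  have e2 : ((normL2 (fun Y => ((√(U Y) : ℝ) : ℂ) * w Y) ^ 2 : ℝ) : ℂ) - Complex.I * ε
      * (((normL2 w₁ ^ 2 : ℝ) : ℂ) + (a : ℂ) ^ 2 * ((normL2 w ^ 2 : ℝ) : ℂ))
      = ((normL2 (fun Y => ((√(U Y) : ℝ) : ℂ) * w Y) ^ 2 : ℝ) : ℂ)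
        - ((ε * (normL2 w₁ ^ 2 + a ^ 2 * normL2 w ^ 2) : ℝ) : ℂ) * Complex.I := by
    push_cast; ring
  rw [e2, Complex.sub_im, Complex.ofReal_im, Complex.im_ofReal_mul, Complex.I_im, mul_one] at im
  have n1 := (Complex.abs_im_le_norm _).trans (norm_integral_mul_conj_le S.mf S.hw.m)
  rw [← im, zero_sub, abs_neg] at n1
  have n2 := (le_abs_self _).trans n1
  have h0 : 0 ≤ ε * a ^ 2 := by positivity
  rcases (normL2_nonneg w).eq_or_lt with hw | hw
  · rw [← hw, mul_zero]; exact normL2_nonneg f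
  · refine le_of_mul_le_mul_right ?_ hw
    have : 0 ≤ ε * normL2 w₁ ^ 2 := by positivity
    linarith

end OSSystem

/-! ### Existence for the Orr--Sommerfeld system -/

/-- `w` is the Neumann solution for the datum `h`, and `φ` the Dirichlet solution for the datum
`w`. -/
structure Reconstruction (a : ℝ) (φ φ₁ w w₁ h : ℝ → ℂ) : Prop where
  hφ : HelmholtzTriple a φ φ₁ w
  hw : HelmholtzTriple a w w₁ h
  φ_zero : φ 0 = 0
  w₁_zero : w₁ 0 = 0

namespace Reconstruction

variable {a : ℝ} {φ φ₁ w w₁ h φ' φ₁' w' w₁' h' : ℝ → ℂ}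

theorem exists_of_memL2 (ha : 0 < a) (hh : MemL2 h) : ∃ φ φ₁ w w₁, Reconstruction a φ φ₁ w w₁ h := by
  obtain ⟨w, w₁, hw, hn, -⟩ := exists_helmholtzTriple ha hh 1
  obtain ⟨φ, φ₁, hφ, -, hd⟩ := exists_helmholtzTriple ha hw.m (-1)
  exact ⟨φ, φ₁, w, w₁, hφ, hw, hd (by ring), hn (by ring)⟩

theorem add (R : Reconstruction a φ φ₁ w w₁ h) (R' : Reconstruction a φ' φ₁' w' w₁' h') :
    Reconstruction a (φ + φ') (φ₁ + φ₁') (w + w') (w₁ + w₁') (h + h') :=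
  ⟨R.hφ.add R'.hφ, R.hw.add R'.hw, by simp [R.φ_zero, R'.φ_zero], by simp [R.w₁_zero, R'.w₁_zero]⟩

theorem smul (c : ℂ) (R : Reconstruction a φ φ₁ w w₁ h) :
    Reconstruction a (c • φ) (c • φ₁) (c • w) (c • w₁) (c • h) :=
  ⟨R.hφ.smul c, R.hw.smul c, by simp [R.φ_zero], by simp [R.w₁_zero]⟩

theorem norm_w_le (ha : 0 < a) (R : Reconstruction a φ φ₁ w w₁ h) :
    normL2 w ≤ (a ^ 2)⁻¹ * normL2 h := by
  rw [inv_mul_eq_div, le_div_iff₀ (by positivity), mul_comm]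
  exact R.hw.sq_mul_norm_le (by simp [R.w₁_zero])

theorem norm_φ_le (ha : 0 < a) (R : Reconstruction a φ φ₁ w w₁ h) :
    normL2 φ ≤ (a ^ 2)⁻¹ * normL2 w := by
  rw [inv_mul_eq_div, le_div_iff₀ (by positivity), mul_comm]
  exact R.hφ.sq_mul_norm_le (by simp [R.φ_zero])

end Reconstruction

section operator

variable {U U₁ U₂ : ℝ → ℝ} {K a : ℝ}

/-- The maps `h ↦ U w` and `h ↦ U'' φ` are bounded operators on `L²`. -/
theorem exists_operators (hU : ProfileBounds U U₁ U₂ K) (ha : 0 < a) :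
    ∃ A B : Lp ℂ 2 halfLine →L[ℂ] Lp ℂ 2 halfLine, ∀ {φ φ₁ w w₁ h : ℝ → ℂ},
      Reconstruction a φ φ₁ w w₁ h → ∀ (hh : MemL2 h) (h1 : MemL2 (fun Y => (U Y : ℂ) * w Y))
        (h2 : MemL2 (fun Y => (U₂ Y : ℂ) * φ Y)),
        A (hh.toLp h) = h1.toLp _ ∧ B (hh.toLp h) = h2.toLp _ := by
  have K0 := hU.K_pos
  have bw : ∀ {w : ℝ → ℂ}, MemL2 w → normL2 (fun Y => (U Y : ℂ) * w Y) ≤ K * normL2 w :=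
    fun hw => normL2_le_of_le K0.le hw fun Y hY => by
      rw [norm_ofReal_mul (hU.pos hY).le]
      exact mul_le_mul_of_nonneg_right (hU.le Y hY) (norm_nonneg _)
  have kφ : ∀ (φ : ℝ → ℂ) (Y : ℝ), 0 < Y → ‖(U₂ Y : ℂ) * φ Y‖ ≤ K * ‖φ Y‖ := fun φ Y hY => by
    rw [norm_mul, Complex.norm_real, Real.norm_eq_abs]
    exact mul_le_mul_of_nonneg_right (hU.abs_deriv2_le hY) (norm_nonneg _)
  obtain ⟨A, hA⟩ := exists_clm_of_relation (C := K * (a ^ 2)⁻¹)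
    (R := fun h u => ∃ φ φ₁ w w₁, Reconstruction a φ φ₁ w w₁ h ∧ u = fun Y => (U Y : ℂ) * w Y)
    (fun g hg => by
      obtain ⟨φ, φ₁, w, w₁, R⟩ := Reconstruction.exists_of_memL2 ha hg
      exact ⟨_, φ, φ₁, w, w₁, R, rfl⟩)
    (by rintro g u ⟨φ, φ₁, w, w₁, R, rfl⟩; exact hU.memL2_mul R.hw.m)
    (by
      rintro g u g' u' ⟨φ, φ₁, w, w₁, R, rfl⟩ ⟨φ', φ₁', w', w₁', R', rfl⟩
      exact ⟨_, _, _, _, R.add R', by ext Y; simp only [Pi.add_apply]; ring⟩)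
    (by
      rintro g u c ⟨φ, φ₁, w, w₁, R, rfl⟩
      exact ⟨_, _, _, _, R.smul c, by ext Y; simp only [Pi.smul_apply, smul_eq_mul]; ring⟩)
    (by
      rintro g u ⟨φ, φ₁, w, w₁, R, rfl⟩
      refine (bw R.hw.m).trans ?_
      rw [mul_assoc]
      exact mul_le_mul_of_nonneg_left (R.norm_w_le ha) K0.le)
  obtain ⟨B, hB⟩ := exists_clm_of_relation (C := K * ((a ^ 2)⁻¹ * (a ^ 2)⁻¹))
    (R := fun h u => ∃ φ φ₁ w w₁, Reconstruction a φ φ₁ w w₁ h ∧ u = fun Y => (U₂ Y : ℂ) * φ Y)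
    (fun g hg => by
      obtain ⟨φ, φ₁, w, w₁, R⟩ := Reconstruction.exists_of_memL2 ha hg
      exact ⟨_, φ, φ₁, w, w₁, R, rfl⟩)
    (by
      rintro g u ⟨φ, φ₁, w, w₁, R, rfl⟩
      exact R.hφ.m.of_le (hU.aesm_deriv2.mul R.hφ.m.1) (kφ φ))
    (by
      rintro g u g' u' ⟨φ, φ₁, w, w₁, R, rfl⟩ ⟨φ', φ₁', w', w₁', R', rfl⟩
      exact ⟨_, _, _, _, R.add R', by ext Y; simp only [Pi.add_apply]; ring⟩)
    (by
      rintro g u c ⟨φ, φ₁, w, w₁, R, rfl⟩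
      exact ⟨_, _, _, _, R.smul c, by ext Y; simp only [Pi.smul_apply, smul_eq_mul]; ring⟩)
    (by
      rintro g u ⟨φ, φ₁, w, w₁, R, rfl⟩
      refine (normL2_le_of_le K0.le R.hφ.m (kφ φ)).trans ?_
      rw [mul_assoc, mul_assoc]
      refine mul_le_mul_of_nonneg_left ((R.norm_φ_le ha).trans ?_) K0.le
      exact mul_le_mul_of_nonneg_left (R.norm_w_le ha) (by positivity))
  exact ⟨A, B, fun {φ φ₁ w w₁ h} R hh h1 h2 =>
    ⟨hA hh h1 ⟨φ, φ₁, w, w₁, R, rfl⟩, hB hh h2 ⟨φ, φ₁, w, w₁, R, rfl⟩⟩⟩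

/-- The system is governed by a family of bounded operators on `L²`, acting on `h`: it is solvable
for all data where the operator is invertible, and a bound for all solutions is a lower bound for
the operator. -/
theorem exists_system_operator (hU : ProfileBounds U U₁ U₂ K) (ha : 0 < a) :
    ∃ T : ℝ → ℝ → Lp ℂ 2 halfLine →L[ℂ] Lp ℂ 2 halfLine,
      (Continuous fun p : ℝ × ℝ => T p.1 p.2) ∧
      (∀ ε₀ : ℝ, ∃ ε ≥ ε₀, IsUnit (T 0 ε)) ∧
      (∀ t ε, IsUnit (T t ε) → ∀ f, MemL2 f →
        ∃ φ φ₁ w w₁ h, OSSystem U U₂ t ε a f φ φ₁ w w₁ h) ∧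
      (∀ t ε c, (∀ f φ φ₁ w w₁ h, OSSystem U U₂ t ε a f φ φ₁ w w₁ h →
        c * normL2 h ≤ normL2 f) → ∀ v, c * ‖v‖ ≤ ‖T t ε v‖) := by
  obtain ⟨A, B, hAB⟩ := exists_operators hU ha
  have solve : ∀ t ε : ℝ, ∀ v : Lp ℂ 2 halfLine, ∃ φ φ₁ w w₁, OSSystem U U₂ t ε a
      ((A - (t : ℂ) • B + (Complex.I * ε) • 1 : Lp ℂ 2 halfLine →L[ℂ] Lp ℂ 2 halfLine) v)
      φ φ₁ w w₁ v := by
    intro t ε v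
    obtain ⟨φ, φ₁, w, w₁, R⟩ := Reconstruction.exists_of_memL2 ha (Lp.memLp v)
    have h1 := hU.memL2_mul R.hw.m
    have h2 : MemL2 (fun Y => (U₂ Y : ℂ) * φ Y) :=
      R.hφ.m.of_le (C := K) (hU.aesm_deriv2.mul R.hφ.m.1) fun Y hY => by
        rw [norm_mul, Complex.norm_real, Real.norm_eq_abs]
        exact mul_le_mul_of_nonneg_right (hU.abs_deriv2_le hY) (norm_nonneg _)
    obtain ⟨e1, e2⟩ := hAB R (Lp.memLp v) h1 h2
    rw [Lp.toLp_coeFn] at e1 e2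
    refine ⟨φ, φ₁, w, w₁, R.hφ, R.hw, R.φ_zero, R.w₁_zero, Lp.memLp _, ?_⟩
    have e3 : (A - (t : ℂ) • B + (Complex.I * ε) • 1 : Lp ℂ 2 halfLine →L[ℂ] Lp ℂ 2 halfLine) v
        = h1.toLp _ - (t : ℂ) • h2.toLp _ + (Complex.I * (ε : ℂ)) • v := by
      rw [← e1, ← e2]; rfl
    rw [e3]
    filter_upwards [Lp.coeFn_add (h1.toLp _ - (t : ℂ) • h2.toLp _) ((Complex.I * (ε : ℂ)) • v),
      Lp.coeFn_sub (h1.toLp _) ((t : ℂ) • h2.toLp _), Lp.coeFn_smul (t : ℂ) (h2.toLp _),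
      Lp.coeFn_smul (Complex.I * (ε : ℂ)) v, h1.coeFn_toLp, h2.coeFn_toLp] with Y k1 k2 k3 k4 k5 k6
    rw [k1, Pi.add_apply, k2, Pi.sub_apply, k3, Pi.smul_apply, k4, Pi.smul_apply, k5, k6]
    simp only [smul_eq_mul]
    ring
  refine ⟨fun t ε => A - (t : ℂ) • B + (Complex.I * ε) • 1, ?_, fun ε₀ => ?_, ?_, ?_⟩
  · fun_prop
  · set ε := max ε₀ 0 + ‖A‖ + 1 with hε
    have hε0 : 0 < ε := by
      have := norm_nonneg A
      have := le_max_right ε₀ 0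
      linarith
    refine ⟨ε, ?_, isUnit_of_norm_sub_lt (S := (Complex.I * (ε : ℂ)) • 1) hε0 ?_ ?_ ?_⟩
    · have := norm_nonneg A
      have := le_max_left ε₀ 0
      rw [ge_iff_le]; linarith
    · have : (Complex.I * (ε : ℂ)) ≠ 0 :=
        mul_ne_zero Complex.I_ne_zero (by exact_mod_cast hε0.ne')
      exact (Units.mk0 _ this • (1 : (Lp ℂ 2 halfLine →L[ℂ] Lp ℂ 2 halfLine)ˣ)).isUnit
    · intro v
      have : ((Complex.I * (ε : ℂ)) • (1 : Lp ℂ 2 halfLine →L[ℂ] Lp ℂ 2 halfLine)) v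
          = (Complex.I * (ε : ℂ)) • v := rfl
      rw [this, norm_smul, norm_mul, Complex.norm_I, one_mul, Complex.norm_real,
        Real.norm_of_nonneg hε0.le]
    · have : A - ((0 : ℝ) : ℂ) • B + (Complex.I * ε) • 1
          - (Complex.I * (ε : ℂ)) • (1 : Lp ℂ 2 halfLine →L[ℂ] Lp ℂ 2 halfLine) = A := by
        simp
      rw [this]
      have := le_max_right ε₀ 0
      linarith
  · intro t ε hT f hf
    obtain ⟨u, hu⟩ := hT
    set v := ((u⁻¹ : (Lp ℂ 2 halfLine →L[ℂ] Lp ℂ 2 halfLine)ˣ) :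
      Lp ℂ 2 halfLine →L[ℂ] Lp ℂ 2 halfLine) (hf.toLp f) with hv
    obtain ⟨φ, φ₁, w, w₁, S⟩ := solve t ε v
    have hu' : (u : Lp ℂ 2 halfLine →L[ℂ] Lp ℂ 2 halfLine)
        = A - (t : ℂ) • B + (Complex.I * ε) • 1 := hu
    have e : (A - (t : ℂ) • B + (Complex.I * ε) • 1 : Lp ℂ 2 halfLine →L[ℂ] Lp ℂ 2 halfLine) v
        = hf.toLp f := by
      rw [← hu', hv, ← mul_apply_eq_comp, Units.mul_inv, one_apply_eq_self]
    rw [e] at S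
    refine ⟨φ, φ₁, w, w₁, v, S.hφ, S.hw, S.φ_zero, S.w₁_zero, hf, ?_⟩
    filter_upwards [S.eq, hf.coeFn_toLp] with Y h1 h2
    rw [h1, h2]
  · intro t ε c lower v
    obtain ⟨φ, φ₁, w, w₁, S⟩ := solve t ε v
    exact lower _ _ _ _ _ _ S

end operator

/-- Existence for the Orr--Sommerfeld system for all small `ε = s⁶`. The method of continuity leads
from large `ε` without stretching term to the given `ε` without stretching term, then, at a very
small `ε`, to the full stretching term, and finally back to the given `ε`. -/
theorem exists_osSystem {U U₁ U₂ : ℝ → ℝ} {K C a s : ℝ} (hU : ProfileBounds U U₁ U₂ K) (ha : 0 < a)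
    (hs : 0 < s) (hC : 1 ≤ C) (hCs : C * s ≤ 1)
    (apriori : ∀ {s : ℝ} {f φ φ₁ w w₁ h : ℝ → ℂ},
      OSSystem U U₂ 1 (s ^ 6) a f φ φ₁ w w₁ h → 0 < s → C * s ≤ 1 → MemL2 (weighted 2 f) →
      s ^ 2 * normL2 w ≤ C * (normL2 (weighted 2 f) + ‖∫ Y, f Y ∂halfLine‖ / a ^ 2))
    {f : ℝ → ℂ} (hf : MemL2 f) :
    ∃ φ φ₁ w w₁ h, OSSystem U U₂ 1 (s ^ 6) a f φ φ₁ w w₁ h := by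
  have hK := hU.one_le
  have K0 := hU.K_pos
  obtain ⟨T, cT, large, solve, lower⟩ := exists_system_operator hU ha
  -- no stretching, all positive `ε`
  have unit0 : ∀ ε : ℝ, 0 < ε → IsUnit (T 0 ε) := by
    intro ε hε
    obtain ⟨E, hE, hu⟩ := large ε
    set c := ε / (1 + K * (1 + (a ^ 2)⁻¹) * (ε * a ^ 2)⁻¹) with hc
    have hc0 : 0 < c := by positivity
    refine isUnit_of_path (T := fun x => T 0 x) (s := Ici ε) isPreconnected_Ici
      (cT.comp (by fun_prop : Continuous fun x : ℝ => ((0 : ℝ), x))) hc0 (fun x hx => ?_) hE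
      self_mem_Ici hu
    have hx0 : 0 < x := hε.trans_le hx
    refine lower 0 x c fun f φ φ₁ w w₁ h S => ?_
    have h1 := S.norm_h_le hU ha hx0 le_rfl zero_le_one
    have h2 := S.norm_w_le hU hx0
    have h3 : normL2 w ≤ (ε * a ^ 2)⁻¹ * normL2 f := by
      rw [inv_mul_eq_div, le_div_iff₀ (by positivity)]
      refine le_trans ?_ h2
      rw [mul_comm]
      have := normL2_nonneg w
      have : ε ≤ x := hx
      gcongr
    have h4 : ε * normL2 h ≤ (1 + K * (1 + (a ^ 2)⁻¹) * (ε * a ^ 2)⁻¹) * normL2 f := by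
      have := normL2_nonneg h
      have : ε ≤ x := hx
      calc ε * normL2 h ≤ x * normL2 h := by gcongr
        _ ≤ normL2 f + K * (1 + (a ^ 2)⁻¹) * ((ε * a ^ 2)⁻¹ * normL2 f) := h1.trans (by gcongr)
        _ = _ := by ring
    rw [hc, div_mul_eq_mul_div, div_le_iff₀ (by positivity)]
    linarith
  -- the full stretching term, at a very small viscosity
  set L := 4000 * K ^ 9 * (1 + (a ^ 2)⁻¹) ^ 2 with hL
  have L0 : 0 < L := by positivity
  have LK : 64 * K ≤ L := by
    have h1 : K ≤ K ^ 9 := le_self_pow₀ hK (by norm_num)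
    have h2 : (1 : ℝ) ≤ (1 + (a ^ 2)⁻¹) ^ 2 :=
      one_le_pow₀ (by have : 0 ≤ (a ^ 2)⁻¹ := by positivity
                      linarith)
    calc 64 * K ≤ 4000 * K ^ 9 * 1 := by linarith
      _ ≤ L := by rw [hL]; gcongr
  have unit1 : ∀ r : ℝ, 0 < r → L * r ≤ 1 → IsUnit (T 1 (r ^ 6)) := by
    intro r hr hLr
    have hr1 : r ≤ 1 := by nlinarith
    have hr2 : 64 * K * r ^ 2 ≤ 1 := by
      have : 64 * K * r ≤ 1 := le_trans (by gcongr) hLr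
      nlinarith
    set M := 64 * K ^ 3 * (1 + r * L) / r ^ 2 with hM
    set c := r ^ 6 / (1 + K * (1 + (a ^ 2)⁻¹) * M) with hc
    have hc0 : 0 < c := by positivity
    refine isUnit_of_path (T := fun x => T x (r ^ 6)) (s := Icc 0 1) isPreconnected_Icc
      (cT.comp (by fun_prop : Continuous fun x : ℝ => (x, r ^ 6))) hc0 (fun x hx => ?_)
      (left_mem_Icc.2 zero_le_one) (right_mem_Icc.2 zero_le_one) (unit0 _ (by positivity))
    refine lower x _ c fun f φ φ₁ w w₁ h S => ?_
    have F0 := normL2_nonneg f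
    have h1 := S.norm_h_le hU ha (by positivity) hx.1 hx.2
    have h2 := S.energy_estimate hU hx.1 hx.2 ha hr hLr
    have w0 : ∀ g : ℝ → ℂ, weighted 0 g = g := fun g => by ext Y; simp [weighted]
    obtain ⟨-, -, h3, -⟩ := S.weighted_estimate hU hx.1 hx.2 ha hr hr1 hr2 (k := 0) (by norm_num)
      (by rw [w0]; exact S.mf)
    rw [w0, w0] at h3
    have aφ := mul_nonneg ha.le (normL2_nonneg φ)
    have h4 : normL2 φ₁ ≤ L * normL2 f := by linarith
    have h5 : normL2 w ≤ M * normL2 f := by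
      rw [hM, div_mul_eq_mul_div, le_div_iff₀ (by positivity), mul_comm]
      refine h3.trans ?_
      calc 64 * K ^ 3 * (normL2 f + r * normL2 φ₁)
          ≤ 64 * K ^ 3 * (normL2 f + r * (L * normL2 f)) := by gcongr
        _ = _ := by ring
    have h6 : r ^ 6 * normL2 h ≤ (1 + K * (1 + (a ^ 2)⁻¹) * M) * normL2 f := by
      refine h1.trans ?_
      calc normL2 f + K * (1 + (a ^ 2)⁻¹) * normL2 w
          ≤ normL2 f + K * (1 + (a ^ 2)⁻¹) * (M * normL2 f) := by gcongr
        _ = _ := by ring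
    rw [hc, div_mul_eq_mul_div, div_le_iff₀ (by positivity)]
    linarith
  -- back to the given viscosity; the assumption `C s ≤ 1` of the a priori estimate, unlike
  -- `L r ≤ 1`, does not involve `a`
  set r := min s L⁻¹ with hr
  have hr0 : 0 < r := lt_min hs (by positivity)
  have hrs : r ≤ s := min_le_left _ _
  have hLr : L * r ≤ 1 := by
    calc L * r ≤ L * L⁻¹ := by gcongr; exact min_le_right _ _
      _ = 1 := mul_inv_cancel₀ L0.ne'
  set κ := 1 + normL2 invWeight / a ^ 2 with hκ
  have κ0 : 0 < κ := by have := normL2_nonneg invWeight; positivity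
  set M := (r ^ 6 * a ^ 2)⁻¹ + C * (2 * K * κ * (a⁻¹ * (r ^ 6 * a ^ 2)⁻¹)) / r ^ 2 with hM
  set c := r ^ 6 / (1 + K * (1 + (a ^ 2)⁻¹) * M) with hc
  have hc0 : 0 < c := by positivity
  refine solve 1 (s ^ 6) ?_ f hf
  refine isUnit_of_path (T := fun x => T 1 (x ^ 6)) (s := Icc r s) isPreconnected_Icc
    (cT.comp (by fun_prop : Continuous fun x : ℝ => ((1 : ℝ), x ^ 6))) hc0 (fun x hx => ?_)
    (left_mem_Icc.2 hrs) (right_mem_Icc.2 hrs) (unit1 r hr0 hLr)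
  have hx0 : 0 < x := hr0.trans_le hx.1
  have hx6 : r ^ 6 ≤ x ^ 6 := pow_le_pow_left₀ hr0.le hx.1 6
  refine lower 1 _ c fun f φ φ₁ w w₁ h S => ?_
  have F0 := normL2_nonneg f
  -- The a priori estimate needs a weighted source. The solution without stretching term takes up
  -- the source `f`; the difference has the source `U'' φ'`, which decays.
  obtain ⟨φ', φ₁', w', w₁', h', S'⟩ := solve 0 (x ^ 6) (unit0 _ (by positivity)) f S.mf
  obtain ⟨mg, ng⟩ := S'.memL2_weighted_stretching hU
  have D := S.sub S' (S'.memL2_stretching hU) fun Y => by push_cast; ring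
  have n1 := apriori D hx0 (le_trans (by have := hx.2; gcongr) hCs) mg
  obtain ⟨-, ni⟩ := integrable_of_weighted (S'.memL2_stretching hU).1 mg
  have n2 : normL2 w' ≤ (r ^ 6 * a ^ 2)⁻¹ * normL2 f := by
    rw [inv_mul_eq_div, le_div_iff₀ (by positivity), mul_comm]
    refine le_trans ?_ (S'.norm_w_le hU (by positivity))
    have := normL2_nonneg w'
    gcongr
  have n3 : normL2 φ₁' ≤ a⁻¹ * normL2 w' := by
    have h1 := S'.hφ.energy_le (by simp [S'.φ_zero])
    have h2 := S'.hφ.sq_mul_norm_le (by simp [S'.φ_zero])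
    have W0 := normL2_nonneg w'
    have h3 : (a * normL2 φ₁') ^ 2 ≤ normL2 w' ^ 2 := by
      have h4 : a ^ 2 * (normL2 w' * normL2 φ') ≤ normL2 w' * normL2 w' := by
        calc a ^ 2 * (normL2 w' * normL2 φ') = normL2 w' * (a ^ 2 * normL2 φ') := by ring
          _ ≤ _ := by gcongr
      have h5 : 0 ≤ a ^ 2 * (a ^ 2 * normL2 φ' ^ 2) := by positivity
      have h6 := mul_le_mul_of_nonneg_left h1 (sq_nonneg a)
      linarith
    rw [inv_mul_eq_div, le_div_iff₀ ha, mul_comm]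
    exact (sq_le_sq₀ (mul_nonneg ha.le (normL2_nonneg _)) W0).1 h3
  have n4 : r ^ 2 * normL2 (w - w')
      ≤ C * (2 * K * κ * (a⁻¹ * (r ^ 6 * a ^ 2)⁻¹)) * normL2 f := by
    have W0 := normL2_nonneg (w - w')
    have hx2 : r ^ 2 ≤ x ^ 2 := pow_le_pow_left₀ hr0.le hx.1 2
    have h1 : normL2 (weighted 2 fun Y => (U₂ Y : ℂ) * φ' Y)
        + ‖∫ Y, (U₂ Y : ℂ) * φ' Y ∂halfLine‖ / a ^ 2
        ≤ κ * normL2 (weighted 2 fun Y => (U₂ Y : ℂ) * φ' Y) := by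
      rw [hκ, add_mul, one_mul, div_mul_eq_mul_div]
      gcongr
    calc r ^ 2 * normL2 (w - w') ≤ x ^ 2 * normL2 (w - w') := by gcongr
      _ ≤ C * (κ * (2 * K * (a⁻¹ * ((r ^ 6 * a ^ 2)⁻¹ * normL2 f)))) := by
          refine n1.trans ?_
          have h2 := h1.trans (mul_le_mul_of_nonneg_left (ng.trans (mul_le_mul_of_nonneg_left
            (n3.trans (mul_le_mul_of_nonneg_left n2 (by positivity))) (by positivity))) κ0.le)
          exact mul_le_mul_of_nonneg_left h2 (by linarith)
      _ = _ := by ring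
  have n5 : normL2 w ≤ M * normL2 f := by
    have h1 := normL2_add_le (D.hw.m) (S'.hw.m)
    have e : (fun Y => (w - w') Y + w' Y) = w := by ext Y; simp
    rw [e] at h1
    have h2 : normL2 (w - w') ≤ C * (2 * K * κ * (a⁻¹ * (r ^ 6 * a ^ 2)⁻¹)) / r ^ 2 * normL2 f := by
      rw [div_mul_eq_mul_div, le_div_iff₀ (by positivity), mul_comm]
      exact n4
    rw [hM, add_mul]
    linarith
  have h1 := S.norm_h_le hU ha (by positivity) zero_le_one le_rfl
  have h6 : r ^ 6 * normL2 h ≤ (1 + K * (1 + (a ^ 2)⁻¹) * M) * normL2 f := by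
    have := normL2_nonneg h
    calc r ^ 6 * normL2 h ≤ x ^ 6 * normL2 h := by gcongr
      _ ≤ normL2 f + K * (1 + (a ^ 2)⁻¹) * normL2 w := h1
      _ ≤ normL2 f + K * (1 + (a ^ 2)⁻¹) * (M * normL2 f) := by gcongr
      _ = _ := by ring
  rw [hc, div_mul_eq_mul_div, div_le_iff₀ (by positivity)]
  linarith

/-! ### Weak derivatives and absolutely continuous representatives -/

theorem LocallyIntegrableOn.integrable_test_smul {u : ℝ → ℂ}
    (hu : LocallyIntegrableOn u (Ioi (0 : ℝ))) {ψ : ℝ → ℝ} (hψ : Continuous ψ)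
    (hc : HasCompactSupport ψ) (hs : tsupport ψ ⊆ Ioi (0 : ℝ)) :
    Integrable (fun Y => ψ Y • u Y) := by
  have hK : IntegrableOn (fun Y => ψ Y • u Y) (tsupport ψ) :=
    (hu.integrableOn_compact_subset hs hc).continuousOn_smul hψ.continuousOn hc
  refine (integrableOn_iff_integrable_of_support_subset fun Y hY => ?_).mp hK
  exact subset_tsupport ψ fun h0 => hY (by simp [h0])

/-- The support of a test function on `(0, ∞)` keeps a positive distance from `0`. -/
theorem exists_tsupport_subset_Icc {ψ : ℝ → ℝ} (hc : HasCompactSupport ψ)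
    (hs : tsupport ψ ⊆ Ioi (0 : ℝ)) : ∃ x y, 0 < x ∧ x ≤ y ∧ tsupport ψ ⊆ Icc x y := by
  rcases (tsupport ψ).eq_empty_or_nonempty with h | h
  · exact ⟨1, 1, one_pos, le_rfl, by simp [h]⟩
  · refine ⟨sInf (tsupport ψ), sSup (tsupport ψ), hs (hc.isCompact.sInf_mem h), ?_, ?_⟩
    · exact csInf_le hc.isCompact.bddBelow (hc.isCompact.sSup_mem h)
    · exact fun t ht => ⟨csInf_le hc.isCompact.bddBelow ht, le_csSup hc.isCompact.bddAbove ht⟩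

theorem LocAC.hasWeakDeriv {u v : ℝ → ℂ} (h : LocAC u v) : HasWeakDeriv u v where
  locInt := h.continuousOn.locallyIntegrableOn measurableSet_Ioi
  locInt_deriv := fun x hx => by
    have hx0 : 0 < x := hx
    refine ⟨Icc (x / 2) (2 * x), mem_nhdsWithin_of_mem_nhds
      (Icc_mem_nhds (by linarith) (by linarith)), ?_⟩
    exact (intervalIntegrable_iff_integrableOn_Icc_of_le (by linarith)).1
      (h.integrable (by linarith : 0 < x / 2) (by linarith))
  integral_eq := by
    intro ψ hψ hc hs
    have lv : LocallyIntegrableOn v (Ioi (0 : ℝ)) := fun x hx => by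
      have hx0 : 0 < x := hx
      refine ⟨Icc (x / 2) (2 * x), mem_nhdsWithin_of_mem_nhds
        (Icc_mem_nhds (by linarith) (by linarith)), ?_⟩
      exact (intervalIntegrable_iff_integrableOn_Icc_of_le (by linarith)).1
        (h.integrable (by linarith : 0 < x / 2) (by linarith))
    have lu : LocallyIntegrableOn u (Ioi (0 : ℝ)) :=
      h.continuousOn.locallyIntegrableOn measurableSet_Ioi
    have hψ1 : ContDiff ℝ 1 ψ := hψ.of_le (by exact_mod_cast le_top)
    have hd : Continuous (deriv ψ) := hψ1.continuous_deriv le_rfl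
    have i1 := (LocallyIntegrableOn.integrable_test_smul lu hd hc.deriv
      ((tsupport_deriv_subset).trans hs)).restrict (s := Ioi 0)
    have i2 := (LocallyIntegrableOn.integrable_test_smul lv hψ.continuous hc hs).restrict
      (s := Ioi 0)
    have i3 := (LocallyIntegrableOn.integrable_test_smul lu hψ.continuous hc hs).restrict
      (s := Ioi 0)
    simp only [Complex.real_smul] at i1 i2 i3 ⊢
    have lψ : LocAC (fun Y => (ψ Y : ℂ)) (fun Y => ((deriv ψ Y : ℝ) : ℂ)) :=
      LocAC.ofReal (fun Y _ => (hψ1.differentiable one_ne_zero Y).hasDerivAt) hd.continuousOn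
    obtain ⟨x, y, hx, -, hsub⟩ := exists_tsupport_subset_Icc hc hs
    have lim : Tendsto (fun Y => (ψ Y : ℂ) * u Y) (𝓝[>] 0) (𝓝 0) := by
      refine tendsto_const_nhds.congr' ?_
      filter_upwards [Ioo_mem_nhdsGT hx] with Y hY
      have : ψ Y = 0 := image_eq_zero_of_notMem_tsupport fun hm => absurd (hsub hm).1 (not_le.2 hY.2)
      simp [this]
    have := integral_add_eq_neg (lψ.mul h) i3 i1 i2 lim
    rw [this]
    ring

theorem HasWeakDeriv.congr {u v u' : ℝ → ℂ} (h : HasWeakDeriv u v) (e : u' =ᵐ[halfLine] u) :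
    HasWeakDeriv u' v where
  locInt := fun x hx => by
    obtain ⟨s, hs, hi⟩ := h.locInt x hx
    refine ⟨s ∩ Ioi 0, inter_mem hs self_mem_nhdsWithin, ?_⟩
    refine (hi.mono_set inter_subset_left).congr_fun_ae ?_
    exact ae_restrict_of_ae_restrict_of_subset inter_subset_right e.symm
  locInt_deriv := h.locInt_deriv
  integral_eq := fun ψ h1 h2 h3 => by
    rw [← h.integral_eq ψ h1 h2 h3]
    refine integral_congr_ae ?_
    filter_upwards [e] with Y hY
    rw [hY]

theorem LocAC.weakDeriv_ae_eq {u v u' : ℝ → ℂ} (h : LocAC u v) (e : u' =ᵐ[halfLine] u) :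
    weakDeriv u' =ᵐ[halfLine] v := by
  have h1 := h.hasWeakDeriv.congr e
  exact h1.hasWeakDeriv_weakDeriv.ae_eq h1

/-- A test function with integral one. -/
theorem exists_test_integral_one : ∃ ρ : ℝ → ℝ, ContDiff ℝ ∞ ρ ∧ HasCompactSupport ρ ∧
    tsupport ρ ⊆ Ioi (0 : ℝ) ∧ ∫ Y, ρ Y = 1 := by
  let b : ContDiffBump (2 : ℝ) := ⟨1 / 2, 1, by norm_num, by norm_num⟩
  refine ⟨b.normed volume, b.contDiff_normed, b.hasCompactSupport_normed, ?_, b.integral_normed⟩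
  rw [b.tsupport_normed_eq, Real.closedBall_eq_Icc]
  intro x hx
  have : (2 : ℝ) - 1 ≤ x := hx.1
  exact show (0 : ℝ) < x by linarith

/-- A test function with integral zero is the derivative of a test function. -/
theorem exists_test_primitive {g : ℝ → ℝ} (hg : ContDiff ℝ ∞ g) (hc : HasCompactSupport g)
    (hs : tsupport g ⊆ Ioi (0 : ℝ)) (h0 : ∫ Y, g Y = 0) :
    ∃ ψ : ℝ → ℝ, ContDiff ℝ ∞ ψ ∧ HasCompactSupport ψ ∧ tsupport ψ ⊆ Ioi (0 : ℝ) ∧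
      deriv ψ = g := by
  obtain ⟨x, y, hx, hxy, hsub⟩ := exists_tsupport_subset_Icc hc hs
  have zero : ∀ Y, Y ∉ Icc x y → g Y = 0 := fun Y hY =>
    image_eq_zero_of_notMem_tsupport fun hm => hY (hsub hm)
  set ψ : ℝ → ℝ := fun Y => ∫ Z in x..Y, g Z with hψ
  have hd : ∀ Y, HasDerivAt ψ (g Y) Y := fun Y =>
    intervalIntegral.integral_hasDerivAt_right (hg.continuous.intervalIntegrable _ _)
      hg.continuous.stronglyMeasurable.stronglyMeasurableAtFilter hg.continuous.continuousAt
  have hder : deriv ψ = g := funext fun Y => (hd Y).deriv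
  have supp : tsupport ψ ⊆ Icc x y := by
    refine closure_minimal (fun Y hY => ?_) isClosed_Icc
    by_contra hn
    refine hY ?_
    rcases not_and_or.1 hn with h | h
    · have hYx : Y < x := not_le.1 h
      simp only [hψ]
      rw [intervalIntegral.integral_symm, intervalIntegral.integral_of_le hYx.le,
        integral_Ioc_eq_integral_Ioo, setIntegral_eq_zero_of_forall_eq_zero, neg_zero]
      exact fun Z hZ => zero Z fun hm => absurd hm.1 (not_le.2 hZ.2)
    · have hyY : y < Y := not_le.1 h
      have hxY := hxy.trans hyY.le
      simp only [hψ]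
      rw [intervalIntegral.integral_of_le hxY, ← integral_Icc_eq_integral_Ioc,
        setIntegral_eq_integral_of_forall_compl_eq_zero, h0]
      exact fun Z hZ => zero Z fun hm => hZ ⟨hm.1, hm.2.trans hyY.le⟩
  refine ⟨ψ, contDiff_infty_iff_deriv.2 ⟨fun Y => (hd Y).differentiableAt, hder ▸ hg⟩,
    isCompact_Icc.of_isClosed_subset (isClosed_tsupport _) supp,
    supp.trans fun Z hZ => hx.trans_le hZ.1, hder⟩

/-- The lemma of du Bois-Reymond. -/
theorem HasWeakDeriv.exists_const {d : ℝ → ℂ} (h : HasWeakDeriv d 0) :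
    ∃ c : ℂ, d =ᵐ[halfLine] fun _ => c := by
  obtain ⟨ρ, ρ1, ρ2, ρ3, ρ4⟩ := exists_test_integral_one
  have full : ∀ {g : ℝ → ℝ} (u : ℝ → ℂ), tsupport g ⊆ Ioi (0 : ℝ) →
      ∫ Y in Ioi (0 : ℝ), g Y • u Y = ∫ Y, g Y • u Y := by
    intro g u hs
    refine setIntegral_eq_integral_of_forall_compl_eq_zero fun Y hY => ?_
    rw [image_eq_zero_of_notMem_tsupport fun hmem => hY (hs hmem), zero_smul]
  refine ⟨∫ Y, ρ Y • d Y, ?_⟩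
  set c := ∫ Y, ρ Y • d Y with hcdef
  have lc : LocallyIntegrableOn (fun _ : ℝ => c) (Ioi 0) :=
    continuousOn_const.locallyIntegrableOn measurableSet_Ioi
  have key : ∀ᵐ Y ∂(volume : Measure ℝ), Y ∈ Ioi (0 : ℝ) → (d - (fun _ => c : ℝ → ℂ)) Y = 0 := by
    refine isOpen_Ioi.ae_eq_zero_of_integral_contDiff_smul_eq_zero (h.locInt.sub lc) ?_
    intro g hg hc hs
    have hgc := hg.continuous.integrable_of_hasCompactSupport hc (μ := volume)
    have hρc := ρ1.continuous.integrable_of_hasCompactSupport ρ2 (μ := volume)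
    set m := ∫ Y, g Y with hm
    have sub : tsupport (fun Y => g Y - m * ρ Y) ⊆ tsupport g ∪ tsupport ρ := by
      refine (tsupport_sub _ _).trans (union_subset_union_right _ ?_)
      exact closure_mono (Function.support_mul_subset_right (fun _ => m) ρ)
    obtain ⟨ψ, p1, p2, p3, p4⟩ := exists_test_primitive (g := fun Y => g Y - m * ρ Y)
      (hg.sub (contDiff_const.mul ρ1)) (hc.sub ρ2.mul_left) (sub.trans (union_subset hs ρ3)) (by
        rw [integral_sub hgc (hρc.const_mul m), integral_const_mul, ρ4, mul_one, sub_self])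
    have e := h.integral_eq ψ p1 p2 p3
    have i1 := LocallyIntegrableOn.integrable_test_smul h.locInt hg.continuous hc hs
    have i2 := LocallyIntegrableOn.integrable_test_smul h.locInt ρ1.continuous ρ2 ρ3
    have i3 := LocallyIntegrableOn.integrable_test_smul lc hg.continuous hc hs
    rw [p4] at e
    simp only [Pi.zero_apply, smul_zero, integral_zero, neg_zero] at e
    rw [full (g := fun Y => g Y - m * ρ Y) d (sub.trans (union_subset hs ρ3))] at e
    have e2 : ∫ Y, (g Y - m * ρ Y) • d Y = (∫ Y, g Y • d Y) - (m : ℂ) * c := by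
      rw [hcdef, ← integral_const_mul, ← integral_sub i1 (i2.const_mul _)]
      refine integral_congr_ae (ae_of_all _ fun Y => ?_)
      simp only [Complex.real_smul]
      push_cast
      ring
    have e3 : ∫ Y, g Y • c = (m : ℂ) * c := by
      rw [integral_smul_const, Complex.real_smul]
    simp only [Pi.sub_apply, smul_sub]
    rw [integral_sub i1 i3, e3, ← e2, e]
  rw [Filter.EventuallyEq, ae_restrict_iff' measurableSet_Ioi]
  filter_upwards [key] with Y hY hm
  exact sub_eq_zero.mp (hY hm)

/-- A function with square integrable weak derivative has a representative that is absolutely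
continuous up to the boundary. -/
theorem HasWeakDeriv.exists_locAC {u v : ℝ → ℂ} (h : HasWeakDeriv u v) (hv : MemL2 v) :
    ∃ u' : ℝ → ℂ, u =ᵐ[halfLine] u' ∧ LocAC u' v ∧ ContinuousOn u' (Ici 0) := by
  have hi := hv.intervalIntegrable_indicator
  set V : ℝ → ℂ := fun Y => ∫ Z in (0 : ℝ)..Y, (Ioi (0 : ℝ)).indicator v Z with hV
  have dV : LocAC V v := (locAC_primitive hi).congr (fun _ _ => rfl) fun Y hY =>
    (indicator_of_mem (show Y ∈ Ioi (0 : ℝ) from hY) v).symm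
  have cV : Continuous V := intervalIntegral.continuous_primitive hi 0
  have wV := dV.hasWeakDeriv
  have wd : HasWeakDeriv (u - V) 0 :=
    { locInt := h.locInt.sub wV.locInt
      locInt_deriv := continuousOn_const.locallyIntegrableOn measurableSet_Ioi
      integral_eq := fun ψ h1 h2 h3 => by
        have hψ1 : ContDiff ℝ 1 ψ := h1.of_le (by exact_mod_cast le_top)
        have i : ∀ {f : ℝ → ℂ}, LocallyIntegrableOn f (Ioi (0 : ℝ)) →
            Integrable (fun Y => deriv ψ Y • f Y) halfLine := fun hf =>
          (LocallyIntegrableOn.integrable_test_smul hf (hψ1.continuous_deriv le_rfl) h2.deriv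
            ((tsupport_deriv_subset).trans h3)).restrict
        simp only [Pi.sub_apply, smul_sub, Pi.zero_apply, smul_zero, integral_zero, neg_zero]
        rw [integral_sub (i h.locInt) (i wV.locInt), h.integral_eq ψ h1 h2 h3,
          wV.integral_eq ψ h1 h2 h3, sub_self] }
  obtain ⟨c, hc⟩ := wd.exists_const
  have h0 : LocAC (fun _ => c) (fun _ => 0) := LocAC.of_hasDerivAt_continuousOn
    (fun Y _ => hasDerivAt_const Y c) continuousOn_const
  refine ⟨fun Y => V Y + c, ?_, (dV.add h0).congr (fun _ _ => rfl) fun Y _ => by simp,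
    (cV.add continuous_const).continuousOn⟩
  filter_upwards [hc] with Y hY
  rw [← hY, Pi.sub_apply]
  ring

/-- The boundary value can be read off from any representative that is continuous up to the wall. -/
theorem eq_of_hasBoundaryValue {u u' : ℝ → ℂ} {c : ℂ} (h : HasBoundaryValue u c)
    (hu' : ContinuousOn u' (Ici 0)) (e : u =ᵐ[halfLine] u') : u' 0 = c := by
  obtain ⟨v, hv, e', rfl⟩ := h
  have h1 : EqOn u' v (Ioi 0) := Measure.eqOn_open_of_ae_eq (μ := volume) (e.symm.trans e')
    isOpen_Ioi (hu'.mono Ioi_subset_Ici_self) (hv.mono Ioi_subset_Ici_self)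
  refine tendsto_nhds_unique (tendsto_of_continuousOn hu') ((tendsto_of_continuousOn hv).congr' ?_)
  filter_upwards [self_mem_nhdsWithin] with Y hY
  exact (h1 hY).symm

/-! ### Solutions of the equation and solutions of the first order system -/

theorem HelmholtzTriple.helmholtz_ae_eq {α a : ℝ} {u u' u₁ g : ℝ → ℂ}
    (H : HelmholtzTriple a u u₁ g) (hα : α ^ 2 = a ^ 2) (e : u' =ᵐ[halfLine] u) :
    helmholtz α u' =ᵐ[halfLine] g := by
  have hα' : (α : ℂ) ^ 2 = (a : ℂ) ^ 2 := by exact_mod_cast hα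
  filter_upwards [H.d₁.weakDeriv_ae_eq (H.d.weakDeriv_ae_eq e), e] with Y h1 h2
  rw [helmholtz, h1, h2, hα', add_sub_cancel_right]

/-- Regular representatives of the first two members of a chain of weak derivatives. -/
theorem exists_helmholtzTriple_of_hasWeakDeriv {u v z : ℝ → ℂ} (h : HasWeakDeriv u v)
    (h' : HasWeakDeriv v z) (mu : MemL2 u) (mv : MemL2 v) (mz : MemL2 z) (a : ℝ) :
    ∃ u' u₁ : ℝ → ℂ, u =ᵐ[halfLine] u' ∧
      HelmholtzTriple a u' u₁ (fun Y => z Y - (a : ℂ) ^ 2 * u' Y) := by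
  obtain ⟨u', e, d, c⟩ := h.exists_locAC mv
  obtain ⟨u₁, e₁, d₁, c₁⟩ := h'.exists_locAC mz
  have mu' : MemL2 u' := mu.ae_eq e
  exact ⟨u', u₁, e, d.congr_ae e₁, d₁.congr (fun _ _ => rfl) fun Y _ => by ring, c, c₁, mu',
    mv.ae_eq e₁, mz.sub (mu'.const_mul _)⟩

theorem IsSolution.exists_osSystem {U : ℝ → ℝ} {ε α a : ℝ} {f φ : ℝ → ℂ}
    (S : IsSolution U ε α f φ) (hα : α ^ 2 = a ^ 2) (hf : MemL2 f) :
    ∃ φ' φ₁ w w₁ h : ℝ → ℂ, φ =ᵐ[halfLine] φ' ∧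
      OSSystem U (profileDeriv (profileDeriv U)) 1 ε a f φ' φ₁ w w₁ h := by
  obtain ⟨m, v₁, d₁, m₁, v₂, d₂, m₂, v₃, d₃, m₃, v₄, d₄, m₄⟩ := S.memSobolev
  obtain ⟨φ', φ₁, e, H⟩ := exists_helmholtzTriple_of_hasWeakDeriv d₁ d₂ m m₁ m₂ a
  obtain ⟨p, p₁, ep, Hp⟩ := exists_helmholtzTriple_of_hasWeakDeriv d₃ d₄ m₂ m₃ m₄ a
  have Hw := Hp.sub (H.smul ((a : ℂ) ^ 2))
  set w := p - (a : ℂ) ^ 2 • φ' with hw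
  set h := (fun Y => v₄ Y - (a : ℂ) ^ 2 * p Y) - (a : ℂ) ^ 2 • fun Y => v₂ Y - (a : ℂ) ^ 2 * φ' Y
  have Hφ : HelmholtzTriple a φ' φ₁ w := by
    refine H.congr Hw.m ?_
    filter_upwards [ep] with Y hY
    rw [hY]
    rfl
  have ew : helmholtz α φ =ᵐ[halfLine] w := Hφ.helmholtz_ae_eq hα e
  refine ⟨φ', φ₁, w, _, h, e, Hφ, Hw, eq_of_hasBoundaryValue S.memH10.2 Hφ.c e,
    eq_of_hasBoundaryValue S.neumann Hw.c₁ (Hw.d.weakDeriv_ae_eq ew), hf, ?_⟩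
  filter_upwards [S.equation, e, ew, Hw.helmholtz_ae_eq hα ew] with Y h0 h1 h2 h3
  rw [← h0, h1, h2, h3, Complex.ofReal_one, one_mul]

theorem OSSystem.isSolution {U : ℝ → ℝ} {ε α a : ℝ} {f φ φ₁ w w₁ h : ℝ → ℂ}
    (S : OSSystem U (profileDeriv (profileDeriv U)) 1 ε a f φ φ₁ w w₁ h) (hα : α ^ 2 = a ^ 2) :
    IsSolution U ε α f φ := by
  have ew : helmholtz α φ =ᵐ[halfLine] w := S.hφ.helmholtz_ae_eq hα EventuallyEq.rfl
  have d₃ := S.hw.d.add (S.hφ.d.const_mul ((a : ℂ) ^ 2))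
  have d₄ := S.hw.d₁.add (S.hφ.d₁.const_mul ((a : ℂ) ^ 2))
  refine ⟨⟨S.hφ.m, φ₁, S.hφ.d.hasWeakDeriv, S.hφ.m₁, _, S.hφ.d₁.hasWeakDeriv, S.hφ.mdd, _,
    d₃.hasWeakDeriv, S.hw.m₁.add (S.hφ.m₁.const_mul _), _, d₄.hasWeakDeriv,
    S.hw.mdd.add (S.hφ.mdd.const_mul _)⟩,
    ⟨⟨S.hφ.m, φ₁, S.hφ.d.hasWeakDeriv, S.hφ.m₁⟩, φ, S.hφ.c, EventuallyEq.rfl, S.φ_zero⟩, ?_,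
    w₁, S.hw.c₁, S.hw.d.weakDeriv_ae_eq ew, S.w₁_zero⟩
  filter_upwards [S.eq, ew, S.hw.helmholtz_ae_eq hα ew] with Y h0 h1 h2
  rw [h1, h2, ← h0, Complex.ofReal_one, one_mul]

theorem normL2Pair_le (u v : ℝ → ℂ) : normL2Pair u v ≤ normL2 u + normL2 v := by
  have h1 := normL2_nonneg u
  have h2 := normL2_nonneg v
  refine Real.sqrt_le_iff.2 ⟨by positivity, ?_⟩
  nlinarith [mul_nonneg h1 h2]

theorem weighted_congr_ae {u v : ℝ → ℂ} (k : ℕ) (e : u =ᵐ[halfLine] v) :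
    weighted k u =ᵐ[halfLine] weighted k v := by
  filter_upwards [e] with Y hY
  rw [weighted, weighted, hY]

end OrrSommerfeld

theorem proposition2p1 (U : ℝ → ℝ) (hU : IsShearProfile U) :
    ∃ c₁ : ℝ, 0 < c₁ ∧ ∃ C : ℝ, 0 < C ∧
      ∀ ε α : ℝ, 0 < ε → ε ≤ c₁ → α ≠ 0 →
      ∀ f : ℝ → ℂ, MemH10 f →
        MemLp (weighted 2 f) 2 halfLine →
      ∃ φ : ℝ → ℂ,
        IsSolution U ε α f φ ∧
        (∀ φ' : ℝ → ℂ, IsSolution U ε α f φ' →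
          φ' =ᵐ[halfLine] φ) ∧
        ∃ w : ℝ → ℂ, w = helmholtz α φ ∧
          MemLp (weighted 1 w) 2 halfLine ∧
          MemLp (weighted 1 (weakDeriv w)) 2
            halfLine ∧
          MemLp (weighted 1 (helmholtz α w)) 2
            halfLine ∧
          ε ^ (1 / 3 : ℝ) * normL2 (weighted 1 w)
            + ε ^ (2 / 3 : ℝ) * normL2Pair
                (weighted 1 (weakDeriv w))
                (weighted 1 (fun Y => (α : ℂ) * w Y))
            + ε * normL2 (weighted 1 (helmholtz α w))
            + normL2Pair (weakDeriv φ) (fun Y => (α : ℂ) * φ Y)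
          ≤ C * (normL2 (weighted 2 f)
              + (|α| ^ 2)⁻¹ * ‖∫ Y in Ioi (0 : ℝ), f Y‖) := by
  obtain ⟨K, hK⟩ := hU.exists_profileBounds
  obtain ⟨C, hC, apriori⟩ := a_priori_estimate hK
  have hC0 : 0 < C := by linarith
  refine ⟨(C⁻¹) ^ 6, by positivity, C, hC0, fun ε α hε hεc hα f hf hwf => ?_⟩
  have ha : 0 < |α| := abs_pos.2 hα
  have hα2 : α ^ 2 = |α| ^ 2 := (sq_abs α).symm
  have mf : MemL2 f := hf.1.1
  -- the powers of `ε` in the estimate are `s²`, `s⁴` and `s⁶`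
  obtain ⟨s, hs, rfl⟩ : ∃ s : ℝ, 0 < s ∧ s ^ 6 = ε :=
    ⟨ε ^ (1 / 6 : ℝ), by positivity, by
      rw [← Real.rpow_natCast, ← Real.rpow_mul hε.le]; norm_num⟩
  have hCs : C * s ≤ 1 := by
    have : s ≤ C⁻¹ := le_of_pow_le_pow_left₀ (by norm_num) (by positivity) hεc
    calc C * s ≤ C * C⁻¹ := by gcongr
      _ = 1 := mul_inv_cancel₀ hC0.ne'
  have p1 : (s ^ 6) ^ (1 / 3 : ℝ) = s ^ 2 := by
    rw [← Real.rpow_natCast, ← Real.rpow_mul hs.le, ← Real.rpow_natCast]; norm_num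
  have p2 : (s ^ 6) ^ (2 / 3 : ℝ) = s ^ 4 := by
    rw [← Real.rpow_natCast, ← Real.rpow_mul hs.le, ← Real.rpow_natCast]; norm_num
  obtain ⟨φ, φ₁, w, w₁, h, S⟩ := exists_osSystem hK ha hs hC hCs
    (fun {s f φ φ₁ w w₁ h} S hs hCs hwf => by
      obtain ⟨m, -, -, b⟩ := apriori S ha hs hCs hwf
      refine le_trans ?_ b
      have h1 := mul_le_mul_of_nonneg_left (normL2_le_weighted m) (pow_pos hs 2).le
      have h2 := mul_nonneg (pow_pos hs 4).le (add_nonneg (normL2_nonneg (weighted 1 w₁))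
        (mul_nonneg ha.le (normL2_nonneg (weighted 1 w))))
      have h3 := mul_nonneg (pow_pos hs 6).le (normL2_nonneg (weighted 1 h))
      have h4 := add_nonneg (normL2_nonneg φ₁) (mul_nonneg ha.le (normL2_nonneg φ))
      linarith) mf
  obtain ⟨m, m₁, mh, b⟩ := apriori S ha hs hCs hwf
  have ew : helmholtz α φ =ᵐ[halfLine] w := S.hφ.helmholtz_ae_eq hα2 EventuallyEq.rfl
  have ew₁ : weakDeriv (helmholtz α φ) =ᵐ[halfLine] w₁ := S.hw.d.weakDeriv_ae_eq ew
  have eh : helmholtz α (helmholtz α φ) =ᵐ[halfLine] h := S.hw.helmholtz_ae_eq hα2 ew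
  have eφ : weakDeriv φ =ᵐ[halfLine] φ₁ := S.hφ.d.weakDeriv_ae_eq EventuallyEq.rfl
  refine ⟨φ, S.isSolution hα2, fun φ' S' => ?_, _, rfl, m.ae_eq (weighted_congr_ae 1 ew).symm,
    m₁.ae_eq (weighted_congr_ae 1 ew₁).symm, mh.ae_eq (weighted_congr_ae 1 eh).symm, ?_⟩
  -- the difference of two solutions is a solution for the source `0`
  · obtain ⟨ψ, ψ₁, v, v₁, g, e, T⟩ := S'.exists_osSystem hα2 mf
    have D := T.sub S (k := 0) MemLp.zero fun Y => by simp
    have zero : weighted 2 (0 : ℝ → ℂ) = 0 := funext fun Y => mul_zero _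
    obtain ⟨-, -, -, b'⟩ := apriori D ha hs hCs (by rw [zero]; exact MemLp.zero)
    have n0 : normL2 (0 : ℝ → ℂ) = 0 := by simp [normL2]
    rw [zero, n0] at b'
    simp only [Pi.zero_apply, integral_zero, norm_zero, zero_div, add_zero, mul_zero] at b'
    have h0 : normL2 (ψ - φ) ≤ 0 := by
      by_contra! hlt
      have := mul_pos ha hlt
      have t1 := mul_nonneg (pow_pos hs 2).le (normL2_nonneg (weighted 1 (v - w)))
      have t2 := mul_nonneg (pow_pos hs 4).le (add_nonneg (normL2_nonneg (weighted 1 (v₁ - w₁)))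
        (mul_nonneg ha.le (normL2_nonneg (weighted 1 (v - w)))))
      have t3 := mul_nonneg (pow_pos hs 6).le (normL2_nonneg (weighted 1 (g - h)))
      have t4 := normL2_nonneg (ψ₁ - φ₁)
      linarith
    refine e.trans ?_
    filter_upwards [normL2_eq_zero (T.hφ.m.sub S.hφ.m) h0] with Y hY
    exact sub_eq_zero.1 hY
  · have nα : ∀ {u v : ℝ → ℂ}, (∀ Y, u Y = (α : ℂ) * v Y) → normL2 u = |α| * normL2 v := by
      intro u v huv
      have : u = (α : ℂ) • v := funext huv
      rw [this, normL2, eLpNorm_const_smul, ENNReal.toReal_mul, normL2]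
      simp
    have e1 : normL2 (weighted 1 fun Y => (α : ℂ) * helmholtz α φ Y)
        = |α| * normL2 (weighted 1 w) := by
      rw [← normL2_congr (weighted_congr_ae 1 ew)]
      exact nα fun Y => by simp only [weighted]; ring
    have e2 : normL2 (fun Y => (α : ℂ) * φ Y) = |α| * normL2 φ := nα fun Y => rfl
    have b1 := normL2Pair_le (weighted 1 (weakDeriv (helmholtz α φ)))
      (weighted 1 fun Y => (α : ℂ) * helmholtz α φ Y)
    have b2 := normL2Pair_le (weakDeriv φ) (fun Y => (α : ℂ) * φ Y)
    rw [e1, normL2_congr (weighted_congr_ae 1 ew₁)] at b1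
    rw [e2, normL2_congr eφ] at b2
    rw [p1, p2, normL2_congr (weighted_congr_ae 1 ew), normL2_congr (weighted_congr_ae 1 eh),
      inv_mul_eq_div]
    refine le_trans ?_ b
    gcongr
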